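/- **Setting.** Let $\mathcal F$ be the bosonic Fock space over $L^2(\mathbb R^3)\otimes\mathbb C^2$, with annihilation and creation operators $a_\lambda(k),a^*_\lambda(k)$ ($k\in\mathbb R^3$, $\lambda=\pm$, $[a_\lambda(k),a^*_{\lambda'}(k')]=\delta_{\lambda\lambda'}\delta(k-k')$), vacuum $\Omega_f$, $H_f=\sum_\lambda\int|k|a^*_\lambda(k)a_\lambda(k)\,dk$, $P_f=\sum_\lambda\int k\,a^*_\lambda(k)a_\lambda(k)\,dk$, and put $\mathcal H_r=\mathbf 1[H_f\le r]\mathcal F$. Fix a unit vector $n_p\in\mathbb R^3$ and split $P_f=P_f^\parallel n_p+P_f^\perp$ along $n_p$. Let $\chi_1,\bar\chi_1\ge 0$ be smooth functions with $\chi_1^2+\bar\chi_1^2=1$, $\chi_1=1$ on $[0,\frac23]$, $\chi_1$ strictly decreasing on $[\frac23,1]$ and $\chi_1=0$ on $[1,\infty)$. For $\sigma>0$ let $\bar\kappa_\sigma(x)=x/\sigma$ for $x\le\sigma$ and $\bar\kappa_\sigma(x)=1$ for $x>\sigma$. Let $g\in\mathbb R$, and let $\epsilon_{1,0}[n,\lambda]$,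 $\epsilon_{0,1}[n,\lambda]\in\mathbb R^3$ be measurable in $n\in S^2$ and such that $\{\epsilon_{M,N}[n,+],\epsilon_{M,N}[n,-],n\}$ is orthonormal for each $n$ and $M+N=1$. **Effective hamiltonians.** A point $\mathfrak h=(z,T,\{w_{M,N}\}_{M+N\ge1})$ consists of $z\in\mathbb C$, a $C^2$ function $T$ of $(H_f,P_f^\parallel,|P_f^\perp|)\in[0,1]\times[-1,1]\times[0,1]$ and measurable kernels $w_{M,N}[Y;k_1,\lambda_1,\dots,k_M,\lambda_M;\tilde k_1,\tilde\lambda_1,\dots,\tilde k_N,\tilde\lambda_N]$ that are $C^2$ in $Y=(H_f,P_f^\parallel,P_f^\perp)\in[0,1]\times[-1,1]\times D_1(0)$ and symmetric in the variables $(k_i,\lambda_i)$ and in the variables $(\tilde k_j,\tilde\lambda_j)$. At running infrared cutoff $\sigma$ its effective hamiltonian is the operator on $\mathcal H_1$ $$H_\sigma[\mathfrak h]=T-z+\sum_{M+N\ge1}\chi_1(H_f)\,W_{M,N}\,\chi_1(H_f),$$ $$W_{M,N}=\sum_{\lambda,\tilde\lambda}\int\prod_{i=1}^M dk_i\,\omega_\sigma(k_i)\prod_{j=1}^N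 d\tilde k_j\,\omega_\sigma(\tilde k_j)\ a^*_{\lambda_1}(k_1)\cdots a^*_{\lambda_M}(k_M)\,w_{M,N}[(H_f,P_f);k,\lambda;\tilde k,\tilde\lambda]\,a_{\tilde\lambda_1}(\tilde k_1)\cdots a_{\tilde\lambda_N}(\tilde k_N),$$ with $\omega_\sigma(k)=\bar\kappa_\sigma(|k|)|k|^{-1/2}$ if $\sigma\le1$ and $\omega_\sigma(k)=|k|^{1/2}$ if $\sigma>1$. The polydisc $\mathfrak V_{\epsilon,\xi}$ consists of the points with $z\in[-\epsilon,0]$; $T$ real, with all partial derivatives of order at most $2$ bounded by $2$, analytic in $P_f$, and $T=H_f+\chi_1(H_f)^2(a\,P_f^\parallel+T_{n\text{-}l})$ with $a\in\mathbb R$ and $T_{n\text{-}l}=O(H_f^2)$ as $H_f\to0$ on $|P_f|\le H_f$; and $\sum_{|\alpha|\le2}\sup|\partial_Y^\alpha w_{M,N}|\le\epsilon\,\xi^{M+N}$ for all $M+N\ge1$. The derivative $\partial_{P_f}H_\sigma[\mathfrak h]$ is defined by differentiating $T$ and all kernels $w_{M,N}$ with respect to $P_f$. **Renormalization map.** Let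 $0<\rho<1$, $\chi=\chi_1(H_f/\rho)$, $\bar\chi=\bar\chi_1(H_f/\rho)$, and let $U_\rho:\mathcal H_\rho\to\mathcal H_1$ be the unitary $(U_\rho\psi)_n(k_1,\dots,k_n)=\rho^{3n/2}\psi_n(\rho k_1,\dots,\rho k_n)$ (polarizations unchanged). A point $\hat{\mathfrak h}$ is a renormalized image $\mathcal R[\mathfrak h]$ of $\mathfrak h$ (at cutoff $\sigma$) if there are scalars $\Delta\ne-1$ and $\Delta E$ such that, with $\tau=(1+\Delta)H_f-z+\Delta E$ and $\omega=H_\sigma[\mathfrak h]-\tau$, the operator $\tau+\bar\chi\omega\bar\chi$ has a bounded inverse $\bar R$ on $\overline{\mathrm{Ran}\,\bar\chi}\subset\mathcal H_1$, the smooth Feshbach image $F=\tau+\chi\omega\chi-\chi\omega\bar\chi\bar R\bar\chi\omega\chi$ satisfies $\langle\Omega_f,F\Omega_f\rangle=\Delta E-z$, the coefficient of $H_f$ in the Wick ordered form of $F$ is $1+\Delta$, and $$\hat z=\frac{z-\Delta E}{\rho(1+\Delta)},\qquad H_{\sigma/\rho}[\hat{\mathfrak h}]=\frac{1}{\rho(1+\Delta)}\,U_\rho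 F U_\rho^*.$$ **Ward–Takahashi derivations.** For $n\in S^2$, $\lambda=\pm$ set $$\mathcal D_{WT,n,\lambda,\sigma}=g\,\epsilon_{0,1}[n,\lambda]\cdot\partial_{P_f}+\lim_{r\to0^+}\bar\kappa_\sigma(r)^{-1}\sqrt r\,[a_\lambda(rn),\,\cdot\,],\qquad \mathcal D^*_{WT,n,\lambda,\sigma}=g\,\epsilon_{1,0}[n,\lambda]\cdot\partial_{P_f}+\lim_{r\to0^+}\bar\kappa_\sigma(r)^{-1}\sqrt r\,[\,\cdot\,,a^*_\lambda(rn)].$$ The identity $\mathcal D^\sharp_{WT,n,\lambda,\sigma}[H_\sigma[\mathfrak h]]=0$ for almost every $n$ in a measurable set $\mathcal U\subset S^2$ means that, for all $\varphi,\psi\in\mathcal H_1$ with finitely many photons and bounded wave functions, the $(\varphi,\psi)$ matrix element of the left side vanishes for almost every $n\in\mathcal U$, where the matrix elements of $[a_\lambda(k),\cdot]$ and $[\cdot,a_\lambda^*(k)]$ are functions of $k$ defined up to null sets and the limit $r\to0^+$ is an essential limit. **Proposition.** There are $\epsilon_0,\xi_0>0$ such that the following holds for all choices of the data above and all $\sigma>0$.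 Let $0<\epsilon<\epsilon_0$, $0<\xi,\hat\xi<\xi_0$ and $\hat\epsilon>0$, let $\mathfrak h\in\mathfrak V_{\epsilon,\xi}$, and let $\hat{\mathfrak h}=\mathcal R[\mathfrak h]$ be a renormalized image of $\mathfrak h$ lying in $\mathfrak V_{\hat\epsilon,\hat\xi}$. For each $\lambda$, each of the two choices of $\sharp$, and each measurable set $\mathcal U\subset S^2$ of directions: if $$\mathcal D^\sharp_{WT,n,\lambda,\sigma}\big[H_\sigma[\mathfrak h]\big]=0\quad\text{for almost every }n\in\mathcal U,$$ then $$\mathcal D^\sharp_{WT,n,\lambda,\hat\sigma}\big[H_{\hat\sigma}[\hat{\mathfrak h}]\big]=0\quad\text{for almost every }n\in\mathcal U,\qquad \hat\sigma=\sigma/\rho.$$ -/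

import Mathlib

open MeasureTheory Filter Topology
open scoped ENNReal ComplexConjugate

noncomputable section

namespace SoftPhoton

/-! ### Photon configurations and Fock space -/

/-- Photon momentum space `ℝ³`. -/
abbrev Momentum := EuclideanSpace ℝ (Fin 3)

/-- A photon: its momentum and its polarization. -/
abbrev Photon := Momentum × Bool

/-- Integration over momenta and summation over polarizations. -/
def photonMeasure : Measure Photon := (volume : Measure Momentum).prod Measure.count

/-- `n`-photon measure. -/
def photonMeasureN (n : ℕ) : Measure (Fin n → Photon) := Measure.pi fun _ => photonMeasure

/-- A configuration of finitely many photons. -/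
abbrev Config := Σ n : ℕ, (Fin n → Photon)

/-- Embedding of the `n`-photon sector. -/
abbrev inSector (n : ℕ) (k : Fin n → Photon) : Config := ⟨n, k⟩

/-- The measure on configurations that restricts to `photonMeasureN n` on the `n`-photon sector. -/
def configMeasure : Measure Config :=
  Measure.sum fun n => (photonMeasureN n).map (inSector n)

/-- The value of `H_f` on a configuration. -/
def energy {n : ℕ} (k : Fin n → Photon) : ℝ := ∑ i, ‖(k i).1‖

/-- The value of `P_f` on a configuration. -/
def momentum {n : ℕ} (k : Fin n → Photon) : Momentum := ∑ i, (k i).1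

instance : SigmaFinite photonMeasure := by
  unfold photonMeasure; infer_instance

lemma inSector_injective (n : ℕ) : Function.Injective (inSector n) := by
  intro k k' h
  exact eq_of_heq (Sigma.mk.inj h).2

lemma inSector_measurableEmbedding (n : ℕ) :
    MeasurableEmbedding (inSector n) where
  injective := inSector_injective n
  measurable := measurable_iff_le_map.mpr (iInf_le _ n)
  measurableSet_image' := by
    intro s hs
    refine MeasurableSpace.measurableSet_iInf.mpr fun m => ?_
    change MeasurableSet (inSector m ⁻¹' (inSector n '' s))
    by_cases h : m = n
    · subst h
      rwa [Set.preimage_image_eq _ (inSector_injective m)]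
    · have : (inSector m ⁻¹' (inSector n '' s) : Set (Fin m → Photon)) = ∅ := by
        ext x
        simp only [Set.mem_preimage, Set.mem_image, Set.mem_empty_iff_false, iff_false]
        rintro ⟨y, _, hy⟩
        exact h (congrArg Sigma.fst hy).symm
      rw [this]
      exact MeasurableSet.empty

lemma ae_config_iff {p : Config → Prop} :
    (∀ᵐ x ∂configMeasure, p x) ↔ ∀ n, ∀ᵐ k ∂photonMeasureN n, p ⟨n, k⟩ := by
  unfold configMeasure
  rw [Measure.ae_sum_iff]
  exact forall_congr' fun n => (inSector_measurableEmbedding n).ae_map_iff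

lemma ae_perm {n : ℕ} (π : Equiv.Perm (Fin n)) {p : (Fin n → Photon) → Prop}
    (h : ∀ᵐ k ∂photonMeasureN n, p k) : ∀ᵐ k ∂photonMeasureN n, p (k ∘ π) := by
  have hmp := measurePreserving_piCongrLeft (fun _ : Fin n => photonMeasure) π.symm
  have h2 := hmp.quasiMeasurePreserving.ae h
  filter_upwards [h2] with k hk
  have : (MeasurableEquiv.piCongrLeft (fun _ : Fin n => Photon) π.symm) k = k ∘ π := by
    funext i
    have := Equiv.piCongrLeft_apply_apply (fun _ : Fin n => Photon) π.symm k (π i)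
    rw [Equiv.symm_apply_apply] at this
    exact this
  rwa [this] at hk

/-- The defining properties of wave functions in `P_1 H_p`: permutation symmetry in each sector, and
spectral support of `H_f` in `[0, 1]`. -/
def IsFockVector (ψ : Config → ℂ) : Prop :=
  (∀ (n : ℕ) (π : Equiv.Perm (Fin n)),
      ∀ᵐ k ∂photonMeasureN n, ψ ⟨n, k ∘ π⟩ = ψ ⟨n, k⟩) ∧
    ∀ᵐ x ∂configMeasure, 1 < energy x.2 → ψ x = 0

lemma IsFockVector.congr {ψ ψ' : Config → ℂ} (h : IsFockVector ψ)
    (e : ψ' =ᵐ[configMeasure] ψ) : IsFockVector ψ' := by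
  refine ⟨fun n π => ?_, ?_⟩
  · have e1 := ae_config_iff.1 e n
    filter_upwards [h.1 n π, e1, ae_perm π e1] with k h1 h2 h3
    rw [h2, h3, h1]
  · filter_upwards [h.2, e] with x h1 h2 hx
    rw [h2, h1 hx]

/-- The Hilbert space `P_1 H_p`: the part of the bosonic Fock space over `L²(ℝ³) ⊗ ℂ²` on which
`H_f ≤ 1`. -/
def FockOne : Submodule ℂ (Lp ℂ 2 configMeasure) where
  carrier := {ψ | IsFockVector ψ}
  zero_mem' := by
    refine IsFockVector.congr (ψ := fun _ => 0) ⟨by simp, by simp⟩ ?_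
    exact Lp.coeFn_zero _ _ _
  add_mem' := by
    intro f g hf hg
    refine IsFockVector.congr (ψ := fun x => f x + g x) ⟨fun n π => ?_, ?_⟩ (Lp.coeFn_add f g)
    · filter_upwards [hf.1 n π, hg.1 n π] with k h1 h2
      rw [h1, h2]
    · filter_upwards [hf.2, hg.2] with x h1 h2 hx
      rw [h1 hx, h2 hx, add_zero]
  smul_mem' := by
    intro c f hf
    refine IsFockVector.congr (ψ := fun x => c * f x) ⟨fun n π => ?_, ?_⟩ (Lp.coeFn_smul c f)
    · filter_upwards [hf.1 n π] with k h1
      rw [h1]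
    · filter_upwards [hf.2] with x h1 hx
      rw [h1 hx, mul_zero]

lemma isClosed_fockOne : IsClosed (FockOne : Set (Lp ℂ 2 configMeasure)) := by
  refine IsSeqClosed.isClosed fun u f hu huf => ?_
  obtain ⟨s, -, hs⟩ := (tendstoInMeasure_of_tendsto_Lp huf).exists_seq_tendsto_ae
  have hu' : ∀ n, IsFockVector (u n) := hu
  change IsFockVector f
  refine ⟨fun n π => ?_, ?_⟩
  · have h1 := ae_config_iff.1 hs n
    have h2 := ae_all_iff.2 fun i => (hu' (s i)).1 n π
    filter_upwards [h1, ae_perm π h1, h2] with k a b c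
    refine tendsto_nhds_unique (b.congr fun i => ?_) a
    exact c i
  · have h2 := ae_all_iff.2 fun i => (hu' (s i)).2
    filter_upwards [hs, h2] with x a c hx
    refine tendsto_nhds_unique (a.congr fun i => c i hx) tendsto_const_nhds

instance : CompleteSpace FockOne := isClosed_fockOne.completeSpace_coe

/-- The wave function of a Fock vector. -/
def wave (ψ : FockOne) : Config → ℂ := fun x => (ψ : Lp ℂ 2 configMeasure) x

lemma configMeasure_zero_sector : configMeasure {x : Config | x.1 = 0} ≠ ∞ := by
  have hm : MeasurableSet {x : Config | x.1 = 0} := by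
    have : {x : Config | x.1 = 0} = inSector 0 '' (Set.univ : Set (Fin 0 → Photon)) := by
      ext ⟨n, k⟩
      constructor
      · rintro (rfl : n = 0)
        exact ⟨k, trivial, rfl⟩
      · rintro ⟨y, -, hy⟩
        exact (congrArg Sigma.fst hy).symm
    rw [this]
    exact (inSector_measurableEmbedding 0).measurableSet_image.2 MeasurableSet.univ
  have h : ∀ n, ((photonMeasureN n).map (inSector n)) {x : Config | x.1 = 0}
      = if n = 0 then 1 else 0 := by
    intro n
    rw [(inSector_measurableEmbedding n).map_apply]
    by_cases hn : n = 0
    · subst hn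
      have : (inSector 0 ⁻¹' {x : Config | x.1 = 0} : Set (Fin 0 → Photon)) = Set.univ := by
        ext; simp
      rw [this, photonMeasureN, Measure.pi_empty_univ]
      simp
    · have : (inSector n ⁻¹' {x : Config | x.1 = 0} : Set (Fin n → Photon)) = ∅ := by
        ext; simp [hn]
      rw [this]
      simp [hn]
  rw [configMeasure, Measure.sum_apply _ hm]
  simp only [h]
  rw [tsum_ite_eq]
  exact ENNReal.one_ne_top

lemma measurableSet_zero_sector : MeasurableSet {x : Config | x.1 = 0} := by
  have : {x : Config | x.1 = 0} = inSector 0 '' (Set.univ : Set (Fin 0 → Photon)) := by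
    ext ⟨n, k⟩
    constructor
    · rintro (rfl : n = 0)
      exact ⟨k, trivial, rfl⟩
    · rintro ⟨y, -, hy⟩
      exact (congrArg Sigma.fst hy).symm
  rw [this]
  exact (inSector_measurableEmbedding 0).measurableSet_image.2 MeasurableSet.univ

/-- The photon vacuum `Ω_f`. -/
def vacuum : FockOne :=
  ⟨indicatorConstLp 2 measurableSet_zero_sector configMeasure_zero_sector (1 : ℂ), by
    change IsFockVector _
    refine IsFockVector.congr (ψ := Set.indicator {x : Config | x.1 = 0} fun _ => 1)
      ⟨fun n π => ?_, ?_⟩ indicatorConstLp_coeFn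
    · refine Eventually.of_forall fun k => ?_
      by_cases hn : n = 0 <;> simp [hn]
    · refine Eventually.of_forall fun ⟨n, k⟩ hx => ?_
      by_cases hn : n = 0
      · subst hn
        simp only [energy, Finset.univ_eq_empty, Finset.sum_empty] at hx
        linarith
      · simp [hn]⟩

/-- Bounded operators on `P_1 H_p`. -/
abbrev Op := FockOne →L[ℂ] FockOne

open Classical in
/-- The bounded operator `A` whose matrix elements `⟨φ, A ψ⟩` are `B φ ψ`. It is unique; the value is
`0` when `B` is not the form of a bounded operator. -/
def opOfForm (B : FockOne → FockOne → ℂ) : Op :=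
  if h : ∃ A : Op, ∀ φ ψ, inner ℂ φ (A ψ) = B φ ψ then h.choose else 0

lemma opOfForm_eq {B : FockOne → FockOne → ℂ} {A : Op} (h : ∀ φ ψ, inner ℂ φ (A ψ) = B φ ψ) :
    opOfForm B = A := by
  have hex : ∃ A : Op, ∀ φ ψ, inner ℂ φ (A ψ) = B φ ψ := ⟨A, h⟩
  rw [opOfForm, dif_pos hex]
  ext1 ψ
  refine ext_inner_left ℂ fun φ => ?_
  rw [hex.choose_spec, h]

/-- The operator `f(H_f)`. -/
def energyOp (f : ℝ → ℂ) : Op :=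
  opOfForm fun φ ψ => ∫ x, conj (wave φ x) * f (energy x.2) * wave ψ x ∂configMeasure

/-! ### Cutoffs and polarization vectors -/

/-- The smooth partition of unity `χ₁² + χ̄₁² = 1`. -/
structure SmoothCutoff where
  chi : ℝ → ℝ
  chibar : ℝ → ℝ
  chi_smooth : ContDiff ℝ (⊤ : ℕ∞) chi
  chibar_smooth : ContDiff ℝ (⊤ : ℕ∞) chibar
  chi_nonneg : ∀ x, 0 ≤ chi x
  chibar_nonneg : ∀ x, 0 ≤ chibar x
  sq_add_sq : ∀ x, chi x ^ 2 + chibar x ^ 2 = 1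
  chi_eq_one : ∀ x ∈ Set.Icc (0 : ℝ) (2 / 3), chi x = 1
  chi_strictAnti : StrictAntiOn chi (Set.Icc (2 / 3) 1)
  chi_eq_zero : ∀ x, 1 ≤ x → chi x = 0

/-- The infrared regulator `κ̄_σ`. -/
def infraredReg (σ x : ℝ) : ℝ := if σ < x then 1 else x / σ

/-- The integration weight attached to each photon variable of a Wick monomial; the linear factor of
the regulator is absorbed into the kernels up to the constant `1/σ` once `σ > 1`. -/
def photonWeight (σ : ℝ) (k : Photon) : ℝ :=
  if σ ≤ 1 then infraredReg σ ‖k.1‖ / √‖k.1‖ else √‖k.1‖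

/-- The choice of sign `♯`: commutators with annihilation or with creation operators. -/
inductive Sharp
  | annihilation
  | creation

/-- Directions `n_k`. -/
abbrev Direction := Metric.sphere (0 : Momentum) 1

/-- Polarization vectors in the Coulomb gauge: `vec creation n lam` is `ε_{1,0}[n, lam]` and
`vec annihilation n lam` is `ε_{0,1}[n, lam]`. -/
structure Polarization where
  vec : Sharp → Direction → Bool → Momentum
  measurable_vec : ∀ s lam, Measurable fun n => vec s n lam
  orthonormal : ∀ s n, Orthonormal ℝ ![vec s n true, vec s n false, (n : Momentum)]

/-! ### The parameter space of effective hamiltonians -/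

/-- Component of `P` along the unit vector `np`. -/
def par (np P : Momentum) : ℝ := inner ℝ np P

/-- Component of `P` orthogonal to the unit vector `np`. -/
def perp (np P : Momentum) : Momentum := P - (inner ℝ np P : ℝ) • np

/-- `Spec (H_f, P_f^∥, |P_f^⊥|)`, as the box `[0,1] × [-1,1] × [0,1]`. -/
def specZero : Set (ℝ × ℝ × ℝ) := Set.Icc 0 1 ×ˢ Set.Icc (-1) 1 ×ˢ Set.Icc 0 1

/-- `Spec (H_f, P_f^∥, P_f^⊥)`, as `[0,1] × [-1,1] ×` unit disc, in terms of the pair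
`(H_f, P_f)`. -/
def spec (np : Momentum) : Set (ℝ × Momentum) :=
  {Y | Y.1 ∈ Set.Icc (0 : ℝ) 1 ∧ par np Y.2 ∈ Set.Icc (-1 : ℝ) 1 ∧ ‖perp np Y.2‖ ≤ 1}

/-- A free part `t(H_f, P_f^∥, |P_f^⊥|)` as a function of `(H_f, P_f)`. -/
def axial (np : Momentum) (t : ℝ × ℝ × ℝ → ℂ) (Y : ℝ × Momentum) : ℂ :=
  t (Y.1, par np Y.2, ‖perp np Y.2‖)

/-- Families of integral kernels `w_{M,N}[(H_f, P_f); k, k̃]`. -/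
abbrev Kernels :=
  ∀ M N : ℕ, ℝ × Momentum → (Fin M → Photon) → (Fin N → Photon) → ℂ

/-- A point `(z, T, {w_{M,N}})` of the parameter space (for the given direction `np` of the total
momentum). Only the kernels with `M + N ≥ 1` matter. -/
structure Point (np : Momentum) where
  z : ℂ
  T : ℝ × ℝ × ℝ → ℂ
  w : Kernels
  T_contDiff : ContDiffOn ℝ 2 T specZero
  w_measurable : ∀ M N, 1 ≤ M + N → Measurable fun x :
    (ℝ × Momentum) × (Fin M → Photon) × (Fin N → Photon) => w M N x.1 x.2.1 x.2.2
  w_contDiff : ∀ M N, 1 ≤ M + N → ∀ k k', ContDiffOn ℝ 2 (fun Y => w M N Y k k') (spec np)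
  w_symm : ∀ M N, 1 ≤ M + N → ∀ (π : Equiv.Perm (Fin M)) (π' : Equiv.Perm (Fin N)) Y k k',
    w M N Y (k ∘ π) (k' ∘ π') = w M N Y k k'

/-- `sup_{|α| ≤ 2} sup_Y |∂_Y^α T|`. -/
def freeNorm (T : ℝ × ℝ × ℝ → ℂ) : ℝ≥0∞ :=
  ⨆ (j : Fin 3) (c : Fin j → Fin 3) (Y ∈ specZero),
    ‖iteratedFDerivWithin ℝ j T specZero Y fun i =>
      (![((1 : ℝ), (0 : ℝ), (0 : ℝ)), (0, 1, 0), (0, 0, 1)] : Fin 3 → ℝ × ℝ × ℝ) (c i)‖ₑ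

/-- Projection of `ℝ × ℝ³` onto its components `H_f`, `P_f^∥`, `P_f^⊥` (numbered `0, 1, 2`). -/
def componentProj (np : Momentum) (c : Fin 3) : ℝ × Momentum →L[ℝ] ℝ × Momentum :=
  let one := ContinuousLinearMap.id ℝ Momentum
  let p := (innerSL ℝ np).smulRight np
  (![(ContinuousLinearMap.id ℝ ℝ).prodMap (0 : Momentum →L[ℝ] Momentum),
     (0 : ℝ →L[ℝ] ℝ).prodMap p,
     (0 : ℝ →L[ℝ] ℝ).prodMap (one - p)] : Fin 3 → _) c

open Classical in
/-- `∑_{|α| ≤ 2} sup_{Y, K} |∂_Y^α w|`, with `Y = (H_f, P_f^∥, P_f^⊥)`. The multi-indices with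
`|α| = j` are listed as the monotone maps `Fin j → Fin 3`. -/
def kernelNorm (np : Momentum) {M N : ℕ}
    (w : ℝ × Momentum → (Fin M → Photon) → (Fin N → Photon) → ℂ) : ℝ≥0∞ :=
  ∑ j : Fin 3, ∑ c : Fin j → Fin 3, if Monotone c then
    ⨆ (Y ∈ spec np) (k : Fin M → Photon) (k' : Fin N → Photon),
      ‖(iteratedFDerivWithin ℝ j (fun Y => w Y k k') (spec np) Y).compContinuousLinearMap
        fun i => componentProj np (c i)‖ₑ
  else 0

/-- Membership in the polydisc of effective hamiltonians with parameters `ε, ξ`. -/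
structure InPolydisc (C : SmoothCutoff) {np : Momentum} (ε ξ : ℝ) (h : Point np) : Prop where
  z_mem : ∃ x ∈ Set.Icc (-ε) 0, h.z = (x : ℂ)
  T_real : ∀ Y ∈ specZero, (h.T Y).im = 0
  T_norm : freeNorm h.T ≤ 2
  T_analytic : ∀ r ∈ Set.Icc (0 : ℝ) 1, AnalyticOnNhd ℝ (fun P => axial np h.T (r, P))
    {P | par np P ∈ Set.Ioo (-1 : ℝ) 1 ∧ ‖perp np P‖ < 1}
  /- `T = H_f + a χ₁ P_f^∥ χ₁ + χ₁ T_{n-l} χ₁` with `T_{n-l} = O(H_f²)` on the joint spectrum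
  `|P_f| ≤ H_f`. -/
  T_decomp : ∃ (a : ℝ) (Tnl : ℝ × ℝ × ℝ → ℂ),
    (∀ Y ∈ specZero, h.T Y = Y.1 + (C.chi Y.1 : ℂ) * (a * Y.2.1 + Tnl Y) * C.chi Y.1) ∧
    ∃ c δ : ℝ, 0 < δ ∧ ∀ Y ∈ specZero, Y.1 < δ → Y.2.1 ^ 2 + Y.2.2 ^ 2 ≤ Y.1 ^ 2 →
      ‖Tnl Y‖ ≤ c * Y.1 ^ 2
  w_norm : ∀ M N, 1 ≤ M + N → kernelNorm np (h.w M N) ≤ ENNReal.ofReal (ε * ξ ^ (M + N))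

/-! ### From kernels to operators -/

/-- The matrix element `⟨φ, χ₁ W_{M,N}[[w]] χ₁ ψ⟩` of the cut-off Wick monomial
`χ₁ ∫ a*(k₁) ⋯ a*(k_M) w[(H_f, P_f); k, k̃] a(k̃₁) ⋯ a(k̃_N) χ₁`: by
`(a(k̃₁) ⋯ a(k̃_N) ψ)(q) = ((n+N)!/n!)^{1/2} ψ(k̃, q)` it is an integral over the momenta `q` of the
spectator photons and over `k, k̃`. -/
def wickForm (C : SmoothCutoff) (σ : ℝ) {M N : ℕ}
    (w : ℝ × Momentum → (Fin M → Photon) → (Fin N → Photon) → ℂ) (φ ψ : FockOne) : ℂ :=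
  ∑' n : ℕ, (√((M + n).descFactorial M) * √((N + n).descFactorial N) : ℝ) *
    ∫ x : (Fin n → Photon) × (Fin M → Photon) × (Fin N → Photon),
      ((∏ i, photonWeight σ (x.2.1 i)) * (∏ j, photonWeight σ (x.2.2 j)) : ℝ) *
      (conj ((C.chi (energy (Fin.append x.2.1 x.1)) : ℂ) * wave φ ⟨M + n, Fin.append x.2.1 x.1⟩) *
        w (energy x.1, momentum x.1) x.2.1 x.2.2 *
        ((C.chi (energy (Fin.append x.2.2 x.1)) : ℂ) * wave ψ ⟨N + n, Fin.append x.2.2 x.1⟩))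
      ∂(photonMeasureN n).prod ((photonMeasureN M).prod (photonMeasureN N))

/-- The matrix element of `T₀(H_f, P_f) + ∑_{M+N ≥ 1} χ₁ W_{M,N}[[w_{M,N}]] χ₁`. -/
def seriesForm (C : SmoothCutoff) (σ : ℝ) (T₀ : ℝ × Momentum → ℂ) (w : Kernels)
    (φ ψ : FockOne) : ℂ :=
  (∫ x, conj (wave φ x) * T₀ (energy x.2, momentum x.2) * wave ψ x ∂configMeasure) +
    ∑' m : ℕ × ℕ, if 1 ≤ m.1 + m.2 then wickForm C σ (w m.1 m.2) φ ψ else 0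

/-- The effective hamiltonian `H[h] = T - z + ∑_{M+N ≥ 1} χ₁ W_{M,N} χ₁` at running infrared
cutoff `σ`. -/
def effHam (C : SmoothCutoff) {np : Momentum} (σ : ℝ) (h : Point np) : Op :=
  opOfForm (seriesForm C σ (fun Y => axial np h.T Y - h.z) h.w)

/-- The matrix elements of `v · ∂_{P_f} H[h]`; the derivative acts on the kernels. -/
def momentumDerivForm (C : SmoothCutoff) {np : Momentum} (σ : ℝ) (h : Point np) (v : Momentum) :
    FockOne → FockOne → ℂ :=
  seriesForm C σ (fun Y => lineDeriv ℝ (fun P => axial np h.T (Y.1, P)) Y.2 v)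
    (fun M N Y k k' => lineDeriv ℝ (fun P => h.w M N (Y.1, P) k k') Y.2 v)

/-! ### The renormalization map -/

/-- `R` is the inverse of `A` on the range of the projection `Pbar`, extended by zero. -/
structure IsRestrictedInverse (Pbar A R : Op) : Prop where
  left : Pbar * R = R
  right : R * Pbar = R
  mul_left : Pbar * A * R = Pbar
  mul_right : R * A * Pbar = Pbar

/-- The function `ψ'` is `U_ρ ψ`, that is `(U_ρ ψ)_n(k) = ρ^{3n/2} ψ_n(ρ k)`; so
`U_ρ H_f U_ρ* = ρ H_f`, and `U_ρ` maps `P_ρ H_p` onto `P_1 H_p`. -/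
def IsDilation (ρ : ℝ) (ψ ψ' : Config → ℂ) : Prop :=
  ∀ n, ∀ᵐ k ∂photonMeasureN n,
    ψ' ⟨n, k⟩ = (ρ ^ ((3 / 2 : ℝ) * n) : ℝ) * ψ ⟨n, fun i => (ρ • (k i).1, (k i).2)⟩

/-- `G = U_ρ F U_ρ*` on `P_1 H_p`, where `F` acts on `P_ρ H_p` (every `ψ'` in `P_1 H_p` is `U_ρ ψ`
for exactly one `ψ` in `P_ρ H_p`). -/
def IsDilated (ρ : ℝ) (F G : Op) : Prop :=
  ∀ ψ ψ' : FockOne, IsDilation ρ (wave ψ) (wave ψ') → IsDilation ρ (wave (F ψ)) (wave (G ψ'))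

/-- The smooth Feshbach map `τ + χ ω χ - χ ω χ̄ R̄ χ̄ ω χ`. -/
def feshbach (τ ω χ χbar Rbar : Op) : Op :=
  τ + χ * ω * χ - χ * ω * χbar * Rbar * χbar * ω * χ

/-- `h'` is the image of `h` under the renormalization map, for the scale factor `ρ` and the running
infrared cutoff `σ` of `h`. That is, the smooth Feshbach map is defined on `H[h]` for
`τ = (1 + Δ) H_f - z + ΔE` and the cutoff `χ_ρ = χ₁(H_f / ρ)`, and
`H[h'] = (1 + Δ)⁻¹ ρ⁻¹ U_ρ F U_ρ*`, where `ΔE - z = ⟨Ω_f, F Ω_f⟩`, the coefficient of `H_f` in the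
Wick ordered form of `F` is `1 + Δ`, and `z' = (1 + Δ)⁻¹ ρ⁻¹ (z - ΔE)`. -/
def IsRenormalized (C : SmoothCutoff) {np : Momentum} (ρ σ : ℝ) (h h' : Point np) : Prop :=
  ∃ (Δ ΔE : ℂ) (Rbar : Op),
    let H := effHam C σ h
    let τ := energyOp fun r => (1 + Δ) * r - h.z + ΔE
    let ω := H - τ
    let χ := energyOp fun r => (C.chi (r / ρ) : ℂ)
    let χbar := energyOp fun r => (C.chibar (r / ρ) : ℂ)
    -- the projection onto the closure of the range of `χbar`
    let Pbar := energyOp (Set.indicator {r | C.chibar (r / ρ) ≠ 0} 1)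
    let F := feshbach τ ω χ χbar Rbar
    1 + Δ ≠ 0 ∧
    IsRestrictedInverse Pbar (τ + χbar * ω * χbar) Rbar ∧
    inner ℂ vacuum (F vacuum) = ΔE - h.z ∧
    -- `r ↦ ρ (1 + Δ) (T'(r / ρ, 0, 0) - z')` is the vacuum kernel of `F`
    HasDerivWithinAt (fun r : ℝ => ρ * (1 + Δ) * (h'.T (r / ρ, 0, 0) - h'.z)) (1 + Δ)
      (Set.Ici 0) 0 ∧
    h'.z = (h.z - ΔE) / (ρ * (1 + Δ)) ∧
    IsDilated ρ F ((ρ * (1 + Δ)) • effHam C (σ / ρ) h')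

/-! ### Ward-Takahashi derivations -/

/-- The matrix element `⟨φ, a_lam(k) ψ⟩`, where `(a_lam(k) ψ)_n(q) = (n+1)^{1/2} ψ_{n+1}((k, lam), q)`;
as a function of `k` it is determined almost everywhere. -/
def annihilationForm (k : Photon) (φ ψ : FockOne) : ℂ :=
  ∑' n : ℕ, (√(n + 1) : ℝ) *
    ∫ q : Fin n → Photon, conj (wave φ ⟨n, q⟩) * wave ψ ⟨n + 1, Fin.cons k q⟩ ∂photonMeasureN n

/-- The matrix elements `⟨φ, [a_lam(k), A] ψ⟩` and `⟨φ, [A, a*_lam(k)] ψ⟩`. -/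
def commutatorForm (A : Op) (k : Photon) (φ ψ : FockOne) : Sharp → ℂ
  | .annihilation =>
      annihilationForm k φ (A ψ) - annihilationForm k (ContinuousLinearMap.adjoint A φ) ψ
  | .creation =>
      conj (annihilationForm k ψ (ContinuousLinearMap.adjoint A φ)) -
        conj (annihilationForm k (A ψ) φ)

/-- Vectors with finitely many photons and a bounded wave function; a dense set on which the soft
photon limits of the commutators are taken. -/
def IsTestVector (ψ : FockOne) : Prop :=
  ∃ (N : ℕ) (c : ℝ), ∀ᵐ x ∂configMeasure, (N < x.1 → wave ψ x = 0) ∧ ‖wave ψ x‖ ≤ c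

/-- The Ward-Takahashi identity `D[H[h]] = 0`, for almost all directions in `U`, where `D` is
`g ε[n, lam] · ∂_{P_f} + lim_{r → 0} κ̄_σ(r)⁻¹ √r [a_lam(r n), ·]`, respectively the same with
`[·, a*_lam(r n)]`. Matrix elements between test vectors are considered; since `a_lam(k)` is an
operator-valued distribution, the limit along a ray is an essential limit and the direction is
determined up to null sets. -/
def WardTakahashi (C : SmoothCutoff) (pol : Polarization) {np : Momentum} (g : ℝ)
    (s : Sharp) (lam : Bool) (U : Set Direction) (σ : ℝ) (h : Point np) : Prop :=
  ∀ φ ψ : FockOne, IsTestVector φ → IsTestVector ψ →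
    ∀ᵐ n ∂((volume : Measure Momentum).toSphere.restrict U),
      Tendsto (fun r : ℝ => g * momentumDerivForm C σ h (pol.vec s n lam) φ ψ +
          (√r / infraredReg σ r : ℝ) *
            commutatorForm (effHam C σ h) (r • (n : Momentum), lam) φ ψ s)
        (𝓝[>] 0 ⊓ ae volume) (𝓝 0)

end SoftPhoton

end

noncomputable section

namespace SoftPhoton

set_option maxHeartbeats 4000000
open Real (norm_of_nonneg)
open Complex (norm_real conj_ofReal continuous_conj measurable_ofReal conj_conj)
open ENNReal (ofReal rpow_natCast toReal_mul)

local notation "adj" => ContinuousLinearMap.adjoint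

local notation "Bag" => Multiset Photon

local notation "Tuple" n:max => Fin n → Photon

section
/-! ### Configurations as multisets -/

/-- The multiset of photons of a configuration. -/
def bag (x : Config) : Bag := Finset.univ.val.map x.2

/-- The energy of a multiset of photons. -/
def mEnergy (s : Bag) : ℝ := (s.map fun k => ‖k.1‖).sum

/-- The momentum of a multiset of photons. -/
def mMomentum (s : Bag) : Momentum := (s.map Prod.fst).sum

lemma mEnergy_bag (x : Config) : mEnergy (bag x) = energy x.2 := by
  simp only [mEnergy, bag, Multiset.map_map]; rfl

lemma mMomentum_bag (x : Config) : mMomentum (bag x) = momentum x.2 := by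
  simp only [mMomentum, bag, Multiset.map_map]; rfl

lemma card_bag (x : Config) : (bag x).card = x.1 := by
  simp [bag]

@[simp] lemma mEnergy_cons (k : Photon) (s : Bag) :
    mEnergy (k ::ₘ s) = ‖k.1‖ + mEnergy s := by simp [mEnergy]

@[simp] lemma mEnergy_add (s t : Bag) :
    mEnergy (s + t) = mEnergy s + mEnergy t := by simp [mEnergy]

@[simp] lemma mMomentum_cons (k : Photon) (s : Bag) :
    mMomentum (k ::ₘ s) = k.1 + mMomentum s := by simp [mMomentum]

lemma mEnergy_nonneg (s : Bag) : 0 ≤ mEnergy s :=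
  Multiset.sum_nonneg (by simp only [Multiset.mem_map]; rintro _ ⟨k, -, rfl⟩; exact norm_nonneg _)

lemma norm_mMomentum_le (s : Bag) : ‖mMomentum s‖ ≤ mEnergy s := by
  induction s using Multiset.induction with
  | empty => simp [mMomentum, mEnergy]
  | cons k s ih => simp only [mMomentum_cons, mEnergy_cons]; exact (norm_add_le _ _).trans (by gcongr)

/-- Adding a photon. -/
def consConfig (p : Photon × Config) : Config := inSector (p.2.1 + 1) (Fin.cons p.1 p.2.2)

/-- Adding `M` photons. -/
def appendConfig {M : ℕ} (p : Tuple M × Config) : Config :=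
  inSector (M + p.2.1) (Fin.append p.1 p.2.2)

/-- The multiset of photons of a tuple. -/
abbrev tupleBag {M : ℕ} (K : Tuple M) : Bag := bag (inSector M K)

lemma bag_insertNth {n : ℕ} (i : Fin (n + 1)) (k : Photon) (q : Tuple n) :
    tupleBag (i.insertNth k q) = k ::ₘ tupleBag q := by
  simp only [tupleBag, bag, Fin.univ_succAbove n i]
  simp [Function.comp_def]

lemma bag_removeNth {n : ℕ} (i : Fin (n + 1)) (q : Tuple (n + 1)) :
    tupleBag q = q i ::ₘ tupleBag (i.removeNth q) := by
  rw [← bag_insertNth i, Fin.insertNth_self_removeNth]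

@[simp] lemma bag_consConfig (p : Photon × Config) :
    bag (consConfig p) = p.1 ::ₘ bag p.2 := by
  have := bag_insertNth 0 p.1 p.2.2
  rwa [Fin.insertNth_zero'] at this

@[simp] lemma bag_appendConfig {M : ℕ} (p : Tuple M × Config) :
    bag (appendConfig p) = tupleBag p.1 + bag p.2 := by
  obtain ⟨K, n, q⟩ := p
  have h : ∀ {m : ℕ} (f : Tuple m), Multiset.map f Finset.univ.val = (List.ofFn f : Bag) := by
    intro m f
    simp [Fin.univ_val_map]
  have e : bag (appendConfig (K, ⟨n, q⟩)) = (List.ofFn (Fin.append K q) : Bag) :=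
    h (Fin.append K q)
  have e1 : tupleBag K = (List.ofFn K : Bag) := h K
  have e2 : bag ⟨n, q⟩ = (List.ofFn q : Bag) := h q
  rw [e, e1, e2, List.ofFn_fin_append]
  simp

lemma measurable_prod_config {α β : Type*} [MeasurableSpace α] [MeasurableSpace β]
    {f : α × Config → β}
    (h : ∀ n, Measurable fun p : α × Tuple n => f (p.1, inSector n p.2)) :
    Measurable f := by
  intro s hs
  have : f ⁻¹' s = ⋃ n, Prod.map id (inSector n) ''
      ((fun p : α × Tuple n => f (p.1, inSector n p.2)) ⁻¹' s) := by
    ext ⟨a, n, q⟩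
    simp only [Set.mem_preimage, Set.mem_iUnion, Set.mem_image]
    constructor
    · intro hx
      exact ⟨n, (a, q), hx, rfl⟩
    · rintro ⟨m, ⟨b, q'⟩, hx, e⟩
      obtain ⟨e1, e2⟩ := Prod.mk.inj e
      simp only [id] at e1
      rw [← e1, ← e2]; exact hx
  rw [this]
  exact MeasurableSet.iUnion fun n =>
    (MeasurableEmbedding.id.prodMap (inSector_measurableEmbedding n)).measurableSet_image.2 (h n hs)

lemma measurable_config {β : Type*} [MeasurableSpace β] {f : Config → β}
    (h : ∀ n, Measurable fun q : Tuple n => f (inSector n q)) : Measurable f := by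
  have : Measurable fun p : Unit × Config => f p.2 :=
    measurable_prod_config fun n => (h n).comp measurable_snd
  exact this.comp (measurable_const.prodMk measurable_id : Measurable fun x : Config => ((), x))

lemma measurable_inSector (n : ℕ) : Measurable (inSector n) :=
  (inSector_measurableEmbedding n).measurable

lemma measurable_consConfig : Measurable consConfig :=
  measurable_prod_config fun n => (measurable_inSector (n + 1)).comp
    (measurable_pi_iff.2 fun i => by
      refine Fin.cases ?_ (fun j => ?_) i
      · simpa using measurable_fst
      · simp only [Fin.cons_succ]; fun_prop)

lemma measurable_appendConfig {M : ℕ} : Measurable (appendConfig (M := M)) :=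
  measurable_prod_config fun n => (measurable_inSector (M + n)).comp
    (measurable_pi_iff.2 fun i => by
      refine Fin.addCases (fun j => ?_) (fun j => ?_) i
      · simp only [Fin.append_left]; fun_prop
      · simp only [Fin.append_right]; fun_prop)

lemma measurable_card : Measurable fun x : Config => x.1 :=
  measurable_config fun n => (measurable_const : Measurable fun _ => n)

lemma measurable_mEnergy : Measurable fun x : Config => mEnergy (bag x) := by
  simp only [mEnergy_bag]
  exact measurable_config fun n => by
    simp only [energy]
    exact Finset.measurable_sum Finset.univ (f := fun i (q : Tuple n) => ‖(q i).1‖)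
      fun i _ => by fun_prop

lemma measurable_mMomentum : Measurable fun x : Config => mMomentum (bag x) := by
  simp only [mMomentum_bag]
  exact measurable_config fun n => by
    simp only [momentum]
    exact Finset.measurable_sum Finset.univ (f := fun i (q : Tuple n) => (q i).1)
      fun i _ => by fun_prop

/-! ### The measure on Fock space -/

instance (n : ℕ) : SigmaFinite (photonMeasureN n) := by unfold photonMeasureN; infer_instance

instance : SFinite configMeasure := by unfold configMeasure; infer_instance

instance : MeasurableSpace.CountablyGenerated Config := by
  have h : ∀ n : ℕ, MeasurableSpace.CountablyGenerated (Tuple n) := fun n => inferInstance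
  choose b hb hg using fun n => (h n).isCountablyGenerated
  refine ⟨⟨⋃ n, (Set.image (inSector n) '' (b n) ∪ {Set.range (inSector n)}), ?_, ?_⟩⟩
  · exact Set.countable_iUnion fun n => ((hb n).image _).union (Set.countable_singleton _)
  · apply le_antisymm
    · intro s hs
      have hs' : s = ⋃ n, inSector n '' (inSector n ⁻¹' s) := by
        ext ⟨n, q⟩
        simp only [Set.mem_iUnion, Set.mem_image, Set.mem_preimage]
        constructor
        · intro hx; exact ⟨n, q, hx, rfl⟩
        · rintro ⟨m, q', hx, e⟩; rw [← e]; exact hx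
      rw [hs']
      refine MeasurableSet.iUnion fun n => ?_
      have h1 : MeasurableSet (inSector n ⁻¹' s) := measurable_inSector n hs
      have h2 : MeasurableSet[MeasurableSpace.generateFrom (b n)] (inSector n ⁻¹' s) := by
        rw [← hg n]; exact h1
      have hr : MeasurableSet[MeasurableSpace.generateFrom (⋃ n, (Set.image (inSector n) '' (b n) ∪ {Set.range (inSector n)}))] (Set.range (inSector n)) :=
        MeasurableSpace.measurableSet_generateFrom (Set.mem_iUnion.2 ⟨n, Or.inr rfl⟩)
      generalize inSector n ⁻¹' s = u at h2
      induction u, h2 using MeasurableSpace.generateFrom_induction with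
      | hC t ht _ =>
        exact MeasurableSpace.measurableSet_generateFrom
          (Set.mem_iUnion.2 ⟨n, Or.inl ⟨t, ht, rfl⟩⟩)
      | empty => simp
      | compl t _ ih =>
        rw [Set.image_compl_eq_range_sdiff_image (inSector_injective n)]
        exact MeasurableSet.diff hr ih
      | iUnion f _ ih =>
        rw [Set.image_iUnion]
        exact MeasurableSet.iUnion ih
    · refine MeasurableSpace.generateFrom_le fun t ht => ?_
      obtain ⟨n, ht⟩ := Set.mem_iUnion.1 ht
      rcases ht with ⟨u, hu, rfl⟩ | ht
      · refine (inSector_measurableEmbedding n).measurableSet_image.2 ?_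
        rw [hg n]; exact MeasurableSpace.measurableSet_generateFrom hu
      · rw [Set.mem_singleton_iff.1 ht]
        exact (inSector_measurableEmbedding n).measurableSet_range

/-- The density `1/n!` on the `n`-photon sector. -/
def sectorDensity (x : Config) : NNReal := (x.1.factorial : NNReal)⁻¹

lemma measurable_sectorDensity : Measurable sectorDensity :=
  measurable_config fun n => (measurable_const : Measurable fun _ => (n.factorial : NNReal)⁻¹)

/-- The measure on configurations of indistinguishable photons. -/
def fockMeasure : Measure Config := configMeasure.withDensity fun x => sectorDensity x

instance : SFinite fockMeasure := by unfold fockMeasure; infer_instance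

lemma ae_fockMeasure {p : Config → Prop} :
    (∀ᵐ x ∂fockMeasure, p x) ↔ ∀ᵐ x ∂configMeasure, p x := by
  rw [fockMeasure, ae_withDensity_iff measurable_sectorDensity.coe_nnreal_ennreal]
  refine eventually_congr (.of_forall fun x => ?_)
  have : (sectorDensity x : ℝ≥0∞) ≠ 0 := by
    simp [sectorDensity, Nat.factorial_ne_zero]
  simp [this]

lemma ae_fockMeasure_iff {p : Config → Prop} :
    (∀ᵐ x ∂fockMeasure, p x) ↔ ∀ n, ∀ᵐ k ∂photonMeasureN n, p (inSector n k) := by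
  rw [ae_fockMeasure, ae_config_iff]

lemma lintegral_fockMeasure {f : Config → ℝ≥0∞} (hf : Measurable f) :
    ∫⁻ x, f x ∂fockMeasure =
      ∑' n : ℕ, (n.factorial : ℝ≥0∞)⁻¹ * ∫⁻ q, f (inSector n q) ∂photonMeasureN n := by
  rw [fockMeasure, lintegral_withDensity_eq_lintegral_mul _
    measurable_sectorDensity.coe_nnreal_ennreal hf, configMeasure, lintegral_sum_measure]
  refine tsum_congr fun n => ?_
  rw [(inSector_measurableEmbedding n).lintegral_map,
    ← lintegral_const_mul _ (show Measurable fun q => f (inSector n q) from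
      hf.comp (measurable_inSector n))]
  refine lintegral_congr fun q => ?_
  simp [sectorDensity, ENNReal.coe_inv, Nat.factorial_ne_zero]

lemma lintegral_prod_fockMeasure {α : Type*} [MeasurableSpace α] (ν : Measure α) [SFinite ν]
    {f : α × Config → ℝ≥0∞} (hf : Measurable f) :
    ∫⁻ p, f p ∂ν.prod fockMeasure =
      ∑' n : ℕ, (n.factorial : ℝ≥0∞)⁻¹ *
        ∫⁻ p, f (p.1, inSector n p.2) ∂ν.prod (photonMeasureN n) := by
  rw [lintegral_prod_symm' _ hf, lintegral_fockMeasure hf.lintegral_prod_left']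
  refine tsum_congr fun n => ?_
  rw [lintegral_prod_symm']
  exact hf.comp (measurable_fst.prodMk ((measurable_inSector n).comp measurable_snd))

lemma hasSum_of_eq {ι : Type*} {f g : ι → ℂ} {a : ℂ} (h : HasSum g a) (e : ∀ i, f i = g i) :
    HasSum f a := by
  rwa [show f = g from funext e]

lemma hasSum_integral_fockMeasure {f : Config → ℂ} (hf : Integrable f fockMeasure) :
    HasSum (fun n : ℕ => ((n.factorial : ℝ)⁻¹ : ℂ) * ∫ q, f (inSector n q) ∂photonMeasureN n)
      (∫ x, f x ∂fockMeasure) := by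
  rw [fockMeasure, integral_withDensity_eq_integral_smul measurable_sectorDensity]
  have hi : Integrable (fun x => sectorDensity x • f x) configMeasure :=
    (integrable_withDensity_iff_integrable_smul measurable_sectorDensity).1 hf
  have := hasSum_integral_measure (f := fun x => sectorDensity x • f x) hi
  refine hasSum_of_eq this fun n => ?_
  rw [(inSector_measurableEmbedding n).integral_map]
  rw [← integral_const_mul]
  refine integral_congr_ae (.of_forall fun q => ?_)
  simp [sectorDensity, NNReal.smul_def]

end

section
/-! ### The Mecke formula -/

open Classical in
/-- Sum over the ways of removing one photon. -/
def mSum {β : Type*} [AddCommMonoid β] (G : Photon → Bag → β) (s : Bag) : β :=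
  (s.map fun k => G k (s.erase k)).sum

lemma mSum_add {β : Type*} [AddCommMonoid β] (G : Photon → Bag → β)
    (s t : Bag) :
    mSum G (s + t) = mSum (fun k u => G k (u + t)) s + mSum (fun k u => G k (s + u)) t := by
  classical
  simp only [mSum, Multiset.map_add, Multiset.sum_add]
  congr 2
  · refine Multiset.map_congr rfl fun k hk => ?_
    rw [Multiset.erase_add_left_pos t hk]
  · refine Multiset.map_congr rfl fun k hk => ?_
    rw [Multiset.erase_add_right_pos s hk]

lemma mSum_cons {β : Type*} [AddCommMonoid β] (G : Photon → Bag → β)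
    (k : Photon) (t : Bag) :
    mSum G (k ::ₘ t) = G k t + mSum (fun k' u => G k' (k ::ₘ u)) t := by
  classical
  have := mSum_add G {k} t
  rw [Multiset.singleton_add] at this
  rw [this]
  simp [mSum]

lemma mSum_tuple {β : Type*} [AddCommMonoid β] (G : Photon → Bag → β) {n : ℕ}
    (q : Tuple (n + 1)) :
    mSum G (tupleBag q) = ∑ i, G (q i) (tupleBag (i.removeNth q)) := by
  classical
  have h : ∀ i, G (q i) (tupleBag (i.removeNth q)) =
      G (q i) ((tupleBag q).erase (q i)) := by
    intro i
    conv_rhs => rw [bag_removeNth i q, Multiset.erase_cons_head]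
  simp only [h, mSum]
  conv_lhs => rw [show tupleBag q = Finset.univ.val.map q from rfl]
  rw [Multiset.map_map]
  rfl

@[simp] lemma mSum_tuple_zero {β : Type*} [AddCommMonoid β] (G : Photon → Bag → β)
    (q : Fin 0 → Photon) : mSum G (tupleBag q) = 0 := by
  have : tupleBag q = 0 := by
    rw [← Multiset.card_eq_zero, card_bag]
  rw [this]; simp [mSum]

lemma measurePreserving_removeNth {n : ℕ} (i : Fin (n + 1)) :
    MeasurePreserving (fun q : Tuple (n + 1) => (q i, i.removeNth q))
      (photonMeasureN (n + 1)) (photonMeasure.prod (photonMeasureN n)) :=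
  measurePreserving_piFinSuccAbove (fun _ : Fin (n + 1) => photonMeasure) i

lemma measurableEmbedding_removeNth {n : ℕ} (i : Fin (n + 1)) :
    MeasurableEmbedding (fun q : Tuple (n + 1) => (q i, i.removeNth q)) :=
  (MeasurableEquiv.piFinSuccAbove (fun _ => Photon) i).measurableEmbedding

lemma measurable_mSum {β : Type*} [AddCommMonoid β] [MeasurableSpace β] [MeasurableAdd₂ β]
    {G : Photon → Bag → β}
    (hG : Measurable fun p : Photon × Config => G p.1 (bag p.2)) :
    Measurable fun x : Config => mSum G (bag x) := by
  refine measurable_config fun n => ?_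
  cases n with
  | zero => simp only [mSum_tuple_zero]; exact measurable_const
  | succ n =>
    simp only [mSum_tuple]
    refine Finset.measurable_sum _ fun i _ => ?_
    have : Measurable fun p : Photon × Tuple n => (p.1, inSector n p.2) :=
      measurable_fst.prodMk ((measurable_inSector n).comp measurable_snd)
    exact hG.comp (this.comp (measurableEmbedding_removeNth i).measurable)

theorem lintegral_mSum {G : Photon → Bag → ℝ≥0∞}
    (hG : Measurable fun p : Photon × Config => G p.1 (bag p.2)) :
    ∫⁻ x, mSum G (bag x) ∂fockMeasure =
      ∫⁻ p, G p.1 (bag p.2) ∂photonMeasure.prod fockMeasure := by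
  rw [lintegral_fockMeasure (measurable_mSum hG), lintegral_prod_fockMeasure _ hG,
    tsum_eq_zero_add' ENNReal.summable]
  simp only [mSum_tuple_zero, lintegral_zero, mul_zero, zero_add]
  refine tsum_congr fun n => ?_
  have hm : Measurable fun p : Photon × Tuple n => G p.1 (tupleBag p.2) := by
    have : Measurable fun p : Photon × Tuple n => (p.1, inSector n p.2) :=
      measurable_fst.prodMk ((measurable_inSector n).comp measurable_snd)
    exact hG.comp this
  simp only [mSum_tuple]
  rw [lintegral_finsetSum _ fun i _ =>
    show Measurable fun q : Tuple (n + 1) => G (q i) (tupleBag (i.removeNth q)) from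
      hm.comp (measurableEmbedding_removeNth i).measurable]
  have : ∀ i : Fin (n + 1), ∫⁻ q, G (q i) (tupleBag (i.removeNth q)) ∂photonMeasureN (n + 1) =
      ∫⁻ p, G p.1 (tupleBag p.2) ∂photonMeasure.prod (photonMeasureN n) := fun i =>
    (measurePreserving_removeNth i).lintegral_comp hm
  simp only [this, Finset.sum_const, Finset.card_univ, Fintype.card_fin, nsmul_eq_mul, ← mul_assoc]
  congr 1
  rw [Nat.factorial_succ]
  push_cast
  rw [ENNReal.mul_inv (Or.inl (by simp)) (Or.inl (by finiteness)), mul_comm, ← mul_assoc,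
    ENNReal.mul_inv_cancel (by simp) (by finiteness), one_mul]

lemma quasiMeasurePreserving_consConfig :
    Measure.QuasiMeasurePreserving consConfig (photonMeasure.prod fockMeasure) fockMeasure := by
  refine ⟨measurable_consConfig, Measure.AbsolutelyContinuous.mk fun s hs h0 => ?_⟩
  rw [Measure.map_apply measurable_consConfig hs]
  have h1 : ∀ n, ∀ᵐ q ∂photonMeasureN n, inSector n q ∉ s := by
    have : ∀ᵐ x ∂fockMeasure, x ∉ s := measure_eq_zero_iff_ae_notMem.1 h0
    exact ae_fockMeasure_iff.1 this
  have hm := measurable_consConfig hs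
  rw [← lintegral_indicator_one hm, lintegral_prod_fockMeasure _ (measurable_one.indicator hm)]
  refine ENNReal.tsum_eq_zero.2 fun n => ?_
  have hp := (measurePreserving_removeNth (n := n) 0)
  have hmeas : Measurable fun p : Photon × Tuple n =>
      (consConfig ⁻¹' s).indicator (1 : Photon × Config → ℝ≥0∞) (p.1, inSector n p.2) :=
    (measurable_one.indicator hm).comp
      (measurable_fst.prodMk ((measurable_inSector n).comp measurable_snd))
  suffices h : ∫⁻ a, (consConfig ⁻¹' s).indicator (1 : Photon × Config → ℝ≥0∞)
      (a 0, inSector n (Fin.removeNth 0 a)) ∂photonMeasureN (n + 1) = 0 by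
    rw [← hp.lintegral_comp hmeas]
    rw [h, mul_zero]
  rw [lintegral_eq_zero_iff (show Measurable fun a : Tuple (n + 1) =>
    (consConfig ⁻¹' s).indicator (1 : Photon × Config → ℝ≥0∞) (a 0, inSector n (Fin.removeNth 0 a))
    from hmeas.comp hp.measurable)]
  filter_upwards [h1 (n + 1)] with q hq
  have : consConfig (q 0, inSector n (Fin.removeNth 0 q)) = inSector (n + 1) q := by
    simp only [consConfig]
    congr 1
    exact Fin.cons_self_tail q
  exact Set.indicator_of_notMem (by rw [Set.mem_preimage, this]; exact hq) _

lemma ae_consConfig {p : Config → Prop} (h : ∀ᵐ x ∂fockMeasure, p x) :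
    ∀ᵐ k ∂photonMeasure, ∀ᵐ x ∂fockMeasure, p (consConfig (k, x)) :=
  Measure.ae_ae_of_ae_prod (quasiMeasurePreserving_consConfig.ae h)

theorem integrable_mSum {G : Photon → Bag → ℂ}
    (hm : Measurable fun p : Photon × Config => G p.1 (bag p.2))
    (hG : Integrable (fun p : Photon × Config => G p.1 (bag p.2))
      (photonMeasure.prod fockMeasure)) :
    Integrable (fun x => mSum G (bag x)) fockMeasure := by
  refine ⟨(measurable_mSum hm).aestronglyMeasurable, ?_⟩
  have h := hG.2
  rw [HasFiniteIntegral] at h ⊢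
  have h2 := lintegral_mSum (G := fun k s => ‖G k s‖ₑ) hm.enorm
  refine lt_of_le_of_lt ?_ (h2.trans_lt h)
  refine lintegral_mono fun x => ?_
  simp only [mSum]
  have := Multiset.le_sum_of_subadditive (fun z : ℂ => ‖z‖ₑ) enorm_zero.le (fun a b => enorm_add_le a b)
  refine (this _).trans_eq ?_
  rw [Multiset.map_map]; rfl

theorem integral_mSum {G : Photon → Bag → ℂ}
    (hm : Measurable fun p : Photon × Config => G p.1 (bag p.2))
    (hG : Integrable (fun p : Photon × Config => G p.1 (bag p.2))
      (photonMeasure.prod fockMeasure)) :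
    ∫ x, mSum G (bag x) ∂fockMeasure =
      ∫ p, G p.1 (bag p.2) ∂photonMeasure.prod fockMeasure := by
  have h1 := hasSum_integral_fockMeasure (integrable_mSum hm hG)
  rw [← hasSum_nat_add_iff' 1] at h1
  simp only [Finset.range_one, Finset.sum_singleton, mSum_tuple_zero, integral_zero, mul_zero,
    sub_zero] at h1
  refine h1.unique ?_
  have hG' := hG.swap
  rw [← integral_prod_swap]
  change HasSum _ (∫ z, ((fun p : Photon × Config => G p.1 (bag p.2)) ∘ Prod.swap) z
    ∂fockMeasure.prod photonMeasure)
  rw [integral_prod _ hG']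
  have h2 := hasSum_integral_fockMeasure hG'.integral_prod_left
  refine hasSum_of_eq h2 fun n => ?_
  have hm' : Measurable fun p : Photon × Tuple n => G p.1 (tupleBag p.2) := by
    have : Measurable fun p : Photon × Tuple n => (p.1, inSector n p.2) :=
      measurable_fst.prodMk ((measurable_inSector n).comp measurable_snd)
    exact hm.comp this
  have hi : Integrable (fun p : Photon × Tuple n => G p.1 (tupleBag p.2))
      (photonMeasure.prod (photonMeasureN n)) := by
    refine ⟨hm'.aestronglyMeasurable, ?_⟩
    have h3 := hG.2
    rw [HasFiniteIntegral, lintegral_prod_fockMeasure _ hm.enorm] at h3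
    have h4 := ENNReal.ne_top_of_tsum_ne_top h3.ne n
    rw [HasFiniteIntegral, lt_top_iff_ne_top]
    intro h5
    rw [h5] at h4
    refine h4 (ENNReal.mul_top ?_)
    simp
  have : ∀ i : Fin (n + 1), ∫ q, G (q i) (tupleBag (i.removeNth q)) ∂photonMeasureN (n + 1) =
      ∫ p, G p.1 (tupleBag p.2) ∂photonMeasure.prod (photonMeasureN n) := fun i =>
    (measurePreserving_removeNth i).integral_comp (measurableEmbedding_removeNth i)
      (fun p => G p.1 (tupleBag p.2))
  simp only [mSum_tuple]
  rw [integral_finsetSum _ fun i _ => show Integrable (fun q : Tuple (n + 1) =>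
    G (q i) (tupleBag (i.removeNth q))) _ from
      (measurePreserving_removeNth i).integrable_comp_of_integrable hi]
  simp only [this, Finset.sum_const, Finset.card_univ, Fintype.card_fin, nsmul_eq_mul, ← mul_assoc]
  have e : ∫ q, (∫ k, (fun p : Photon × Config => G p.1 (bag p.2)) (Prod.swap (inSector n q, k)) ∂photonMeasure) ∂photonMeasureN n =
      ∫ p, G p.1 (tupleBag p.2) ∂photonMeasure.prod (photonMeasureN n) := by
    rw [integral_prod_symm _ hi]; rfl
  rw [← e, Nat.factorial_succ]
  congr 1
  have : (n.factorial : ℂ) ≠ 0 := by exact_mod_cast n.factorial_ne_zero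
  have : (n : ℂ) + 1 ≠ 0 := by exact_mod_cast n.succ_ne_zero
  push_cast
  field_simp

end

section
/-! ### Fock vectors as functions of multisets -/

/-- Functions of photon multisets that represent Fock vectors. -/
structure IsAdm (Ψ : Bag → ℂ) : Prop where
  meas : Measurable fun x => Ψ (bag x)
  supp : ∀ s, 1 < mEnergy s → Ψ s = 0
  sq : ∫⁻ x, ‖Ψ (bag x)‖ₑ ^ 2 ∂fockMeasure ≠ ⊤

/-- The factor `√n!` on the `n`-photon sector. -/
def sqrtFact (x : Config) : ℝ := √(x.1.factorial)

lemma sqrtFact_pos (x : Config) : 0 < sqrtFact x :=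
  Real.sqrt_pos.2 (by exact_mod_cast x.1.factorial_pos)

lemma sqrtFact_sq (x : Config) : sqrtFact x ^ 2 = x.1.factorial := Real.sq_sqrt (by positivity)

lemma measurable_sqrtFact : Measurable sqrtFact :=
  measurable_config fun n => (measurable_const : Measurable fun _ => √(n.factorial : ℝ))

lemma sectorDensity_eq (x : Config) : (sectorDensity x : ℝ) = (sqrtFact x ^ 2)⁻¹ := by
  rw [sqrtFact_sq]; simp [sectorDensity]

lemma sectorDensity_mul_enorm (x : Config) (z : ℂ) :
    (sectorDensity x : ℝ≥0∞) * ‖(sqrtFact x : ℂ) * z‖ₑ ^ 2 = ‖z‖ₑ ^ 2 := by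
  have h : (sectorDensity x : ℝ≥0∞) = ofReal (sqrtFact x ^ 2)⁻¹ := by
    rw [← sectorDensity_eq, ENNReal.ofReal_coe_nnreal]
  have h2 : ‖(sqrtFact x : ℂ)‖ₑ = ofReal (sqrtFact x) := by
    rw [← ofReal_norm, norm_real, norm_of_nonneg (sqrtFact_pos x).le]
  rw [enorm_mul, h2, h, mul_pow, ← mul_assoc, ← ENNReal.ofReal_pow (sqrtFact_pos x).le,
    ← ENNReal.ofReal_mul (by positivity), inv_mul_cancel₀ (pow_pos (sqrtFact_pos x) 2).ne',
    ENNReal.ofReal_one, one_mul]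

lemma map_univ_eq_iff_perm {n : ℕ} {α : Type*} {q q' : Fin n → α} :
    Multiset.map q Finset.univ.val = Multiset.map q' Finset.univ.val ↔
      ∃ π : Equiv.Perm (Fin n), q = q' ∘ π := by
  classical
  constructor
  · intro h
    have hc : ∀ a, Nonempty ({i // q i = a} ≃ {i // q' i = a}) := by
      intro a
      rw [← Fintype.card_eq, Fintype.card_subtype, Fintype.card_subtype]
      have := congrArg (Multiset.count a) h
      rw [Multiset.count_map, Multiset.count_map] at this
      simpa [Finset.card, eq_comm] using this
    let e := fun a => (hc a).some
    refine ⟨(Equiv.sigmaFiberEquiv q).symm.trans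
      ((Equiv.sigmaCongrRight e).trans (Equiv.sigmaFiberEquiv q')), funext fun i => ?_⟩
    exact (e (q i) ⟨i, rfl⟩).2.symm
  · rintro ⟨π, rfl⟩
    rw [← Multiset.map_map, Multiset.map_univ_val_equiv]

lemma bag_eq_iff {x y : Config} (h : bag x = bag y) :
    ∃ (n : ℕ) (q : Tuple n) (π : Equiv.Perm (Fin n)), x = ⟨n, q⟩ ∧ y = ⟨n, q ∘ π⟩ := by
  obtain ⟨n, q⟩ := x
  obtain ⟨m, q'⟩ := y
  have hc := congrArg Multiset.card h
  simp only [card_bag] at hc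
  subst hc
  obtain ⟨π, hπ⟩ := map_univ_eq_iff_perm.1 h.symm
  exact ⟨n, q, π, rfl, congrArg (Sigma.mk n) hπ⟩

/-- Symmetrization of a wave function. -/
def symmetrize (f : Config → ℂ) (x : Config) : ℂ :=
  ((x.1.factorial : ℝ)⁻¹ : ℂ) * ∑ π : Equiv.Perm (Fin x.1), f (inSector x.1 (x.2 ∘ π))

lemma symmetrize_perm (f : Config → ℂ) {n : ℕ} (q : Tuple n) (π : Equiv.Perm (Fin n)) :
    symmetrize f ⟨n, q ∘ π⟩ = symmetrize f ⟨n, q⟩ := by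
  simp only [symmetrize]
  congr 1
  refine Fintype.sum_equiv (Equiv.mulLeft π) _ _ fun σ => ?_
  rfl

lemma measurable_symmetrize {f : Config → ℂ} (hf : Measurable f) : Measurable (symmetrize f) := by
  refine measurable_config fun n => ?_
  have h : Measurable fun q : Tuple n =>
      ∑ π : Equiv.Perm (Fin n), f (inSector n (q ∘ π)) := by
    refine Finset.measurable_sum _ fun π _ => ?_
    have hq : Measurable fun q : Tuple n => q ∘ π :=
      measurable_pi_iff.2 fun i => measurable_pi_apply _
    exact hf.comp ((measurable_inSector n).comp hq)
  exact h.const_mul ((n.factorial : ℝ)⁻¹ : ℂ)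

theorem exists_rep (ψ : FockOne) : ∃ Ψ : Bag → ℂ, IsAdm Ψ ∧
    ∀ᵐ x ∂fockMeasure, Ψ (bag x) = sqrtFact x * wave ψ x := by
  have hw : Measurable (wave ψ) := (Lp.stronglyMeasurable _).measurable
  let F : Config → ℂ := fun x =>
    if mEnergy (bag x) ≤ 1 then (sqrtFact x : ℂ) * symmetrize (wave ψ) x else 0
  have hF : Measurable F := Measurable.ite (measurableSet_le measurable_mEnergy measurable_const)
    ((measurable_ofReal.comp measurable_sqrtFact).mul (measurable_symmetrize hw))
    measurable_const
  have hfac : F.FactorsThrough bag := by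
    intro x y hxy
    have hE : mEnergy (bag x) = mEnergy (bag y) := by rw [hxy]
    obtain ⟨n, q, π, rfl, rfl⟩ := bag_eq_iff hxy
    simp only [F, hE, symmetrize_perm]
    rfl
  have hΨ : ∀ x, Function.extend bag F 0 (bag x) = F x := fun x =>
    hfac.extend_apply 0 x
  have hae : ∀ᵐ x ∂fockMeasure, F x = sqrtFact x * wave ψ x := by
    have h1 : ∀ᵐ x ∂fockMeasure, symmetrize (wave ψ) x = wave ψ x := by
      refine ae_fockMeasure_iff.2 fun n => ?_
      have := ae_all_iff.2 fun π => ψ.2.1 n π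
      filter_upwards [this] with q hq
      simp only [symmetrize, wave]
      rw [Finset.sum_congr rfl fun π _ => hq π]
      have : (n.factorial : ℂ) ≠ 0 := by exact_mod_cast n.factorial_ne_zero
      simp [Fintype.card_perm, this]
    have h2 := ae_fockMeasure.2 ψ.2.2
    filter_upwards [h1, h2] with x a b
    simp only [F]
    split_ifs with h
    · rw [a]
    · rw [mEnergy_bag, not_le] at h
      rw [wave, b h, mul_zero]
  refine ⟨Function.extend bag F 0, ⟨by simpa only [hΨ] using hF, fun s hs => ?_, ?_⟩,
    by simpa only [hΨ] using hae⟩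
  · by_cases h : ∃ x, bag x = s
    · obtain ⟨x, rfl⟩ := h
      rw [hΨ]; simp only [F]; rw [if_neg (not_le.2 hs)]
    · rw [Function.extend_apply' _ _ _ h]; rfl
  · simp only [hΨ]
    have e : ∫⁻ x, ‖F x‖ₑ ^ 2 ∂fockMeasure =
        ∫⁻ x, ‖(sqrtFact x : ℂ) * wave ψ x‖ₑ ^ 2 ∂fockMeasure :=
      lintegral_congr_ae (hae.mono fun x hx => by simp only [hx])
    rw [e, fockMeasure,
      lintegral_withDensity_eq_lintegral_mul _ measurable_sectorDensity.coe_nnreal_ennreal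
        (by exact ((measurable_ofReal.comp measurable_sqrtFact).mul hw).enorm.pow_const 2)]
    simp only [Pi.mul_apply]
    simp only [sectorDensity_mul_enorm]
    have := (Lp.memLp (ψ : Lp ℂ 2 configMeasure)).2
    rw [eLpNorm_lt_top_iff_lintegral_rpow_enorm_lt_top (by simp) (by simp)] at this
    simpa [wave] using this.ne

/-- A representative of a Fock vector, normalized so that
`⟨φ, ψ⟩ = ∑ₙ (1/n!) ∫ conj (rep φ) (rep ψ)`. -/
def rep (ψ : FockOne) : Bag → ℂ := (exists_rep ψ).choose

lemma rep_adm (ψ : FockOne) : IsAdm (rep ψ) := (exists_rep ψ).choose_spec.1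

lemma rep_ae (ψ : FockOne) :
    ∀ᵐ x ∂fockMeasure, rep ψ (bag x) = sqrtFact x * wave ψ x := (exists_rep ψ).choose_spec.2

lemma wave_ae (ψ : FockOne) :
    ∀ᵐ x ∂fockMeasure, wave ψ x = (sqrtFact x : ℂ)⁻¹ * rep ψ (bag x) := by
  filter_upwards [rep_ae ψ] with x hx
  have : (sqrtFact x : ℂ) ≠ 0 := by exact_mod_cast (sqrtFact_pos x).ne'
  rw [hx, inv_mul_cancel_left₀ this]

lemma rep_ext {φ ψ : FockOne} (h : ∀ᵐ x ∂fockMeasure, rep φ (bag x) = rep ψ (bag x)) :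
    φ = ψ := by
  refine Subtype.ext (Lp.ext ?_)
  refine ae_fockMeasure.1 ?_
  filter_upwards [h, wave_ae φ, wave_ae ψ] with x a b c
  change wave φ x = wave ψ x
  rw [b, c, a]



lemma IsAdm.memLp {Ψ : Bag → ℂ} (h : IsAdm Ψ) :
    MemLp (fun x => (sqrtFact x : ℂ)⁻¹ * Ψ (bag x)) 2 configMeasure := by
  have hm : Measurable fun x => (sqrtFact x : ℂ)⁻¹ * Ψ (bag x) :=
    (measurable_ofReal.comp measurable_sqrtFact).inv.mul h.meas
  refine ⟨hm.aestronglyMeasurable, ?_⟩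
  rw [eLpNorm_lt_top_iff_lintegral_rpow_enorm_lt_top (by simp) (by simp)]
  have := h.sq
  rw [fockMeasure, lintegral_withDensity_eq_lintegral_mul _
    measurable_sectorDensity.coe_nnreal_ennreal (h.meas.enorm.pow_const 2)] at this
  refine lt_top_iff_ne_top.2 ?_
  convert this using 3 with x
  simp only [Pi.mul_apply]
  rw [show (2 : ℝ≥0∞).toReal = ((2 : ℕ) : ℝ) by simp, rpow_natCast,
    ← sectorDensity_mul_enorm x ((sqrtFact x : ℂ)⁻¹ * _),
    mul_inv_cancel_left₀ (by exact_mod_cast (sqrtFact_pos x).ne')]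

open Classical in
/-- The Fock vector with a given representative. -/
def ofFun (Ψ : Bag → ℂ) : FockOne :=
  if h : IsAdm Ψ then ⟨h.memLp.toLp, by
    change IsFockVector _
    refine IsFockVector.congr ?_ h.memLp.coeFn_toLp
    refine ⟨fun n π => Eventually.of_forall fun k => ?_, Eventually.of_forall fun x hx => ?_⟩
    · have : bag ⟨n, k ∘ π⟩ = bag ⟨n, k⟩ :=
        map_univ_eq_iff_perm.2 ⟨π, rfl⟩
      simp only [this]; rfl
    · rw [← mEnergy_bag] at hx
      simp only [h.supp _ hx, mul_zero]⟩
  else 0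

lemma rep_ofFun {Ψ : Bag → ℂ} (h : IsAdm Ψ) :
    ∀ᵐ x ∂fockMeasure, rep (ofFun Ψ) (bag x) = Ψ (bag x) := by
  filter_upwards [rep_ae (ofFun Ψ), ae_fockMeasure.2 h.memLp.coeFn_toLp] with x a b
  have : wave (ofFun Ψ) x = (sqrtFact x : ℂ)⁻¹ * Ψ (bag x) := by
    rw [← b, ofFun, dif_pos h]; rfl
  rw [a, this, mul_inv_cancel_left₀ (by exact_mod_cast (sqrtFact_pos x).ne')]

lemma rep_add (φ ψ : FockOne) : ∀ᵐ x ∂fockMeasure,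
    rep (φ + ψ) (bag x) = rep φ (bag x) + rep ψ (bag x) := by
  filter_upwards [rep_ae (φ + ψ), rep_ae φ, rep_ae ψ,
    ae_fockMeasure.2 (Lp.coeFn_add (φ : Lp ℂ 2 configMeasure) ψ)] with x a b c d
  rw [a, b, c, ← mul_add]; congr 1

lemma rep_smul (z : ℂ) (ψ : FockOne) : ∀ᵐ x ∂fockMeasure,
    rep (z • ψ) (bag x) = z * rep ψ (bag x) := by
  filter_upwards [rep_ae (z • ψ), rep_ae ψ,
    ae_fockMeasure.2 (Lp.coeFn_smul z (ψ : Lp ℂ 2 configMeasure))] with x a b d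
  have : wave (z • ψ) x = z * wave ψ x := d
  rw [a, b, this]; ring

lemma integrable_conj_mul {Φ Ψ : Bag → ℂ} (hΦ : IsAdm Φ) (hΨ : IsAdm Ψ) :
    Integrable (fun x => conj (Φ (bag x)) * Ψ (bag x)) fockMeasure := by
  have h : ∀ {Φ : Bag → ℂ}, IsAdm Φ → MemLp (fun x => Φ (bag x)) 2 fockMeasure := by
    intro Φ h
    refine ⟨h.meas.aestronglyMeasurable, ?_⟩
    rw [eLpNorm_lt_top_iff_lintegral_rpow_enorm_lt_top (by simp) (by simp)]
    simpa using lt_top_iff_ne_top.2 h.sq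
  exact MemLp.integrable_mul (h hΦ).star (h hΨ)

theorem inner_eq (φ ψ : FockOne) :
    inner ℂ φ ψ = ∫ x, conj (rep φ (bag x)) * rep ψ (bag x) ∂fockMeasure := by
  rw [Submodule.coe_inner, L2.inner_def, fockMeasure,
    integral_withDensity_eq_integral_smul measurable_sectorDensity]
  refine integral_congr_ae ?_
  filter_upwards [ae_fockMeasure.1 (rep_ae φ), ae_fockMeasure.1 (rep_ae ψ)] with x a b
  rw [a, b, NNReal.smul_def, sectorDensity_eq]
  have : (sqrtFact x : ℂ) ≠ 0 := by exact_mod_cast (sqrtFact_pos x).ne'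
  simp only [RCLike.inner_apply, map_mul, conj_ofReal, wave, Complex.real_smul]
  push_cast
  field_simp

theorem enorm_sq_eq (ψ : FockOne) :
    ‖ψ‖ₑ ^ 2 = ∫⁻ x, ‖rep ψ (bag x)‖ₑ ^ 2 ∂fockMeasure := by
  have h := inner_eq ψ ψ
  have h2 : ∀ z : ℂ, conj z * z = ((‖z‖ ^ 2 : ℝ) : ℂ) := fun z => by
    rw [mul_comm, Complex.mul_conj, Complex.normSq_eq_norm_sq]
  simp only [h2] at h
  rw [integral_complex_ofReal] at h
  have h4 := inner_self_eq_norm_sq_to_K (𝕜 := ℂ) ψ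
  have h3 : ‖ψ‖ ^ 2 = ∫ x, ‖rep ψ (bag x)‖ ^ 2 ∂fockMeasure := by
    have := h4.symm.trans h
    simp only [← Complex.ofReal_pow, Complex.coe_algebraMap] at this
    exact Complex.ofReal_injective this
  rw [← ofReal_norm, ← ENNReal.ofReal_pow (norm_nonneg _), h3,
    integral_eq_lintegral_of_nonneg_ae (.of_forall fun x => by positivity)
      ((rep_adm ψ).meas.norm.pow_const 2).aestronglyMeasurable,
    ENNReal.ofReal_toReal]
  · simp [ENNReal.ofReal_pow]
  · simpa [ENNReal.ofReal_pow] using (rep_adm ψ).sq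

instance : TopologicalSpace.SeparableSpace FockOne := by
  have : Fact ((2 : ℝ≥0∞) ≠ ⊤) := ⟨by simp⟩
  infer_instance

end

section
instance : SFinite photonMeasure := inferInstance

/-! ### Annihilation operators -/

lemma mSum_recons {β : Type*} [AddCommMonoid β] (G : Photon → Bag → β)
    (s : Bag) : mSum (fun k u => G k (k ::ₘ u)) s = (s.map fun k => G k s).sum := by
  classical
  simp only [mSum]
  congr 1
  refine Multiset.map_congr rfl fun k hk => ?_
  rw [Multiset.cons_erase hk]

lemma measurable_rep_cons (ψ : FockOne) :
    Measurable fun p : Photon × Config => rep ψ (p.1 ::ₘ bag p.2) := by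
  have := (rep_adm ψ).meas.comp measurable_consConfig
  simpa [Function.comp_def] using this

lemma ae_photon_ne_zero : ∀ᵐ k ∂photonMeasure, k.1 ≠ 0 := by
  have h : ∀ᵐ p : Momentum ∂volume, p ≠ 0 := Measure.ae_ne volume 0
  exact Measure.quasiMeasurePreserving_fst.ae h

theorem lintegral_norm_mul_cons {Ψ : Bag → ℂ}
    (hΨ : Measurable fun x => Ψ (bag x)) (hs : ∀ s, 1 < mEnergy s → Ψ s = 0) :
    ∫⁻ k, ‖k.1‖ₑ * ∫⁻ x, ‖Ψ (k ::ₘ bag x)‖ₑ ^ 2 ∂fockMeasure ∂photonMeasure ≤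
      ∫⁻ x, ‖Ψ (bag x)‖ₑ ^ 2 ∂fockMeasure := by
  have hc : Measurable fun p : Photon × Config => Ψ (p.1 ::ₘ bag p.2) := by
    have := hΨ.comp measurable_consConfig
    simpa [Function.comp_def] using this
  have hm : Measurable fun p : Photon × Config =>
      ‖p.1.1‖ₑ * ‖Ψ (p.1 ::ₘ bag p.2)‖ₑ ^ 2 :=
    (measurable_fst.comp measurable_fst).enorm.mul (hc.enorm.pow_const 2)
  have h1 := lintegral_mSum (G := fun k s => ‖k.1‖ₑ * ‖Ψ (k ::ₘ s)‖ₑ ^ 2) hm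
  rw [lintegral_prod _ hm.aemeasurable] at h1
  have h2 : ∀ k : Photon, ∫⁻ x, ‖k.1‖ₑ * ‖Ψ (k ::ₘ bag x)‖ₑ ^ 2 ∂fockMeasure =
      ‖k.1‖ₑ * ∫⁻ x, ‖Ψ (k ::ₘ bag x)‖ₑ ^ 2 ∂fockMeasure := fun k =>
    lintegral_const_mul _ ((hc.comp measurable_prodMk_left).enorm.pow_const 2)
  simp only [h2] at h1
  rw [← h1]
  refine lintegral_mono fun x => ?_
  rw [mSum_recons (fun k s => ‖k.1‖ₑ * ‖Ψ s‖ₑ ^ 2), Multiset.sum_map_mul_right]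
  by_cases hx : 1 < mEnergy (bag x)
  · simp [hs _ hx]
  · have : ((bag x).map fun k : Photon => ‖k.1‖ₑ).sum =
        ofReal (mEnergy (bag x)) := by
      generalize bag x = s
      induction s using Multiset.induction with
      | empty => simp [mEnergy]
      | cons k s ih =>
        rw [Multiset.map_cons, Multiset.sum_cons, ih, mEnergy_cons,
          ENNReal.ofReal_add (norm_nonneg _) (mEnergy_nonneg _), ofReal_norm]
    rw [this]
    calc _ ≤ 1 * ‖Ψ (bag x)‖ₑ ^ 2 := by
          gcongr
          exact ENNReal.ofReal_le_one.2 (not_lt.1 hx)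
      _ = _ := one_mul _

theorem lintegral_norm_mul_rep_cons (ψ : FockOne) :
    ∫⁻ k, ‖k.1‖ₑ * ∫⁻ x, ‖rep ψ (k ::ₘ bag x)‖ₑ ^ 2 ∂fockMeasure ∂photonMeasure ≤
      ‖ψ‖ₑ ^ 2 := by
  rw [enorm_sq_eq]
  exact lintegral_norm_mul_cons (rep_adm ψ).meas (rep_adm ψ).supp

/-- The annihilation operator `a(k)`; for fixed `ψ` it is defined for almost every `k`. -/
def ann (k : Photon) (ψ : FockOne) : FockOne := ofFun fun s => rep ψ (k ::ₘ s)

lemma ae_isAdm_cons (ψ : FockOne) :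
    ∀ᵐ k ∂photonMeasure, IsAdm fun s => rep ψ (k ::ₘ s) := by
  have hm : Measurable fun k : Photon => ‖k.1‖ₑ *
      ∫⁻ x, ‖rep ψ (k ::ₘ bag x)‖ₑ ^ 2 ∂fockMeasure :=
    measurable_fst.enorm.mul ((measurable_rep_cons ψ).enorm.pow_const 2).lintegral_prod_right'
  have h := ae_lt_top hm (ne_top_of_le_ne_top (by finiteness) (lintegral_norm_mul_rep_cons ψ))
  filter_upwards [h, ae_photon_ne_zero] with k hk h0
  refine ⟨(measurable_rep_cons ψ).comp measurable_prodMk_left, fun s hs => ?_, fun ht => ?_⟩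
  · refine (rep_adm ψ).supp _ ?_
    rw [mEnergy_cons]; linarith [norm_nonneg k.1]
  · rw [ht, ENNReal.mul_top (by simpa using h0)] at hk
    exact lt_irrefl _ hk

lemma rep_ann (ψ : FockOne) : ∀ᵐ k ∂photonMeasure, ∀ᵐ x ∂fockMeasure,
    rep (ann k ψ) (bag x) = rep ψ (k ::ₘ bag x) := by
  filter_upwards [ae_isAdm_cons ψ] with k hk
  exact rep_ofFun hk

lemma ae_cons {p : Bag → Prop} (h : ∀ᵐ x ∂fockMeasure, p (bag x)) :
    ∀ᵐ k ∂photonMeasure, ∀ᵐ x ∂fockMeasure, p (k ::ₘ bag x) := by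
  simpa using ae_consConfig h

lemma ann_add (φ ψ : FockOne) : ∀ᵐ k ∂photonMeasure, ann k (φ + ψ) = ann k φ + ann k ψ := by
  filter_upwards [rep_ann φ, rep_ann ψ, rep_ann (φ + ψ), ae_consConfig (rep_add φ ψ)] with k a b c d
  refine rep_ext ?_
  filter_upwards [a, b, c, d, rep_add (ann k φ) (ann k ψ)] with x a b c d e
  simp only [bag_consConfig] at d
  rw [c, d, e, a, b]

lemma ann_smul (z : ℂ) (ψ : FockOne) : ∀ᵐ k ∂photonMeasure, ann k (z • ψ) = z • ann k ψ := by
  filter_upwards [rep_ann ψ, rep_ann (z • ψ), ae_consConfig (rep_smul z ψ)] with k b c d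
  refine rep_ext ?_
  filter_upwards [b, c, d, rep_smul z (ann k ψ)] with x b c d e
  simp only [bag_consConfig] at d
  rw [c, d, e, b]

lemma enorm_ann (ψ : FockOne) : ∀ᵐ k ∂photonMeasure,
    ‖ann k ψ‖ₑ ^ 2 = ∫⁻ x, ‖rep ψ (k ::ₘ bag x)‖ₑ ^ 2 ∂fockMeasure := by
  filter_upwards [rep_ann ψ] with k hk
  rw [enorm_sq_eq]
  refine lintegral_congr_ae ?_
  filter_upwards [hk] with x hx
  rw [hx]

lemma lintegral_norm_mul_ann (ψ : FockOne) :
    ∫⁻ k, ‖k.1‖ₑ * ‖ann k ψ‖ₑ ^ 2 ∂photonMeasure ≤ ‖ψ‖ₑ ^ 2 := by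
  refine le_trans (le_of_eq (lintegral_congr_ae ?_)) (lintegral_norm_mul_rep_cons ψ)
  filter_upwards [enorm_ann ψ] with k hk
  rw [hk]

lemma aemeasurable_enorm_ann (ψ : FockOne) :
    AEMeasurable (fun k => ‖ann k ψ‖ₑ ^ 2) photonMeasure :=
  ⟨_, ((measurable_rep_cons ψ).enorm.pow_const 2).lintegral_prod_right', enorm_ann ψ⟩

lemma aemeasurable_norm_ann (ψ : FockOne) :
    AEMeasurable (fun k => ‖ann k ψ‖) photonMeasure := by
  have h := ((aemeasurable_enorm_ann ψ).pow_const (1 / 2 : ℝ)).ennreal_toReal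
  refine h.congr (.of_forall fun k => ?_)
  have : (‖ann k ψ‖ₑ ^ 2) ^ (1 / 2 : ℝ) = ‖ann k ψ‖ₑ := by
    rw [← rpow_natCast, ← ENNReal.rpow_mul]; norm_num
  change ((‖ann k ψ‖ₑ ^ 2) ^ (1 / 2 : ℝ)).toReal = _
  rw [this, toReal_enorm]

lemma inner_ann (φ ψ : FockOne) : ∀ᵐ k ∂photonMeasure, inner ℂ φ (ann k ψ) =
    ∫ x, conj (rep φ (bag x)) * rep ψ (k ::ₘ bag x) ∂fockMeasure := by
  filter_upwards [rep_ann ψ] with k hk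
  rw [inner_eq]
  refine integral_congr_ae ?_
  filter_upwards [hk] with x hx
  rw [hx]

lemma aestronglyMeasurable_inner_ann (φ ψ : FockOne) :
    AEStronglyMeasurable (fun k => inner ℂ φ (ann k ψ)) photonMeasure := by
  have hm : StronglyMeasurable fun p : Photon × Config =>
      conj (rep φ (bag p.2)) * rep ψ (p.1 ::ₘ bag p.2) :=
    ((continuous_conj.measurable.comp ((rep_adm φ).meas.comp measurable_snd)).mul
      (measurable_rep_cons ψ)).stronglyMeasurable
  exact ⟨_, hm.integral_prod_right', inner_ann φ ψ⟩

theorem annihilationForm_eq (φ ψ : FockOne) :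
    ∀ᵐ k ∂photonMeasure, annihilationForm k φ ψ = inner ℂ φ (ann k ψ) := by
  filter_upwards [inner_ann φ ψ, ae_consConfig (wave_ae ψ), ae_isAdm_cons ψ] with k h1 h2 h3
  rw [h1, annihilationForm]
  have hi := integrable_conj_mul (rep_adm φ) h3
  refine (hasSum_of_eq (hasSum_integral_fockMeasure hi) fun n => ?_).tsum_eq
  rw [← integral_const_mul, ← integral_const_mul]
  refine integral_congr_ae ?_
  filter_upwards [ae_fockMeasure_iff.1 h2 n, ae_fockMeasure_iff.1 (wave_ae φ) n] with q a b
  have e : consConfig (k, inSector n q) = ⟨n + 1, Fin.cons k q⟩ := rfl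
  rw [e] at a
  rw [← e, bag_consConfig, e] at a
  change wave φ ⟨n, q⟩ = _ at b
  rw [a, b]
  have s1 : sqrtFact ⟨n + 1, Fin.cons k q⟩ = √(n + 1) * √(n.factorial) := by
    simp only [sqrtFact, Nat.factorial_succ]
    push_cast
    rw [Real.sqrt_mul (by positivity)]
  have s2 : sqrtFact (inSector n q) = √(n.factorial) := rfl
  rw [s1, s2]
  have p1 : ((√((n : ℝ) + 1) : ℝ) : ℂ) ≠ 0 := by
    exact_mod_cast (Real.sqrt_pos.2 (by positivity)).ne'
  have p2 : ((√(n.factorial : ℝ) : ℝ) : ℂ) ≠ 0 := by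
    exact_mod_cast (Real.sqrt_pos.2 (by positivity)).ne'
  have p3 : (n.factorial : ℂ) = (√(n.factorial : ℝ) : ℝ) * (√(n.factorial : ℝ) : ℝ) := by
    rw [← Complex.ofReal_mul, Real.mul_self_sqrt (by positivity)]; simp
  simp only [map_mul, map_inv₀, conj_ofReal, Complex.ofReal_natCast]
  rw [p3]
  push_cast
  field_simp

/-! ### Creation operators -/

/-- Sets of photons on which creation operators are bounded. -/
structure GoodSet (c : ℝ) (S : Set Photon) : Prop where
  pos : 0 < c
  meas : MeasurableSet S
  le : ∀ k ∈ S, c ≤ ‖k.1‖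
  fin : photonMeasure S ≠ ⊤

/-- The representative of `∫_S a*(k) ψ dk`. -/
def creatFun (S : Set Photon) (Ψ : Bag → ℂ) (s : Bag) : ℂ :=
  if mEnergy s ≤ 1 then mSum (fun k u => S.indicator 1 k * Ψ u) s else 0

/-- The creation operator `∫_S a*(k) dk`, restricted to `H_f ≤ 1`. -/
def creat (S : Set Photon) (ψ : FockOne) : FockOne := ofFun (creatFun S (rep ψ))

lemma mSum_indicator_sq_le {c : ℝ} {S : Set Photon} (hS : GoodSet c S)
    (Ψ : Bag → ℂ) (x : Config) (hx : mEnergy (bag x) ≤ 1) :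
    ‖mSum (fun k u => S.indicator 1 k * Ψ u) (bag x)‖ₑ ^ 2 ≤
      ofReal c⁻¹ * mSum (fun k u => S.indicator 1 k * ‖Ψ u‖ₑ ^ 2) (bag x) := by
  obtain ⟨n, q⟩ := x
  cases n with
  | zero => rw [show bag ⟨0, q⟩ = tupleBag q from rfl]; simp
  | succ n =>
    change ‖mSum _ (tupleBag q)‖ₑ ^ 2 ≤ _ * mSum _ (tupleBag q)
    rw [mSum_tuple, mSum_tuple]
    set a : Fin (n + 1) → ℝ := fun i => S.indicator 1 (q i)
    set b : Fin (n + 1) → ℂ := fun i => Ψ (tupleBag (i.removeNth q))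
    have ha : ∀ i, 0 ≤ a i ∧ a i ^ 2 = a i ∧ a i * c ≤ ‖(q i).1‖ := by
      intro i
      by_cases hi : q i ∈ S
      · simp [a, hi, hS.le _ hi]
      · simp [a, hi]
    have hE : (∑ i, a i) * c ≤ 1 := by
      rw [mEnergy_bag] at hx
      refine le_trans ?_ hx
      rw [Finset.sum_mul, energy]
      exact Finset.sum_le_sum fun i _ => (ha i).2.2
    have h1 : ‖∑ i, S.indicator 1 (q i) * b i‖ ^ 2 ≤ c⁻¹ * ∑ i, a i * ‖b i‖ ^ 2 := by
      have e1 : ‖∑ i, S.indicator 1 (q i) * b i‖ ≤ ∑ i, a i * (a i * ‖b i‖) := by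
        refine (norm_sum_le _ _).trans (Finset.sum_le_sum fun i _ => ?_)
        by_cases hi : q i ∈ S <;> simp [a, hi]
      have e2 := Finset.sum_mul_sq_le_sq_mul_sq Finset.univ a fun i => a i * ‖b i‖
      calc _ ≤ (∑ i, a i * (a i * ‖b i‖)) ^ 2 := by gcongr
        _ ≤ _ := e2
        _ = (∑ i, a i) * ∑ i, a i * ‖b i‖ ^ 2 := by
            simp only [mul_pow, (ha _).2.1]
        _ ≤ _ := by
            refine mul_le_mul_of_nonneg_right ?_ (Finset.sum_nonneg fun i _ =>
              mul_nonneg (ha i).1 (by positivity))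
            rw [← one_div, le_div_iff₀ hS.pos]; exact hE
    have h2 : ‖∑ i, S.indicator 1 (q i) * b i‖ₑ ^ 2 =
        ofReal (‖∑ i, S.indicator 1 (q i) * b i‖ ^ 2) := by
      rw [ENNReal.ofReal_pow (norm_nonneg _), ofReal_norm]
    change ‖∑ i, S.indicator 1 (q i) * b i‖ₑ ^ 2 ≤ _
    rw [h2]
    refine (ENNReal.ofReal_le_ofReal h1).trans_eq ?_
    rw [ENNReal.ofReal_mul (inv_nonneg.2 hS.pos.le),
      ENNReal.ofReal_sum_of_nonneg fun i _ => mul_nonneg (ha i).1 (by positivity)]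
    congr 1
    refine Finset.sum_congr rfl fun i _ => ?_
    rw [ENNReal.ofReal_mul (ha i).1, ENNReal.ofReal_pow (norm_nonneg _), ofReal_norm]
    congr 1
    by_cases hi : q i ∈ S <;> simp [a, hi]

lemma creat_lintegral_le {c : ℝ} {S : Set Photon} (hS : GoodSet c S) {Ψ : Bag → ℂ}
    (hΨ : IsAdm Ψ) :
    ∫⁻ x, ‖creatFun S Ψ (bag x)‖ₑ ^ 2 ∂fockMeasure ≤
      ofReal c⁻¹ * (photonMeasure S * ∫⁻ x, ‖Ψ (bag x)‖ₑ ^ 2 ∂fockMeasure) := by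
  have hm : Measurable fun p : Photon × Config =>
      S.indicator (1 : Photon → ℝ≥0∞) p.1 * ‖Ψ (bag p.2)‖ₑ ^ 2 :=
    ((measurable_one.indicator hS.meas).comp measurable_fst).mul
      ((hΨ.meas.comp measurable_snd).enorm.pow_const 2)
  calc _ ≤ ∫⁻ x, ofReal c⁻¹ *
        mSum (fun k u => S.indicator 1 k * ‖Ψ u‖ₑ ^ 2) (bag x) ∂fockMeasure := by
        refine lintegral_mono fun x => ?_
        simp only [creatFun]
        split_ifs with h
        · exact mSum_indicator_sq_le hS _ x h
        · simp
    _ = _ := by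
        rw [lintegral_const_mul _ (measurable_mSum hm)]
        congr 1
        rw [lintegral_mSum hm,
          lintegral_prod_mul (measurable_one.indicator hS.meas).aemeasurable
            (hΨ.meas.enorm.pow_const 2).aemeasurable,
          lintegral_indicator_one hS.meas]

lemma isAdm_creatFun {c : ℝ} {S : Set Photon} (hS : GoodSet c S) {Ψ : Bag → ℂ}
    (hΨ : IsAdm Ψ) : IsAdm (creatFun S Ψ) := by
  refine ⟨?_, fun s hs => ?_, ne_top_of_le_ne_top ?_ (creat_lintegral_le hS hΨ)⟩
  · refine Measurable.ite (measurableSet_le measurable_mEnergy measurable_const)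
      (measurable_mSum ?_) measurable_const
    exact ((measurable_one.indicator hS.meas).comp measurable_fst).mul
      (hΨ.meas.comp measurable_snd)
  · simp [creatFun, not_le.2 hs]
  · have := hS.fin
    have := hΨ.sq
    finiteness

lemma rep_creat {c : ℝ} {S : Set Photon} (hS : GoodSet c S) (ψ : FockOne) :
    ∀ᵐ x ∂fockMeasure, rep (creat S ψ) (bag x) = creatFun S (rep ψ) (bag x) :=
  rep_ofFun (isAdm_creatFun hS (rep_adm ψ))

lemma lintegral_ann_le {c : ℝ} {S : Set Photon} (hS : GoodSet c S) (ψ : FockOne) :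
    ∫⁻ k in S, ‖ann k ψ‖ₑ ^ 2 ∂photonMeasure ≤ ofReal c⁻¹ * ‖ψ‖ₑ ^ 2 := by
  calc _ ≤ ∫⁻ k in S, ofReal c⁻¹ * (‖k.1‖ₑ * ‖ann k ψ‖ₑ ^ 2) ∂photonMeasure := by
        refine setLIntegral_mono_ae' hS.meas (.of_forall fun k hk => ?_)
        rw [← mul_assoc]
        conv_lhs => rw [← one_mul (‖ann k ψ‖ₑ ^ 2)]
        gcongr
        rw [← ofReal_norm, ← ENNReal.ofReal_mul (inv_nonneg.2 hS.pos.le), ENNReal.one_le_ofReal,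
          ← div_eq_inv_mul, le_div_iff₀ hS.pos, one_mul]
        exact hS.le k hk
    _ ≤ ∫⁻ k, ofReal c⁻¹ * (‖k.1‖ₑ * ‖ann k ψ‖ₑ ^ 2) ∂photonMeasure :=
        setLIntegral_le_lintegral _ _
    _ ≤ _ := by
        rw [lintegral_const_mul' _ _ ENNReal.ofReal_ne_top]
        gcongr
        exact lintegral_norm_mul_ann ψ

end

section
lemma norm_inner_le (φ ψ : FockOne) : ‖(inner ℂ φ ψ : ℂ)‖ ≤ ‖φ‖ * ‖ψ‖ := norm_inner_le_norm φ ψ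

lemma inner_self_eq (ψ : FockOne) : (inner ℂ ψ ψ : ℂ) = ((‖ψ‖ ^ 2 : ℝ) : ℂ) := by
  refine (inner_self_eq_norm_sq_to_K (𝕜 := ℂ) ψ).trans ?_
  simp

lemma ennreal_mul_le_sq_add_sq (a b : ℝ≥0∞) : a * b ≤ a ^ 2 + b ^ 2 := by
  rcases le_total a b with h | h
  · calc a * b ≤ b * b := by gcongr
      _ = b ^ 2 := (sq b).symm
      _ ≤ _ := le_add_self
  · calc a * b ≤ a * a := by gcongr
      _ = a ^ 2 := (sq a).symm
      _ ≤ _ := le_self_add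

lemma integrable_indicator_conj_mul {c : ℝ} {S : Set Photon} (hS : GoodSet c S) (φ ψ : FockOne) :
    Integrable (fun p : Photon × Config => S.indicator 1 p.1 *
      (conj (rep φ (bag p.2)) * rep ψ (p.1 ::ₘ bag p.2)))
      (photonMeasure.prod fockMeasure) := by
  have hI : Measurable fun p : Photon × Config => S.indicator (1 : Photon → ℂ) p.1 :=
    (measurable_one.indicator hS.meas).comp measurable_fst
  have hI' : Measurable fun p : Photon × Config => S.indicator (1 : Photon → ℝ≥0∞) p.1 :=
    (measurable_one.indicator hS.meas).comp measurable_fst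
  have hφ : Measurable fun p : Photon × Config => rep φ (bag p.2) :=
    (rep_adm φ).meas.comp measurable_snd
  have hψ := measurable_rep_cons ψ
  refine ⟨(hI.mul ((continuous_conj.measurable.comp hφ).mul hψ)).aestronglyMeasurable, ?_⟩
  have hb : ∀ p : Photon × Config, ‖S.indicator (1 : Photon → ℂ) p.1 *
      (conj (rep φ (bag p.2)) * rep ψ (p.1 ::ₘ bag p.2))‖ₑ ≤
      S.indicator 1 p.1 * ‖rep φ (bag p.2)‖ₑ ^ 2 +
        S.indicator 1 p.1 * ‖rep ψ (p.1 ::ₘ bag p.2)‖ₑ ^ 2 := by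
    intro p
    have hc : ‖conj (rep φ (bag p.2))‖ₑ = ‖rep φ (bag p.2)‖ₑ := by
      rw [← ofReal_norm, RCLike.norm_conj, ofReal_norm]
    rw [← mul_add, enorm_mul, enorm_mul, hc]
    by_cases hp : p.1 ∈ S
    · simpa [hp] using ennreal_mul_le_sq_add_sq _ _
    · simp [hp]
  refine lt_of_le_of_lt (lintegral_mono hb) ?_
  rw [lintegral_add_left (hI'.fun_mul (hφ.enorm.pow_const 2)),
    lintegral_prod_mul (measurable_one.indicator hS.meas).aemeasurable
      ((rep_adm φ).meas.enorm.pow_const 2).aemeasurable,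
    lintegral_indicator_one hS.meas, ← enorm_sq_eq,
    lintegral_prod _ (hI'.fun_mul (hψ.enorm.pow_const 2)).aemeasurable]
  refine ENNReal.add_lt_top.2 ⟨?_, ?_⟩
  · have := hS.fin
    finiteness
  · have h2 : ∀ᵐ k ∂photonMeasure, ∫⁻ x, S.indicator 1 k * ‖rep ψ (k ::ₘ bag x)‖ₑ ^ 2
        ∂fockMeasure = S.indicator (fun k => ‖ann k ψ‖ₑ ^ 2) k := by
      filter_upwards [enorm_ann ψ] with k hk
      by_cases hp : k ∈ S
      · simp [hp, hk]
      · simp [hp]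
    rw [lintegral_congr_ae h2, lintegral_indicator hS.meas]
    refine lt_of_le_of_lt (lintegral_ann_le hS ψ) ?_
    finiteness

/-- `∫_S a*(k) dk` is adjoint to `∫_S a(k) dk`. -/
theorem inner_creat {c : ℝ} {S : Set Photon} (hS : GoodSet c S) (φ ψ : FockOne) :
    inner ℂ (creat S φ) ψ = ∫ k in S, inner ℂ φ (ann k ψ) ∂photonMeasure := by
  have hi := integrable_indicator_conj_mul hS φ ψ
  have hm : Measurable fun p : Photon × Config => S.indicator (1 : Photon → ℂ) p.1 *
      (conj (rep φ (bag p.2)) * rep ψ (p.1 ::ₘ bag p.2)) :=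
    ((measurable_one.indicator hS.meas).comp measurable_fst).mul
      ((continuous_conj.measurable.comp ((rep_adm φ).meas.comp measurable_snd)).mul
        (measurable_rep_cons ψ))
  rw [inner_eq]
  have e1 : ∀ᵐ x ∂fockMeasure, conj (rep (creat S φ) (bag x)) * rep ψ (bag x) =
      mSum (fun k u => S.indicator 1 k * (conj (rep φ u) * rep ψ (k ::ₘ u))) (bag x) := by
    filter_upwards [rep_creat hS φ] with x hx
    rw [hx]
    generalize bag x = s
    have e2 : mSum (fun k u => S.indicator (1 : Photon → ℂ) k *
        (conj (rep φ u) * rep ψ (k ::ₘ u))) s =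
        conj (mSum (fun k u => S.indicator 1 k * rep φ u) s) * rep ψ s := by
      classical
      simp only [mSum]
      rw [map_multiset_sum, ← Multiset.sum_map_mul_right, Multiset.map_map]
      congr 1
      refine Multiset.map_congr rfl fun k hk => ?_
      simp only [Function.comp, Multiset.cons_erase hk, map_mul]
      by_cases hkS : k ∈ S <;> simp [hkS]
    rw [e2, creatFun]
    split_ifs with h
    · rfl
    · rw [(rep_adm ψ).supp s (not_le.1 h)]; simp
  rw [integral_congr_ae e1, integral_mSum (G := fun k u => S.indicator 1 k *
    (conj (rep φ u) * rep ψ (k ::ₘ u))) hm hi, integral_prod _ hi, ← integral_indicator hS.meas]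
  refine integral_congr_ae ?_
  filter_upwards [inner_ann φ ψ] with k hk
  by_cases hp : k ∈ S
  · simp only [hp, Set.indicator_of_mem, Pi.one_apply, one_mul]; exact hk.symm
  · simp [hp]

lemma integrableOn_norm_ann_sq {c : ℝ} {S : Set Photon} (hS : GoodSet c S) (ψ : FockOne) :
    IntegrableOn (fun k => ‖ann k ψ‖ ^ 2) S photonMeasure := by
  refine ⟨((aemeasurable_norm_ann ψ).pow_const 2).aestronglyMeasurable.restrict, ?_⟩
  refine lt_of_le_of_lt (le_of_eq ?_) ((lintegral_ann_le hS ψ).trans_lt (by finiteness))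
  refine lintegral_congr fun k => ?_
  rw [← ofReal_norm, norm_of_nonneg (by positivity), ENNReal.ofReal_pow (norm_nonneg _),
    ofReal_norm]

lemma integral_norm_ann_sq_le {c : ℝ} {S : Set Photon} (hS : GoodSet c S) (ψ : FockOne) :
    ∫ k in S, ‖ann k ψ‖ ^ 2 ∂photonMeasure ≤ c⁻¹ * ‖ψ‖ ^ 2 := by
  rw [integral_eq_lintegral_of_nonneg_ae (.of_forall fun k => by positivity)
    ((aemeasurable_norm_ann ψ).pow_const 2).aestronglyMeasurable.restrict]
  refine ENNReal.toReal_le_of_le_ofReal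
    (mul_nonneg (inv_nonneg.2 hS.pos.le) (by positivity)) ?_
  refine le_trans (le_of_eq ?_) ((lintegral_ann_le hS ψ).trans_eq ?_)
  · refine lintegral_congr fun k => ?_
    rw [ENNReal.ofReal_pow (norm_nonneg _), ofReal_norm]
  · rw [ENNReal.ofReal_mul (inv_nonneg.2 hS.pos.le), ENNReal.ofReal_pow (norm_nonneg _), ofReal_norm]

lemma integrableOn_norm_ann {c : ℝ} {S : Set Photon} (hS : GoodSet c S) (ψ : FockOne) :
    IntegrableOn (fun k => ‖ann k ψ‖) S photonMeasure := by
  have h1 : IntegrableOn (fun _ : Photon => (1 : ℝ)) S photonMeasure :=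
    integrableOn_const hS.fin
  refine Integrable.mono' (h1.add (integrableOn_norm_ann_sq hS ψ))
    (aemeasurable_norm_ann ψ).aestronglyMeasurable.restrict (.of_forall fun k => ?_)
  simp only [Pi.add_apply, norm_norm]
  nlinarith [sq_nonneg (‖ann k ψ‖ - 1), norm_nonneg (ann k ψ)]

lemma integrableOn_inner_ann {c : ℝ} {S : Set Photon} (hS : GoodSet c S) (φ ψ : FockOne) :
    IntegrableOn (fun k => inner ℂ φ (ann k ψ)) S photonMeasure := by
  refine Integrable.mono' ((integrableOn_norm_ann hS ψ).const_mul ‖φ‖)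
    (aestronglyMeasurable_inner_ann φ ψ).restrict (.of_forall fun k => ?_)
  exact norm_inner_le _ _

lemma integral_norm_ann_sq_le_mul {c : ℝ} {S : Set Photon} (hS : GoodSet c S) (ψ : FockOne) :
    (∫ k in S, ‖ann k ψ‖ ∂photonMeasure) ^ 2 ≤
      (photonMeasure S).toReal * ∫ k in S, ‖ann k ψ‖ ^ 2 ∂photonMeasure := by
  set I := ∫ k in S, ‖ann k ψ‖ ∂photonMeasure
  set J := ∫ k in S, ‖ann k ψ‖ ^ 2 ∂photonMeasure
  set V := (photonMeasure S).toReal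
  have hJ := integrableOn_norm_ann_sq hS ψ
  have hI := integrableOn_norm_ann hS ψ
  have h1 : IntegrableOn (fun _ : Photon => (1 : ℝ)) S photonMeasure :=
    integrableOn_const hS.fin
  have hV : ∫ _ in S, (1 : ℝ) ∂photonMeasure = V := by simp [V, Measure.real]
  have key : ∀ t : ℝ, 0 ≤ V * (t * t) + (-2 * I) * t + J := by
    intro t
    have : ∫ k in S, (t - ‖ann k ψ‖) ^ 2 ∂photonMeasure = V * (t * t) + (-2 * I) * t + J := by
      have e : ∀ k, (t - ‖ann k ψ‖) ^ 2 = t * t * 1 + (-2 * t) * ‖ann k ψ‖ + ‖ann k ψ‖ ^ 2 :=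
        fun k => by ring
      simp only [e]
      rw [integral_add ((h1.const_mul _).fun_add (hI.const_mul _)) hJ,
        integral_add (h1.const_mul _) (hI.const_mul _), integral_const_mul, integral_const_mul, hV]
      ring
    rw [← this]
    exact integral_nonneg fun k => sq_nonneg _
  have := discrim_le_zero key
  rw [discrim] at this
  nlinarith

/-! ### The canonical commutation relations -/

open Classical in
lemma ae_erase {p : Bag → Prop} (h : ∀ᵐ x ∂fockMeasure, p (bag x)) :
    ∀ᵐ x ∂fockMeasure, ∀ k ∈ bag x, p ((bag x).erase k) := by
  rw [ae_fockMeasure_iff] at h ⊢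
  intro n
  cases n with
  | zero =>
    refine Eventually.of_forall fun q k hk => ?_
    have : bag (inSector 0 q) = 0 := by rw [← Multiset.card_eq_zero, card_bag]
    rw [this] at hk
    exact absurd hk (Multiset.notMem_zero k)
  | succ n =>
    have h1 : ∀ i : Fin (n + 1), ∀ᵐ q ∂photonMeasureN (n + 1), p (tupleBag (i.removeNth q)) :=
      fun i => (Measure.quasiMeasurePreserving_snd.comp
        (measurePreserving_removeNth i).quasiMeasurePreserving).ae (h n)
    filter_upwards [ae_all_iff.2 h1] with q hq k hk
    obtain ⟨i, -, rfl⟩ := Multiset.mem_map.1 hk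
    have := hq i
    change p ((tupleBag q).erase (q i))
    rwa [bag_removeNth i q, Multiset.erase_cons_head]

/-- The spectral support of `H_f` in the state `ψ` is contained in `(-∞, b]`. -/
def EnergyLE (b : ℝ) (ψ : FockOne) : Prop :=
  ∀ᵐ x ∂fockMeasure, b < mEnergy (bag x) → rep ψ (bag x) = 0

theorem ann_creat {b c : ℝ} {S : Set Photon} (hS : GoodSet c S) (hb : ∀ k ∈ S, ‖k.1‖ ≤ b)
    {ψ : FockOne} (hψ : EnergyLE (1 - b) ψ) :
    ∀ᵐ k ∂photonMeasure, k ∈ S → ann k (creat S ψ) = ψ + creat S (ann k ψ) := by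
  classical
  filter_upwards [rep_ann (creat S ψ), ae_consConfig (rep_creat hS ψ), rep_ann ψ,
    ae_cons (p := fun s => 1 - b < mEnergy s → rep ψ s = 0) hψ] with k h1 h2 h3 h4 hk
  refine rep_ext ?_
  filter_upwards [h1, h2, ae_erase (p := fun s => rep (ann k ψ) s = rep ψ (k ::ₘ s)) h3,
    ae_erase (p := fun s => 1 - b < mEnergy (k ::ₘ s) → rep ψ (k ::ₘ s) = 0) h4, rep_add ψ (creat S (ann k ψ)),
    rep_creat hS (ann k ψ), hψ] with x h1 h2 h3 h4 h5 h6 h7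
  simp only [bag_consConfig] at h2
  rw [h1, h2, h5, h6]
  generalize bag x = s at *
  have e1 : mSum (fun k u => S.indicator 1 k * rep ψ u) (k ::ₘ s) =
      rep ψ s + mSum (fun k' u => S.indicator 1 k' * rep (ann k ψ) u) s := by
    rw [mSum_cons]
    congr 1
    · simp [hk]
    · simp only [mSum]
      congr 1
      refine Multiset.map_congr rfl fun k' hk' => ?_
      rw [h3 k' hk']
  by_cases hE : mEnergy (k ::ₘ s) ≤ 1
  · have hE' : mEnergy s ≤ 1 := by
      rw [mEnergy_cons] at hE; linarith [norm_nonneg k.1]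
    simp only [creatFun, if_pos hE, if_pos hE', e1]
  · rw [mEnergy_cons, not_le] at hE
    have z1 : rep ψ s = 0 := h7 (by linarith [hb k hk])
    have z2 : mSum (fun k' u => S.indicator 1 k' * rep (ann k ψ) u) s = 0 := by
      simp only [mSum]
      refine Multiset.sum_eq_zero fun z hz => ?_
      obtain ⟨k', hk', rfl⟩ := Multiset.mem_map.1 hz
      by_cases hS' : k' ∈ S
      · have he : mEnergy s = ‖k'.1‖ + mEnergy (s.erase k') := by
          rw [← mEnergy_cons, Multiset.cons_erase hk']
        rw [h3 k' hk', h4 k' hk' ?_, mul_zero]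
        rw [mEnergy_cons]; linarith [hb k' hS']
      · simp [hS']
    have : ¬ mEnergy (k ::ₘ s) ≤ 1 := by rw [mEnergy_cons]; exact not_le.2 hE
    simp only [creatFun, if_neg this, z1, z2, ite_self, add_zero]

theorem abs_norm_creat_sq_sub_le {b c : ℝ} {S : Set Photon} (hS : GoodSet c S)
    (hb : ∀ k ∈ S, ‖k.1‖ ≤ b) {ψ : FockOne} (hψ : EnergyLE (1 - b) ψ) :
    |‖creat S ψ‖ ^ 2 - (photonMeasure S).toReal * ‖ψ‖ ^ 2| ≤
      (photonMeasure S).toReal * ∫ k in S, ‖ann k ψ‖ ^ 2 ∂photonMeasure := by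
  refine le_trans ?_ (integral_norm_ann_sq_le_mul hS ψ)
  set I := ∫ k in S, ‖ann k ψ‖ ∂photonMeasure
  have h1 : inner ℂ (creat S ψ) (creat S ψ) =
      ∫ k in S, (inner ℂ ψ (ann k (creat S ψ)) : ℂ) ∂photonMeasure := inner_creat hS ψ _
  have hc : ∫ k in S, (inner ℂ ψ ψ : ℂ) ∂photonMeasure =
      (((photonMeasure S).toReal * ‖ψ‖ ^ 2 : ℝ) : ℂ) := by
    rw [setIntegral_const, inner_self_eq]
    simp [Measure.real]
  have h2 : inner ℂ (creat S ψ) (creat S ψ) -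
      (((photonMeasure S).toReal * ‖ψ‖ ^ 2 : ℝ) : ℂ) =
      ∫ k in S, ((inner ℂ ψ (ann k (creat S ψ)) : ℂ) - inner ℂ ψ ψ) ∂photonMeasure := by
    rw [integral_sub (integrableOn_inner_ann hS _ _) (integrableOn_const hS.fin), hc, h1]
  have h3 : ‖(inner ℂ (creat S ψ) (creat S ψ) : ℂ) -
      (((photonMeasure S).toReal * ‖ψ‖ ^ 2 : ℝ) : ℂ)‖ ≤ I * I := by
    rw [h2, ← integral_mul_const]
    refine norm_integral_le_of_norm_le ((integrableOn_norm_ann hS ψ).mul_const _) ?_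
    filter_upwards [ae_restrict_of_ae (ann_creat hS hb hψ), ae_restrict_mem hS.meas] with k hk hkS
    rw [hk hkS, inner_add_right, add_sub_cancel_left, ← inner_conj_symm, RCLike.norm_conj,
      inner_creat hS, ← integral_const_mul]
    refine norm_integral_le_of_norm_le ((integrableOn_norm_ann hS ψ).const_mul _)
      (.of_forall fun k' => norm_inner_le _ _)
  rw [inner_self_eq, ← Complex.ofReal_sub, norm_real, Real.norm_eq_abs] at h3
  rw [sq I]; exact h3

end

section
/-! ### Operators from sesquilinear forms -/

lemma exists_op_of_form {B : FockOne → FockOne → ℂ} {C : ℝ} (hC : 0 ≤ C)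
    (add_left : ∀ φ φ' ψ, B (φ + φ') ψ = B φ ψ + B φ' ψ)
    (smul_left : ∀ (z : ℂ) φ ψ, B (z • φ) ψ = conj z * B φ ψ)
    (add_right : ∀ φ ψ ψ', B φ (ψ + ψ') = B φ ψ + B φ ψ')
    (smul_right : ∀ (z : ℂ) φ ψ, B φ (z • ψ) = z * B φ ψ)
    (bound : ∀ φ ψ, ‖B φ ψ‖ ≤ C * ‖φ‖ * ‖ψ‖) :
    ∃ A : Op, (∀ φ ψ, inner ℂ φ (A ψ) = B φ ψ) ∧ ‖A‖ ≤ C := by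
  let b : FockOne →ₗ⋆[ℂ] FockOne →ₗ[ℂ] ℂ :=
    LinearMap.mk₂'ₛₗ (starRingEnd ℂ) (RingHom.id ℂ) B add_left smul_left add_right smul_right
  let b' : FockOne →L⋆[ℂ] FockOne →L[ℂ] ℂ := b.mkContinuous₂ C bound
  let A := adj (InnerProductSpace.continuousLinearMapOfBilin b')
  have hA : ∀ φ ψ, inner ℂ φ (A ψ) = B φ ψ := by
    intro φ ψ
    rw [ContinuousLinearMap.adjoint_inner_right,
      InnerProductSpace.continuousLinearMapOfBilin_apply]
    rfl
  refine ⟨A, hA, ContinuousLinearMap.opNorm_le_bound _ hC fun ψ => ?_⟩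
  by_cases h0 : ‖A ψ‖ = 0
  · rw [h0]; positivity
  · have h1 := bound (A ψ) ψ
    rw [← hA, inner_self_eq, norm_real, norm_of_nonneg (by positivity)] at h1
    have : 0 < ‖A ψ‖ := lt_of_le_of_ne (norm_nonneg _) (Ne.symm h0)
    nlinarith

/-! ### Wick monomials -/

/-- Infrared weights. -/
structure IsWeight (ω : Photon → ℝ) : Prop where
  meas : Measurable ω
  nonneg : ∀ k, 0 ≤ ω k
  le : ∀ k, ω k ≤ (√‖k.1‖)⁻¹
  supp : ∀ k, 1 < ‖k.1‖ → ω k = 0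

/-- A bound for `ω(k) / √|k|`. -/
def invNorm (k : Photon) : ℝ := if ‖k.1‖ ≤ 1 then ‖k.1‖⁻¹ else 0

lemma invNorm_nonneg (k : Photon) : 0 ≤ invNorm k := by unfold invNorm; split_ifs <;> positivity

lemma measurable_invNorm : Measurable invNorm :=
  Measurable.ite (measurableSet_le (by fun_prop) measurable_const) (by fun_prop) measurable_const

/-- The constant `∫_{|k| ≤ 1} |k|⁻² dk`. -/
def weightConst : ℝ≥0∞ := ∫⁻ k, ofReal (invNorm k) ^ 2 ∂photonMeasure

lemma IsWeight.le_mul {ω : Photon → ℝ} (h : IsWeight ω) (k : Photon) :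
    ω k ≤ invNorm k * √‖k.1‖ := by
  by_cases h1 : ‖k.1‖ ≤ 1
  · refine (h.le k).trans_eq ?_
    rw [invNorm, if_pos h1]
    by_cases h0 : ‖k.1‖ = 0
    · simp [h0]
    · have : 0 < ‖k.1‖ := lt_of_le_of_ne (norm_nonneg _) (Ne.symm h0)
      have h2 := Real.sqrt_pos.2 this
      field_simp
      rw [Real.sq_sqrt this.le]
  · rw [h.supp k (not_le.1 h1)]
    exact mul_nonneg (invNorm_nonneg k) (Real.sqrt_nonneg _)

/-- Product of weights. -/
def prodWeight (ω : Photon → ℝ) {M : ℕ} (K : Tuple M) : ℝ := ∏ i, ω (K i)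

/-- The pair `(H_f, P_f)` on a multiset of photons. -/
def point (s : Bag) : ℝ × Momentum := (mEnergy s, mMomentum s)

lemma measurable_point : Measurable fun x => point (bag x) :=
  measurable_mEnergy.prodMk measurable_mMomentum

/-- The measure for the variables of a Wick monomial. -/
def wickMeasure (M N : ℕ) : Measure (Config × Tuple M × Tuple N) :=
  fockMeasure.prod ((photonMeasureN M).prod (photonMeasureN N))

/-- The integrand of a Wick monomial. -/
def wickIntegrand (ω : Photon → ℝ) {M N : ℕ}
    (w : ℝ × Momentum → Tuple M → Tuple N → ℂ) (Φ Ψ : Bag → ℂ)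
    (z : Config × Tuple M × Tuple N) : ℂ :=
  ((prodWeight ω z.2.1 * prodWeight ω z.2.2 : ℝ) : ℂ) *
    (conj (Φ (tupleBag z.2.1 + bag z.1)) * w (point (bag z.1)) z.2.1 z.2.2 *
      Ψ (tupleBag z.2.2 + bag z.1))

/-- The form of a Wick monomial. -/
def wick (ω : Photon → ℝ) {M N : ℕ}
    (w : ℝ × Momentum → Tuple M → Tuple N → ℂ) (Φ Ψ : Bag → ℂ) : ℂ :=
  ∫ z, wickIntegrand ω w Φ Ψ z ∂wickMeasure M N

lemma measurable_append {Ψ : Bag → ℂ} (hΨ : Measurable fun x => Ψ (bag x))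
    (M : ℕ) : Measurable fun p : Tuple M × Config =>
      Ψ (tupleBag p.1 + bag p.2) := by
  have := hΨ.comp (measurable_appendConfig (M := M))
  simpa [Function.comp_def] using this

lemma measurable_prodWeight {ω : Photon → ℝ} (h : Measurable ω) {M : ℕ} :
    Measurable (prodWeight ω (M := M)) :=
  Finset.measurable_prod Finset.univ (f := fun i (K : Tuple M) => ω (K i))
    fun i _ => h.comp (measurable_pi_apply i)

theorem lintegral_moment (M : ℕ) {Ψ : Bag → ℂ}
    (hΨ : Measurable fun x => Ψ (bag x)) (hs : ∀ s, 1 < mEnergy s → Ψ s = 0) :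
    ∫⁻ K, (∏ i : Fin M, ‖(K i).1‖ₑ) *
      ∫⁻ x, ‖Ψ (tupleBag K + bag x)‖ₑ ^ 2 ∂fockMeasure ∂photonMeasureN M ≤
      ∫⁻ x, ‖Ψ (bag x)‖ₑ ^ 2 ∂fockMeasure := by
  induction M with
  | zero =>
    have : ∀ K : Fin 0 → Photon, tupleBag K = 0 := fun K => by
      rw [← Multiset.card_eq_zero, card_bag]
    simp only [this, zero_add, Finset.univ_eq_empty, Finset.prod_empty, one_mul, lintegral_const]
    rw [photonMeasureN, Measure.pi_empty_univ, mul_one]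
  | succ M ih =>
    have hA : Measurable fun K : Tuple (M + 1) =>
        ∫⁻ x, ‖Ψ (tupleBag K + bag x)‖ₑ ^ 2 ∂fockMeasure :=
      ((measurable_append hΨ (M + 1)).enorm.pow_const 2).lintegral_prod_right'
    have hc : Measurable fun q : (Photon × Tuple M) × Config =>
        Ψ (q.1.1 ::ₘ (tupleBag q.1.2 + bag q.2)) := by
      have h1 : Measurable fun q : (Photon × Tuple M) × Config =>
          consConfig (q.1.1, appendConfig (q.1.2, q.2)) :=
        measurable_consConfig.comp ((measurable_fst.comp measurable_fst).prodMk
          (measurable_appendConfig.comp ((measurable_snd.comp measurable_fst).prodMk measurable_snd)))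
      have := hΨ.comp h1
      simpa [Function.comp_def] using this
    have hB : Measurable fun p : Photon × Tuple M => ‖p.1.1‖ₑ * (∏ i, ‖(p.2 i).1‖ₑ) *
        ∫⁻ x, ‖Ψ (p.1 ::ₘ (tupleBag p.2 + bag x))‖ₑ ^ 2 ∂fockMeasure := by
      refine Measurable.mul (Measurable.mul (by fun_prop) ?_)
        (hc.enorm.pow_const 2).lintegral_prod_right'
      exact Finset.measurable_prod Finset.univ
        (f := fun i (p : Photon × Tuple M) => ‖(p.2 i).1‖ₑ) fun i _ => by fun_prop
    have e : ∀ K : Tuple (M + 1), (∏ i, ‖(K i).1‖ₑ) *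
        ∫⁻ x, ‖Ψ (tupleBag K + bag x)‖ₑ ^ 2 ∂fockMeasure =
        (fun p : Photon × Tuple M => ‖p.1.1‖ₑ * (∏ i, ‖(p.2 i).1‖ₑ) *
          ∫⁻ x, ‖Ψ (p.1 ::ₘ (tupleBag p.2 + bag x))‖ₑ ^ 2 ∂fockMeasure)
          (K 0, Fin.removeNth 0 K) := by
      intro K
      rw [Fin.prod_univ_succ]
      simp only [← Multiset.cons_add, ← bag_removeNth]
      rfl
    simp only [e]
    rw [(measurePreserving_removeNth 0).lintegral_comp hB, lintegral_prod_symm' _ hB]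
    refine le_trans (lintegral_mono fun K => ?_) ih
    have hK : Measurable fun x => Ψ (tupleBag K + bag x) :=
      (measurable_append hΨ M).comp measurable_prodMk_left
    have := lintegral_norm_mul_cons (Ψ := fun s => Ψ (tupleBag K + s)) hK fun s h => hs _ (by
      rw [mEnergy_add]; linarith [mEnergy_nonneg (tupleBag K)])
    refine le_trans (le_of_eq ?_) (mul_le_mul_right this (∏ i, ‖(K i).1‖ₑ))
    rw [← lintegral_const_mul _ (by
      refine Measurable.mul (by fun_prop) (Measurable.lintegral_prod_right'
        (f := fun q : Photon × Config => ‖Ψ (tupleBag K + (q.1 ::ₘ bag q.2))‖ₑ ^ 2) ?_)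
      simp only [Multiset.add_cons]
      exact (hc.comp (f := fun q : Photon × Config => ((q.1, K), q.2)) (by fun_prop)).enorm.pow_const 2)]
    refine lintegral_congr fun k => ?_
    simp only [Multiset.add_cons]
    ring

end

section
lemma lintegral_prod_photons {f : Photon → ℝ≥0∞} (hf : Measurable f) (M : ℕ) :
    ∫⁻ K, ∏ i : Fin M, f (K i) ∂photonMeasureN M = (∫⁻ k, f k ∂photonMeasure) ^ M := by
  induction M with
  | zero =>
    simp only [Finset.univ_eq_empty, Finset.prod_empty, lintegral_const, pow_zero, one_mul]
    rw [photonMeasureN, Measure.pi_empty_univ]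
  | succ M ih =>
    have hm : Measurable fun K : Tuple M => ∏ i, f (K i) :=
      Finset.measurable_prod Finset.univ (f := fun i (K : Tuple M) => f (K i))
        fun i _ => hf.comp (measurable_pi_apply i)
    have e : ∀ K : Tuple (M + 1), ∏ i, f (K i) =
        (fun p : Photon × Tuple M => f p.1 * ∏ i, f (p.2 i)) (K 0, Fin.removeNth 0 K) := by
      intro K
      rw [Fin.prod_univ_succ]; rfl
    simp only [e]
    have h2 : Measurable fun p : Photon × Tuple M => f p.1 * ∏ i, f (p.2 i) :=
      (hf.comp measurable_fst).mul (hm.comp measurable_snd)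
    rw [(measurePreserving_removeNth 0).lintegral_comp h2,
      lintegral_prod_mul hf.aemeasurable hm.aemeasurable, ih, pow_succ, mul_comm]

/-- The squared norm of a representative. -/
def normSqFun (Φ : Bag → ℂ) : ℝ≥0∞ := ∫⁻ x, ‖Φ (bag x)‖ₑ ^ 2 ∂fockMeasure

lemma lintegral_weights_moment (M N : ℕ) {Φ : Bag → ℂ} (hΦ : IsAdm Φ) :
    ∫⁻ z, (∏ j, ofReal (invNorm (z.2.2 j)) ^ 2) * ((∏ i, ‖(z.2.1 i).1‖ₑ) *
      ‖Φ (tupleBag z.2.1 + bag z.1)‖ₑ ^ 2) ∂wickMeasure M N ≤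
      weightConst ^ N * normSqFun Φ := by
  have m1 : Measurable fun K' : Tuple N => ∏ j, ofReal (invNorm (K' j)) ^ 2 :=
    Finset.measurable_prod Finset.univ
      (f := fun j (K' : Tuple N) => ofReal (invNorm (K' j)) ^ 2)
      fun i _ => ((measurable_invNorm.comp (measurable_pi_apply i)).ennreal_ofReal).pow_const 2
  have m2 : Measurable fun K : Tuple M => ∏ i, ‖(K i).1‖ₑ :=
    Finset.measurable_prod Finset.univ (f := fun i (K : Tuple M) => ‖(K i).1‖ₑ)
      fun i _ => by fun_prop
  have m3 := (measurable_append hΦ.meas M).enorm.pow_const 2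
  have m4 : Measurable fun z : Config × Tuple M × Tuple N =>
      (∏ j, ofReal (invNorm (z.2.2 j)) ^ 2) * ((∏ i, ‖(z.2.1 i).1‖ₑ) *
      ‖Φ (tupleBag z.2.1 + bag z.1)‖ₑ ^ 2) :=
    (m1.comp (f := fun z : Config × Tuple M × Tuple N => z.2.2) (by fun_prop)).mul
    ((m2.comp (f := fun z : Config × Tuple M × Tuple N => z.2.1) (by fun_prop)).mul
     (m3.comp (f := fun z : Config × Tuple M × Tuple N => (z.2.1, z.1))
       (by fun_prop)))
  rw [wickMeasure, lintegral_prod_symm' _ m4]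
  have e : ∀ y : Tuple M × Tuple N,
      ∫⁻ x, (∏ j, ofReal (invNorm (y.2 j)) ^ 2) * ((∏ i, ‖(y.1 i).1‖ₑ) *
        ‖Φ (tupleBag y.1 + bag x)‖ₑ ^ 2) ∂fockMeasure =
      ((∏ i, ‖(y.1 i).1‖ₑ) * ∫⁻ x, ‖Φ (tupleBag y.1 + bag x)‖ₑ ^ 2 ∂fockMeasure) *
        (∏ j, ofReal (invNorm (y.2 j)) ^ 2) := by
    intro y
    have : Measurable fun x => ‖Φ (tupleBag y.1 + bag x)‖ₑ ^ 2 :=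
      m3.comp (f := fun x : Config => (y.1, x)) (by fun_prop)
    rw [lintegral_const_mul _ (by exact this.const_mul _), lintegral_const_mul _ this, mul_comm]
  simp only [e]
  have m5 : Measurable fun K : Tuple M => (∏ i, ‖(K i).1‖ₑ) *
      ∫⁻ x, ‖Φ (tupleBag K + bag x)‖ₑ ^ 2 ∂fockMeasure := m2.mul m3.lintegral_prod_right'
  rw [lintegral_prod_mul m5.aemeasurable m1.aemeasurable,
    lintegral_prod_photons (f := fun k => ofReal (invNorm k) ^ 2)
      (measurable_invNorm.ennreal_ofReal.pow_const 2), mul_comm]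
  exact mul_le_mul_right (lintegral_moment M hΦ.meas hΦ.supp) _

lemma measurable_wickIntegrand {ω : Photon → ℝ} (hω : Measurable ω) {M N : ℕ}
    {w : ℝ × Momentum → Tuple M → Tuple N → ℂ}
    (hw : Measurable fun x : (ℝ × Momentum) × Tuple M × Tuple N =>
      w x.1 x.2.1 x.2.2)
    {Φ Ψ : Bag → ℂ} (hΦ : Measurable fun x => Φ (bag x))
    (hΨ : Measurable fun x => Ψ (bag x)) :
    Measurable (wickIntegrand ω w Φ Ψ) := by
  have h1 : Measurable fun z : Config × Tuple M × Tuple N =>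
      Φ (tupleBag z.2.1 + bag z.1) :=
    (measurable_append hΦ M).comp
      (f := fun z : Config × Tuple M × Tuple N => (z.2.1, z.1)) (by fun_prop)
  have h2 : Measurable fun z : Config × Tuple M × Tuple N =>
      Ψ (tupleBag z.2.2 + bag z.1) :=
    (measurable_append hΨ N).comp
      (f := fun z : Config × Tuple M × Tuple N => (z.2.2, z.1)) (by fun_prop)
  have h3 : Measurable fun z : Config × Tuple M × Tuple N =>
      w (point (bag z.1)) z.2.1 z.2.2 :=
    hw.comp (f := fun z : Config × Tuple M × Tuple N =>
      (point (bag z.1), z.2.1, z.2.2))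
      ((measurable_point.comp measurable_fst).prodMk measurable_snd)
  have h4 : Measurable fun z : Config × Tuple M × Tuple N =>
      ((prodWeight ω z.2.1 * prodWeight ω z.2.2 : ℝ) : ℂ) :=
    measurable_ofReal.comp
      (((measurable_prodWeight hω).comp (f := fun z : Config × Tuple M ×
        Tuple N => z.2.1) (by fun_prop)).mul
      ((measurable_prodWeight hω).comp (f := fun z : Config × Tuple M ×
        Tuple N => z.2.2) (by fun_prop)))
  exact h4.mul (((continuous_conj.measurable.comp h1).mul h3).mul h2)

lemma prodWeight_nonneg {ω : Photon → ℝ} (hω : IsWeight ω) {M : ℕ} (K : Tuple M) :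
    0 ≤ prodWeight ω K := Finset.prod_nonneg fun _ _ => hω.nonneg _

lemma ofReal_prodWeight_le {ω : Photon → ℝ} (hω : IsWeight ω) {M : ℕ} (K : Tuple M) :
    ofReal (prodWeight ω K) ≤ (∏ i, ofReal (invNorm (K i))) *
      ∏ i, ofReal (√‖(K i).1‖) := by
  rw [prodWeight, ENNReal.ofReal_prod_of_nonneg fun i _ => hω.nonneg _, ← Finset.prod_mul_distrib]
  refine Finset.prod_le_prod' fun i _ => ?_
  rw [← ENNReal.ofReal_mul (invNorm_nonneg _)]
  exact ENNReal.ofReal_le_ofReal (hω.le_mul _)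

theorem lintegral_wickIntegrand_le {ω : Photon → ℝ} (hω : IsWeight ω) {M N : ℕ} {B : ℝ}
    {w : ℝ × Momentum → Tuple M → Tuple N → ℂ}
    (hB : ∀ Y K K', ‖w Y K K'‖ ≤ B) {Φ Ψ : Bag → ℂ} (hΦ : IsAdm Φ) (hΨ : IsAdm Ψ) :
    ∫⁻ z, ‖wickIntegrand ω w Φ Ψ z‖ₑ ∂wickMeasure M N ≤ ofReal B *
      ((weightConst ^ N * normSqFun Φ) ^ (1 / 2 : ℝ) *
        (weightConst ^ M * normSqFun Ψ) ^ (1 / 2 : ℝ)) := by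
  let f : Config × Tuple M × Tuple N → ℝ≥0∞ := fun z =>
    (∏ j, ofReal (invNorm (z.2.2 j))) * ((∏ i, ofReal (√‖(z.2.1 i).1‖)) *
      ‖Φ (tupleBag z.2.1 + bag z.1)‖ₑ)
  let g : Config × Tuple M × Tuple N → ℝ≥0∞ := fun z =>
    (∏ i, ofReal (invNorm (z.2.1 i))) * ((∏ j, ofReal (√‖(z.2.2 j).1‖)) *
      ‖Ψ (tupleBag z.2.2 + bag z.1)‖ₑ)
  have minv : ∀ n : ℕ, Measurable fun K : Tuple n =>
      ∏ i, ofReal (invNorm (K i)) := fun n =>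
    Finset.measurable_prod Finset.univ
      (f := fun i (K : Tuple n) => ofReal (invNorm (K i)))
      fun i _ => (measurable_invNorm.comp (measurable_pi_apply i)).ennreal_ofReal
  have msq : ∀ n : ℕ, Measurable fun K : Tuple n =>
      ∏ i, ofReal (√‖(K i).1‖) := fun n =>
    Finset.measurable_prod Finset.univ
      (f := fun i (K : Tuple n) => ofReal (√‖(K i).1‖))
      fun _ _ => by fun_prop
  have hf : Measurable f :=
    ((minv N).comp (f := fun z : Config × Tuple M × Tuple N => z.2.2)
      (by fun_prop)).mul (((msq M).comp (f := fun z : Config × Tuple M ×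
        Tuple N => z.2.1) (by fun_prop)).mul ((measurable_append hΦ.meas M).enorm.comp
      (f := fun z : Config × Tuple M × Tuple N => (z.2.1, z.1)) (by fun_prop)))
  have hg : Measurable g :=
    ((minv M).comp (f := fun z : Config × Tuple M × Tuple N => z.2.1)
      (by fun_prop)).mul (((msq N).comp (f := fun z : Config × Tuple M ×
        Tuple N => z.2.2) (by fun_prop)).mul ((measurable_append hΨ.meas N).enorm.comp
      (f := fun z : Config × Tuple M × Tuple N => (z.2.2, z.1)) (by fun_prop)))
  have hsq : ∀ k : Photon, ofReal (√‖k.1‖) ^ 2 = ‖k.1‖ₑ := fun k => by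
    rw [← ENNReal.ofReal_pow (Real.sqrt_nonneg _), Real.sq_sqrt (norm_nonneg _), ofReal_norm]
  have h1 : ∀ z, ‖wickIntegrand ω w Φ Ψ z‖ₑ ≤ ofReal B * (f * g) z := by
    intro z
    have hc : ∀ u : ℂ, ‖conj u‖ₑ = ‖u‖ₑ := fun u => by
      rw [← ofReal_norm, RCLike.norm_conj, ofReal_norm]
    have hp : ‖((prodWeight ω z.2.1 * prodWeight ω z.2.2 : ℝ) : ℂ)‖ₑ =
        ofReal (prodWeight ω z.2.1) * ofReal (prodWeight ω z.2.2) := by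
      rw [← ofReal_norm, norm_real, norm_of_nonneg (mul_nonneg
        (prodWeight_nonneg hω _) (prodWeight_nonneg hω _)), ENNReal.ofReal_mul
        (prodWeight_nonneg hω _)]
    have hw : ‖w (point (bag z.1)) z.2.1 z.2.2‖ₑ ≤ ofReal B := by
      rw [← ofReal_norm]; exact ENNReal.ofReal_le_ofReal (hB _ _ _)
    rw [wickIntegrand, enorm_mul, enorm_mul, enorm_mul, hc, hp]
    calc _ ≤ ((∏ i, ofReal (invNorm (z.2.1 i))) * ∏ i, ofReal (√‖(z.2.1 i).1‖)) *
          ((∏ i, ofReal (invNorm (z.2.2 i))) * ∏ i, ofReal (√‖(z.2.2 i).1‖)) *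
          (‖Φ (tupleBag z.2.1 + bag z.1)‖ₑ * ofReal B *
            ‖Ψ (tupleBag z.2.2 + bag z.1)‖ₑ) := by
          gcongr
          · exact ofReal_prodWeight_le hω _
          · exact ofReal_prodWeight_le hω _
      _ = _ := by simp only [Pi.mul_apply, f, g]; ring
  have h2 := ENNReal.lintegral_mul_le_Lp_mul_Lq (wickMeasure M N) Real.HolderConjugate.two_two
    hf.aemeasurable hg.aemeasurable
  refine (lintegral_mono h1).trans ?_
  rw [lintegral_const_mul _ (hf.mul hg)]
  gcongr
  refine h2.trans ?_
  gcongr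
  · refine le_trans (le_of_eq (lintegral_congr fun z => ?_)) (lintegral_weights_moment M N hΦ)
    rw [show (2 : ℝ) = ((2 : ℕ) : ℝ) by norm_num, rpow_natCast]
    simp only [f, mul_pow, Finset.prod_pow, ← hsq]
  · have hsw : MeasurePreserving (fun z : Config × Tuple M × Tuple N =>
        (z.1, z.2.2, z.2.1)) (wickMeasure M N) (wickMeasure N M) :=
      (MeasurePreserving.id fockMeasure).prod Measure.measurePreserving_swap
    refine le_trans (le_of_eq ?_) (lintegral_weights_moment N M hΨ)
    rw [← hsw.lintegral_comp]
    · refine lintegral_congr fun z => ?_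
      rw [show (2 : ℝ) = ((2 : ℕ) : ℝ) by norm_num, rpow_natCast]
      simp only [g, mul_pow, Finset.prod_pow, ← hsq]
    · have m1 : Measurable fun K' : Tuple M => ∏ j, ofReal (invNorm (K' j)) ^ 2 := by
        simpa only [Finset.prod_pow] using (minv M).pow_const 2
      have m2 : Measurable fun K' : Tuple N => ∏ j, ‖(K' j).1‖ₑ := by
        exact Finset.measurable_prod Finset.univ (f := fun i (K : Tuple N) => ‖(K i).1‖ₑ)
          fun _ _ => by fun_prop
      exact (m1.comp (f := fun z : Config × Tuple N × Tuple M => z.2.2)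
        (by fun_prop)).mul ((m2.comp (f := fun z : Config × Tuple N × Tuple M =>
          z.2.1) (by fun_prop)).mul (((measurable_append hΨ.meas N).enorm.pow_const 2).comp
        (f := fun z : Config × Tuple N × Tuple M => (z.2.1, z.1)) (by fun_prop)))

end

section
lemma weightConst_ne_top : weightConst ≠ ⊤ := by
  let f : ℝ → ℝ := fun y => if y ≤ 1 then (y⁻¹) ^ 2 else 0
  have h1 : Integrable (fun p : Momentum => f ‖p‖) := by
    rw [integrable_fun_norm_addHaar]
    have h2 : IntegrableOn (Set.indicator (Set.Ioc (0 : ℝ) 1) fun _ => (1 : ℝ)) (Set.Ioi 0) := by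
      refine Integrable.integrableOn ?_
      rw [integrable_indicator_iff measurableSet_Ioc]
      exact integrableOn_const (by simp)
    refine h2.congr_fun (fun y hy => ?_) measurableSet_Ioi
    have hy0 : (0 : ℝ) < y := hy
    simp only [finrank_euclideanSpace, Fintype.card_fin, f, smul_eq_mul, Set.indicator, Set.mem_Ioc]
    by_cases h : y ≤ 1
    · simp only [h, hy0, and_self, if_true]
      field_simp
    · simp [h]
  have e : ∀ k : Photon, ofReal (invNorm k) ^ 2 = ‖f ‖k.1‖‖ₑ := by
    intro k
    rw [← ENNReal.ofReal_pow (invNorm_nonneg k), ← ofReal_norm, norm_of_nonneg]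
    · simp only [invNorm, f]; split_ifs <;> simp
    · simp only [f]; split_ifs <;> positivity
  have h3 := h1.hasFiniteIntegral.ne
  rw [weightConst]
  simp only [e]
  rw [photonMeasure, lintegral_prod _ (by
    simp only [← e]
    exact ((measurable_invNorm.ennreal_ofReal).pow_const 2).aemeasurable)]
  simp only [lintegral_const]
  rw [lintegral_mul_const' _ _ (by simp [Measure.count_apply])]
  exact ENNReal.mul_ne_top h3 (by simp [Measure.count_apply])

/-- The square root of `∫_{|k| ≤ 1} |k|⁻² dk`. -/
def kappa : ℝ := (weightConst ^ (1 / 2 : ℝ)).toReal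

lemma kappa_nonneg : 0 ≤ kappa := ENNReal.toReal_nonneg

/-- The norm of a representative. -/
def nrm (Φ : Bag → ℂ) : ℝ := (normSqFun Φ ^ (1 / 2 : ℝ)).toReal

lemma nrm_nonneg (Φ : Bag → ℂ) : 0 ≤ nrm Φ := ENNReal.toReal_nonneg

lemma nrm_rep (φ : FockOne) : nrm (rep φ) = ‖φ‖ := by
  rw [nrm, normSqFun, ← enorm_sq_eq, ← rpow_natCast, ← ENNReal.rpow_mul]
  norm_num

lemma nrm_eq_zero {Φ : Bag → ℂ} (h : ∀ᵐ x ∂fockMeasure, Φ (bag x) = 0) :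
    nrm Φ = 0 := by
  have : normSqFun Φ = 0 := by
    rw [normSqFun, lintegral_eq_zero_of_ae_eq_zero]
    filter_upwards [h] with x hx
    simp [hx]
  simp [nrm, this]

lemma nrm_congr {Φ Φ' : Bag → ℂ}
    (h : ∀ᵐ x ∂fockMeasure, Φ (bag x) = Φ' (bag x)) : nrm Φ = nrm Φ' := by
  rw [nrm, nrm, normSqFun, normSqFun, lintegral_congr_ae]
  filter_upwards [h] with x hx
  rw [hx]

lemma IsAdm.of_norm_le {Φ Ψ : Bag → ℂ} (hΨ : IsAdm Ψ)
    (hm : Measurable fun x => Φ (bag x)) {C : ℝ} (h : ∀ s, ‖Φ s‖ ≤ C * ‖Ψ s‖) :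
    IsAdm Φ := by
  refine ⟨hm, fun s hs => ?_, ?_⟩
  · have := h s
    rw [hΨ.supp s hs] at this
    simpa using this
  · have h1 : ∫⁻ x, ‖Φ (bag x)‖ₑ ^ 2 ∂fockMeasure ≤
        ∫⁻ x, ofReal |C| ^ 2 * ‖Ψ (bag x)‖ₑ ^ 2 ∂fockMeasure := by
      refine lintegral_mono fun x => ?_
      rw [← mul_pow, ← ofReal_norm, ← ofReal_norm, ← ENNReal.ofReal_mul (abs_nonneg _)]
      gcongr
      exact (h _).trans (by gcongr; exact le_abs_self C)
    refine ne_top_of_le_ne_top ?_ h1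
    rw [lintegral_const_mul _ (hΨ.meas.enorm.pow_const 2)]
    have := hΨ.sq
    finiteness

lemma IsAdm.add {Φ Ψ : Bag → ℂ} (hΦ : IsAdm Φ) (hΨ : IsAdm Ψ) :
    IsAdm fun s => Φ s + Ψ s := by
  refine ⟨hΦ.meas.add hΨ.meas, fun s hs => by rw [hΦ.supp s hs, hΨ.supp s hs, add_zero], ?_⟩
  have h1 : ∫⁻ x, ‖Φ (bag x) + Ψ (bag x)‖ₑ ^ 2 ∂fockMeasure ≤
      ∫⁻ x, 2 * ‖Φ (bag x)‖ₑ ^ 2 + 2 * ‖Ψ (bag x)‖ₑ ^ 2 ∂fockMeasure := by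
    refine lintegral_mono fun x => ?_
    rw [← mul_add]
    refine (pow_le_pow_left' (enorm_add_le _ _) 2).trans ?_
    have := ENNReal.rpow_add_le_mul_rpow_add_rpow ‖Φ (bag x)‖ₑ ‖Ψ (bag x)‖ₑ
      (p := 2) (by norm_num)
    norm_num at this
    exact_mod_cast this
  refine ne_top_of_le_ne_top ?_ h1
  rw [lintegral_add_left ((hΦ.meas.enorm.pow_const 2).const_mul _),
    lintegral_const_mul _ (hΦ.meas.enorm.pow_const 2),
    lintegral_const_mul _ (hΨ.meas.enorm.pow_const 2)]
  have := hΦ.sq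
  have := hΨ.sq
  finiteness

lemma IsAdm.const_mul {Ψ : Bag → ℂ} (hΨ : IsAdm Ψ) (c : ℂ) :
    IsAdm fun s => c * Ψ s :=
  hΨ.of_norm_le (C := ‖c‖) (hΨ.meas.const_mul c) fun _ => (norm_mul _ _).le

lemma IsAdm.sub {Φ Ψ : Bag → ℂ} (hΦ : IsAdm Φ) (hΨ : IsAdm Ψ) :
    IsAdm fun s => Φ s - Ψ s := by
  have := hΦ.add (hΨ.const_mul (-1))
  simpa [sub_eq_add_neg] using this

section Wick

variable {ω : Photon → ℝ} {M N : ℕ} {B : ℝ}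
  {w : ℝ × Momentum → Tuple M → Tuple N → ℂ} {Φ Φ' Ψ Ψ' : Bag → ℂ}

/-- Measurability of a kernel. -/
def KMeas (w : ℝ × Momentum → Tuple M → Tuple N → ℂ) : Prop :=
  Measurable fun x : (ℝ × Momentum) × Tuple M × Tuple N => w x.1 x.2.1 x.2.2

lemma rpow_bound (hΦ : IsAdm Φ) (n : ℕ) :
    (weightConst ^ n * normSqFun Φ) ^ (1 / 2 : ℝ) ≠ ⊤ ∧
      ((weightConst ^ n * normSqFun Φ) ^ (1 / 2 : ℝ)).toReal = kappa ^ n * nrm Φ := by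
  have h1 := weightConst_ne_top
  have h2 : normSqFun Φ ≠ ⊤ := hΦ.sq
  constructor
  · finiteness
  · rw [ENNReal.mul_rpow_of_nonneg _ _ (by norm_num), toReal_mul, nrm, kappa,
      ← ENNReal.toReal_pow]
    congr 2
    rw [← rpow_natCast, ← rpow_natCast, ← ENNReal.rpow_mul, ← ENNReal.rpow_mul,
      mul_comm]

lemma lintegral_wickIntegrand_ne_top (hω : IsWeight ω) (hB : ∀ Y K K', ‖w Y K K'‖ ≤ B)
    (hΦ : IsAdm Φ) (hΨ : IsAdm Ψ) :
    ∫⁻ z, ‖wickIntegrand ω w Φ Ψ z‖ₑ ∂wickMeasure M N ≠ ⊤ := by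
  refine ne_top_of_le_ne_top ?_ (lintegral_wickIntegrand_le hω hB hΦ hΨ)
  have h1 := (rpow_bound hΦ N).1
  have h2 := (rpow_bound hΨ M).1
  finiteness

lemma norm_wick_le (hω : IsWeight ω) (h0 : 0 ≤ B) (hB : ∀ Y K K', ‖w Y K K'‖ ≤ B)
    (hΦ : IsAdm Φ) (hΨ : IsAdm Ψ) :
    ‖wick ω w Φ Ψ‖ ≤ B * kappa ^ (M + N) * nrm Φ * nrm Ψ := by
  have h1 := lintegral_wickIntegrand_le hω hB hΦ hΨ
  have h2 := (rpow_bound hΦ N).1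
  have h3 := (rpow_bound hΨ M).1
  have h4 := ENNReal.toReal_mono (by finiteness) h1
  rw [toReal_mul, toReal_mul, ENNReal.toReal_ofReal h0, (rpow_bound hΦ N).2,
    (rpow_bound hΨ M).2] at h4
  have h5 : ‖wick ω w Φ Ψ‖ₑ ≤ _ := enorm_integral_le_lintegral_enorm _
  have h6 := ENNReal.toReal_mono (lintegral_wickIntegrand_ne_top hω hB hΦ hΨ) h5
  rw [toReal_enorm] at h6
  refine (h6.trans h4).trans (le_of_eq ?_)
  ring

lemma integrable_wickIntegrand (hω : IsWeight ω) (hw : KMeas w) (hB : ∀ Y K K', ‖w Y K K'‖ ≤ B)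
    (hΦ : IsAdm Φ) (hΨ : IsAdm Ψ) : Integrable (wickIntegrand ω w Φ Ψ) (wickMeasure M N) :=
  ⟨(measurable_wickIntegrand hω.meas hw hΦ.meas hΨ.meas).aestronglyMeasurable,
    (lintegral_wickIntegrand_ne_top hω hB hΦ hΨ).lt_top⟩

lemma wick_add_left (hω : IsWeight ω) (hw : KMeas w) (hB : ∀ Y K K', ‖w Y K K'‖ ≤ B)
    (hΦ : IsAdm Φ) (hΦ' : IsAdm Φ') (hΨ : IsAdm Ψ) :
    wick ω w (fun s => Φ s + Φ' s) Ψ = wick ω w Φ Ψ + wick ω w Φ' Ψ := by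
  rw [wick, wick, wick, ← integral_add (integrable_wickIntegrand hω hw hB hΦ hΨ)
    (integrable_wickIntegrand hω hw hB hΦ' hΨ)]
  refine integral_congr_ae (.of_forall fun z => ?_)
  simp only [wickIntegrand, map_add]
  ring

lemma wick_const_mul_left (c : ℂ) :
    wick ω w (fun s => c * Φ s) Ψ = conj c * wick ω w Φ Ψ := by
  rw [wick, wick, ← integral_const_mul]
  refine integral_congr_ae (.of_forall fun z => ?_)
  simp only [wickIntegrand, map_mul]
  ring

lemma wick_congr_left (hω : IsWeight ω) (hw : KMeas w) (hB : ∀ Y K K', ‖w Y K K'‖ ≤ B)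
    (hΦ : IsAdm Φ) (hΦ' : IsAdm Φ') (hΨ : IsAdm Ψ)
    (h : ∀ᵐ x ∂fockMeasure, Φ (bag x) = Φ' (bag x)) :
    wick ω w Φ Ψ = wick ω w Φ' Ψ := by
  have h1 := wick_add_left hω hw hB (hΦ.sub hΦ') hΦ' hΨ
  simp only [sub_add_cancel] at h1
  have h0 : 0 ≤ B := (norm_nonneg _).trans (hB 0 (fun _ => 0) fun _ => 0)
  have h2 := norm_wick_le hω h0 hB (hΦ.sub hΦ') hΨ
  rw [nrm_eq_zero (by filter_upwards [h] with x hx; simp [hx])] at h2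
  have h3 : wick ω w (fun s => Φ s - Φ' s) Ψ = 0 := by simpa using h2
  rw [h1, h3, zero_add]

/-- The adjoint kernel. -/
def kadj (w : ℝ × Momentum → Tuple M → Tuple N → ℂ) :
    ℝ × Momentum → Tuple N → Tuple M → ℂ := fun Y K K' => conj (w Y K' K)

lemma KMeas.kadj (hw : KMeas w) : KMeas (kadj w) :=
  continuous_conj.measurable.comp (hw.comp (f := fun x : (ℝ × Momentum) ×
    Tuple N × Tuple M => (x.1, x.2.2, x.2.1)) (by fun_prop))

lemma measurePreserving_wickMeasure_swap (M N : ℕ) :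
    MeasurePreserving (fun z : Config × Tuple M × Tuple N =>
        (z.1, z.2.2, z.2.1)) (wickMeasure M N) (wickMeasure N M) :=
  (MeasurePreserving.id fockMeasure).prod Measure.measurePreserving_swap

lemma wick_kadj : wick ω (kadj w) Ψ Φ = conj (wick ω w Φ Ψ) := by
  rw [wick, wick, ← integral_conj]
  have h := (measurePreserving_wickMeasure_swap M N).integral_comp
    (MeasurableEquiv.measurableEmbedding ⟨⟨fun z : Config × Tuple M × Tuple N =>
        (z.1, z.2.2, z.2.1), fun z => (z.1, z.2.2, z.2.1), fun _ => rfl, fun _ => rfl⟩,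
        by dsimp; fun_prop, by dsimp; fun_prop⟩) (wickIntegrand ω (kadj w) Ψ Φ)
  rw [← h]
  refine integral_congr_ae (.of_forall fun z => ?_)
  simp only [wickIntegrand, kadj, map_mul, conj_conj, conj_ofReal]
  push_cast
  ring

lemma wick_kadj' : wick ω w Φ Ψ = conj (wick ω (kadj w) Ψ Φ) := by
  rw [wick_kadj, conj_conj]

lemma norm_kadj_le (hB : ∀ Y K K', ‖w Y K K'‖ ≤ B) (Y : ℝ × Momentum) (K : Tuple N)
    (K' : Tuple M) : ‖kadj w Y K K'‖ ≤ B := by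
  rw [kadj, RCLike.norm_conj]; exact hB _ _ _

lemma wick_add_right (hω : IsWeight ω) (hw : KMeas w) (hB : ∀ Y K K', ‖w Y K K'‖ ≤ B)
    (hΦ : IsAdm Φ) (hΨ : IsAdm Ψ) (hΨ' : IsAdm Ψ') :
    wick ω w Φ (fun s => Ψ s + Ψ' s) = wick ω w Φ Ψ + wick ω w Φ Ψ' := by
  rw [wick_kadj', wick_add_left hω hw.kadj (norm_kadj_le hB) hΨ hΨ' hΦ, map_add, ← wick_kadj',
    ← wick_kadj']

lemma wick_const_mul_right (c : ℂ) :
    wick ω w Φ (fun s => c * Ψ s) = c * wick ω w Φ Ψ := by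
  rw [wick_kadj', wick_const_mul_left, map_mul, conj_conj, ← wick_kadj']

lemma wick_congr_right (hω : IsWeight ω) (hw : KMeas w) (hB : ∀ Y K K', ‖w Y K K'‖ ≤ B)
    (hΦ : IsAdm Φ) (hΨ : IsAdm Ψ) (hΨ' : IsAdm Ψ')
    (h : ∀ᵐ x ∂fockMeasure, Ψ (bag x) = Ψ' (bag x)) :
    wick ω w Φ Ψ = wick ω w Φ Ψ' := by
  rw [wick_kadj' (Ψ := Ψ), wick_congr_left hω hw.kadj (norm_kadj_le hB) hΨ hΨ' hΦ h, ← wick_kadj']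

end Wick

/-! ### Families of kernels -/

/-- Bounded families of integral kernels; the degree `(0, 0)` is the free part. -/
structure IsKernel (B θ : ℝ) (v : Kernels) : Prop where
  nonneg : 0 ≤ B
  nonneg' : 0 ≤ θ
  meas : ∀ M N, KMeas (v M N)
  bound : ∀ M N Y K K', ‖v M N Y K K'‖ ≤ B * θ ^ (M + N)
  left : ∀ M N Y K K', v M N Y K K' ≠ 0 → Y.1 + mEnergy (tupleBag K) ≤ 1
  right : ∀ M N Y K K', v M N Y K K' ≠ 0 → Y.1 + mEnergy (tupleBag K') ≤ 1

/-- The form of a family of kernels. -/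
def wickSeries (ω : Photon → ℝ) (v : Kernels) (Φ Ψ : Bag → ℂ) : ℂ :=
  ∑' m : ℕ × ℕ, wick ω (v m.1 m.2) Φ Ψ

lemma summable_geometric_pair {r : ℝ} (h0 : 0 ≤ r) (h1 : r ≤ 1 / 2) :
    Summable (fun m : ℕ × ℕ => r ^ (m.1 + m.2)) ∧ ∑' m : ℕ × ℕ, r ^ (m.1 + m.2) ≤ 4 := by
  have hr : r < 1 := by linarith
  have hs := (summable_geometric_of_lt_one h0 hr)
  have h2 := hs.mul_of_nonneg hs (fun n => pow_nonneg h0 n) (fun n => pow_nonneg h0 n)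
  simp only [pow_add]
  refine ⟨h2, ?_⟩
  rw [← hs.tsum_mul_tsum hs h2, tsum_geometric_of_lt_one h0 hr]
  have : (1 - r)⁻¹ ≤ 2 := by
    rw [inv_le_comm₀ (by linarith) (by norm_num)]; linarith
  have h3 : 0 ≤ (1 - r)⁻¹ := inv_nonneg.2 (by linarith)
  nlinarith

section Series

variable {ω : Photon → ℝ} {B θ : ℝ} {v v' : Kernels} {Φ Φ' Ψ Ψ' : Bag → ℂ}

lemma norm_wick_kernel_le (hω : IsWeight ω) (h0 : 0 ≤ B) (hθ : 0 ≤ θ)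
    (hv : ∀ M N Y K K', ‖v M N Y K K'‖ ≤ B * θ ^ (M + N))
    (hΦ : IsAdm Φ) (hΨ : IsAdm Ψ) (m : ℕ × ℕ) :
    ‖wick ω (v m.1 m.2) Φ Ψ‖ ≤ B * nrm Φ * nrm Ψ * (θ * kappa) ^ (m.1 + m.2) := by
  refine (norm_wick_le hω (by positivity) (hv m.1 m.2) hΦ hΨ).trans (le_of_eq ?_)
  rw [mul_pow]; ring

lemma summable_wick (hω : IsWeight ω) (hv : IsKernel B θ v) (hθ : θ * kappa ≤ 1 / 2)
    (hΦ : IsAdm Φ) (hΨ : IsAdm Ψ) : Summable fun m : ℕ × ℕ => wick ω (v m.1 m.2) Φ Ψ :=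
  Summable.of_norm_bounded ((summable_geometric_pair (mul_nonneg hv.nonneg' kappa_nonneg)
    hθ).1.mul_left (B * nrm Φ * nrm Ψ))
    (norm_wick_kernel_le hω hv.nonneg hv.nonneg' hv.bound hΦ hΨ)

lemma norm_wickSeries_le (hω : IsWeight ω) (hv : IsKernel B θ v) (hθ : θ * kappa ≤ 1 / 2)
    (hΦ : IsAdm Φ) (hΨ : IsAdm Ψ) : ‖wickSeries ω v Φ Ψ‖ ≤ 4 * B * nrm Φ * nrm Ψ := by
  have hg := summable_geometric_pair (mul_nonneg hv.nonneg' kappa_nonneg) hθ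
  have h1 := tsum_of_norm_bounded (hg.1.mul_left (B * nrm Φ * nrm Ψ)).hasSum
    (norm_wick_kernel_le hω hv.nonneg hv.nonneg' hv.bound hΦ hΨ)
  refine h1.trans ?_
  rw [tsum_mul_left]
  have : 0 ≤ B * nrm Φ * nrm Ψ :=
    mul_nonneg (mul_nonneg hv.nonneg (nrm_nonneg _)) (nrm_nonneg _)
  nlinarith [hg.2]

lemma wickSeries_congr (hω : IsWeight ω) (hv : IsKernel B θ v)
    (hΦ : IsAdm Φ) (hΦ' : IsAdm Φ') (hΨ : IsAdm Ψ) (hΨ' : IsAdm Ψ')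
    (h : ∀ᵐ x ∂fockMeasure, Φ (bag x) = Φ' (bag x))
    (h' : ∀ᵐ x ∂fockMeasure, Ψ (bag x) = Ψ' (bag x)) :
    wickSeries ω v Φ Ψ = wickSeries ω v Φ' Ψ' :=
  tsum_congr fun m => by
    rw [wick_congr_left hω (hv.meas _ _) (hv.bound _ _) hΦ hΦ' hΨ h,
      wick_congr_right hω (hv.meas _ _) (hv.bound _ _) hΦ' hΨ hΨ' h']

/-- The operator with a given family of kernels. -/
def kop (ω : Photon → ℝ) (v : Kernels) : Op := opOfForm fun φ ψ => wickSeries ω v (rep φ) (rep ψ)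

theorem kop_spec (hω : IsWeight ω) (hv : IsKernel B θ v) (hθ : θ * kappa ≤ 1 / 2) :
    (∀ φ ψ, inner ℂ φ (kop ω v ψ) = wickSeries ω v (rep φ) (rep ψ)) ∧ ‖kop ω v‖ ≤ 4 * B := by
  have ha := fun φ : FockOne => rep_adm φ
  obtain ⟨A, hA, hA'⟩ := exists_op_of_form (B := fun φ ψ => wickSeries ω v (rep φ) (rep ψ))
    (C := 4 * B) (mul_nonneg (by norm_num) hv.nonneg)
    (fun φ φ' ψ => by
      rw [wickSeries_congr hω hv (ha _) ((ha φ).add (ha φ')) (ha ψ) (ha ψ) (rep_add φ φ')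
        (.of_forall fun _ => rfl), wickSeries, wickSeries, wickSeries,
        ← (summable_wick hω hv hθ (ha φ) (ha ψ)).tsum_add (summable_wick hω hv hθ (ha φ') (ha ψ))]
      exact tsum_congr fun m => wick_add_left hω (hv.meas _ _) (hv.bound _ _) (ha _) (ha _) (ha _))
    (fun z φ ψ => by
      rw [wickSeries_congr hω hv (ha _) ((ha φ).const_mul z) (ha ψ) (ha ψ) (rep_smul z φ)
        (.of_forall fun _ => rfl), wickSeries, wickSeries, ← tsum_mul_left]
      exact tsum_congr fun m => wick_const_mul_left z)
    (fun φ ψ ψ' => by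
      rw [wickSeries_congr hω hv (ha φ) (ha φ) (ha _) ((ha ψ).add (ha ψ'))
        (.of_forall fun _ => rfl) (rep_add ψ ψ'), wickSeries, wickSeries, wickSeries,
        ← (summable_wick hω hv hθ (ha φ) (ha ψ)).tsum_add (summable_wick hω hv hθ (ha φ) (ha ψ'))]
      exact tsum_congr fun m => wick_add_right hω (hv.meas _ _) (hv.bound _ _) (ha _) (ha _) (ha _))
    (fun z φ ψ => by
      rw [wickSeries_congr hω hv (ha φ) (ha φ) (ha _) ((ha ψ).const_mul z)
        (.of_forall fun _ => rfl) (rep_smul z ψ), wickSeries, wickSeries, ← tsum_mul_left]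
      exact tsum_congr fun m => wick_const_mul_right z)
    (fun φ ψ => by
      have := norm_wickSeries_le hω hv hθ (ha φ) (ha ψ)
      rwa [nrm_rep, nrm_rep] at this)
  have : kop ω v = A := opOfForm_eq hA
  rw [this]
  exact ⟨hA, hA'⟩

lemma conj_inner (φ ψ : FockOne) : conj (inner ℂ φ ψ : ℂ) = inner ℂ ψ φ := inner_conj_symm ψ φ

/-- The kernels of the adjoint operator. -/
def kernelsAdj (v : Kernels) : Kernels := fun M N => kadj (v N M)

lemma IsKernel.adj (hv : IsKernel B θ v) : IsKernel B θ (kernelsAdj v) where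
  nonneg := hv.nonneg
  nonneg' := hv.nonneg'
  meas M N := (hv.meas N M).kadj
  bound M N := norm_kadj_le (by rw [add_comm]; exact hv.bound N M)
  left M N Y K K' h := hv.right N M Y K' K (by simpa [kernelsAdj, kadj] using h)
  right M N Y K K' h := hv.left N M Y K' K (by simpa [kernelsAdj, kadj] using h)

lemma wickSeries_adj : wickSeries ω (kernelsAdj v) Ψ Φ = conj (wickSeries ω v Φ Ψ) := by
  rw [wickSeries, wickSeries, Complex.conj_tsum, ← (Equiv.prodComm ℕ ℕ).tsum_eq]
  exact tsum_congr fun m => wick_kadj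

theorem adjoint_kop (hω : IsWeight ω) (hv : IsKernel B θ v) (hθ : θ * kappa ≤ 1 / 2) :
    adj (kop ω v) = kop ω (kernelsAdj v) := by
  ext1 ψ
  refine ext_inner_left ℂ fun φ => ?_
  rw [ContinuousLinearMap.adjoint_inner_right, (kop_spec hω hv.adj hθ).1, wickSeries_adj,
    ← (kop_spec hω hv hθ).1, conj_inner]

end Series

end

section
/-! ### The Mecke formula with parameters -/

section Mecke

variable {α : Type*} [MeasurableSpace α] {ν : Measure α} [SFinite ν]

lemma measurable_mSum_param {β : Type*} [AddCommMonoid β] [MeasurableSpace β] [MeasurableAdd₂ β]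
    {G : Photon → Bag → α → β}
    (hG : Measurable fun p : Photon × Config × α => G p.1 (bag p.2.1) p.2.2) :
    Measurable fun z : Config × α => mSum (fun k u => G k u z.2) (bag z.1) := by
  have : Measurable fun z : α × Config => mSum (fun k u => G k u z.1) (bag z.2) := by
    refine measurable_prod_config fun n => ?_
    cases n with
    | zero => simp only [mSum_tuple_zero]; exact measurable_const
    | succ n =>
      simp only [mSum_tuple]
      refine Finset.measurable_sum _ fun i _ => ?_
      have h2 : Measurable fun p : α × Tuple (n + 1) =>
          (p.2 i, inSector n (i.removeNth p.2), p.1) := by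
        refine Measurable.prodMk (by fun_prop) (Measurable.prodMk ?_ measurable_fst)
        refine (measurable_inSector n).comp ?_
        exact (measurable_snd.comp (measurableEmbedding_removeNth i).measurable).comp measurable_snd
      exact hG.comp h2
  exact this.comp measurable_swap

theorem lintegral_mSum_param {G : Photon → Bag → α → ℝ≥0∞}
    (hG : Measurable fun p : Photon × Config × α => G p.1 (bag p.2.1) p.2.2) :
    ∫⁻ z, mSum (fun k u => G k u z.2) (bag z.1) ∂fockMeasure.prod ν =
      ∫⁻ p, G p.1 (bag p.2.1) p.2.2 ∂photonMeasure.prod (fockMeasure.prod ν) := by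
  have hG' : Measurable fun p : (Photon × Config) × α => G p.1.1 (bag p.1.2) p.2 :=
    hG.comp (f := fun p : (Photon × Config) × α => (p.1.1, p.1.2, p.2)) (by fun_prop)
  rw [lintegral_prod_symm' _ (measurable_mSum_param hG),
    ← (measurePreserving_prodAssoc photonMeasure fockMeasure ν).lintegral_comp hG]
  simp only [MeasurableEquiv.prodAssoc, MeasurableEquiv.coe_mk, Equiv.prodAssoc_apply]
  rw [lintegral_prod_symm' _ hG']
  refine lintegral_congr fun y => lintegral_mSum ?_
  exact hG'.comp (measurable_id.prodMk measurable_const)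

theorem integral_mSum_param {G : Photon → Bag → α → ℂ}
    (hm : Measurable fun p : Photon × Config × α => G p.1 (bag p.2.1) p.2.2)
    (hG : Integrable (fun p : Photon × Config × α => G p.1 (bag p.2.1) p.2.2)
      (photonMeasure.prod (fockMeasure.prod ν))) :
    Integrable (fun z : Config × α => mSum (fun k u => G k u z.2) (bag z.1))
      (fockMeasure.prod ν) ∧
    ∫ z, mSum (fun k u => G k u z.2) (bag z.1) ∂fockMeasure.prod ν =
      ∫ p, G p.1 (bag p.2.1) p.2.2 ∂photonMeasure.prod (fockMeasure.prod ν) := by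
  have h1 : Integrable (fun z : Config × α => mSum (fun k u => G k u z.2) (bag z.1))
      (fockMeasure.prod ν) := by
    refine ⟨(measurable_mSum_param hm).aestronglyMeasurable, ?_⟩
    have h2 := lintegral_mSum_param (ν := ν) (G := fun k u y => ‖G k u y‖ₑ) hm.enorm
    refine lt_of_le_of_lt ?_ (h2.trans_lt hG.hasFiniteIntegral)
    refine lintegral_mono fun z => ?_
    simp only [mSum]
    induction bag z.1 using Quotient.inductionOn with
    | h l =>
      simp only [Multiset.quot_mk_to_coe, Multiset.map_coe, Multiset.sum_coe]
      have (f : Photon → ℂ) (l' : List Photon) :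
          ‖(l'.map f).sum‖ₑ ≤ (l'.map fun k => ‖f k‖ₑ).sum := by
        induction l' with
        | nil => simp
        | cons a l' ih =>
          simp only [List.map_cons, List.sum_cons]
          exact (enorm_add_le _ _).trans (by gcongr)
      exact this _ l
  refine ⟨h1, ?_⟩
  have e := measurePreserving_prodAssoc photonMeasure fockMeasure ν
  have hG' : Integrable (fun p : (Photon × Config) × α => G p.1.1 (bag p.1.2) p.2)
      ((photonMeasure.prod fockMeasure).prod ν) :=
    (e.integrable_comp_emb MeasurableEquiv.prodAssoc.measurableEmbedding).2 hG
  rw [integral_prod_symm _ h1, ← e.integral_comp MeasurableEquiv.prodAssoc.measurableEmbedding]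
  simp only [MeasurableEquiv.prodAssoc, MeasurableEquiv.coe_mk, Equiv.prodAssoc_apply]
  rw [integral_prod_symm _ hG']
  refine integral_congr_ae ?_
  filter_upwards [hG'.prod_left_ae] with y hy
  refine integral_mSum ?_ hy
  exact hm.comp (f := fun p : Photon × Config => (p.1, p.2, y)) (by fun_prop)

end Mecke

/-! ### Shifted kernels and contracted kernels -/

/-- The translated kernels `v[Y + (|k|, k)]`. -/
def shiftK (k : Momentum) (v : Kernels) : Kernels :=
  fun M N Y K L => v M N (‖k‖ + Y.1, k + Y.2) K L

/-- The kernels obtained by fixing one of the outgoing photons. -/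
def contractK (k : Photon) (v : Kernels) : Kernels :=
  fun M N Y K K' => ∑ i : Fin (M + 1), v (M + 1) N Y (i.insertNth k K) K'

lemma measurable_insertNth {M : ℕ} (i : Fin (M + 1)) :
    Measurable fun p : Photon × Tuple M =>
      (i.insertNth p.1 p.2 : Tuple (M + 1)) :=
  (MeasurableEquiv.piFinSuccAbove (fun _ => Photon) i).symm.measurable

lemma IsKernel.shift {B θ : ℝ} {v : Kernels} (hv : IsKernel B θ v) (k : Momentum) :
    IsKernel B θ (shiftK k v) where
  nonneg := hv.nonneg
  nonneg' := hv.nonneg'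
  meas M N := (hv.meas M N).comp (f := fun x : (ℝ × Momentum) × Tuple M ×
    Tuple N => ((‖k‖ + x.1.1, k + x.1.2), x.2.1, x.2.2)) (by fun_prop)
  bound M N Y K K' := hv.bound M N _ K K'
  left M N Y K K' h := by
    have := hv.left M N _ K K' h
    linarith [norm_nonneg k]
  right M N Y K K' h := by
    have := hv.right M N _ K K' h
    linarith [norm_nonneg k]

lemma measurable_contract {M N : ℕ}
    {w : ℝ × Momentum → Tuple (M + 1) → Tuple N → ℂ} (hw : KMeas w)
    (i : Fin (M + 1)) : Measurable fun p : Photon × (ℝ × Momentum) × Tuple M ×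
      Tuple N => w p.2.1 (i.insertNth p.1 p.2.2.1) p.2.2.2 := by
  have h1 : Measurable fun p : Photon × (ℝ × Momentum) × Tuple M × Tuple N =>
      (i.insertNth p.1 p.2.2.1 : Tuple (M + 1)) :=
    (measurable_insertNth i).comp (f := fun p : Photon × (ℝ × Momentum) × Tuple M ×
      Tuple N => (p.1, p.2.2.1)) (by fun_prop)
  exact hw.comp (f := fun p : Photon × (ℝ × Momentum) × Tuple M × Tuple N =>
    (p.2.1, (i.insertNth p.1 p.2.2.1 : Tuple (M + 1)), p.2.2.2))
    ((measurable_fst.comp measurable_snd).prodMk (h1.prodMk (by fun_prop)))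

lemma IsKernel.contract {B θ : ℝ} {v : Kernels} (hv : IsKernel B θ v) (k : Photon) :
    IsKernel (θ * B) (2 * θ) (contractK k v) where
  nonneg := mul_nonneg hv.nonneg' hv.nonneg
  nonneg' := mul_nonneg (by norm_num) hv.nonneg'
  meas M N := by
    refine Finset.measurable_sum (f := fun (i : Fin (M + 1)) (x : (ℝ × Momentum) ×
      Tuple M × Tuple N) => v (M + 1) N x.1 (i.insertNth k x.2.1) x.2.2) _
      fun i _ => ?_
    exact (measurable_contract (hv.meas _ _) i).comp (measurable_const.prodMk measurable_id)
  bound M N Y K K' := by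
    refine (norm_sum_le _ _).trans ((Finset.sum_le_card_nsmul _ _ _
      fun i _ => hv.bound (M + 1) N Y _ K').trans ?_)
    rw [Finset.card_univ, Fintype.card_fin, nsmul_eq_mul, mul_pow]
    have h1 : ((M + 1 : ℕ) : ℝ) ≤ 2 ^ (M + N) := by
      have h2 : M + 1 ≤ 2 ^ M := Nat.lt_two_pow_self
      have h3 : 2 ^ M ≤ 2 ^ (M + N) := Nat.pow_le_pow_right (by norm_num) (by omega)
      exact_mod_cast h2.trans h3
    have h4 : B * θ ^ (M + 1 + N) = θ * B * θ ^ (M + N) := by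
      rw [show M + 1 + N = M + N + 1 by omega, pow_succ]; ring
    rw [h4]
    have h5 : 0 ≤ θ * B * θ ^ (M + N) :=
      mul_nonneg (mul_nonneg hv.nonneg' hv.nonneg) (pow_nonneg hv.nonneg' _)
    nlinarith
  left M N Y K K' h := by
    obtain ⟨i, -, hi⟩ := Finset.exists_ne_zero_of_sum_ne_zero h
    have := hv.left _ _ _ _ _ hi
    rw [bag_insertNth, mEnergy_cons] at this
    linarith [norm_nonneg k.1]
  right M N Y K K' h := by
    obtain ⟨i, -, hi⟩ := Finset.exists_ne_zero_of_sum_ne_zero h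
    exact hv.right _ _ _ _ _ hi

section Pull

variable {ω : Photon → ℝ} {B θ c : ℝ} {v : Kernels} {S : Set Photon} {Φ Ψ : Bag → ℂ}

/-- The integrand of a Wick monomial on multisets. -/
def wickAt (ω : Photon → ℝ) {M N : ℕ}
    (w : ℝ × Momentum → Tuple M → Tuple N → ℂ) (Φ Ψ : Bag → ℂ)
    (s : Bag) (y : Tuple M × Tuple N) : ℂ :=
  ((prodWeight ω y.1 * prodWeight ω y.2 : ℝ) : ℂ) *
    (conj (Φ (tupleBag y.1 + s)) * w (point s) y.1 y.2 * Ψ (tupleBag y.2 + s))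

lemma integral_norm_wickIntegrand_le (hω : IsWeight ω) {M N : ℕ}
    {w : ℝ × Momentum → Tuple M → Tuple N → ℂ} (hw : KMeas w) (h0 : 0 ≤ B)
    (hB : ∀ Y K K', ‖w Y K K'‖ ≤ B) (hΦ : IsAdm Φ) (hΨ : IsAdm Ψ) :
    ∫ z, ‖wickIntegrand ω w Φ Ψ z‖ ∂wickMeasure M N ≤ B * kappa ^ (M + N) * nrm Φ * nrm Ψ := by
  have h1 := lintegral_wickIntegrand_le hω hB hΦ hΨ
  have h2 := (rpow_bound hΦ N).1
  have h3 := (rpow_bound hΨ M).1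
  have h4 := ENNReal.toReal_mono (by finiteness) h1
  rw [toReal_mul, toReal_mul, ENNReal.toReal_ofReal h0, (rpow_bound hΦ N).2,
    (rpow_bound hΨ M).2, ← integral_norm_eq_lintegral_enorm
    (measurable_wickIntegrand hω.meas hw hΦ.meas hΨ.meas).aestronglyMeasurable] at h4
  refine h4.trans (le_of_eq ?_)
  ring

/-- The contribution of a spectator photon to `[a(k), W]`. -/
def spectator (ω : Photon → ℝ) (S : Set Photon) (v : Kernels) (Φ Ψ : Bag → ℂ)
    (M N : ℕ) (k : Photon) (u : Bag) (y : Tuple M × Tuple N) : ℂ :=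
  S.indicator 1 k * wickAt ω (shiftK k.1 v M N) Φ (fun s => Ψ (k ::ₘ s)) u y

/-- The contribution of a created photon to `[a(k), W]`. -/
def created (ω : Photon → ℝ) (S : Set Photon) (v : Kernels) (Φ Ψ : Bag → ℂ)
    (M N : ℕ) (i : Fin (M + 1))
    (p : Photon × Config × Tuple M × Tuple N) : ℂ :=
  S.indicator 1 p.1 * ((ω p.1 : ℂ) *
    wickIntegrand ω (fun Y K K' => v (M + 1) N Y (i.insertNth p.1 K) K') Φ Ψ p.2)

lemma conj_indicator (S : Set Photon) (k : Photon) :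
    conj (S.indicator (1 : Photon → ℂ) k) = S.indicator 1 k := by
  by_cases h : k ∈ S <;> simp [h]

lemma conj_mSum (G : Photon → Bag → ℂ) (s : Bag) :
    conj (mSum G s) = mSum (fun k u => conj (G k u)) s := by
  simp only [mSum]
  rw [map_multiset_sum, Multiset.map_map]
  rfl

lemma mSum_mul (G : Photon → Bag → ℂ) (h : Bag → ℂ) (s : Bag) :
    mSum G s * h s = mSum (fun k u => G k u * h (k ::ₘ u)) s := by
  simp only [mSum]
  rw [← Multiset.sum_map_mul_right]
  congr 1
  refine Multiset.map_congr rfl fun k hk => ?_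
  rw [Multiset.cons_erase hk]

lemma mul_mSum (c : ℂ) (G : Photon → Bag → ℂ) (s : Bag) :
    c * mSum G s = mSum (fun k u => c * G k u) s := by
  simp only [mSum]
  rw [← Multiset.sum_map_mul_left]

lemma wickAt_creatFun (hv : IsKernel B θ v) {M N : ℕ} (s : Bag)
    (y : Tuple M × Tuple N) :
    wickAt ω (v M N) (creatFun S Φ) Ψ s y =
      ((prodWeight ω y.1 * prodWeight ω y.2 : ℝ) : ℂ) *
        (mSum (fun k u => S.indicator 1 k * conj (Φ (u + s))) (tupleBag y.1) *
          v M N (point s) y.1 y.2 * Ψ (tupleBag y.2 + s)) +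
      mSum (fun k u => spectator ω S v Φ Ψ M N k u y) s := by
  have h1 : conj (creatFun S Φ (tupleBag y.1 + s)) * v M N (point s) y.1 y.2 =
      conj (mSum (fun k u => S.indicator 1 k * Φ u) (tupleBag y.1 + s)) *
        v M N (point s) y.1 y.2 := by
    by_cases h0 : v M N (point s) y.1 y.2 = 0
    · rw [h0, mul_zero, mul_zero]
    · have := hv.left M N _ _ _ h0
      rw [creatFun, if_pos]
      rw [mEnergy_add]
      simp only [point] at this
      linarith
  rw [wickAt, h1, mSum_add, map_add, add_mul, add_mul, mul_add, conj_mSum, conj_mSum]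
  simp only [map_mul, conj_indicator]
  congr 1
  rw [mul_assoc (mSum _ _), mSum_mul _ (fun u => v M N (point u) y.1 y.2 *
    Ψ (tupleBag y.2 + u)), mul_mSum]
  congr 1
  funext k u
  simp only [spectator, wickAt, shiftK, point, mEnergy_cons, mMomentum_cons, Multiset.add_cons]
  ring

lemma wickAt_created {M N : ℕ} (x : Config)
    (y : Tuple (M + 1) × Tuple N) :
    ((prodWeight ω y.1 * prodWeight ω y.2 : ℝ) : ℂ) *
        (mSum (fun k u => S.indicator 1 k * conj (Φ (u + bag x))) (tupleBag y.1) *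
          v (M + 1) N (point (bag x)) y.1 y.2 * Ψ (tupleBag y.2 + bag x)) =
      ∑ i, created ω S v Φ Ψ M N i (y.1 i, x, i.removeNth y.1, y.2) := by
  rw [mSum_tuple, Finset.sum_mul, Finset.sum_mul, Finset.mul_sum]
  refine Finset.sum_congr rfl fun i _ => ?_
  have h1 : prodWeight ω y.1 = ω (y.1 i) * prodWeight ω (i.removeNth y.1) :=
    Fin.prod_univ_succAbove _ i
  simp only [created, wickIntegrand, Fin.insertNth_self_removeNth, h1]
  push_cast
  ring

lemma measurable_spectator (hω : Measurable ω) (hS : MeasurableSet S) (hv : IsKernel B θ v)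
    (hΦ : Measurable fun x => Φ (bag x)) (hΨ : Measurable fun x => Ψ (bag x))
    (M N : ℕ) : Measurable fun p : Photon × Config × Tuple M × Tuple N =>
      spectator ω S v Φ Ψ M N p.1 (bag p.2.1) p.2.2 := by
  have h1 : Measurable fun p : Photon × Config × Tuple M × Tuple N =>
      Φ (tupleBag p.2.2.1 + bag p.2.1) :=
    (measurable_append hΦ M).comp (f := fun p : Photon × Config × Tuple M ×
      Tuple N => (p.2.2.1, p.2.1)) (by fun_prop)
  have h2 : Measurable fun p : Photon × Config × Tuple M × Tuple N =>
      Ψ (p.1 ::ₘ (tupleBag p.2.2.2 + bag p.2.1)) := by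
    have h3 : Measurable fun p : Photon × Config × Tuple M × Tuple N =>
        consConfig (p.1, appendConfig (p.2.2.2, p.2.1)) :=
      measurable_consConfig.comp (measurable_fst.prodMk (measurable_appendConfig.comp
        (f := fun p : Photon × Config × Tuple M × Tuple N => (p.2.2.2, p.2.1))
        (by fun_prop)))
    have := hΨ.comp h3
    simpa [Function.comp_def] using this
  have h3 : Measurable fun p : Photon × Config × Tuple M × Tuple N =>
      shiftK p.1.1 v M N (point (bag p.2.1)) p.2.2.1 p.2.2.2 := by
    have hp := measurable_point
    refine (hv.meas M N).comp (f := fun p : Photon × Config × Tuple M ×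
      Tuple N => ((‖p.1.1‖ + (point (bag p.2.1)).1,
        p.1.1 + (point (bag p.2.1)).2), p.2.2.1, p.2.2.2)) ?_
    refine Measurable.prodMk (Measurable.prodMk (Measurable.add (by fun_prop) ?_)
      (Measurable.add (by fun_prop) ?_)) (by fun_prop)
    · exact hp.fst.comp (f := fun p : Photon × Config × Tuple M ×
        Tuple N => p.2.1) (by fun_prop)
    · exact hp.snd.comp (f := fun p : Photon × Config × Tuple M ×
        Tuple N => p.2.1) (by fun_prop)
  have h4 : Measurable fun p : Photon × Config × Tuple M × Tuple N =>
      ((prodWeight ω p.2.2.1 * prodWeight ω p.2.2.2 : ℝ) : ℂ) :=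
    measurable_ofReal.comp
      (((measurable_prodWeight hω).comp (f := fun p : Photon × Config × Tuple M ×
        Tuple N => p.2.2.1) (by fun_prop)).mul
      ((measurable_prodWeight hω).comp (f := fun p : Photon × Config × Tuple M ×
        Tuple N => p.2.2.2) (by fun_prop)))
  exact ((measurable_one.indicator hS).comp measurable_fst).mul
    (h4.mul (((continuous_conj.measurable.comp h1).mul h3).mul h2))

lemma measurable_created (hω : Measurable ω) (hS : MeasurableSet S) (hv : IsKernel B θ v)
    (hΦ : Measurable fun x => Φ (bag x)) (hΨ : Measurable fun x => Ψ (bag x))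
    (M N : ℕ) (i : Fin (M + 1)) : Measurable (created ω S v Φ Ψ M N i) := by
  have h1 : Measurable fun p : Photon × Config × Tuple M × Tuple N =>
      Φ (tupleBag p.2.2.1 + bag p.2.1) :=
    (measurable_append hΦ M).comp (f := fun p : Photon × Config × Tuple M ×
      Tuple N => (p.2.2.1, p.2.1)) (by fun_prop)
  have h2 : Measurable fun p : Photon × Config × Tuple M × Tuple N =>
      Ψ (tupleBag p.2.2.2 + bag p.2.1) :=
    (measurable_append hΨ N).comp (f := fun p : Photon × Config × Tuple M ×
      Tuple N => (p.2.2.2, p.2.1)) (by fun_prop)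
  have h3 : Measurable fun p : Photon × Config × Tuple M × Tuple N =>
      v (M + 1) N (point (bag p.2.1)) (i.insertNth p.1 p.2.2.1) p.2.2.2 :=
    (measurable_contract (hv.meas _ _) i).comp (f := fun p : Photon × Config × Tuple M ×
      Tuple N => (p.1, point (bag p.2.1), p.2.2.1, p.2.2.2))
      (measurable_fst.prodMk ((measurable_point.comp (f := fun p : Photon × Config ×
        Tuple M × Tuple N => p.2.1) (by fun_prop)).prodMk (by fun_prop)))
  have h4 : Measurable fun p : Photon × Config × Tuple M × Tuple N =>
      ((prodWeight ω p.2.2.1 * prodWeight ω p.2.2.2 : ℝ) : ℂ) :=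
    measurable_ofReal.comp
      (((measurable_prodWeight hω).comp (f := fun p : Photon × Config × Tuple M ×
        Tuple N => p.2.2.1) (by fun_prop)).mul
      ((measurable_prodWeight hω).comp (f := fun p : Photon × Config × Tuple M ×
        Tuple N => p.2.2.2) (by fun_prop)))
  exact ((measurable_one.indicator hS).comp measurable_fst).mul
    ((measurable_ofReal.comp (hω.comp measurable_fst)).mul
    (h4.mul (((continuous_conj.measurable.comp h1).mul h3).mul h2)))

end Pull

end

section
section Pull

variable {ω : Photon → ℝ} {B θ c : ℝ} {v : Kernels} {S : Set Photon}

instance (M N : ℕ) : SFinite (wickMeasure M N) := by unfold wickMeasure; infer_instance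

lemma indicator_one_mul (S : Set Photon) (f : Photon → ℂ) :
    (fun k => S.indicator 1 k * f k) = S.indicator f := by
  funext k
  by_cases h : k ∈ S <;> simp [h]

lemma nrm_cons (ψ : FockOne) :
    ∀ᵐ k ∂photonMeasure, nrm (fun s => rep ψ (k ::ₘ s)) = ‖ann k ψ‖ := by
  filter_upwards [rep_ann ψ] with k hk
  exact (nrm_congr (Φ := rep (ann k ψ)) (Φ' := fun s => rep ψ (k ::ₘ s)) hk).symm.trans
    (nrm_rep (ann k ψ))

lemma integrable_spectator (hω : IsWeight ω) (hS : GoodSet c S) (hv : IsKernel B θ v)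
    (φ ψ : FockOne) (M N : ℕ) :
    Integrable (fun p : Photon × Config × Tuple M × Tuple N =>
      spectator ω S v (rep φ) (rep ψ) M N p.1 (bag p.2.1) p.2.2)
      (photonMeasure.prod (wickMeasure M N)) := by
  have hm := measurable_spectator hω.meas hS.meas hv (rep_adm φ).meas (rep_adm ψ).meas M N
  rw [integrable_prod_iff hm.aestronglyMeasurable]
  constructor
  · filter_upwards [ae_isAdm_cons ψ] with k hk
    exact (integrable_wickIntegrand hω ((hv.shift k.1).meas M N) ((hv.shift k.1).bound M N)
      (rep_adm φ) hk).const_mul _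
  · have h1 : Integrable (S.indicator fun k => B * θ ^ (M + N) * kappa ^ (M + N) * ‖φ‖ * ‖ann k ψ‖)
        photonMeasure := by
      rw [integrable_indicator_iff hS.meas]
      exact (integrableOn_norm_ann hS ψ).const_mul _
    refine h1.mono' hm.aestronglyMeasurable.norm.integral_prod_right' ?_
    filter_upwards [ae_isAdm_cons ψ, nrm_cons ψ] with k hk hk'
    rw [norm_of_nonneg (integral_nonneg fun _ => norm_nonneg _)]
    by_cases hkS : k ∈ S
    · have := integral_norm_wickIntegrand_le hω ((hv.shift k.1).meas M N)
        (mul_nonneg hv.nonneg (pow_nonneg hv.nonneg' _)) ((hv.shift k.1).bound M N)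
        (rep_adm φ) hk
      rw [nrm_rep, hk'] at this
      rw [Set.indicator_of_mem hkS]
      refine le_trans (le_of_eq ?_) this
      refine integral_congr_ae (.of_forall fun z => ?_)
      simp only [spectator, Set.indicator_of_mem hkS, Pi.one_apply, one_mul]
      rfl
    · simp [spectator, hkS]

lemma integral_spectator (hω : IsWeight ω) (hS : GoodSet c S) (hv : IsKernel B θ v)
    (φ ψ : FockOne) (M N : ℕ) :
    IntegrableOn (fun k => wick ω (shiftK k.1 v M N) (rep φ) (rep (ann k ψ))) S photonMeasure ∧
    ∫ p, spectator ω S v (rep φ) (rep ψ) M N p.1 (bag p.2.1) p.2.2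
      ∂photonMeasure.prod (wickMeasure M N) =
      ∫ k in S, wick ω (shiftK k.1 v M N) (rep φ) (rep (ann k ψ)) ∂photonMeasure := by
  have hi := integrable_spectator hω hS hv φ ψ M N
  have e : (fun k => ∫ z, spectator ω S v (rep φ) (rep ψ) M N k (bag z.1) z.2
        ∂wickMeasure M N) =ᵐ[photonMeasure]
      S.indicator fun k => wick ω (shiftK k.1 v M N) (rep φ) (rep (ann k ψ)) := by
    filter_upwards [ae_isAdm_cons ψ, rep_ann ψ] with k hk hk'
    rw [← indicator_one_mul]
    dsimp only
    rw [wick_congr_right hω ((hv.shift k.1).meas M N) ((hv.shift k.1).bound M N) (rep_adm φ)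
      (rep_adm _) hk hk', wick, ← integral_const_mul]
    rfl
  constructor
  · rw [← integrable_indicator_iff hS.meas]
    exact hi.integral_prod_left.congr e
  · rw [integral_prod _ hi, integral_congr_ae e, integral_indicator hS.meas]

lemma norm_insert_le (hv : IsKernel B θ v) {M : ℕ} (N : ℕ) (i : Fin (M + 1)) (k : Photon)
    (Y : ℝ × Momentum) (K : Tuple M) (K' : Tuple N) :
    ‖v (M + 1) N Y (i.insertNth k K) K'‖ ≤ B * θ ^ (M + 1 + N) := hv.bound _ _ _ _ _

lemma kmeas_insert (hv : IsKernel B θ v) {M : ℕ} (N : ℕ) (i : Fin (M + 1)) (k : Photon) :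
    KMeas fun Y K K' => v (M + 1) N Y (i.insertNth k K) K' :=
  (measurable_contract (hv.meas _ _) i).comp (measurable_const.prodMk measurable_id)

lemma integrable_created (hω : IsWeight ω) (hS : GoodSet c S) (hv : IsKernel B θ v)
    (φ ψ : FockOne) (M N : ℕ) (i : Fin (M + 1)) :
    Integrable (created ω S v (rep φ) (rep ψ) M N i) (photonMeasure.prod (wickMeasure M N)) := by
  have hm := measurable_created hω.meas hS.meas hv (rep_adm φ).meas (rep_adm ψ).meas M N i
  rw [integrable_prod_iff hm.aestronglyMeasurable]
  constructor
  · exact Eventually.of_forall fun k => ((integrable_wickIntegrand hω (kmeas_insert hv N i k)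
      (norm_insert_le hv N i k) (rep_adm φ) (rep_adm ψ)).const_mul (ω k : ℂ)).const_mul (S.indicator 1 k)
  · have h1 : Integrable (S.indicator fun _ => (√c)⁻¹ *
        (B * θ ^ (M + 1 + N) * kappa ^ (M + N) * ‖φ‖ * ‖ψ‖)) photonMeasure := by
      rw [integrable_indicator_iff hS.meas]
      exact integrableOn_const hS.fin
    refine h1.mono' hm.aestronglyMeasurable.norm.integral_prod_right'
      (.of_forall fun k => ?_)
    rw [norm_of_nonneg (integral_nonneg fun _ => norm_nonneg _)]
    by_cases hkS : k ∈ S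
    · have := integral_norm_wickIntegrand_le hω (kmeas_insert hv N i k)
        (mul_nonneg hv.nonneg (pow_nonneg hv.nonneg' _)) (norm_insert_le hv N i k)
        (rep_adm φ) (rep_adm ψ)
      rw [nrm_rep, nrm_rep] at this
      rw [Set.indicator_of_mem hkS]
      have h2 : ω k ≤ (√c)⁻¹ := by
        refine (hω.le k).trans ?_
        have := Real.sqrt_le_sqrt (hS.le k hkS)
        have := Real.sqrt_pos.2 hS.pos
        gcongr
      refine le_trans (le_of_eq ?_) (mul_le_mul h2 this (integral_nonneg fun _ => norm_nonneg _)
        (by positivity))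
      rw [← integral_const_mul]
      refine integral_congr_ae (.of_forall fun z => ?_)
      simp only [created, Set.indicator_of_mem hkS, Pi.one_apply, one_mul, norm_mul,
        norm_real, norm_of_nonneg (hω.nonneg k)]
    · simp [created, hkS]

lemma integral_created (hω : IsWeight ω) (hS : GoodSet c S) (hv : IsKernel B θ v)
    (φ ψ : FockOne) (M N : ℕ) :
    IntegrableOn (fun k => (ω k : ℂ) * wick ω (contractK k v M N) (rep φ) (rep ψ)) S
      photonMeasure ∧
    ∑ i, ∫ p, created ω S v (rep φ) (rep ψ) M N i p ∂photonMeasure.prod (wickMeasure M N) =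
      ∫ k in S, (ω k : ℂ) * wick ω (contractK k v M N) (rep φ) (rep ψ) ∂photonMeasure := by
  have hi := integrable_created hω hS hv φ ψ M N
  have e : ∀ k, (∑ i, ∫ z, created ω S v (rep φ) (rep ψ) M N i (k, z) ∂wickMeasure M N) =
      S.indicator (fun k => (ω k : ℂ) * wick ω (contractK k v M N) (rep φ) (rep ψ)) k := by
    intro k
    rw [← indicator_one_mul]
    have h1 : wick ω (contractK k v M N) (rep φ) (rep ψ) = ∑ i : Fin (M + 1),
        wick ω (fun Y K K' => v (M + 1) N Y (i.insertNth k K) K') (rep φ) (rep ψ) := by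
      simp only [wick]
      rw [← integral_finsetSum _ fun i _ => integrable_wickIntegrand hω (kmeas_insert hv N i k)
        (norm_insert_le hv N i k) (rep_adm φ) (rep_adm ψ)]
      refine integral_congr_ae (.of_forall fun z => ?_)
      simp only [wickIntegrand, contractK, Finset.mul_sum, Finset.sum_mul]
    dsimp only
    rw [h1, Finset.mul_sum, Finset.mul_sum]
    refine Finset.sum_congr rfl fun i _ => ?_
    simp only [created]
    rw [integral_const_mul, integral_const_mul, wick]
  constructor
  · rw [← integrable_indicator_iff hS.meas]
    refine (integrable_finsetSum Finset.univ fun i _ => (hi i).integral_prod_left).congr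
      (.of_forall fun k => ?_)
    exact e k
  · rw [← integral_indicator hS.meas, ← integral_congr_ae (.of_forall e),
      integral_finsetSum _ fun i _ => (hi i).integral_prod_left]
    exact Finset.sum_congr rfl fun i _ => integral_prod _ (hi i)

lemma measurePreserving_created (M N : ℕ) (i : Fin (M + 1)) :
    MeasurePreserving (fun z : Config × Tuple (M + 1) × Tuple N =>
      (z.2.1 i, z.1, i.removeNth z.2.1, z.2.2)) (wickMeasure (M + 1) N)
      (photonMeasure.prod (wickMeasure M N)) := by
  have h1 : MeasurePreserving (fun z : Config × Tuple (M + 1) × Tuple N =>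
      (z.1, ((z.2.1 i, i.removeNth z.2.1), z.2.2))) (wickMeasure (M + 1) N)
      (fockMeasure.prod ((photonMeasure.prod (photonMeasureN M)).prod (photonMeasureN N))) :=
    (MeasurePreserving.id _).prod ((measurePreserving_removeNth i).prod (MeasurePreserving.id _))
  have h2 := (MeasurePreserving.id fockMeasure).prod
    (measurePreserving_prodAssoc photonMeasure (photonMeasureN M) (photonMeasureN N))
  have h3 := (measurePreserving_prodAssoc fockMeasure photonMeasure
    ((photonMeasureN M).prod (photonMeasureN N))).symm
  have h4 : MeasurePreserving Prod.swap (fockMeasure.prod photonMeasure)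
      (photonMeasure.prod fockMeasure) := Measure.measurePreserving_swap
  have h5 := h4.prod (MeasurePreserving.id ((photonMeasureN M).prod (photonMeasureN N)))
  have h6 := measurePreserving_prodAssoc photonMeasure fockMeasure
    ((photonMeasureN M).prod (photonMeasureN N))
  exact h6.comp (h5.comp (h3.comp (h2.comp h1)))

lemma wick_creat (hω : IsWeight ω) (hS : GoodSet c S) (hv : IsKernel B θ v)
    (φ ψ : FockOne) (N : ℕ) :
    wick ω (v 0 N) (creatFun S (rep φ)) (rep ψ) =
      ∫ k in S, wick ω (shiftK k.1 v 0 N) (rep φ) (rep (ann k ψ)) ∂photonMeasure ∧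
    ∀ M, wick ω (v (M + 1) N) (creatFun S (rep φ)) (rep ψ) =
      ∫ k in S, wick ω (shiftK k.1 v (M + 1) N) (rep φ) (rep (ann k ψ)) ∂photonMeasure +
      ∫ k in S, (ω k : ℂ) * wick ω (contractK k v M N) (rep φ) (rep ψ) ∂photonMeasure := by
  have hsp : ∀ M, Integrable (fun z : Config × Tuple M × Tuple N =>
        mSum (fun k u => spectator ω S v (rep φ) (rep ψ) M N k u z.2) (bag z.1))
        (wickMeasure M N) ∧
      ∫ z, mSum (fun k u => spectator ω S v (rep φ) (rep ψ) M N k u z.2) (bag z.1)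
        ∂wickMeasure M N = ∫ p, spectator ω S v (rep φ) (rep ψ) M N p.1 (bag p.2.1) p.2.2
        ∂photonMeasure.prod (wickMeasure M N) :=
    fun M => integral_mSum_param (measurable_spectator hω.meas hS.meas hv
    (rep_adm φ).meas (rep_adm ψ).meas M N) (integrable_spectator hω hS hv φ ψ M N)
  constructor
  · rw [← (integral_spectator hω hS hv φ ψ 0 N).2, ← (hsp 0).2, wick]
    refine integral_congr_ae (.of_forall fun z => ?_)
    refine (wickAt_creatFun hv (bag z.1) z.2).trans ?_
    rw [mSum_tuple_zero, zero_mul, zero_mul, mul_zero, zero_add]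
  · intro M
    have hmp := measurePreserving_created M N
    have hcr := fun i => integrable_created hω hS hv φ ψ M N i
    have hci : ∀ i, Integrable (fun z : Config × Tuple (M + 1) × Tuple N =>
        created ω S v (rep φ) (rep ψ) M N i (z.2.1 i, z.1, i.removeNth z.2.1, z.2.2))
        (wickMeasure (M + 1) N) := fun i =>
      (hmp i).integrable_comp_of_integrable (hcr i)
    rw [← (integral_spectator hω hS hv φ ψ (M + 1) N).2, ← (hsp (M + 1)).2,
      ← (integral_created hω hS hv φ ψ M N).2, wick]
    refine Eq.trans ?_ (add_comm _ _)
    have e : ∀ i, ∫ p, created ω S v (rep φ) (rep ψ) M N i p ∂photonMeasure.prod (wickMeasure M N) =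
        ∫ z, created ω S v (rep φ) (rep ψ) M N i (z.2.1 i, z.1, i.removeNth z.2.1, z.2.2)
          ∂wickMeasure (M + 1) N := by
      intro i
      rw [← (hmp i).map_eq, integral_map (hmp i).measurable.aemeasurable]
      rw [(hmp i).map_eq]
      exact (hcr i).aestronglyMeasurable
    simp only [e]
    rw [← integral_finsetSum _ fun i _ => hci i, ← integral_add
      (integrable_finsetSum Finset.univ fun i _ => hci i) (hsp (M + 1)).1]
    refine integral_congr_ae (.of_forall fun z => ?_)
    refine (wickAt_creatFun hv (bag z.1) z.2).trans ?_
    rw [wickAt_created]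

end Pull

end

section
section Pull

variable {ω : Photon → ℝ} {B θ c : ℝ} {v : Kernels} {S : Set Photon}

lemma hasSum_setIntegral {F : ℕ × ℕ → Photon → ℂ} {g : Photon → ℝ} {r : ℝ} (h0 : 0 ≤ r)
    (h1 : r ≤ 1 / 2) (hF : ∀ m, IntegrableOn (F m) S photonMeasure)
    (hg : IntegrableOn g S photonMeasure)
    (hb : ∀ m, ∀ᵐ k ∂photonMeasure.restrict S, ‖F m k‖ ≤ g k * r ^ (m.1 + m.2)) :
    IntegrableOn (fun k => ∑' m, F m k) S photonMeasure ∧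
      HasSum (fun m => ∫ k in S, F m k ∂photonMeasure) (∫ k in S, ∑' m, F m k ∂photonMeasure) := by
  obtain ⟨hs, hs4⟩ := summable_geometric_pair h0 h1
  constructor
  · refine (hg.mul_const 4).mono'
      (AEMeasurable.tsum fun m => (hF m).aestronglyMeasurable.aemeasurable).aestronglyMeasurable ?_
    filter_upwards [ae_all_iff.2 hb] with k hk
    refine (tsum_of_norm_bounded (hs.mul_left (g k)).hasSum hk).trans ?_
    have h2 : 0 ≤ g k := by
      have := (norm_nonneg _).trans (hk (0, 0))
      simpa using this
    rw [tsum_mul_left]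
    gcongr
  · refine hasSum_integral_of_summable_integral_norm hF ?_
    refine Summable.of_nonneg_of_le (fun m => integral_nonneg fun _ => norm_nonneg _)
      (fun m => ?_) (hs.mul_left (∫ k in S, g k ∂photonMeasure))
    rw [← integral_mul_const]
    exact integral_mono_ae (hF m).norm (hg.mul_const _) (hb m)

theorem pull_smeared (hω : IsWeight ω) (hS : GoodSet c S) (hv : IsKernel B θ v)
    (hθ : θ * kappa ≤ 1 / 4) (φ ψ : FockOne) :
    IntegrableOn (fun k => inner ℂ φ (kop ω (shiftK k.1 v) (ann k ψ)) +
      (ω k : ℂ) * inner ℂ φ (kop ω (contractK k v) ψ)) S photonMeasure ∧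
    inner ℂ (creat S φ) (kop ω v ψ) = ∫ k in S, (inner ℂ φ (kop ω (shiftK k.1 v) (ann k ψ)) +
      (ω k : ℂ) * inner ℂ φ (kop ω (contractK k v) ψ)) ∂photonMeasure := by
  have h0 : 0 ≤ θ * kappa := mul_nonneg hv.nonneg' kappa_nonneg
  have h12 : θ * kappa ≤ 1 / 2 := by linarith
  have h22 : 2 * θ * kappa ≤ 1 / 2 := by linarith
  obtain ⟨i1, s1⟩ := hasSum_setIntegral (S := S)
    (F := fun m k => wick ω (shiftK k.1 v m.1 m.2) (rep φ) (rep (ann k ψ)))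
    (g := fun k => B * ‖φ‖ * ‖ann k ψ‖) h0 h12
    (fun m => (integral_spectator hω hS hv φ ψ m.1 m.2).1) ((integrableOn_norm_ann hS ψ).const_mul _)
    (fun m => Eventually.of_forall fun k => by
      have := norm_wick_kernel_le hω hv.nonneg hv.nonneg' (hv.shift k.1).bound (rep_adm φ)
        (rep_adm (ann k ψ)) m
      rwa [nrm_rep, nrm_rep] at this)
  obtain ⟨i2, s2⟩ := hasSum_setIntegral (S := S)
    (F := fun m k => (ω k : ℂ) * wick ω (contractK k v m.1 m.2) (rep φ) (rep ψ))
    (g := fun _ => (√c)⁻¹ * (θ * B * ‖φ‖ * ‖ψ‖)) (by linarith : 0 ≤ 2 * θ * kappa) h22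
    (fun m => (integral_created hω hS hv φ ψ m.1 m.2).1) (integrableOn_const hS.fin)
    (fun m => by
      filter_upwards [ae_restrict_mem hS.meas] with k hkS
      have := norm_wick_kernel_le hω (hv.contract k).nonneg (hv.contract k).nonneg'
        (hv.contract k).bound (rep_adm φ) (rep_adm ψ) m
      rw [nrm_rep, nrm_rep] at this
      have h2 : ω k ≤ (√c)⁻¹ := by
        refine (hω.le k).trans ?_
        have := Real.sqrt_le_sqrt (hS.le k hkS)
        have := Real.sqrt_pos.2 hS.pos
        gcongr
      rw [norm_mul, norm_real, norm_of_nonneg (hω.nonneg k), mul_assoc]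
      exact mul_le_mul h2 this (norm_nonneg _) (by positivity))
  have e1 : ∀ k, ∑' m : ℕ × ℕ, wick ω (shiftK k.1 v m.1 m.2) (rep φ) (rep (ann k ψ)) =
      inner ℂ φ (kop ω (shiftK k.1 v) (ann k ψ)) := fun k =>
    ((kop_spec hω (hv.shift k.1) h12).1 φ (ann k ψ)).symm
  have e2 : ∀ k, ∑' m : ℕ × ℕ, (ω k : ℂ) * wick ω (contractK k v m.1 m.2) (rep φ) (rep ψ) =
      (ω k : ℂ) * inner ℂ φ (kop ω (contractK k v) ψ) := fun k => by
    rw [tsum_mul_left]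
    congr 1
    exact ((kop_spec hω (hv.contract k) h22).1 φ ψ).symm
  simp only [e1] at i1 s1
  simp only [e2] at i2 s2
  refine ⟨i1.add i2, ?_⟩
  rw [integral_add i1 i2, (kop_spec hω hv h12).1,
    wickSeries_congr hω hv (rep_adm _) (isAdm_creatFun hS (rep_adm φ)) (rep_adm ψ) (rep_adm ψ)
    (rep_creat hS φ) (.of_forall fun _ => rfl), wickSeries]
  have hinj : Function.Injective fun m : ℕ × ℕ => (m.1 + 1, m.2) := by
    rintro ⟨a, b⟩ ⟨a', b'⟩ h
    simp only [Prod.mk.injEq, add_left_inj] at h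
    simp [h.1, h.2]
  let f : ℕ × ℕ → ℂ := fun m => match m with
    | (0, _) => 0
    | (M + 1, N) => ∫ k in S, (ω k : ℂ) * wick ω (contractK k v M N) (rep φ) (rep ψ) ∂photonMeasure
  have s3 : HasSum f (∫ k in S, (ω k : ℂ) * inner ℂ φ (kop ω (contractK k v) ψ) ∂photonMeasure) := by
    refine (hinj.hasSum_iff ?_).1 s2
    rintro ⟨M, N⟩ h
    cases M with
    | zero => rfl
    | succ M => exact absurd ⟨(M, N), rfl⟩ h
  refine HasSum.tsum_eq (hasSum_of_eq (s1.add s3) fun m => ?_)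
  obtain ⟨M, N⟩ := m
  cases M with
  | zero => simp only [f, add_zero]; exact (wick_creat hω hS hv φ ψ N).1
  | succ M => exact (wick_creat hω hS hv φ ψ N).2 M

/-- Sets of photons with momentum bounded away from `0` and `∞`. -/
def shell (n : ℕ) : Set Photon := {k | ((n : ℝ) + 1)⁻¹ ≤ ‖k.1‖ ∧ ‖k.1‖ ≤ n}

lemma measurableSet_shell (n : ℕ) : MeasurableSet (shell n) := by
  have h : Measurable fun k : Photon => ‖k.1‖ := by fun_prop
  exact (measurableSet_le measurable_const h).inter (measurableSet_le h measurable_const)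

lemma photonMeasure_lt_top {R : ℝ} {S : Set Photon} (h : ∀ k ∈ S, ‖k.1‖ ≤ R) :
    photonMeasure S < ⊤ := by
  have h1 : S ⊆ Metric.closedBall (0 : Momentum) R ×ˢ Set.univ := fun k hk => by
    simpa using h k hk
  refine (measure_mono h1).trans_lt ?_
  rw [photonMeasure, Measure.prod_prod]
  refine ENNReal.mul_lt_top measure_closedBall_lt_top ?_
  simp [Measure.count_apply]

lemma goodSet_shell (n : ℕ) {S : Set Photon} (hS : MeasurableSet S) :
    GoodSet ((n : ℝ) + 1)⁻¹ (S ∩ shell n) where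
  pos := by positivity
  meas := hS.inter (measurableSet_shell n)
  le k hk := hk.2.1
  fin := (photonMeasure_lt_top fun _ hk => hk.2.2).ne

lemma ae_mem_shell : ∀ᵐ k ∂photonMeasure, ∃ n, k ∈ shell n := by
  filter_upwards [ae_photon_ne_zero] with k hk
  have h0 : 0 < ‖k.1‖ := norm_pos_iff.2 hk
  obtain ⟨n, hn⟩ := exists_nat_ge (max ‖k.1‖⁻¹ ‖k.1‖)
  refine ⟨n, ?_, (le_max_right _ _).trans hn⟩
  rw [inv_le_comm₀ (by positivity) h0]
  linarith [(le_max_left _ _).trans hn]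

/-- The pull-through formula. -/
theorem ann_kop (hω : IsWeight ω) (hv : IsKernel B θ v) (hθ : θ * kappa ≤ 1 / 4) (ψ : FockOne) :
    ∀ᵐ k ∂photonMeasure, ann k (kop ω v ψ) =
      kop ω (shiftK k.1 v) (ann k ψ) + (ω k : ℂ) • kop ω (contractK k v) ψ := by
  have h1 : ∀ (φ : FockOne) (n : ℕ), ∀ᵐ k ∂photonMeasure.restrict (shell n),
      inner ℂ φ (ann k (kop ω v ψ)) = inner ℂ φ (kop ω (shiftK k.1 v) (ann k ψ)) +
        (ω k : ℂ) * inner ℂ φ (kop ω (contractK k v) ψ) := by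
    intro φ n
    have hg := fun {S : Set Photon} (hS : MeasurableSet S) => goodSet_shell n hS
    have hu := hg MeasurableSet.univ
    rw [Set.univ_inter] at hu
    refine Integrable.ae_eq_of_forall_setIntegral_eq _ _ (integrableOn_inner_ann hu φ _)
      (pull_smeared hω hu hv hθ φ ψ).1 fun S hS _ => ?_
    rw [Measure.restrict_restrict hS, ← (pull_smeared hω (hg hS) hv hθ φ ψ).2,
      inner_creat (hg hS)]
  have h2 : ∀ (φ : FockOne), ∀ᵐ k ∂photonMeasure,
      inner ℂ φ (ann k (kop ω v ψ)) = inner ℂ φ (kop ω (shiftK k.1 v) (ann k ψ)) +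
        (ω k : ℂ) * inner ℂ φ (kop ω (contractK k v) ψ) := by
    intro φ
    have h3 : ∀ n, ∀ᵐ k ∂photonMeasure, k ∈ shell n →
      inner ℂ φ (ann k (kop ω v ψ)) = inner ℂ φ (kop ω (shiftK k.1 v) (ann k ψ)) +
        (ω k : ℂ) * inner ℂ φ (kop ω (contractK k v) ψ) := fun n =>
      (ae_restrict_iff' (measurableSet_shell n)).1 (h1 φ n)
    filter_upwards [ae_all_iff.2 h3, ae_mem_shell] with k hk hk'
    obtain ⟨n, hn⟩ := hk'
    exact hk n hn
  filter_upwards [ae_all_iff.2 fun n => h2 (TopologicalSpace.denseSeq FockOne n)] with k hk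
  have hd : Dense (Set.range (TopologicalSpace.denseSeq FockOne)) :=
    TopologicalSpace.denseRange_denseSeq FockOne
  refine hd.eq_of_inner_right ℂ fun φ hφ => ?_
  obtain ⟨n, rfl⟩ := hφ
  rw [hk n, inner_add_right]
  congr 1
  exact (inner_smul_right (𝕜 := ℂ) (TopologicalSpace.denseSeq FockOne n)
    (kop ω (contractK k v) ψ) (ω k : ℂ)).symm

end Pull

end

section
/-! ### Functions of the field energy -/

/-- Bounded measurable functions on `[0, 1]`. -/
structure EFun (C : ℝ) (f : ℝ → ℂ) : Prop where
  meas : Measurable f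
  bound : ∀ r, 0 ≤ r → r ≤ 1 → ‖f r‖ ≤ C

lemma EFun.adm {C : ℝ} {f : ℝ → ℂ} (hf : EFun C f) {Ψ : Bag → ℂ} (hΨ : IsAdm Ψ) :
    IsAdm fun s => f (mEnergy s) * Ψ s := by
  refine hΨ.of_norm_le (C := C) ((hf.meas.comp measurable_mEnergy).mul hΨ.meas) fun s => ?_
  by_cases h : 1 < mEnergy s
  · rw [hΨ.supp s h]; simp
  · rw [norm_mul]
    gcongr
    exact hf.bound _ (mEnergy_nonneg s) (not_lt.1 h)

lemma rep_supp (ψ : FockOne) (s : Bag) (h : 1 < mEnergy s) : rep ψ s = 0 :=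
  (rep_adm ψ).supp s h

theorem norm_le_of_rep {φ ψ : FockOne} {C : ℝ} (hC : 0 ≤ C)
    (h : ∀ᵐ x ∂fockMeasure, ‖rep φ (bag x)‖ ≤ C * ‖rep ψ (bag x)‖) :
    ‖φ‖ ≤ C * ‖ψ‖ := by
  have h1 : ‖φ‖ₑ ^ 2 ≤ (ofReal C * ‖ψ‖ₑ) ^ 2 := by
    rw [mul_pow, enorm_sq_eq, enorm_sq_eq ψ, ← lintegral_const_mul _
      ((rep_adm ψ).meas.enorm.pow_const 2)]
    refine lintegral_mono_ae ?_
    filter_upwards [h] with x hx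
    rw [← mul_pow, ← ofReal_norm, ← ofReal_norm, ← ENNReal.ofReal_mul hC]
    gcongr
  have h2 : ‖φ‖ₑ ≤ ofReal C * ‖ψ‖ₑ := (ENNReal.pow_right_strictMono two_ne_zero).le_iff_le.1 h1
  rw [← ofReal_norm, ← ofReal_norm, ← ENNReal.ofReal_mul hC] at h2
  exact (ENNReal.ofReal_le_ofReal_iff (by positivity)).1 h2

lemma integral_fock_eq_config {φ ψ : FockOne} (f : Config → ℂ) :
    ∫ x, conj (rep φ (bag x)) * f x * rep ψ (bag x) ∂fockMeasure =
      ∫ x, conj (wave φ x) * f x * wave ψ x ∂configMeasure := by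
  rw [fockMeasure, integral_withDensity_eq_integral_smul measurable_sectorDensity]
  refine integral_congr_ae ?_
  filter_upwards [ae_fockMeasure.1 (rep_ae φ), ae_fockMeasure.1 (rep_ae ψ)] with x a b
  rw [a, b, NNReal.smul_def, sectorDensity_eq]
  have : (sqrtFact x : ℂ) ≠ 0 := by exact_mod_cast (sqrtFact_pos x).ne'
  simp only [map_mul, conj_ofReal, Complex.real_smul]
  push_cast
  field_simp

theorem energyOp_spec {C : ℝ} {f : ℝ → ℂ} (hf : EFun C f) :
    (∀ ψ, ∀ᵐ x ∂fockMeasure, rep (energyOp f ψ) (bag x) =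
      f (mEnergy (bag x)) * rep ψ (bag x)) ∧ ‖energyOp f‖ ≤ C := by
  have hC : 0 ≤ C := (norm_nonneg _).trans (hf.bound 0 le_rfl zero_le_one)
  have hr := fun ψ : FockOne => rep_ofFun (hf.adm (rep_adm ψ))
  let L : FockOne →ₗ[ℂ] FockOne :=
    { toFun := fun ψ => ofFun fun s => f (mEnergy s) * rep ψ s
      map_add' := fun φ ψ => by
        refine rep_ext ?_
        filter_upwards [hr φ, hr ψ, hr (φ + ψ), rep_add φ ψ, rep_add (ofFun fun s =>
          f (mEnergy s) * rep φ s) (ofFun fun s => f (mEnergy s) * rep ψ s)] with x a b c d e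
        rw [c, d, e, a, b, mul_add]
      map_smul' := fun z ψ => by
        refine rep_ext ?_
        filter_upwards [hr ψ, hr (z • ψ), rep_smul z ψ, rep_smul z (ofFun fun s =>
          f (mEnergy s) * rep ψ s)] with x b c d e
        rw [RingHom.id_apply, c, d, e, b]; ring }
  have hL : ∀ ψ, ‖L ψ‖ ≤ C * ‖ψ‖ := fun ψ => norm_le_of_rep hC (by
    filter_upwards [hr ψ] with x a
    have : ‖rep (L ψ) (bag x)‖ = ‖f (mEnergy (bag x)) * rep ψ (bag x)‖ :=
      congrArg norm a
    rw [this]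
    by_cases h : 1 < mEnergy (bag x)
    · rw [rep_supp ψ _ h]; simp
    · rw [norm_mul]
      gcongr
      exact hf.bound _ (mEnergy_nonneg _) (not_lt.1 h))
  have he : energyOp f = L.mkContinuous C hL := by
    refine opOfForm_eq fun φ ψ => ?_
    rw [inner_eq]
    simp only [← mEnergy_bag]
    rw [← integral_fock_eq_config]
    refine integral_congr_ae ?_
    filter_upwards [hr ψ] with x a
    have : rep (L.mkContinuous C hL ψ) (bag x) =
      f (mEnergy (bag x)) * rep ψ (bag x) := a
    rw [this]; ring
  rw [he]
  exact ⟨hr, L.mkContinuous_norm_le hC hL⟩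

lemma energyOp_mul {C C' C'' : ℝ} {f g h : ℝ → ℂ} (hf : EFun C f) (hg : EFun C' g)
    (hh : EFun C'' h) (e : ∀ r, 0 ≤ r → r ≤ 1 → f r * g r = h r) :
    energyOp f * energyOp g = energyOp h := by
  ext1 ψ
  refine rep_ext ?_
  filter_upwards [(energyOp_spec hf).1 (energyOp g ψ), (energyOp_spec hg).1 ψ,
    (energyOp_spec hh).1 ψ] with x a b c
  have : (energyOp f * energyOp g) ψ = energyOp f (energyOp g ψ) := rfl
  rw [this, a, b, c]
  by_cases h1 : 1 < mEnergy (bag x)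
  · rw [rep_supp ψ _ h1]; simp
  · rw [← e _ (mEnergy_nonneg _) (not_lt.1 h1), mul_assoc]

lemma energyOp_add {C C' C'' : ℝ} {f g h : ℝ → ℂ} (hf : EFun C f) (hg : EFun C' g)
    (hh : EFun C'' h) (e : ∀ r, 0 ≤ r → r ≤ 1 → f r + g r = h r) :
    energyOp f + energyOp g = energyOp h := by
  ext1 ψ
  refine rep_ext ?_
  filter_upwards [(energyOp_spec hf).1 ψ, (energyOp_spec hg).1 ψ,
    (energyOp_spec hh).1 ψ, rep_add (energyOp f ψ) (energyOp g ψ)] with x a b c d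
  have : (energyOp f + energyOp g) ψ = energyOp f ψ + energyOp g ψ := rfl
  rw [this, d, a, b, c]
  by_cases h1 : 1 < mEnergy (bag x)
  · rw [rep_supp ψ _ h1]; simp
  · rw [← e _ (mEnergy_nonneg _) (not_lt.1 h1), add_mul]

lemma efun_one : EFun 1 fun _ => 1 := ⟨measurable_const, fun _ _ _ => by simp⟩

lemma energyOp_one : energyOp (fun _ => 1) = 1 := by
  ext1 ψ
  refine rep_ext ?_
  filter_upwards [(energyOp_spec efun_one).1 ψ] with x a
  rw [a, one_mul]; rfl

lemma EFun.conj {C : ℝ} {f : ℝ → ℂ} (hf : EFun C f) : EFun C fun r => conj (f r) :=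
  ⟨continuous_conj.measurable.comp hf.meas, fun r h0 h1 => by
    rw [RCLike.norm_conj]; exact hf.bound r h0 h1⟩

lemma adjoint_energyOp {C : ℝ} {f : ℝ → ℂ} (hf : EFun C f) :
    adj (energyOp f) = energyOp fun r => conj (f r) := by
  ext1 ψ
  refine ext_inner_left ℂ fun φ => ?_
  rw [ContinuousLinearMap.adjoint_inner_right, inner_eq, inner_eq]
  refine integral_congr_ae ?_
  filter_upwards [(energyOp_spec hf).1 φ, (energyOp_spec hf.conj).1 ψ] with x a b
  rw [a, b, map_mul]
  ring

/-- Translation of a function of the energy, with the restriction to the spectrum. -/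
def shiftE (a : ℝ) (f : ℝ → ℂ) (r : ℝ) : ℂ := if a + r ≤ 1 then f (a + r) else 0

lemma EFun.shift {C : ℝ} {f : ℝ → ℂ} (hf : EFun C f) {a : ℝ} (ha : 0 ≤ a) :
    EFun C (shiftE a f) where
  meas := Measurable.ite (measurableSet_le (by fun_prop) measurable_const)
    (hf.meas.comp (by fun_prop)) measurable_const
  bound r h0 h1 := by
    have hC : 0 ≤ C := (norm_nonneg _).trans (hf.bound 0 le_rfl zero_le_one)
    rw [shiftE]
    split_ifs with h
    · exact hf.bound _ (by linarith) h
    · simpa using hC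

theorem ann_energyOp {C : ℝ} {f : ℝ → ℂ} (hf : EFun C f) (ψ : FockOne) :
    ∀ᵐ k ∂photonMeasure, ann k (energyOp f ψ) = energyOp (shiftE ‖k.1‖ f) (ann k ψ) := by
  filter_upwards [rep_ann ψ, rep_ann (energyOp f ψ), ae_consConfig ((energyOp_spec hf).1 ψ)]
    with k a b c
  refine rep_ext ?_
  filter_upwards [a, b, c, (energyOp_spec (hf.shift (norm_nonneg k.1))).1 (ann k ψ)] with x a b c d
  rw [bag_consConfig] at c
  rw [b, c, d, a, mEnergy_cons, shiftE]
  split_ifs with h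
  · rfl
  · rw [rep_supp ψ _ (by rw [mEnergy_cons]; exact not_le.1 h)]; simp

theorem tendsto_energyOp {ι : Type*} {l : Filter ι} [l.IsCountablyGenerated] {C : ℝ}
    {F : ι → ℝ → ℂ} {f : ℝ → ℂ} (hF : ∀ i, EFun C (F i)) (hf : EFun C f) (ψ : FockOne)
    (h : ∀ᵐ x ∂fockMeasure, mEnergy (bag x) ≤ 1 →
      Tendsto (fun i => F i (mEnergy (bag x))) l (𝓝 (f (mEnergy (bag x))))) :
    Tendsto (fun i => energyOp (F i) ψ) l (𝓝 (energyOp f ψ)) := by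
  have hC : 0 ≤ C := (norm_nonneg _).trans (hf.bound 0 le_rfl zero_le_one)
  have hm := fun i => (((hF i).meas.sub hf.meas).comp measurable_mEnergy)
  have h1 : Tendsto (fun i => ∫⁻ x, ‖(F i (mEnergy (bag x)) - f (mEnergy (bag x))) *
      rep ψ (bag x)‖ₑ ^ 2 ∂fockMeasure) l (𝓝 (∫⁻ _, 0 ∂fockMeasure)) := by
    refine tendsto_lintegral_filter_of_dominated_convergence
      (fun x => ofReal (2 * C) ^ 2 * ‖rep ψ (bag x)‖ₑ ^ 2)
      (.of_forall fun i => ((hm i).mul (rep_adm ψ).meas).enorm.pow_const 2)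
      (.of_forall fun i => Eventually.of_forall fun x => ?_) ?_ ?_
    · rw [← mul_pow]
      gcongr
      by_cases h1 : 1 < mEnergy (bag x)
      · rw [rep_supp ψ _ h1]; simp
      · rw [enorm_mul]
        gcongr
        rw [← ofReal_norm]
        refine ENNReal.ofReal_le_ofReal ((norm_sub_le _ _).trans ?_)
        linarith [(hF i).bound _ (mEnergy_nonneg (bag x)) (not_lt.1 h1),
          hf.bound _ (mEnergy_nonneg (bag x)) (not_lt.1 h1)]
    · rw [lintegral_const_mul _ ((rep_adm ψ).meas.enorm.pow_const 2)]
      have := (rep_adm ψ).sq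
      finiteness
    · filter_upwards [h] with x hx
      by_cases h1 : 1 < mEnergy (bag x)
      · rw [rep_supp ψ _ h1]; simpa using tendsto_const_nhds
      · have h2 := (((hx (not_lt.1 h1)).sub_const (f (mEnergy (bag x)))).mul_const
          (rep ψ (bag x))).enorm
        have h3 := ((ENNReal.continuous_pow 2).tendsto _).comp h2
        simpa [Function.comp_def] using h3
  rw [lintegral_zero] at h1
  have h2 : ∀ i, ∫⁻ x, ‖(F i (mEnergy (bag x)) - f (mEnergy (bag x))) *
      rep ψ (bag x)‖ₑ ^ 2 ∂fockMeasure = ofReal (‖energyOp (F i) ψ - energyOp f ψ‖ ^ 2) := by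
    intro i
    rw [ENNReal.ofReal_pow (norm_nonneg _), ofReal_norm, enorm_sq_eq]
    refine lintegral_congr_ae ?_
    have e : energyOp (F i) ψ - energyOp f ψ = energyOp (F i) ψ + (-1 : ℂ) • energyOp f ψ := by
      rw [neg_one_smul, sub_eq_add_neg]
    filter_upwards [(energyOp_spec (hF i)).1 ψ, (energyOp_spec hf).1 ψ,
      rep_add (energyOp (F i) ψ) ((-1 : ℂ) • energyOp f ψ), rep_smul (-1) (energyOp f ψ)]
      with x a b c d
    rw [e, c, d, a, b]
    congr 2
    ring
  simp only [h2] at h1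
  have h3 := (ENNReal.tendsto_toReal ENNReal.zero_ne_top).comp h1
  simp only [Function.comp_def, ENNReal.toReal_zero] at h3
  rw [tendsto_iff_norm_sub_tendsto_zero]
  have h4 := h3.sqrt
  simp only [Real.sqrt_zero] at h4
  refine h4.congr fun i => ?_
  rw [ENNReal.toReal_ofReal (by positivity), Real.sqrt_sq (norm_nonneg _)]

lemma energy_ne {c : ℝ} (hc : 0 < c) : ∀ᵐ x ∂fockMeasure, mEnergy (bag x) ≠ c := by
  rw [ae_fockMeasure_iff]
  intro n
  cases n with
  | zero =>
    refine Eventually.of_forall fun q => ?_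
    rw [mEnergy_bag]
    simp only [energy, Finset.univ_eq_empty, Finset.sum_empty]
    exact hc.ne
  | succ n =>
    have h1 : ∀ᵐ p ∂photonMeasure.prod (photonMeasureN n), ‖p.1.1‖ + mEnergy (tupleBag p.2) ≠ c := by
      have hm : MeasurableSet {p : Photon × Tuple n |
          ‖p.1.1‖ + mEnergy (tupleBag p.2) = c} :=
        measurableSet_eq_fun (Measurable.add (by fun_prop)
          ((measurable_mEnergy.comp (measurable_inSector n)).comp measurable_snd)) measurable_const
      have hz : photonMeasure.prod (photonMeasureN n) {p : Photon × Tuple n |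
          ‖p.1.1‖ + mEnergy (tupleBag p.2) = c} = 0 := by
        rw [Measure.prod_apply_symm hm, lintegral_eq_zero_of_ae_eq_zero]
        refine Eventually.of_forall fun q => ?_
        have : (fun k : Photon => (k, q)) ⁻¹' {p : Photon × Tuple n |
            ‖p.1.1‖ + mEnergy (tupleBag p.2) = c} ⊆
            Metric.sphere (0 : Momentum) (c - mEnergy (tupleBag q)) ×ˢ Set.univ := by
          intro k hk
          have : ‖k.1‖ + mEnergy (tupleBag q) = c := hk
          simp only [Set.mem_prod, mem_sphere_iff_norm, sub_zero, Set.mem_univ, and_true]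
          linarith
        refine measure_mono_null this ?_
        rw [photonMeasure, Measure.prod_prod, Measure.addHaar_sphere, zero_mul]
      rw [ae_iff]
      simpa using hz
    have h2 := (measurePreserving_removeNth (n := n) 0).quasiMeasurePreserving.ae h1
    filter_upwards [h2] with q hq
    change mEnergy (tupleBag q) ≠ c
    rw [bag_removeNth 0 q, mEnergy_cons]
    exact hq

/-! ### Spectral projections -/

lemma efun_indicator (b : ℝ) : EFun 1 (fun r => if r ≤ b then 1 else 0) :=
  ⟨Measurable.ite (measurableSet_le measurable_id measurable_const) measurable_const
    measurable_const, fun r _ _ => by split_ifs <;> simp⟩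

/-- The spectral projection `1[H_f ≤ b]`. -/
def eproj (b : ℝ) : Op := energyOp fun r => if r ≤ b then 1 else 0

lemma rep_eproj (b : ℝ) (ψ : FockOne) : ∀ᵐ x ∂fockMeasure, rep (eproj b ψ) (bag x) =
    (if mEnergy (bag x) ≤ b then 1 else 0) * rep ψ (bag x) :=
  (energyOp_spec (efun_indicator b)).1 ψ

lemma energyLE_iff {b : ℝ} {ψ : FockOne} : EnergyLE b ψ ↔ eproj b ψ = ψ := by
  constructor
  · intro h
    refine rep_ext ?_
    filter_upwards [h, rep_eproj b ψ] with x hx hx'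
    rw [hx']
    split_ifs with h1
    · rw [one_mul]
    · rw [hx (not_le.1 h1), mul_zero]
  · intro h
    filter_upwards [rep_eproj b ψ] with x hx hb
    rw [h, if_neg (not_le.2 hb), zero_mul] at hx
    exact hx

lemma eproj_mul_eproj (b : ℝ) : eproj b * eproj b = eproj b :=
  energyOp_mul (efun_indicator b) (efun_indicator b) (efun_indicator b) fun r _ _ => by
    split_ifs <;> simp

lemma energyLE_eproj (b : ℝ) (ψ : FockOne) : EnergyLE b (eproj b ψ) := by
  rw [energyLE_iff]
  exact congrArg (fun A : Op => A ψ) (eproj_mul_eproj b)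

lemma adjoint_eproj (b : ℝ) : adj (eproj b) = eproj b := by
  rw [eproj, adjoint_energyOp (efun_indicator b)]
  congr 1
  funext r
  split_ifs <;> simp

lemma norm_eproj_le (b : ℝ) : ‖eproj b‖ ≤ 1 := (energyOp_spec (efun_indicator b)).2

lemma EnergyLE.mono {b b' : ℝ} {ψ : FockOne} (h : EnergyLE b ψ) (hb : b ≤ b') : EnergyLE b' ψ := by
  filter_upwards [h] with x hx hlt
  exact hx (hb.trans_lt hlt)

lemma EnergyLE.sub {b : ℝ} {φ ψ : FockOne} (h : EnergyLE b φ) (h' : EnergyLE b ψ) :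
    EnergyLE b (φ - ψ) := by
  rw [energyLE_iff] at *
  rw [map_sub, h, h']

lemma EnergyLE.add {b : ℝ} {φ ψ : FockOne} (h : EnergyLE b φ) (h' : EnergyLE b ψ) :
    EnergyLE b (φ + ψ) := by
  rw [energyLE_iff] at *
  rw [map_add, h, h']

lemma EnergyLE.smul {b : ℝ} {ψ : FockOne} (h : EnergyLE b ψ) (z : ℂ) : EnergyLE b (z • ψ) := by
  rw [energyLE_iff] at *
  rw [map_smul, h]

lemma energyLE_ann (ψ : FockOne) : ∀ᵐ k ∂photonMeasure, EnergyLE (1 - ‖k.1‖) (ann k ψ) := by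
  filter_upwards [rep_ann ψ] with k hk
  filter_upwards [hk] with x hx h
  rw [hx, rep_supp]
  rw [mEnergy_cons]; linarith

lemma energyLE_energyOp_shift {C a : ℝ} {f : ℝ → ℂ} (hf : EFun C f) (ha : 0 ≤ a) (ψ : FockOne) :
    EnergyLE (1 - a) (energyOp (shiftE a f) ψ) := by
  filter_upwards [(energyOp_spec (hf.shift ha)).1 ψ] with x hx h
  rw [hx, shiftE, if_neg (by linarith), zero_mul]

lemma energyOp_shift_eproj {C a : ℝ} {f : ℝ → ℂ} (hf : EFun C f) (ha : 0 ≤ a) :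
    energyOp (shiftE a f) * eproj (1 - a) = energyOp (shiftE a f) ∧
      eproj (1 - a) * energyOp (shiftE a f) = energyOp (shiftE a f) := by
  constructor
  · refine energyOp_mul (hf.shift ha) (efun_indicator _) (hf.shift ha) fun r _ _ => ?_
    simp only [shiftE]
    split_ifs with h1 h2 <;> first | (exfalso; linarith) | simp
  · refine energyOp_mul (efun_indicator _) (hf.shift ha) (hf.shift ha) fun r _ _ => ?_
    simp only [shiftE]
    split_ifs with h1 h2 <;> first | (exfalso; linarith) | simp

lemma tendsto_eproj (ψ : FockOne) : Tendsto (fun a : ℝ => eproj (1 - a) ψ) (𝓝 0) (𝓝 ψ) := by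
  have h := tendsto_energyOp (l := 𝓝 (0 : ℝ)) (fun a : ℝ => efun_indicator (1 - a)) efun_one ψ (by
    filter_upwards [energy_ne one_pos] with x hx h1
    refine tendsto_const_nhds.congr' ?_
    have h2 : mEnergy (bag x) < 1 := lt_of_le_of_ne h1 hx
    have h3 : ∀ᶠ a : ℝ in 𝓝 0, a < 1 - mEnergy (bag x) :=
      eventually_lt_nhds (by linarith)
    filter_upwards [h3] with a ha
    rw [if_pos (by linarith)])
  rwa [energyOp_one] at h

end

section
/-! ### Creation of a nearly monochromatic photon -/

lemma creat_add {c : ℝ} {S : Set Photon} (hS : GoodSet c S) (φ ψ : FockOne) :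
    creat S (φ + ψ) = creat S φ + creat S ψ := by
  refine ext_inner_right ℂ fun χ => ?_
  rw [inner_add_left, inner_creat hS, inner_creat hS, inner_creat hS,
    ← integral_add (integrableOn_inner_ann hS φ χ) (integrableOn_inner_ann hS ψ χ)]
  exact integral_congr_ae (.of_forall fun k => inner_add_left _ _ _)

lemma inner_smul_l (φ ψ : FockOne) (z : ℂ) : inner ℂ (z • φ) ψ = conj z * inner ℂ φ ψ :=
  inner_smul_left φ ψ z

lemma inner_smul_r (φ ψ : FockOne) (z : ℂ) : inner ℂ φ (z • ψ) = z * inner ℂ φ ψ :=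
  inner_smul_right φ ψ z

lemma creat_smul {c : ℝ} {S : Set Photon} (hS : GoodSet c S) (z : ℂ) (ψ : FockOne) :
    creat S (z • ψ) = z • creat S ψ := by
  refine ext_inner_right ℂ fun χ => ?_
  rw [inner_smul_l, inner_creat hS, inner_creat hS, ← integral_const_mul]
  exact integral_congr_ae (.of_forall fun k => inner_smul_l _ _ _)

/-- The relative radius of the momentum windows. -/
def winRad (j : ℕ) : ℝ := 1 / (j + 4)

lemma winRad_pos (j : ℕ) : 0 < winRad j := by unfold winRad; positivity

lemma winRad_le (j : ℕ) : winRad j ≤ 1 / 4 := by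
  unfold winRad
  gcongr
  linarith [(Nat.cast_nonneg j : (0 : ℝ) ≤ j)]

lemma tendsto_winRad : Tendsto winRad atTop (𝓝 0) := by
  have h : Tendsto (fun j : ℕ => ((j : ℝ) + 4)) atTop atTop :=
    tendsto_atTop_add_const_right _ _ tendsto_natCast_atTop_atTop
  exact h.inv_tendsto_atTop.congr fun j => by simp [winRad]

/-- A small momentum window next to `k`, contained in `{|q| ≤ |k|}`. -/
def window (k : Photon) (j : ℕ) : Set Photon :=
  Metric.closedBall ((1 - winRad j) • k.1) (winRad j * ‖k.1‖) ×ˢ {k.2}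

section Window

variable {k : Photon}

lemma window_bounds (k : Photon) (j : ℕ) {q : Photon} (hq : q ∈ window k j) :
    ‖q.1‖ ≤ ‖k.1‖ ∧ ‖k.1‖ / 2 ≤ ‖q.1‖ ∧ ‖q.1 - k.1‖ ≤ 2 * winRad j * ‖k.1‖ := by
  have h := hq.1
  rw [mem_closedBall_iff_norm] at h
  have h0 := winRad_pos j
  have h1 := winRad_le j
  have e : ‖(1 - winRad j) • k.1‖ = (1 - winRad j) * ‖k.1‖ := by
    rw [norm_smul, norm_of_nonneg (by linarith)]
  have hk := norm_nonneg k.1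
  refine ⟨?_, ?_, ?_⟩
  · calc ‖q.1‖ = ‖(q.1 - (1 - winRad j) • k.1) + (1 - winRad j) • k.1‖ := by rw [sub_add_cancel]
      _ ≤ _ := norm_add_le _ _
      _ ≤ ‖k.1‖ := by rw [e]; linarith
  · have : ‖(1 - winRad j) • k.1‖ ≤ ‖q.1‖ + ‖q.1 - (1 - winRad j) • k.1‖ := by
      rw [norm_sub_rev]
      calc _ = ‖q.1 + ((1 - winRad j) • k.1 - q.1)‖ := by rw [add_sub_cancel]
        _ ≤ _ := norm_add_le _ _
    rw [e] at this
    nlinarith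
  · calc ‖q.1 - k.1‖ = ‖(q.1 - (1 - winRad j) • k.1) - winRad j • k.1‖ := by
          congr 1; rw [sub_smul, one_smul]; abel
      _ ≤ _ := norm_sub_le _ _
      _ ≤ _ := by rw [norm_smul, norm_of_nonneg h0.le]; linarith

lemma photonMeasure_window (k : Photon) (j : ℕ) : photonMeasure (window k j) =
    volume (Metric.closedBall ((1 - winRad j) • k.1) (winRad j * ‖k.1‖)) := by
  rw [window, photonMeasure, Measure.prod_prod, Measure.count_singleton, mul_one]

lemma goodSet_window (hk : k.1 ≠ 0) (j : ℕ) : GoodSet (‖k.1‖ / 2) (window k j) where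
  pos := by have := norm_pos_iff.2 hk; positivity
  meas := Metric.isClosed_closedBall.measurableSet.prod (measurableSet_singleton _)
  le q hq := (window_bounds k j hq).2.1
  fin := by rw [photonMeasure_window]; exact measure_closedBall_lt_top.ne

/-- The volume of a momentum window. -/
def winVol (k : Photon) (j : ℕ) : ℝ := (photonMeasure (window k j)).toReal

lemma winVol_pos (hk : k.1 ≠ 0) (j : ℕ) : 0 < winVol k j := by
  refine ENNReal.toReal_pos ?_ (goodSet_window hk j).fin
  rw [photonMeasure_window]
  exact (Metric.measure_closedBall_pos _ _ (mul_pos (winRad_pos j) (norm_pos_iff.2 hk))).ne'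

lemma tendsto_photonMeasure_window (k : Photon) :
    Tendsto (fun j => photonMeasure (window k j)) atTop (𝓝 0) := by
  simp only [photonMeasure_window]
  have e : ∀ j, volume (Metric.closedBall ((1 - winRad j) • k.1) (winRad j * ‖k.1‖)) =
      ofReal ((winRad j * ‖k.1‖) ^ 3) * volume (Metric.ball (0 : Momentum) 1) := fun j => by
    rw [Measure.addHaar_closedBall _ _ (mul_nonneg (winRad_pos j).le (norm_nonneg _))]
    simp
  simp only [e]
  have h1 : Tendsto (fun j => ofReal ((winRad j * ‖k.1‖) ^ 3)) atTop (𝓝 0) := by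
    have := ENNReal.tendsto_ofReal ((tendsto_winRad.mul_const ‖k.1‖).pow 3)
    simpa using this
  have := ENNReal.Tendsto.mul_const (b := volume (Metric.ball (0 : Momentum) 1)) h1
    (Or.inr measure_ball_lt_top.ne)
  simpa using this

lemma tendsto_winVol (k : Photon) : Tendsto (winVol k) atTop (𝓝 0) := by
  have := (ENNReal.tendsto_toReal ENNReal.zero_ne_top).comp (tendsto_photonMeasure_window k)
  rw [ENNReal.toReal_zero] at this
  exact this

/-- Creation of a photon with momentum close to `k`, normalized. -/
def addPhoton (k : Photon) (j : ℕ) (ψ : FockOne) : FockOne :=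
  (((√(winVol k j))⁻¹ : ℝ) : ℂ) • creat (window k j) ψ

lemma addPhoton_add (hk : k.1 ≠ 0) (j : ℕ) (φ ψ : FockOne) :
    addPhoton k j (φ + ψ) = addPhoton k j φ + addPhoton k j ψ := by
  rw [addPhoton, creat_add (goodSet_window hk j), smul_add]; rfl

lemma addPhoton_smul (hk : k.1 ≠ 0) (j : ℕ) (z : ℂ) (ψ : FockOne) :
    addPhoton k j (z • ψ) = z • addPhoton k j ψ := by
  rw [addPhoton, creat_smul (goodSet_window hk j), smul_comm]; rfl

lemma addPhoton_sub (hk : k.1 ≠ 0) (j : ℕ) (φ ψ : FockOne) :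
    addPhoton k j (φ - ψ) = addPhoton k j φ - addPhoton k j ψ := by
  rw [sub_eq_add_neg, sub_eq_add_neg, addPhoton_add hk, ← neg_one_smul ℂ ψ, addPhoton_smul hk,
    neg_one_smul]

lemma norm_addPhoton_sq (k : Photon) (j : ℕ) (ψ : FockOne) :
    ‖addPhoton k j ψ‖ ^ 2 = (winVol k j)⁻¹ * ‖creat (window k j) ψ‖ ^ 2 := by
  rw [addPhoton, norm_smul, mul_pow, norm_real, norm_inv, inv_pow,
    norm_of_nonneg (Real.sqrt_nonneg _),
    Real.sq_sqrt (show 0 ≤ winVol k j from ENNReal.toReal_nonneg)]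

lemma tendsto_norm_addPhoton (hk : k.1 ≠ 0) {ψ : FockOne} (hψ : EnergyLE (1 - ‖k.1‖) ψ) :
    Tendsto (fun j => ‖addPhoton k j ψ‖) atTop (𝓝 ‖ψ‖) := by
  have h1 : ∀ j, |‖addPhoton k j ψ‖ ^ 2 - ‖ψ‖ ^ 2| ≤
      ∫ q in window k j, ‖ann q ψ‖ ^ 2 ∂photonMeasure := by
    intro j
    have h2 := abs_norm_creat_sq_sub_le (goodSet_window hk j)
      (fun q hq => (window_bounds k j hq).1) hψ
    have hv := winVol_pos hk j
    rw [norm_addPhoton_sq]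
    have e : (winVol k j)⁻¹ * ‖creat (window k j) ψ‖ ^ 2 - ‖ψ‖ ^ 2 =
        (winVol k j)⁻¹ * (‖creat (window k j) ψ‖ ^ 2 - winVol k j * ‖ψ‖ ^ 2) := by
      field_simp
    rw [e, abs_mul, abs_of_nonneg (inv_nonneg.2 hv.le), inv_mul_le_iff₀ hv]
    exact h2
  have hW : GoodSet (‖k.1‖ / 2) {q : Photon | ‖k.1‖ / 2 ≤ ‖q.1‖ ∧ ‖q.1‖ ≤ ‖k.1‖} := by
    have hm : Measurable fun q : Photon => ‖q.1‖ := by fun_prop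
    exact ⟨by have := norm_pos_iff.2 hk; positivity,
      (measurableSet_le measurable_const hm).inter (measurableSet_le hm measurable_const),
      fun q hq => hq.1, (photonMeasure_lt_top fun q hq => hq.2).ne⟩
  have h3 : Tendsto (fun j => ∫ q in window k j, ‖ann q ψ‖ ^ 2 ∂photonMeasure) atTop (𝓝 0) := by
    have hi := integrableOn_norm_ann_sq hW ψ
    have h4 : Tendsto (fun j => (photonMeasure.restrict
        {q : Photon | ‖k.1‖ / 2 ≤ ‖q.1‖ ∧ ‖q.1‖ ≤ ‖k.1‖}) (window k j)) atTop (𝓝 0) :=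
      tendsto_of_tendsto_of_tendsto_of_le_of_le tendsto_const_nhds
        (tendsto_photonMeasure_window k) (fun _ => bot_le)
        fun j => Measure.restrict_apply_le _ _
    have h5 := hi.tendsto_setIntegral_nhds_zero h4
    refine h5.congr fun j => ?_
    rw [Measure.restrict_restrict (goodSet_window hk j).meas, Set.inter_eq_left.2]
    intro q hq
    exact ⟨(window_bounds k j hq).2.1, (window_bounds k j hq).1⟩
  have h4 : Tendsto (fun j => ‖addPhoton k j ψ‖ ^ 2) atTop (𝓝 (‖ψ‖ ^ 2)) := by
    rw [tendsto_iff_norm_sub_tendsto_zero]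
    exact squeeze_zero (fun _ => norm_nonneg _) h1 h3
  have h5 := h4.sqrt
  simpa only [Real.sqrt_sq (norm_nonneg _)] using h5

/-! ### Shifted operators as limits -/

/-- `A' = "A` in the presence of an additional photon `k"`. -/
structure ShiftOf (A : Op) (k : Photon) (A' : Op) : Prop where
  pres : ∀ ψ, EnergyLE (1 - ‖k.1‖) ψ → EnergyLE (1 - ‖k.1‖) (A' ψ)
  lim : ∀ ψ, EnergyLE (1 - ‖k.1‖) ψ →
    Tendsto (fun j => A (addPhoton k j ψ) - addPhoton k j (A' ψ)) atTop (𝓝 0)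

lemma ShiftOf.add (hk : k.1 ≠ 0) {A B A' B' : Op} (hA : ShiftOf A k A') (hB : ShiftOf B k B') :
    ShiftOf (A + B) k (A' + B') where
  pres ψ h := (hA.pres ψ h).add (hB.pres ψ h)
  lim ψ h := by
    have := (hA.lim ψ h).add (hB.lim ψ h)
    rw [add_zero] at this
    refine this.congr fun j => ?_
    have e : (A' + B') ψ = A' ψ + B' ψ := rfl
    rw [e, addPhoton_add hk]
    have e : (A + B) (addPhoton k j ψ) = A (addPhoton k j ψ) + B (addPhoton k j ψ) := rfl
    rw [e]; abel

lemma ShiftOf.smul (hk : k.1 ≠ 0) {A A' : Op} (hA : ShiftOf A k A') (z : ℂ) :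
    ShiftOf (z • A) k (z • A') where
  pres ψ h := (hA.pres ψ h).smul z
  lim ψ h := by
    have := (hA.lim ψ h).const_smul z
    rw [smul_zero] at this
    refine this.congr fun j => ?_
    have e : (z • A') ψ = z • A' ψ := rfl
    rw [e, addPhoton_smul hk, smul_sub]
    rfl

lemma ShiftOf.mul {A B A' B' : Op} (hA : ShiftOf A k A') (hB : ShiftOf B k B') :
    ShiftOf (A * B) k (A' * B') where
  pres ψ h := hA.pres _ (hB.pres ψ h)
  lim ψ h := by
    have h1 := (A.continuous.tendsto 0).comp (hB.lim ψ h)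
    rw [map_zero] at h1
    have := h1.add (hA.lim (B' ψ) (hB.pres ψ h))
    rw [add_zero] at this
    refine this.congr fun j => ?_
    have e : (A * B) (addPhoton k j ψ) = A (B (addPhoton k j ψ)) := rfl
    have e' : (A' * B') ψ = A' (B' ψ) := rfl
    rw [e, e', Function.comp_apply, map_sub]
    abel

lemma ShiftOf.norm_le (hk : k.1 ≠ 0) {A A' R : Op} (h : ShiftOf A k A') (hR : R * A = 1)
    {ψ : FockOne} (hψ : EnergyLE (1 - ‖k.1‖) ψ) : ‖ψ‖ ≤ ‖R‖ * ‖A' ψ‖ := by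
  have h1 := ((h.lim ψ hψ).norm.add (tendsto_norm_addPhoton hk (h.pres ψ hψ))).const_mul ‖R‖
  rw [norm_zero, zero_add] at h1
  refine le_of_tendsto_of_tendsto' (tendsto_norm_addPhoton hk hψ) h1 fun j => ?_
  have e : addPhoton k j ψ = R (A (addPhoton k j ψ)) :=
    (congrArg (fun B : Op => B (addPhoton k j ψ)) hR).symm
  calc ‖addPhoton k j ψ‖ = ‖R (A (addPhoton k j ψ))‖ := by rw [← e]
    _ ≤ ‖R‖ * ‖A (addPhoton k j ψ)‖ := R.le_opNorm _
    _ ≤ _ := by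
      gcongr
      calc _ = ‖(A (addPhoton k j ψ) - addPhoton k j (A' ψ)) + addPhoton k j (A' ψ)‖ := by
            rw [sub_add_cancel]
        _ ≤ _ := norm_add_le _ _

lemma ShiftOf.inverse {A A' R N : Op} (h : ShiftOf A k A') (hR : R * A = 1)
    (hN : ∀ ψ, EnergyLE (1 - ‖k.1‖) ψ → EnergyLE (1 - ‖k.1‖) (N ψ) ∧ A' (N ψ) = ψ) :
    ShiftOf R k N where
  pres ψ hψ := (hN ψ hψ).1
  lim ψ hψ := by
    have h1 := (R.continuous.tendsto 0).comp (h.lim (N ψ) (hN ψ hψ).1)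
    rw [map_zero] at h1
    have h2 := h1.neg
    rw [neg_zero] at h2
    refine h2.congr fun j => ?_
    have e : addPhoton k j (N ψ) = R (A (addPhoton k j (N ψ))) :=
      (congrArg (fun B : Op => B (addPhoton k j (N ψ))) hR).symm
    rw [(hN ψ hψ).2, Function.comp_apply, map_sub, ← e, neg_sub]

lemma inner_addPhoton (hk : k.1 ≠ 0) (j : ℕ) (φ ψ : FockOne) : inner ℂ (addPhoton k j φ) ψ =
    (((√(winVol k j))⁻¹ : ℝ) : ℂ) * ∫ q in window k j, inner ℂ φ (ann q ψ) ∂photonMeasure := by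
  rw [addPhoton, inner_smul_l, conj_ofReal, inner_creat (goodSet_window hk j)]

lemma inner_sub_l (φ φ' ψ : FockOne) : inner ℂ (φ - φ') ψ = inner ℂ φ ψ - inner ℂ φ' ψ :=
  inner_sub_left φ φ' ψ

lemma inner_add_r (φ ψ ψ' : FockOne) : inner ℂ φ (ψ + ψ') = inner ℂ φ ψ + inner ℂ φ ψ' :=
  inner_add_right φ ψ ψ'

lemma inner_sub_r (φ ψ ψ' : FockOne) : inner ℂ φ (ψ - ψ') = inner ℂ φ ψ - inner ℂ φ ψ' :=
  inner_sub_right φ ψ ψ'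

lemma adjoint_inner_r (A : Op) (φ ψ : FockOne) :
    inner ℂ φ (adj A ψ) = inner ℂ (A φ) ψ :=
  ContinuousLinearMap.adjoint_inner_right A φ ψ

lemma adjoint_inner_l (A : Op) (φ ψ : FockOne) :
    inner ℂ (adj A φ) ψ = inner ℂ φ (A ψ) :=
  ContinuousLinearMap.adjoint_inner_left A ψ φ

lemma integral_norm_ann_window_le (hk : k.1 ≠ 0) (j : ℕ) (χ : FockOne) :
    ∫ q in window k j, ‖ann q χ‖ ∂photonMeasure ≤
      √(winVol k j) * √((‖k.1‖ / 2)⁻¹) * ‖χ‖ := by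
  have hv := winVol_pos hk j
  have hc : 0 < ‖k.1‖ / 2 := by have := norm_pos_iff.2 hk; positivity
  have h4 := integral_norm_ann_sq_le_mul (goodSet_window hk j) χ
  have h5 := integral_norm_ann_sq_le (goodSet_window hk j) χ
  refine (abs_le_of_sq_le_sq' ?_ (by positivity)).2
  rw [mul_pow, mul_pow, Real.sq_sqrt hv.le, Real.sq_sqrt (inv_nonneg.2 hc.le), mul_assoc]
  exact h4.trans (mul_le_mul_of_nonneg_left h5 hv.le)

lemma norm_sub_addPhoton_le (hk : k.1 ≠ 0) {A : Op} {T : Momentum → Op} {D : Photon → Op} {C : ℝ}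
    (hC : 0 ≤ C)
    (hp : ∀ φ, ∀ᵐ q ∂photonMeasure, ann q (adj A φ) =
      adj (T q.1) (ann q φ) + D q φ)
    (hD : ∀ q, ‖k.1‖ / 2 ≤ ‖q.1‖ → ‖D q‖ ≤ C) (ψ ψ' : FockOne) (j : ℕ) {ε : ℝ} (hε : 0 ≤ ε)
    (hq : ∀ q ∈ window k j, ‖T q.1 ψ - ψ'‖ ≤ ε) :
    ‖A (addPhoton k j ψ) - addPhoton k j ψ'‖ ≤
      ε * √((‖k.1‖ / 2)⁻¹) + C * ‖ψ‖ * √(winVol k j) := by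
  have hg := goodSet_window hk j
  have hv := winVol_pos hk j
  have hs := Real.sqrt_pos.2 hv
  obtain ⟨χ, hχ⟩ : ∃ χ, χ = A (addPhoton k j ψ) - addPhoton k j ψ' := ⟨_, rfl⟩
  have i1 := integrableOn_inner_ann hg ψ (adj A χ)
  have i2 := integrableOn_inner_ann hg ψ' χ
  have h1 : inner ℂ χ χ = (((√(winVol k j))⁻¹ : ℝ) : ℂ) * ∫ q in window k j,
      (inner ℂ ψ (ann q (adj A χ)) - inner ℂ ψ' (ann q χ))
        ∂photonMeasure := by
    have e1 : inner ℂ χ χ = inner ℂ (A (addPhoton k j ψ)) χ - inner ℂ (addPhoton k j ψ') χ :=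
      (congrArg (fun z => inner ℂ z χ) hχ).trans (inner_sub_l _ _ _)
    have e2 := (adjoint_inner_r A (addPhoton k j ψ) χ).symm.trans
      (inner_addPhoton hk j ψ (adj A χ))
    have e3 := inner_addPhoton hk j ψ' χ
    refine e1.trans ((congrArg₂ _ e2 e3).trans ?_)
    rw [integral_sub i1 i2, mul_sub]
  have i3 : IntegrableOn (fun q => ε * ‖ann q χ‖) (window k j) photonMeasure :=
    (integrableOn_norm_ann hg χ).const_mul ε
  have i4 : IntegrableOn (fun _ => C * ‖ψ‖ * ‖χ‖) (window k j) photonMeasure :=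
    integrableOn_const hg.fin
  have h2 : ‖∫ q in window k j, (inner ℂ ψ (ann q (adj A χ)) -
      inner ℂ ψ' (ann q χ)) ∂photonMeasure‖ ≤
      ∫ q in window k j, (ε * ‖ann q χ‖ + C * ‖ψ‖ * ‖χ‖) ∂photonMeasure := by
    refine norm_integral_le_of_norm_le (i3.add i4) ?_
    filter_upwards [ae_restrict_of_ae (hp χ), ae_restrict_mem hg.meas] with q hpq hqw
    have e : inner ℂ ψ (ann q (adj A χ)) - inner ℂ ψ' (ann q χ) =
        inner ℂ (T q.1 ψ - ψ') (ann q χ) + inner ℂ ψ (D q χ) := by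
      rw [hpq, inner_add_r, adjoint_inner_r, inner_sub_l]; ring
    rw [e]
    refine (norm_add_le _ _).trans (add_le_add ((norm_inner_le _ _).trans ?_)
      ((norm_inner_le _ _).trans ?_))
    · exact mul_le_mul_of_nonneg_right (hq q hqw) (norm_nonneg _)
    · have := ((D q).le_opNorm χ).trans (mul_le_mul_of_nonneg_right
        (hD q (window_bounds k j hqw).2.1) (norm_nonneg χ))
      calc _ ≤ ‖ψ‖ * (C * ‖χ‖) := by gcongr
        _ = _ := by ring
  rw [integral_add i3 i4, integral_const_mul, setIntegral_const, smul_eq_mul] at h2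
  have h3 := integral_norm_ann_window_le hk j χ
  have h6 : ‖χ‖ ^ 2 ≤ (ε * √((‖k.1‖ / 2)⁻¹) + C * ‖ψ‖ * √(winVol k j)) * ‖χ‖ := by
    have e : ‖χ‖ ^ 2 = ‖(inner ℂ χ χ : ℂ)‖ := by
      rw [inner_self_eq, norm_real, norm_of_nonneg (by positivity)]
    rw [e, h1, norm_mul, norm_real, norm_inv, norm_of_nonneg hs.le,
      inv_mul_le_iff₀ hs]
    refine h2.trans ?_
    have h7 := mul_le_mul_of_nonneg_left h3 hε
    have h8 : photonMeasure.real (window k j) = √(winVol k j) * √(winVol k j) :=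
      (Real.mul_self_sqrt hv.le).symm
    rw [h8]
    refine (add_le_add_left h7 _).trans (le_of_eq ?_)
    ring
  rw [← hχ]
  by_cases h0 : ‖χ‖ = 0
  · rw [h0]; positivity
  · have : 0 < ‖χ‖ := lt_of_le_of_ne (norm_nonneg _) (Ne.symm h0)
    rw [sq] at h6
    exact le_of_mul_le_mul_right h6 this

theorem shiftOf_of_pull (hk : k.1 ≠ 0) {A : Op} {T : Momentum → Op} {D : Photon → Op} {C : ℝ}
    (hp : ∀ φ, ∀ᵐ q ∂photonMeasure, ann q (adj A φ) =
      adj (T q.1) (ann q φ) + D q φ)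
    (hD : ∀ q, ‖k.1‖ / 2 ≤ ‖q.1‖ → ‖D q‖ ≤ C)
    (hpres : ∀ ψ, EnergyLE (1 - ‖k.1‖) ψ → EnergyLE (1 - ‖k.1‖) (T k.1 ψ))
    (hT : ∀ ψ, EnergyLE (1 - ‖k.1‖) ψ →
      Tendsto (fun q => T q ψ) (𝓝[{q | ‖q‖ ≤ ‖k.1‖}] k.1) (𝓝 (T k.1 ψ))) :
    ShiftOf A k (T k.1) := by
  refine ⟨hpres, fun ψ hψ => ?_⟩
  have hC : 0 ≤ C := (D k).opNorm_nonneg.trans (hD k (by linarith [norm_nonneg k.1]))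
  have hc : 0 < ‖k.1‖ / 2 := by have := norm_pos_iff.2 hk; positivity
  have key := fun j (ε : ℝ) (hε : 0 ≤ ε) hq =>
    norm_sub_addPhoton_le hk hC hp hD ψ (T k.1 ψ) j hε hq
  rw [tendsto_zero_iff_norm_tendsto_zero]
  rw [Metric.tendsto_atTop]
  intro ε hε
  have hs : 0 < √((‖k.1‖ / 2)⁻¹) := Real.sqrt_pos.2 (inv_pos.2 hc)
  have hcont := hT ψ hψ
  rw [Metric.tendsto_nhdsWithin_nhds] at hcont
  obtain ⟨δ, hδ, hd⟩ := hcont (ε / (2 * √((‖k.1‖ / 2)⁻¹) + 1)) (by positivity)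
  have t1 : ∀ᶠ j in atTop, 2 * winRad j * ‖k.1‖ < δ := by
    have := (tendsto_winRad.const_mul 2).mul_const ‖k.1‖
    rw [mul_zero, zero_mul] at this
    exact this.eventually_lt_const hδ
  have t2 : ∀ᶠ j in atTop, C * ‖ψ‖ * √(winVol k j) < ε / 2 := by
    have := (tendsto_winVol k).sqrt.const_mul (C * ‖ψ‖)
    rw [Real.sqrt_zero, mul_zero] at this
    exact this.eventually_lt_const (by positivity)
  obtain ⟨J, hJ⟩ := eventually_atTop.1 (t1.and t2)
  refine ⟨J, fun j hj => ?_⟩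
  obtain ⟨a, b⟩ := hJ j hj
  have := key j (ε / (2 * √((‖k.1‖ / 2)⁻¹) + 1)) (by positivity) fun q hq => by
    have hw := window_bounds k j hq
    have := hd (x := q.1) hw.1 (by rw [dist_eq_norm]; linarith [hw.2.2])
    rw [dist_eq_norm] at this
    exact this.le
  rw [dist_zero_right, norm_norm]
  refine this.trans_lt ?_
  have h9 : ε / (2 * √((‖k.1‖ / 2)⁻¹) + 1) * √((‖k.1‖ / 2)⁻¹) ≤ ε / 2 := by
    rw [div_mul_eq_mul_div, div_le_div_iff₀ (by positivity) (by norm_num)]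
    nlinarith
  linarith

end Window

end

section
/-! ### The calculus of operators with a pull-through formula -/

instance : NormedAddCommGroup FockOne := Submodule.normedAddCommGroup _
instance : InnerProductSpace ℂ FockOne := Submodule.innerProductSpace _
instance : NormedSpace ℂ FockOne := InnerProductSpace.toNormedSpace
instance : NormedRing Op := ContinuousLinearMap.toNormedRing
instance : NormedAlgebra ℂ Op := ContinuousLinearMap.toNormedAlgebra
instance : NormedSpace ℂ Op := ContinuousLinearMap.toNormedSpace
instance : Ring Op := NormedRing.toRing
instance : Module ℂ Op := NormedSpace.toModule
instance : AddCommGroup FockOne := NormedAddCommGroup.toAddCommGroup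
instance : Module ℂ FockOne := NormedSpace.toModule

/-- The operator `A` satisfies the pull-through formula `a(k) A = T_k a(k) + D_k`, with the
translated operators `T_k` and the commutators `D_k`. -/
structure Soft (A : Op) (T : Momentum → Op) (D : Photon → Op) : Prop where
  pull : ∀ ψ, ∀ᵐ k ∂photonMeasure, ann k (A ψ) = T k.1 (ann k ψ) + D k ψ
  shift : ∀ k : Photon, k.1 ≠ 0 → ShiftOf A k (T k.1)
  shift_adj : ∀ k : Photon, k.1 ≠ 0 → ShiftOf (adj A) k (adj (T k.1))
  conv : ∀ ψ, Tendsto (fun q => T q ψ) (𝓝[≠] 0) (𝓝 (A ψ))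
  conv_adj : ∀ ψ, Tendsto (fun q => adj (T q) ψ) (𝓝[≠] 0) (𝓝 (adj A ψ))
  bdd : ∃ C : ℝ, ∀ q, ‖T q‖ ≤ C
  proj_right : ∀ q, T q * eproj (1 - ‖q‖) = T q
  proj_left : ∀ q, eproj (1 - ‖q‖) * T q = T q

lemma tendsto_mul_apply {ι : Type*} {l : Filter ι} {S T : ι → Op} {A B : Op} {C : ℝ}
    (hb : ∀ i, ‖S i‖ ≤ C) (hS : ∀ ψ, Tendsto (fun i => S i ψ) l (𝓝 (A ψ)))
    (ψ : FockOne) (hT : Tendsto (fun i => T i ψ) l (𝓝 (B ψ))) :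
    Tendsto (fun i => (S i * T i) ψ) l (𝓝 ((A * B) ψ)) := by
  have h1 : Tendsto (fun i => S i (T i ψ - B ψ)) l (𝓝 0) := by
    have h2 : Tendsto (fun i => C * ‖T i ψ - B ψ‖) l (𝓝 0) := by
      have := (tendsto_iff_norm_sub_tendsto_zero.1 hT).const_mul C
      rwa [mul_zero] at this
    refine squeeze_zero_norm (fun i => ?_) h2
    exact ((S i).le_opNorm _).trans (mul_le_mul_of_nonneg_right (hb i) (norm_nonneg _))
  have h3 := h1.add (hS (B ψ))
  rw [zero_add] at h3
  refine h3.congr fun i => ?_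
  rw [map_sub, sub_add_cancel]
  rfl

lemma adj_mul (A B : Op) : adj (A * B) = adj B * adj A := ContinuousLinearMap.adjoint_comp A B

lemma adj_add (A B : Op) : adj (A + B) = adj A + adj B := map_add _ A B

lemma adj_sub (A B : Op) : adj (A - B) = adj A - adj B := map_sub _ A B

lemma adj_smul (z : ℂ) (A : Op) : adj (z • A) = conj z • adj A :=
  LinearEquiv.map_smulₛₗ (ContinuousLinearMap.adjoint (𝕜 := ℂ) (E := FockOne)
    (F := FockOne)).toLinearEquiv z A

lemma norm_zero_op : ‖(0 : Op)‖ = 0 := ContinuousLinearMap.opNorm_zero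

lemma adj_one : adj (1 : Op) = 1 := ContinuousLinearMap.adjoint_id

lemma adj_adj (A : Op) : adj (adj A) = A := ContinuousLinearMap.adjoint_adjoint A

lemma norm_adj (A : Op) : ‖adj A‖ = ‖A‖ := LinearIsometryEquiv.norm_map _ A

variable {A B : Op} {T S : Momentum → Op} {D E : Photon → Op}

lemma Soft.add (hA : Soft A T D) (hB : Soft B S E) :
    Soft (A + B) (fun q => T q + S q) (fun k => D k + E k) where
  pull ψ := by
    filter_upwards [hA.pull ψ, hB.pull ψ, ann_add (A ψ) (B ψ)] with k a b c
    refine c.trans ?_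
    refine (congrArg₂ (· + ·) a b).trans ?_
    exact add_add_add_comm (T k.1 (ann k ψ)) (D k ψ) (S k.1 (ann k ψ)) (E k ψ)
  shift k hk := (hA.shift k hk).add hk (hB.shift k hk)
  shift_adj k hk := by
    rw [adj_add, adj_add]
    exact (hA.shift_adj k hk).add hk (hB.shift_adj k hk)
  conv ψ := (hA.conv ψ).add (hB.conv ψ)
  conv_adj ψ := by
    rw [adj_add]
    exact ((hA.conv_adj ψ).add (hB.conv_adj ψ)).congr fun q =>
      (congrArg (fun X : Op => X ψ) (adj_add (T q) (S q))).symm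
  bdd := by
    obtain ⟨C, hC⟩ := hA.bdd
    obtain ⟨C', hC'⟩ := hB.bdd
    exact ⟨C + C', fun q => (norm_add_le _ _).trans (add_le_add (hC q) (hC' q))⟩
  proj_right q := by rw [add_mul, hA.proj_right, hB.proj_right]
  proj_left q := by rw [mul_add, hA.proj_left, hB.proj_left]

lemma Soft.smul (hA : Soft A T D) (z : ℂ) :
    Soft (z • A) (fun q => z • T q) (fun k => z • D k) where
  pull ψ := by
    filter_upwards [hA.pull ψ, ann_smul z (A ψ)] with k a c
    exact c.trans ((congrArg (z • ·) a).trans (smul_add z (T k.1 (ann k ψ)) (D k ψ)))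
  shift k hk := (hA.shift k hk).smul hk z
  shift_adj k hk := by
    rw [adj_smul, adj_smul]
    exact (hA.shift_adj k hk).smul hk _
  conv ψ := (hA.conv ψ).const_smul z
  conv_adj ψ := by
    rw [adj_smul]
    exact ((hA.conv_adj ψ).const_smul (conj z)).congr fun q =>
      (congrArg (fun X : Op => X ψ) (adj_smul z (T q))).symm
  bdd := by
    obtain ⟨C, hC⟩ := hA.bdd
    refine ⟨‖z‖ * C, fun q => (norm_smul_le z (T q)).trans ?_⟩
    exact mul_le_mul_of_nonneg_left (hC q) (norm_nonneg z)
  proj_right q := by rw [smul_mul_assoc, hA.proj_right]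
  proj_left q := by rw [mul_smul_comm, hA.proj_left]

lemma Soft.sub (hA : Soft A T D) (hB : Soft B S E) :
    Soft (A - B) (fun q => T q - S q) (fun k => D k - E k) := by
  have e : ∀ B : Op, (-1 : ℂ) • B = -B := fun B => neg_one_smul ℂ B
  have := hA.add (hB.smul (-1))
  simpa only [e, ← sub_eq_add_neg] using this

lemma Soft.mul (hA : Soft A T D) (hB : Soft B S E) :
    Soft (A * B) (fun q => T q * S q) (fun k => T k.1 * E k + D k * B) where
  pull ψ := by
    filter_upwards [hA.pull (B ψ), hB.pull ψ] with k a b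
    refine a.trans ?_
    rw [b]
    exact (congrArg (· + D k (B ψ)) ((T k.1).map_add (S k.1 (ann k ψ)) (E k ψ))).trans
      (add_assoc (T k.1 (S k.1 (ann k ψ))) (T k.1 (E k ψ)) (D k (B ψ)))
  shift k hk := (hA.shift k hk).mul (hB.shift k hk)
  shift_adj k hk := by
    rw [adj_mul, adj_mul]
    exact (hB.shift_adj k hk).mul (hA.shift_adj k hk)
  conv ψ := by
    obtain ⟨C, hC⟩ := hA.bdd
    exact tendsto_mul_apply hC hA.conv ψ (hB.conv ψ)
  conv_adj ψ := by
    obtain ⟨C, hC⟩ := hB.bdd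
    rw [adj_mul]
    have := tendsto_mul_apply (S := fun q => adj (S q)) (T := fun q => adj (T q)) (C := C)
      (fun q => by rw [norm_adj]; exact hC q) hB.conv_adj ψ (hA.conv_adj ψ)
    exact this.congr fun q => (congrArg (fun X : Op => X ψ) (adj_mul (T q) (S q))).symm
  bdd := by
    obtain ⟨C, hC⟩ := hA.bdd
    obtain ⟨C', hC'⟩ := hB.bdd
    refine ⟨C * C', fun q => (norm_mul_le _ _).trans ?_⟩
    exact mul_le_mul (hC q) (hC' q) (norm_nonneg _) ((norm_nonneg _).trans (hC q))
  proj_right q := by rw [mul_assoc, hB.proj_right]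
  proj_left q := by rw [← mul_assoc, hA.proj_left]

/-- Functions of the energy with at most one point of discontinuity, continuous from the left. -/
structure EnergySymbol (C : ℝ) (f : ℝ → ℂ) : Prop extends EFun C f where
  left : ∀ r, ContinuousWithinAt f (Set.Iic r) r
  cont : ∃ c : ℝ, 0 < c ∧ ∀ r, r ≠ c → ContinuousAt f r

lemma EnergySymbol.conj {C : ℝ} {f : ℝ → ℂ} (hf : EnergySymbol C f) :
    EnergySymbol C fun r => conj (f r) where
  toEFun := hf.toEFun.conj
  left r := (continuous_conj.continuousAt).comp_continuousWithinAt (hf.left r)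
  cont := by
    obtain ⟨c, hc, h⟩ := hf.cont
    exact ⟨c, hc, fun r hr => (continuous_conj.continuousAt).comp (h r hr)⟩

lemma EnergySymbol.tendsto_shift {C : ℝ} {f : ℝ → ℂ} (hf : EnergySymbol C f) {k : Momentum}
    (ψ : FockOne) : Tendsto (fun q : Momentum => energyOp (shiftE ‖q‖ f) ψ)
      (𝓝[{q | ‖q‖ ≤ ‖k‖}] k) (𝓝 (energyOp (shiftE ‖k‖ f) ψ)) := by
  refine tendsto_energyOp (fun q : Momentum => hf.toEFun.shift (norm_nonneg q))
    (hf.toEFun.shift (norm_nonneg k)) ψ (.of_forall fun x _ => ?_)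
  generalize mEnergy (bag x) = r
  by_cases h : ‖k‖ + r ≤ 1
  · have h1 : Tendsto (fun q : Momentum => ‖q‖ + r) (𝓝[{q | ‖q‖ ≤ ‖k‖}] k)
        (𝓝[Set.Iic (‖k‖ + r)] (‖k‖ + r)) := by
      refine tendsto_nhdsWithin_iff.2 ⟨?_, ?_⟩
      · exact ((continuous_norm.add continuous_const).tendsto k).mono_left nhdsWithin_le_nhds
      · filter_upwards [self_mem_nhdsWithin] with q hq
        have : ‖q‖ ≤ ‖k‖ := hq
        simpa using this
    rw [shiftE, if_pos h]
    refine ((hf.left (‖k‖ + r)).tendsto.comp h1).congr' ?_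
    filter_upwards [self_mem_nhdsWithin] with q hq
    have : ‖q‖ ≤ ‖k‖ := hq
    rw [Function.comp_apply, shiftE, if_pos (by linarith)]
  · rw [shiftE, if_neg h]
    refine tendsto_const_nhds.congr' ?_
    have h1 : ∀ᶠ q : Momentum in 𝓝 k, 1 < ‖q‖ + r :=
      (continuous_norm.add continuous_const).tendsto k |>.eventually_const_lt (not_le.1 h)
    filter_upwards [nhdsWithin_le_nhds h1] with q hq
    rw [shiftE, if_neg (not_le.2 hq)]

lemma EnergySymbol.tendsto_zero {C : ℝ} {f : ℝ → ℂ} (hf : EnergySymbol C f)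
    (ψ : FockOne) : Tendsto (fun q : Momentum => energyOp (shiftE ‖q‖ f) ψ)
      (𝓝[≠] 0) (𝓝 (energyOp f ψ)) := by
  obtain ⟨c, hc, hcont⟩ := hf.cont
  refine tendsto_energyOp (fun q : Momentum => hf.toEFun.shift (norm_nonneg q)) hf.toEFun ψ ?_
  filter_upwards [energy_ne one_pos, energy_ne hc] with x h1 h2 h3
  generalize mEnergy (bag x) = r at *
  have hr : r < 1 := lt_of_le_of_ne h3 h1
  have h4 : Tendsto (fun q : Momentum => ‖q‖ + r) (𝓝[≠] 0) (𝓝 r) := by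
    have : Tendsto (fun q : Momentum => ‖q‖ + r) (𝓝 0) (𝓝 (‖(0 : Momentum)‖ + r)) :=
      (continuous_norm.add continuous_const).tendsto 0
    rw [norm_zero, zero_add] at this
    exact this.mono_left nhdsWithin_le_nhds
  refine ((hcont r h2).tendsto.comp h4).congr' ?_
  filter_upwards [h4.eventually_lt_const hr] with q hq
  rw [Function.comp_apply, shiftE, if_pos hq.le]

lemma adjoint_shiftE {C : ℝ} {f : ℝ → ℂ} (hf : EFun C f) (q : Momentum) :
    adj (energyOp (shiftE ‖q‖ f)) = energyOp (shiftE ‖q‖ fun r => conj (f r)) := by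
  rw [adjoint_energyOp (hf.shift (norm_nonneg q))]
  congr 1
  funext r
  simp only [shiftE]
  split_ifs <;> simp

lemma EnergySymbol.shiftOf {C : ℝ} {f : ℝ → ℂ} (hf : EnergySymbol C f) {k : Photon}
    (hk : k.1 ≠ 0) : ShiftOf (energyOp f) k (energyOp (shiftE ‖k.1‖ f)) := by
  refine shiftOf_of_pull hk (T := fun q => energyOp (shiftE ‖q‖ f)) (D := fun _ => 0) (C := 0)
    (fun φ => ?_) (fun q _ => by rw [norm_zero_op])
    (fun ψ _ => energyLE_energyOp_shift hf.toEFun (norm_nonneg _) ψ) fun ψ _ => hf.tendsto_shift ψ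
  rw [adjoint_energyOp hf.toEFun]
  filter_upwards [ann_energyOp hf.toEFun.conj φ] with q hq
  rw [hq, adjoint_shiftE hf.toEFun]
  simp

theorem EnergySymbol.soft {C : ℝ} {f : ℝ → ℂ} (hf : EnergySymbol C f) :
    Soft (energyOp f) (fun q => energyOp (shiftE ‖q‖ f)) (fun _ => 0) where
  pull ψ := by
    filter_upwards [ann_energyOp hf.toEFun ψ] with k hk
    rw [hk]; simp
  shift k hk := hf.shiftOf hk
  shift_adj k hk := by
    rw [adjoint_energyOp hf.toEFun, adjoint_shiftE hf.toEFun]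
    exact hf.conj.shiftOf hk
  conv ψ := hf.tendsto_zero ψ
  conv_adj ψ := by
    rw [adjoint_energyOp hf.toEFun]
    refine (hf.conj.tendsto_zero ψ).congr fun q => ?_
    rw [adjoint_shiftE hf.toEFun]
  bdd := ⟨C, fun q => (energyOp_spec (hf.toEFun.shift (norm_nonneg q))).2⟩
  proj_right q := (energyOp_shift_eproj hf.toEFun (norm_nonneg q)).1
  proj_left q := (energyOp_shift_eproj hf.toEFun (norm_nonneg q)).2

/-! ### Inverses -/

theorem isUnit_of_bounded_below {Q : Op} {C : ℝ} (hC : 0 < C) (h : ∀ ψ, ‖ψ‖ ≤ C * ‖Q ψ‖)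
    (h' : ∀ ψ, ‖ψ‖ ≤ C * ‖adj Q ψ‖) : IsUnit Q := by
  rw [ContinuousLinearMap.isUnit_iff_bijective,
    ContinuousLinearMap.bijective_iff_dense_range_and_antilipschitz]
  refine ⟨?_, ⟨C, hC.le⟩, ?_⟩
  · rw [Submodule.topologicalClosure_eq_top_iff, ContinuousLinearMap.orthogonal_range,
      Submodule.eq_bot_iff]
    intro ψ hψ
    have h0 : adj Q ψ = 0 := hψ
    have := h' ψ
    rw [h0, norm_zero, mul_zero] at this
    exact norm_le_zero_iff.1 this
  · exact AddMonoidHomClass.antilipschitz_of_bound _ h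

lemma bounded_below_aux {k : Photon} (hk : k.1 ≠ 0) {A T' R : Op} (h : ShiftOf A k T')
    (hR : R * A = 1) (h1 : T' * eproj (1 - ‖k.1‖) = T') (h2 : eproj (1 - ‖k.1‖) * T' = T')
    (ψ : FockOne) : ‖ψ‖ ≤ (‖R‖ + 2) * ‖(T' + (1 - eproj (1 - ‖k.1‖))) ψ‖ := by
  set P := eproj (1 - ‖k.1‖) with hP
  set Q := T' + (1 - P) with hQ
  have hPP : P * P = P := eproj_mul_eproj _
  have e1 : P * Q = T' * P := by rw [hQ, mul_add, mul_sub, hPP, h2, h1, mul_one, sub_self, add_zero]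
  have e2 : P (Q ψ) = T' (P ψ) := congrArg (fun X : Op => X ψ) e1
  have e3 : ψ - P ψ = Q ψ - P (Q ψ) := by
    have : (1 - P) = Q - P * Q := by rw [e1, h1, hQ]; abel
    exact congrArg (fun X : Op => X ψ) this
  have h3 := h.norm_le hk hR (energyLE_eproj (1 - ‖k.1‖) ψ)
  have h4 : ‖P (Q ψ)‖ ≤ ‖Q ψ‖ := (P.le_opNorm _).trans
    ((mul_le_mul_of_nonneg_right (norm_eproj_le _) (norm_nonneg _)).trans (one_mul _).le)
  rw [← hP, ← e2] at h3
  calc ‖ψ‖ = ‖P ψ + (ψ - P ψ)‖ := by rw [add_sub_cancel]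
    _ ≤ ‖P ψ‖ + ‖ψ - P ψ‖ := norm_add_le _ _
    _ ≤ ‖R‖ * ‖Q ψ‖ + (‖Q ψ‖ + ‖Q ψ‖) := by
        rw [e3]
        exact add_le_add (h3.trans (mul_le_mul_of_nonneg_left h4 R.opNorm_nonneg))
          ((norm_sub_le _ _).trans (add_le_add_right h4 _))
    _ = _ := by ring

theorem Soft.exists_inverse_at (hA : Soft A T D) {R : Op} (hRA : R * A = 1) (hAR : A * R = 1)
    {q : Momentum} (hq : q ≠ 0) : ∃ M : Op, M * T q = eproj (1 - ‖q‖) ∧ T q * M = eproj (1 - ‖q‖) ∧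
      M * eproj (1 - ‖q‖) = M ∧ eproj (1 - ‖q‖) * M = M := by
  let k : Photon := (q, true)
  set P := eproj (1 - ‖q‖) with hP
  have hPP : P * P = P := eproj_mul_eproj _
  have hPa : adj P = P := adjoint_eproj _
  have hRA' : adj R * adj A = 1 := by rw [← adj_mul, hAR, adj_one]
  have hTP : T q * P = T q := hA.proj_right q
  have hPT : P * T q = T q := hA.proj_left q
  have hTP' : adj (T q) * P = adj (T q) := by
    have := congrArg adj hPT
    rwa [adj_mul, hPa] at this
  have hPT' : P * adj (T q) = adj (T q) := by
    have := congrArg adj hTP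
    rwa [adj_mul, hPa] at this
  have b1 := bounded_below_aux (k := k) hq (hA.shift k hq) hRA hTP hPT
  have b2 := bounded_below_aux (k := k) hq (hA.shift_adj k hq) hRA' hTP' hPT'
  have hQa : adj (T q + (1 - P)) = adj (T q) + (1 - P) := by
    rw [adj_add, adj_sub, adj_one, hPa]
  have hu : IsUnit (T q + (1 - P)) := by
    refine isUnit_of_bounded_below (C := ‖R‖ + 2) (by positivity) b1 fun ψ => ?_
    rw [hQa]
    have := b2 ψ
    rwa [norm_adj] at this
  obtain ⟨u, hu⟩ := hu
  have hQP : (u : Op) * P = T q := by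
    rw [hu, add_mul, sub_mul, hTP, hPP, one_mul, sub_self, add_zero]
  have hPQ : P * (u : Op) = T q := by
    rw [hu, mul_add, mul_sub, hPT, hPP, mul_one, sub_self, add_zero]
  have hc : (↑u⁻¹ : Op) * P = P * ↑u⁻¹ := by
    calc (↑u⁻¹ : Op) * P = ↑u⁻¹ * (P * u) * ↑u⁻¹ := by
          rw [mul_assoc, mul_assoc, Units.mul_inv, mul_one]
      _ = P * ↑u⁻¹ := by rw [hPQ, ← hQP, ← mul_assoc, Units.inv_mul, one_mul]
  refine ⟨↑u⁻¹ * P, ?_, ?_, ?_, ?_⟩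
  · rw [mul_assoc, hPT, ← hQP, ← mul_assoc, Units.inv_mul, one_mul]
  · rw [hc, ← mul_assoc, hTP, ← hPQ, mul_assoc, Units.mul_inv, mul_one]
  · rw [mul_assoc, hPP]
  · rw [hc, ← mul_assoc, hPP]

theorem Soft.inverse (hA : Soft A T D) {R : Op} (hRA : R * A = 1) (hAR : A * R = 1) :
    ∃ M : Momentum → Op, Soft R M (fun k => -(M k.1 * D k * R)) ∧ ∀ q ≠ 0,
      M q * T q = eproj (1 - ‖q‖) ∧ T q * M q = eproj (1 - ‖q‖) := by
  classical
  choose! M hM using fun (q : Momentum) (hq : q ≠ 0) => hA.exists_inverse_at hRA hAR hq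
  let M' : Momentum → Op := fun q => if q = 0 then 0 else M q
  have hM' : ∀ q ≠ 0, M' q * T q = eproj (1 - ‖q‖) ∧ T q * M' q = eproj (1 - ‖q‖) ∧
      M' q * eproj (1 - ‖q‖) = M' q ∧ eproj (1 - ‖q‖) * M' q = M' q := fun q hq => by
    simp only [M', if_neg hq]; exact hM q hq
  have hle : ∀ q ψ, EnergyLE (1 - ‖q‖) (M' q ψ) := fun q ψ => by
    by_cases hq : q = 0
    · simp only [M', if_pos hq]
      rw [energyLE_iff]; simp
    · rw [energyLE_iff]
      exact congrArg (fun X : Op => X ψ) (hM' q hq).2.2.2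
  have hRA' : adj R * adj A = 1 := by rw [← adj_mul, hAR, adj_one]
  have hAR' : adj A * adj R = 1 := by rw [← adj_mul, hRA, adj_one]
  have hadj : ∀ q ≠ 0, adj (M' q) * adj (T q) = eproj (1 - ‖q‖) ∧
      adj (T q) * adj (M' q) = eproj (1 - ‖q‖) ∧
      eproj (1 - ‖q‖) * adj (M' q) = adj (M' q) := fun q hq => by
    obtain ⟨a, b, c, d⟩ := hM' q hq
    refine ⟨?_, ?_, ?_⟩
    · rw [← adj_mul, b, adjoint_eproj]
    · rw [← adj_mul, a, adjoint_eproj]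
    · have := congrArg adj c
      rwa [adj_mul, adjoint_eproj] at this
  have hbd : ∀ q, ‖M' q‖ ≤ ‖R‖ := fun q => by
    refine ContinuousLinearMap.opNorm_le_bound _ R.opNorm_nonneg fun ψ => ?_
    by_cases hq : q = 0
    · simp only [M', if_pos hq]
      simpa using mul_nonneg R.opNorm_nonneg (norm_nonneg ψ)
    · have h1 := (hA.shift (q, true) hq).norm_le hq hRA (hle q ψ)
      have h2 : T q (M' q ψ) = eproj (1 - ‖q‖) ψ := congrArg (fun X : Op => X ψ) (hM' q hq).2.1
      refine h1.trans (mul_le_mul_of_nonneg_left ?_ R.opNorm_nonneg)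
      rw [h2]
      exact ((eproj _).le_opNorm _).trans
        ((mul_le_mul_of_nonneg_right (norm_eproj_le _) (norm_nonneg _)).trans (one_mul _).le)
  have hproj : ∀ ψ : FockOne, Tendsto (fun q : Momentum => eproj (1 - ‖q‖) ψ) (𝓝[≠] 0) (𝓝 ψ) := by
    intro ψ
    have h1 : Tendsto (fun q : Momentum => ‖q‖) (𝓝[≠] 0) (𝓝 0) := by
      have := (continuous_norm (E := Momentum)).tendsto 0
      rw [norm_zero] at this
      exact this.mono_left nhdsWithin_le_nhds
    exact (tendsto_eproj ψ).comp h1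
  have hconv : ∀ {X Y : Op} {U V : Momentum → Op}, (∀ ψ, Tendsto (fun q => U q ψ) (𝓝[≠] 0) (𝓝 (X ψ))) →
      X * Y = 1 → (∀ q, ‖V q‖ ≤ ‖R‖) → (∀ q ≠ 0, V q * U q = eproj (1 - ‖q‖)) →
      ∀ ψ, Tendsto (fun q => V q ψ) (𝓝[≠] 0) (𝓝 (Y ψ)) := by
    intro X Y U V hU hXY hV hVU ψ
    have h1 : Tendsto (fun q => V q (X (Y ψ) - U q (Y ψ))) (𝓝[≠] 0) (𝓝 0) := by
      have h2 : Tendsto (fun q => ‖R‖ * ‖U q (Y ψ) - X (Y ψ)‖) (𝓝[≠] 0) (𝓝 0) := by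
        have := (tendsto_iff_norm_sub_tendsto_zero.1 (hU (Y ψ))).const_mul ‖R‖
        rwa [mul_zero] at this
      refine squeeze_zero_norm (fun i => ?_) h2
      rw [norm_sub_rev]
      exact ((V i).le_opNorm _).trans (mul_le_mul_of_nonneg_right (hV i) (norm_nonneg _))
    have h3 := h1.add (hproj (Y ψ))
    rw [zero_add] at h3
    refine h3.congr' ?_
    filter_upwards [self_mem_nhdsWithin] with q hq
    have e1 : X (Y ψ) = ψ := congrArg (fun Z : Op => Z ψ) hXY
    have e2 : V q (U q (Y ψ)) = eproj (1 - ‖q‖) (Y ψ) :=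
      congrArg (fun Z : Op => Z (Y ψ)) (hVU q hq)
    rw [map_sub, e1, e2, sub_add_cancel]
  refine ⟨M', ?_, fun q hq => ⟨(hM' q hq).1, (hM' q hq).2.1⟩⟩
  exact
  { pull := fun ψ => by
      filter_upwards [hA.pull (R ψ), energyLE_ann (R ψ), ae_photon_ne_zero] with k a b c
      have e1 : A (R ψ) = ψ := congrArg (fun Z : Op => Z ψ) hAR
      have e2 : M' k.1 (T k.1 (ann k (R ψ))) = eproj (1 - ‖k.1‖) (ann k (R ψ)) :=
        congrArg (fun Z : Op => Z (ann k (R ψ))) (hM' k.1 c).1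
      rw [energyLE_iff] at b
      rw [e1] at a
      have e3 : (-(M' k.1 * D k * R)) ψ = -(M' k.1 (D k (R ψ))) := rfl
      rw [e3, a, map_add, e2, b, add_neg_cancel_right]
    shift := fun k hk => (hA.shift k hk).inverse hRA fun ψ hψ => ⟨hle _ ψ, by
      have e : T k.1 (M' k.1 ψ) = eproj (1 - ‖k.1‖) ψ :=
        congrArg (fun Z : Op => Z ψ) (hM' k.1 hk).2.1
      rw [e, energyLE_iff.1 hψ]⟩
    shift_adj := fun k hk => (hA.shift_adj k hk).inverse hRA' fun ψ hψ => ⟨by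
      rw [energyLE_iff]
      exact congrArg (fun Z : Op => Z ψ) (hadj k.1 hk).2.2, by
      have e : adj (T k.1) (adj (M' k.1) ψ) = eproj (1 - ‖k.1‖) ψ :=
        congrArg (fun Z : Op => Z ψ) (hadj k.1 hk).2.1
      rw [e, energyLE_iff.1 hψ]⟩
    conv := hconv hA.conv hAR hbd fun q hq => (hM' q hq).1
    conv_adj := hconv (V := fun q => adj (M' q)) hA.conv_adj hAR'
      (fun q => by rw [norm_adj]; exact hbd q) fun q hq => (hadj q hq).1
    bdd := ⟨_, hbd⟩
    proj_right := fun q => by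
      by_cases hq : q = 0
      · simp only [M', if_pos hq, zero_mul]
      · exact (hM' q hq).2.2.1
    proj_left := fun q => by
      by_cases hq : q = 0
      · simp only [M', if_pos hq, mul_zero]
      · exact (hM' q hq).2.2.2 }

end

section
/-! ### The smooth Feshbach map -/

section Ring

variable {R : Type*} [Ring R]

lemma feshbach_ring_deriv (c w X D c₀ X₀ w₀ : R) :
    c * (w * (0 : R) + D * c₀) + (0 : R) * (w₀ * c₀) -
      (c * (w * (X * (w * (0 : R) + D * c₀) + -(X * D * X₀) * (w₀ * c₀)) +
        D * (X₀ * (w₀ * c₀))) + (0 : R) * (w₀ * (X₀ * (w₀ * c₀)))) =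
      (c - c * (w * X)) * D * (c₀ - X₀ * (w₀ * c₀)) := by
  noncomm_ring

lemma feshbach_ring_resolvent (b M D b₀ R₀ : R) :
    b * (M * (0 : R) + -(M * (b * (0 * 0 + D * b₀) + 0 * b₀) * R₀) * b₀) + 0 * (R₀ * b₀) =
      -(b * (M * b) * D * (b₀ * (R₀ * b₀))) := by
  noncomm_ring

lemma feshbach_ring_diff {t h w w' c b p M M' : R} (hM : M * (h + b * (w * b)) = p)
    (hM' : (h + b * (w' * b)) * M' = p) (hp : M * p = M) (hp' : p * M' = M') :
    (t + c * (w * c) - c * (w * (b * (M * b) * (w * c)))) -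
        (t + c * (w' * c) - c * (w' * (b * (M' * b) * (w' * c)))) =
      (c - c * (w * (b * (M * b)))) * (w - w') * (c - b * (M' * b) * (w' * c)) := by
  have e : M - M' + M * (b * ((w - w') * b)) * M' = 0 := by
    have h1 : M * ((h + b * (w * b)) * M') - M * ((h + b * (w' * b)) * M') =
        M * (b * ((w - w') * b)) * M' := by noncomm_ring
    rw [← mul_assoc, hM, hp', hM', hp] at h1
    rw [← h1]; abel
  have e2 : (t + c * (w * c) - c * (w * (b * (M * b) * (w * c)))) -
        (t + c * (w' * c) - c * (w' * (b * (M' * b) * (w' * c)))) -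
      (c - c * (w * (b * (M * b)))) * (w - w') * (c - b * (M' * b) * (w' * c)) =
      - (c * (w * (b * ((M - M' + M * (b * ((w - w') * b)) * M') * (b * (w' * c)))))) := by
    noncomm_ring
  rw [e, zero_mul, mul_zero, mul_zero, mul_zero, neg_zero] at e2
  exact sub_eq_zero.1 e2

end Ring

lemma Soft.congr {A A' : Op} {T T' : Momentum → Op} {D D' : Photon → Op} (h : Soft A T D)
    (hA : A = A') (hT : T = T') (hD : D = D') : Soft A' T' D' := by
  subst hA hT hD; exact h

/-- The smooth Feshbach map of an operator with a pull-through formula. -/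
theorem Soft.feshbach {H : Op} {T : Momentum → Op} {D : Photon → Op} (hH : Soft H T D)
    {ct ch cc cb : ℝ} {ft fh fc fb : ℝ → ℂ} (ht : EnergySymbol ct ft) (hh : EnergySymbol ch fh)
    (hc : EnergySymbol cc fc) (hb : EnergySymbol cb fb) {R : Op}
    (hR : R * (energyOp fh + energyOp fb * ((H - energyOp ft) * energyOp fb)) = 1)
    (hR' : (energyOp fh + energyOp fb * ((H - energyOp ft) * energyOp fb)) * R = 1) :
    ∃ (F Y Z : Momentum → Op) (DY DZ : Photon → Op),
      Soft (energyOp ft + energyOp fc * ((H - energyOp ft) * energyOp fc) -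
          energyOp fc * ((H - energyOp ft) * (energyOp fb * (R * energyOp fb) *
            ((H - energyOp ft) * energyOp fc)))) F
        (fun k => Y k.1 * D k * (energyOp fc - energyOp fb * (R * energyOp fb) *
            ((H - energyOp ft) * energyOp fc))) ∧
      Soft (energyOp fc - energyOp fc * ((H - energyOp ft) * (energyOp fb * (R * energyOp fb))))
        Y DY ∧
      Soft (energyOp fc - energyOp fb * (R * energyOp fb) * ((H - energyOp ft) * energyOp fc))
        Z DZ ∧
      ∀ q q', q ≠ 0 → q' ≠ 0 → ‖q‖ = ‖q'‖ → F q - F q' = Y q * (T q - T q') * Z q' := by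
  have st := ht.soft
  have sh := hh.soft
  have sc := hc.soft
  have sb := hb.soft
  have sw := hH.sub st
  have sQ := sh.add (sb.mul (sw.mul sb))
  obtain ⟨M, sM, hM⟩ := sQ.inverse hR hR'
  have sX := sb.mul (sM.mul sb)
  have sF := (st.add (sc.mul (sw.mul sc))).sub (sc.mul (sw.mul (sX.mul (sw.mul sc))))
  have sY := sc.sub (sc.mul (sw.mul sX))
  have sZ := sc.sub (sX.mul (sw.mul sc))
  refine ⟨_, _, _, _, _, sF.congr rfl rfl ?_, sY, sZ, ?_⟩
  · funext k
    have e := feshbach_ring_deriv (energyOp (shiftE ‖k.1‖ fc))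
      (T k.1 - energyOp (shiftE ‖k.1‖ ft))
      (energyOp (shiftE ‖k.1‖ fb) * (M k.1 * energyOp (shiftE ‖k.1‖ fb))) (D k)
      (energyOp fc) (energyOp fb * (R * energyOp fb)) (H - energyOp ft)
    have e' := feshbach_ring_resolvent (energyOp (shiftE ‖k.1‖ fb)) (M k.1) (D k)
      (energyOp fb) R
    refine Eq.trans ?_ e
    simp only [zero_add, sub_zero, mul_zero, zero_mul, add_zero] at e' ⊢
    rw [e']
  · intro q q' hq hq' hqq
    have h1 := (hM q hq).1
    have h2 := (hM q' hq').2
    have h3 := sM.proj_right q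
    have h4 := sM.proj_left q'
    simp only [hqq] at h1 h2 h3 h4 ⊢
    have := feshbach_ring_diff (t := energyOp (shiftE ‖q'‖ ft)) (c := energyOp (shiftE ‖q'‖ fc))
      h1 h2 h3 h4
    refine this.trans ?_
    rw [sub_sub_sub_cancel_right]

end

section
lemma energySymbol_of_continuous {B : ℝ} {f : ℝ → ℂ} (hf : Continuous f)
    (h : ∀ r, 0 ≤ r → r ≤ 1 → ‖f r‖ ≤ B) : EnergySymbol B f where
  meas := hf.measurable
  bound := h
  left _ := hf.continuousWithinAt
  cont := ⟨1, one_pos, fun _ _ => hf.continuousAt⟩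

lemma energySymbol_affine (α β : ℂ) : EnergySymbol (‖α‖ + ‖β‖) fun r => α * r + β := by
  refine energySymbol_of_continuous (by fun_prop) fun r h0 h1 => (norm_add_le _ _).trans ?_
  refine add_le_add ?_ le_rfl
  rw [norm_mul, norm_real, norm_of_nonneg h0]
  exact mul_le_of_le_one_right (norm_nonneg _) h1

lemma SmoothCutoff.chi_le_one (C : SmoothCutoff) (x : ℝ) : C.chi x ≤ 1 := by
  nlinarith [C.sq_add_sq x, C.chi_nonneg x, C.chibar_nonneg x]

lemma SmoothCutoff.chibar_le_one (C : SmoothCutoff) (x : ℝ) : C.chibar x ≤ 1 := by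
  nlinarith [C.sq_add_sq x, C.chi_nonneg x, C.chibar_nonneg x]

lemma SmoothCutoff.chibar_ne_zero_iff (C : SmoothCutoff) {x : ℝ} (hx : 0 ≤ x) :
    C.chibar x ≠ 0 ↔ 2 / 3 < x := by
  constructor
  · intro h
    by_contra h'
    have := C.sq_add_sq x
    rw [C.chi_eq_one x ⟨hx, not_lt.1 h'⟩] at this
    exact h (pow_eq_zero_iff two_ne_zero |>.1 (by linarith))
  · intro h h'
    have h1 := C.sq_add_sq x
    rw [h', zero_pow two_ne_zero, add_zero] at h1
    rcases le_total 1 x with h2 | h2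
    · rw [C.chi_eq_zero x h2] at h1; norm_num at h1
    · have h3 := C.chi_strictAnti ⟨le_rfl, by norm_num⟩ ⟨h.le, h2⟩ h
      rw [C.chi_eq_one _ ⟨by norm_num, le_rfl⟩] at h3
      nlinarith [C.chi_nonneg x]

lemma energySymbol_chi (C : SmoothCutoff) (ρ : ℝ) :
    EnergySymbol 1 fun r => (C.chi (r / ρ) : ℂ) := by
  refine energySymbol_of_continuous ?_ fun r _ _ => ?_
  · exact Complex.continuous_ofReal.comp (C.chi_smooth.continuous.comp (continuous_id.div_const ρ))
  · rw [norm_real, norm_of_nonneg (C.chi_nonneg _)]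
    exact C.chi_le_one _

lemma energySymbol_chibar (C : SmoothCutoff) (ρ : ℝ) :
    EnergySymbol 1 fun r => (C.chibar (r / ρ) : ℂ) := by
  refine energySymbol_of_continuous ?_ fun r _ _ => ?_
  · exact Complex.continuous_ofReal.comp
      (C.chibar_smooth.continuous.comp (continuous_id.div_const ρ))
  · rw [norm_real, norm_of_nonneg (C.chibar_nonneg _)]
    exact C.chibar_le_one _

lemma energySymbol_step {B : ℝ} {f : ℝ → ℂ} (hf : Continuous f)
    (h : ∀ r, 0 ≤ r → r ≤ 1 → ‖f r‖ ≤ B) {c : ℝ} (hc : 0 < c) :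
    EnergySymbol (B + 1) fun r => if r ≤ c then 1 else f r where
  meas := Measurable.ite measurableSet_Iic measurable_const hf.measurable
  bound r h0 h1 := by
    have := h r h0 h1
    have := norm_nonneg (f r)
    split_ifs
    · rw [norm_one]; linarith
    · linarith
  left r := by
    by_cases hr : r ≤ c
    · have : ContinuousWithinAt (fun _ : ℝ => (1 : ℂ)) (Set.Iic r) r := continuousWithinAt_const
      refine this.congr (fun y hy => if_pos (le_trans hy hr)) (if_pos hr)
    · have : ContinuousAt (fun r => if r ≤ c then 1 else f r) r := by
        refine hf.continuousAt.congr ?_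
        filter_upwards [lt_mem_nhds (not_le.1 hr)] with y hy
        rw [if_neg (not_le.2 hy)]
      exact this.continuousWithinAt
  cont := by
    refine ⟨c, hc, fun r hr => ?_⟩
    rcases lt_or_gt_of_ne hr with h | h
    · refine (continuousAt_const (y := (1 : ℂ))).congr ?_
      filter_upwards [gt_mem_nhds h] with y hy
      rw [if_pos (le_of_lt hy)]
    · refine hf.continuousAt.congr ?_
      filter_upwards [lt_mem_nhds h] with y hy
      rw [if_neg (not_le.2 hy)]

/-- The relation between an operator `H` with a pull-through formula and its image `F` under the
smooth Feshbach map, with `Y`, `Z` the auxiliary operators of the Feshbach pair. -/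
structure FeshbachPair (T : Momentum → Op) (D : Photon → Op) (F : Op) (FT : Momentum → Op)
    (Y₀ : Op) (Y : Momentum → Op) (Z₀ : Op) (Z : Momentum → Op) : Prop where
  soft : Soft F FT fun k => Y k.1 * D k * Z₀
  left : ∃ DY, Soft Y₀ Y DY
  right : ∃ DZ, Soft Z₀ Z DZ
  diff : ∀ q q', q ≠ 0 → q' ≠ 0 → ‖q‖ = ‖q'‖ → FT q - FT q' = Y q * (T q - T q') * Z q'

lemma restricted_inverse_ring {R : Type*} [Ring R] {t h w b p r : R} (hpp : p * p = p)
    (hbp : b * p = b) (hpb : p * b = b) (hhp : h = p * t * p + (1 - p)) (hpr : p * r = r)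
    (hrp : r * p = r) (hl : p * (t + b * w * b) * r = p) (hr : r * (t + b * w * b) * p = p) :
    (r + (1 - p)) * (h + b * (w * b)) = 1 ∧ (h + b * (w * b)) * (r + (1 - p)) = 1 := by
  have e : h + b * (w * b) = p * (t + b * w * b) * p + (1 - p) := by
    rw [hhp, mul_add, add_mul, mul_assoc b w b, ← mul_assoc p b (w * b), hpb, mul_assoc b (w * b) p,
      mul_assoc w b p, hbp]
    abel
  have e1 : (1 - p) * p = 0 := by rw [sub_mul, one_mul, hpp, sub_self]
  have e2 : p * (1 - p) = 0 := by rw [mul_sub, mul_one, hpp, sub_self]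
  have e3 : r * (1 - p) = 0 := by rw [mul_sub, mul_one, hrp, sub_self]
  have e4 : (1 - p) * r = 0 := by rw [sub_mul, one_mul, hpr, sub_self]
  have e5 : (1 - p) * (1 - p) = 1 - p := by rw [mul_sub, mul_one, e1, sub_zero]
  rw [e]
  constructor
  · have : (r + (1 - p)) * (p * (t + b * w * b) * p + (1 - p)) =
      (r * p) * (t + b * w * b) * p + r * (1 - p) + ((1 - p) * p) * (t + b * w * b) * p +
        (1 - p) * (1 - p) := by noncomm_ring
    rw [this, hrp, hr, e3, e1, e5]; noncomm_ring
  · have : (p * (t + b * w * b) * p + (1 - p)) * (r + (1 - p)) =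
      p * (t + b * w * b) * (p * r) + p * (t + b * w * b) * (p * (1 - p)) + (1 - p) * r +
        (1 - p) * (1 - p) := by noncomm_ring
    rw [this, hpr, hl, e2, e4, e5]; noncomm_ring

lemma feshbach_ring_eq {R : Type*} [Ring R] {t w c b p r : R} (hbp : b * p = b) :
    t + c * (w * c) - c * (w * (b * ((r + (1 - p)) * b) * (w * c))) =
      t + c * w * c - c * w * b * r * b * w * c := by
  have e : b * (1 - p) = 0 := by rw [mul_sub, mul_one, hbp, sub_self]
  have : t + c * (w * c) - c * (w * (b * ((r + (1 - p)) * b) * (w * c))) =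
      t + c * w * c - c * w * b * r * b * w * c - c * w * (b * (1 - p)) * b * w * c := by
    noncomm_ring
  rw [this, e]; noncomm_ring

section

variable (C : SmoothCutoff) {ρ : ℝ} (hρ : 0 < ρ)

/-- The projection onto the closure of the range of `χ̄₁(H_f / ρ)`. -/
def barProj (C : SmoothCutoff) (ρ : ℝ) : Op :=
  energyOp (Set.indicator {r | C.chibar (r / ρ) ≠ 0} 1)

lemma efun_barProj : EFun 1 (Set.indicator {r | C.chibar (r / ρ) ≠ 0} 1) where
  meas := by
    refine measurable_one.indicator ?_
    have : Measurable fun r : ℝ => C.chibar (r / ρ) :=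
      (C.chibar_smooth.continuous.comp (continuous_id.div_const ρ)).measurable
    exact this (measurableSet_singleton 0).compl
  bound r _ _ := by
    rw [Set.indicator_apply]; split_ifs <;> simp

theorem Soft.feshbachPair (hρ : 0 < ρ) {H : Op} {T : Momentum → Op} {D : Photon → Op} (hH : Soft H T D)
    (α β : ℂ) {R : Op}
    (hR : IsRestrictedInverse (barProj C ρ) (energyOp (fun r => α * r + β) +
      energyOp (fun r => (C.chibar (r / ρ) : ℂ)) * (H - energyOp fun r => α * r + β) *
        energyOp (fun r => (C.chibar (r / ρ) : ℂ))) R) :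
    ∃ (FT : Momentum → Op) (Y₀ : Op) (Y : Momentum → Op) (Z₀ : Op) (Z : Momentum → Op),
      FeshbachPair T D (SoftPhoton.feshbach (energyOp fun r => α * r + β) (H - energyOp fun r => α * r + β)
        (energyOp fun r => (C.chi (r / ρ) : ℂ)) (energyOp fun r => (C.chibar (r / ρ) : ℂ)) R)
        FT Y₀ Y Z₀ Z := by
  have st := energySymbol_affine α β
  have sh := energySymbol_step (f := fun r => α * r + β) (by fun_prop) st.bound
    (c := 2 * ρ / 3) (by positivity)
  have sc := energySymbol_chi C ρ
  have sb := energySymbol_chibar C ρ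
  have sp := efun_barProj C (ρ := ρ)
  have hsupp : ∀ r : ℝ, 0 ≤ r → (C.chibar (r / ρ) ≠ 0 ↔ ¬ r ≤ 2 * ρ / 3) := fun r hr => by
    rw [C.chibar_ne_zero_iff (by positivity), lt_div_iff₀ hρ, not_le]
    constructor <;> intro h <;> linarith
  have hpp : barProj C ρ * barProj C ρ = barProj C ρ :=
    energyOp_mul sp sp sp fun r _ _ => by
      simp only [Set.indicator_apply]; split_ifs <;> simp
  have hbp : energyOp (fun r => (C.chibar (r / ρ) : ℂ)) * barProj C ρ =
      energyOp (fun r => (C.chibar (r / ρ) : ℂ)) :=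
    energyOp_mul sb.toEFun sp sb.toEFun fun r _ _ => by
      simp only [Set.indicator_apply, Set.mem_ofPred_eq]; split_ifs with h
      · simp
      · rw [not_not] at h; simp [h]
  have hpb : barProj C ρ * energyOp (fun r => (C.chibar (r / ρ) : ℂ)) =
      energyOp (fun r => (C.chibar (r / ρ) : ℂ)) :=
    energyOp_mul sp sb.toEFun sb.toEFun fun r _ _ => by
      simp only [Set.indicator_apply, Set.mem_ofPred_eq]; split_ifs with h
      · simp
      · rw [not_not] at h; simp [h]
  have hhp : energyOp (fun r => if r ≤ 2 * ρ / 3 then 1 else α * r + β) =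
      barProj C ρ * energyOp (fun r => α * r + β) * barProj C ρ + (1 - barProj C ρ) := by
    have sn : EFun 1 (fun r => if r ≤ 2 * ρ / 3 then (1 : ℂ) else 0) := efun_indicator _
    have s1 : EFun (‖α‖ + ‖β‖) (fun r => if r ≤ 2 * ρ / 3 then 0 else α * r + β) :=
      ⟨Measurable.ite measurableSet_Iic measurable_const st.meas, fun r h0 h1 => by
        split_ifs
        · rw [norm_zero]; positivity
        · exact st.bound r h0 h1⟩
    have e1 : barProj C ρ * energyOp (fun r => α * r + β) =
        energyOp (fun r => if r ≤ 2 * ρ / 3 then 0 else α * r + β) :=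
      energyOp_mul sp st.toEFun s1 fun r h0 _ => by
        simp only [Set.indicator_apply, Set.mem_ofPred_eq, hsupp r h0]
        split_ifs <;> simp
    have e2 : energyOp (fun r => if r ≤ 2 * ρ / 3 then 0 else α * r + β) * barProj C ρ =
        energyOp (fun r => if r ≤ 2 * ρ / 3 then 0 else α * r + β) :=
      energyOp_mul s1 sp s1 fun r h0 _ => by
        simp only [Set.indicator_apply, Set.mem_ofPred_eq, hsupp r h0]
        split_ifs <;> simp
    have e3 : barProj C ρ + energyOp (fun r => if r ≤ 2 * ρ / 3 then (1 : ℂ) else 0) = 1 := by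
      rw [← energyOp_one]
      exact energyOp_add sp sn efun_one fun r h0 _ => by
        simp only [Set.indicator_apply, Set.mem_ofPred_eq, hsupp r h0]
        split_ifs <;> simp
    have e4 : energyOp (fun r => if r ≤ 2 * ρ / 3 then 0 else α * r + β) +
        energyOp (fun r => if r ≤ 2 * ρ / 3 then (1 : ℂ) else 0) =
        energyOp (fun r => if r ≤ 2 * ρ / 3 then 1 else α * r + β) :=
      energyOp_add s1 sn sh.toEFun fun r h0 _ => by
        split_ifs <;> simp
    rw [e1, e2, ← e4, ← e3, add_sub_cancel_left]
  obtain ⟨h1, h2⟩ := restricted_inverse_ring hpp hbp hpb hhp hR.left hR.right hR.mul_left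
    hR.mul_right
  obtain ⟨F, Y, Z, DY, DZ, sF, sY, sZ, hd⟩ := hH.feshbach st sh sc sb h1 h2
  exact ⟨F, _, Y, _, Z, sF.congr (feshbach_ring_eq hbp) rfl rfl, ⟨DY, sY⟩, ⟨DZ, sZ⟩, hd⟩

lemma adj_feshbach (t w c b r : Op) (hc : adj c = c) (hb : adj b = b) :
    adj (feshbach t w c b r) = feshbach (adj t) (adj w) c b (adj r) := by
  simp only [feshbach, adj_sub, adj_add, adj_mul, hc, hb]
  noncomm_ring

lemma adj_real_energyOp {f : ℝ → ℝ} (hf : EFun 1 fun r => (f r : ℂ)) :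
    adj (energyOp fun r => (f r : ℂ)) = energyOp fun r => (f r : ℂ) := by
  rw [adjoint_energyOp hf]
  simp only [conj_ofReal]

lemma adj_affine (α β : ℂ) : adj (energyOp fun r => α * r + β) =
    energyOp fun r => conj α * r + conj β := by
  rw [adjoint_energyOp (energySymbol_affine α β).toEFun]
  simp only [map_add, map_mul, conj_ofReal]

lemma IsRestrictedInverse.adj {p t w b r : Op} (hp : adj p = p) (hb : adj b = b)
    (h : IsRestrictedInverse p (t + b * w * b) r) :
    IsRestrictedInverse p (adj t + b * adj w * b) (adj r) := by
  have e : adj t + b * adj w * b = adj (t + b * w * b) := by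
    rw [adj_add, adj_mul, adj_mul, hb, mul_assoc]
  rw [e]
  constructor
  · have := congrArg (fun X : Op => adj X) h.right
    simpa only [adj_mul, hp] using this
  · have := congrArg (fun X : Op => adj X) h.left
    simpa only [adj_mul, hp] using this
  · have := congrArg (fun X : Op => adj X) h.mul_right
    simpa only [adj_mul, hp, mul_assoc] using this
  · have := congrArg (fun X : Op => adj X) h.mul_left
    simpa only [adj_mul, hp, mul_assoc] using this

lemma adj_barProj : adj (barProj C ρ) = barProj C ρ := by
  rw [barProj, adjoint_energyOp (efun_barProj C)]
  congr 1
  funext r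
  rw [Set.indicator_apply]; split_ifs <;> simp

lemma feshbach_comm_eproj (hρ : 0 < ρ) (α β : ℂ) (w b r : Op) :
    feshbach (energyOp fun r => α * r + β) w (energyOp fun r => (C.chi (r / ρ) : ℂ)) b r *
      eproj ρ = eproj ρ *
    feshbach (energyOp fun r => α * r + β) w (energyOp fun r => (C.chi (r / ρ) : ℂ)) b r := by
  have st := (energySymbol_affine α β).toEFun
  have sc := (energySymbol_chi C ρ).toEFun
  have s1 : EFun (‖α‖ + ‖β‖) (fun r => if r ≤ ρ then α * r + β else 0) :=
    ⟨Measurable.ite measurableSet_Iic st.meas measurable_const, fun r h0 h1 => by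
      split_ifs
      · exact st.bound r h0 h1
      · rw [norm_zero]; positivity⟩
  have e1 : energyOp (fun r => α * r + β) * eproj ρ = eproj ρ * energyOp fun r => α * r + β := by
    rw [eproj, energyOp_mul st (efun_indicator ρ) s1 fun r _ _ => by split_ifs <;> simp,
      energyOp_mul (efun_indicator ρ) st s1 fun r _ _ => by split_ifs <;> simp]
  have hz : ∀ r, ¬ r ≤ ρ → C.chi (r / ρ) = 0 := fun r hr =>
    C.chi_eq_zero _ ((one_le_div hρ).2 (not_le.1 hr).le)
  have e2 : energyOp (fun r => (C.chi (r / ρ) : ℂ)) * eproj ρ =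
      energyOp fun r => (C.chi (r / ρ) : ℂ) :=
    energyOp_mul sc (efun_indicator ρ) sc fun r _ _ => by
      split_ifs with h
      · simp
      · simp [hz r h]
  have e3 : eproj ρ * energyOp (fun r => (C.chi (r / ρ) : ℂ)) =
      energyOp fun r => (C.chi (r / ρ) : ℂ) :=
    energyOp_mul (efun_indicator ρ) sc sc fun r _ _ => by
      split_ifs with h
      · simp
      · simp [hz r h]
  simp only [feshbach, add_mul, sub_mul, mul_add, mul_sub, mul_assoc, e1, e2]
  simp only [← mul_assoc, e3]

end

end

section
/-! ### Dilations -/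

/-- Dilation of the momentum of a photon. -/
def scale (a : ℝ) (k : Photon) : Photon := (a • k.1, k.2)

lemma scale_scale (a b : ℝ) (k : Photon) : scale a (scale b k) = scale (a * b) k := by
  simp [scale, smul_smul]

lemma scale_one (k : Photon) : scale 1 k = k := by simp [scale]

lemma measurable_scale (a : ℝ) : Measurable (scale a) :=
  (measurable_fst.const_smul a).prodMk measurable_snd

/-- Dilation of a configuration. -/
def scaleConfig (a : ℝ) (x : Config) : Config := ⟨x.1, fun i => scale a (x.2 i)⟩

lemma bag_scaleConfig (a : ℝ) (x : Config) :
    bag (scaleConfig a x) = (bag x).map (scale a) := by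
  rw [bag, bag, Multiset.map_map]; rfl

lemma mEnergy_map_scale {a : ℝ} (ha : 0 ≤ a) (s : Bag) :
    mEnergy (s.map (scale a)) = a * mEnergy s := by
  simp only [mEnergy, Multiset.map_map, Function.comp_def, scale, norm_smul, norm_of_nonneg ha]
  rw [Multiset.sum_map_mul_left]

lemma measurable_scaleConfig (a : ℝ) : Measurable (scaleConfig a) :=
  measurable_config fun n => (measurable_inSector n).comp
    (measurable_pi_lambda _ fun i => (measurable_scale a).comp (measurable_pi_apply i))

lemma map_scale_photonMeasure {a : ℝ} (ha : 0 < a) :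
    photonMeasure.map (scale a) = ofReal (a ^ 3)⁻¹ • photonMeasure := by
  have h1 : scale a = Prod.map (fun p : Momentum => a • p) (id : Bool → Bool) := rfl
  rw [h1, photonMeasure, ← Measure.map_prod_map _ _ (measurable_const_smul a) measurable_id,
    Measure.map_addHaar_smul _ ha.ne', Measure.map_id, Measure.prod_smul_left]
  rw [finrank_euclideanSpace_fin, abs_of_pos (by positivity)]

lemma map_scale_photonMeasureN {a : ℝ} (ha : 0 < a) (n : ℕ) :
    (photonMeasureN n).map (fun q i => scale a (q i)) =
      ofReal ((a ^ 3)⁻¹ ^ n) • photonMeasureN n := by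
  have hm : Measurable fun (q : Tuple n) i => scale a (q i) :=
    measurable_pi_lambda _ fun i => (measurable_scale a).comp (measurable_pi_apply i)
  have h3 : (0 : ℝ) < a ^ 3 := by positivity
  have h : photonMeasureN n = ofReal ((a ^ 3) ^ n) •
      (photonMeasureN n).map (fun q i => scale a (q i)) := by
    refine Measure.pi_eq fun s hs => ?_
    rw [Measure.smul_apply, Measure.map_apply hm (MeasurableSet.univ_pi hs)]
    have e : (fun (q : Tuple n) i => scale a (q i)) ⁻¹' Set.univ.pi s =
        Set.univ.pi fun i => scale a ⁻¹' s i := by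
      ext q; simp
    have e2 : ∀ i, photonMeasure (scale a ⁻¹' s i) =
        ofReal (a ^ 3)⁻¹ * photonMeasure (s i) := fun i => by
      rw [← Measure.map_apply (measurable_scale a) (hs i), map_scale_photonMeasure ha]
      rfl
    rw [e, photonMeasureN, Measure.pi_pi]
    simp only [e2, Finset.prod_mul_distrib, Finset.prod_const, Finset.card_univ, Fintype.card_fin]
    rw [smul_eq_mul, ← mul_assoc, ENNReal.ofReal_pow h3.le, ← mul_pow, ← ENNReal.ofReal_mul h3.le,
      mul_inv_cancel₀ h3.ne', ENNReal.ofReal_one, one_pow, one_mul]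
  conv_rhs => rw [h]
  rw [smul_smul, ← ENNReal.ofReal_mul (by positivity), ← mul_pow, inv_mul_cancel₀ h3.ne', one_pow,
    ENNReal.ofReal_one, one_smul]

lemma lintegral_scaleConfig {a : ℝ} (ha : 0 < a) {f : Config → ℝ≥0∞} (hf : Measurable f) :
    ∫⁻ x, ofReal ((a ^ 3) ^ x.1) * f (scaleConfig a x) ∂fockMeasure =
      ∫⁻ x, f x ∂fockMeasure := by
  have hc : Measurable fun x : Config => ofReal ((a ^ 3) ^ x.1) :=
    (measurable_from_top (f := fun n : ℕ => ofReal ((a ^ 3) ^ n))).comp measurable_card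
  have hm' : Measurable fun x => ofReal ((a ^ 3) ^ x.1) * f (scaleConfig a x) :=
    hc.mul (hf.comp (measurable_scaleConfig a))
  rw [lintegral_fockMeasure hm',
    lintegral_fockMeasure hf]
  refine tsum_congr fun n => ?_
  congr 1
  have hm : Measurable fun (q : Tuple n) i => scale a (q i) :=
    measurable_pi_lambda _ fun i => (measurable_scale a).comp (measurable_pi_apply i)
  have hfn : Measurable fun q => f (inSector n q) := hf.comp (measurable_inSector n)
  have h3 : (0 : ℝ) < a ^ 3 := by positivity
  change ∫⁻ q, ofReal ((a ^ 3) ^ n) * f (inSector n fun i => scale a (q i))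
    ∂photonMeasureN n = _
  have hfm : Measurable fun q : Tuple n => f (inSector n fun i => scale a (q i)) :=
    hfn.comp hm
  rw [lintegral_const_mul _ hfm, ← lintegral_map hfn hm, map_scale_photonMeasureN ha,
    lintegral_smul_measure, smul_eq_mul, ← mul_assoc, ← ENNReal.ofReal_mul (by positivity), ← mul_pow,
    mul_inv_cancel₀ h3.ne', one_pow, ENNReal.ofReal_one, one_mul]

lemma ae_scaleConfig {a : ℝ} (ha : 0 < a) {p : Config → Prop} (h : ∀ᵐ x ∂fockMeasure, p x) :
    ∀ᵐ x ∂fockMeasure, p (scaleConfig a x) := by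
  rw [ae_fockMeasure_iff] at h ⊢
  intro n
  have hm : Measurable fun (q : Tuple n) i => scale a (q i) :=
    measurable_pi_lambda _ fun i => (measurable_scale a).comp (measurable_pi_apply i)
  have hq : Measure.QuasiMeasurePreserving (fun (q : Tuple n) i => scale a (q i))
      (photonMeasureN n) (photonMeasureN n) := ⟨hm, by
    rw [map_scale_photonMeasureN ha]; exact Measure.smul_absolutelyContinuous⟩
  exact hq.ae (h n)

lemma ae_scale {a : ℝ} (ha : 0 < a) {p : Photon → Prop} (h : ∀ᵐ k ∂photonMeasure, p k) :
    ∀ᵐ k ∂photonMeasure, p (scale a k) := by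
  have hq : Measure.QuasiMeasurePreserving (scale a) photonMeasure photonMeasure :=
    ⟨measurable_scale a, by
      rw [map_scale_photonMeasure ha]; exact Measure.smul_absolutelyContinuous⟩
  exact hq.ae h

/-- The dilation of a symmetric function, with the weight that preserves the norm. -/
def dilFun (a : ℝ) (Ψ : Bag → ℂ) (s : Bag) : ℂ :=
  ((a ^ (3 / 2 : ℝ)) ^ s.card : ℝ) * Ψ (s.map (scale a))

lemma rpow_three_halves_sq {a : ℝ} (ha : 0 < a) : (a ^ (3 / 2 : ℝ)) ^ 2 = a ^ 3 := by
  rw [← Real.rpow_natCast (a ^ (3 / 2 : ℝ)), ← Real.rpow_mul ha.le]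
  norm_num

lemma lintegral_dilFun {a : ℝ} (ha : 0 < a) {Ψ : Bag → ℂ}
    (hΨ : Measurable fun x => Ψ (bag x)) :
    ∫⁻ x, ‖dilFun a Ψ (bag x)‖ₑ ^ 2 ∂fockMeasure =
      ∫⁻ x, ‖Ψ (bag x)‖ₑ ^ 2 ∂fockMeasure := by
  rw [← lintegral_scaleConfig ha (hΨ.enorm.pow_const 2)]
  refine lintegral_congr fun x => ?_
  rw [dilFun, bag_scaleConfig, enorm_mul, mul_pow, card_bag]
  congr 1
  have : (0 : ℝ) ≤ (a ^ (3 / 2 : ℝ)) ^ x.1 := by positivity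
  rw [← ofReal_norm, norm_real, norm_of_nonneg this,
    ← ENNReal.ofReal_pow this, ← pow_mul, mul_comm, pow_mul, rpow_three_halves_sq ha]

lemma measurable_dilFun {a : ℝ} {Ψ : Bag → ℂ}
    (hΨ : Measurable fun x => Ψ (bag x)) : Measurable fun x => dilFun a Ψ (bag x) := by
  have hc : Measurable fun x : Config => (((a ^ (3 / 2 : ℝ)) ^ x.1 : ℝ) : ℂ) :=
    (measurable_from_top (f := fun n : ℕ => (((a ^ (3 / 2 : ℝ)) ^ n : ℝ) : ℂ))).comp measurable_card
  have h : Measurable fun x => (((a ^ (3 / 2 : ℝ)) ^ x.1 : ℝ) : ℂ) *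
      Ψ (bag (scaleConfig a x)) := hc.mul (hΨ.comp (measurable_scaleConfig a))
  simpa only [bag_scaleConfig, dilFun, card_bag] using h

lemma isAdm_dilFun {a : ℝ} (ha : 0 < a) {Ψ : Bag → ℂ} (hΨ : IsAdm Ψ)
    (hs : ∀ s, a < mEnergy s → Ψ s = 0) : IsAdm (dilFun a Ψ) where
  meas := measurable_dilFun hΨ.meas
  supp s h := by
    rw [dilFun, hs, mul_zero]
    rw [mEnergy_map_scale ha.le]
    exact lt_mul_of_one_lt_right ha h
  sq := by rw [lintegral_dilFun ha hΨ.meas]; exact hΨ.sq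

lemma dilFun_dilFun {a b : ℝ} (ha : 0 < a) (hb : 0 < b) (hab : a * b = 1)
    (Ψ : Bag → ℂ) (s : Bag) : dilFun a (dilFun b Ψ) s = Ψ s := by
  have e : scale b ∘ scale a = id := by
    funext k; rw [Function.comp_apply, scale_scale, mul_comm, hab, scale_one]; rfl
  rw [dilFun, dilFun, Multiset.map_map, e, Multiset.map_id, Multiset.card_map, ← mul_assoc,
    ← Complex.ofReal_mul, ← mul_pow, ← Real.mul_rpow ha.le hb.le, hab, Real.one_rpow, one_pow,
    Complex.ofReal_one, one_mul]

lemma dilFun_cons (a : ℝ) (Ψ : Bag → ℂ) (k : Photon) (s : Bag) :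
    dilFun a Ψ (k ::ₘ s) =
      ((a ^ (3 / 2 : ℝ) : ℝ) : ℂ) * dilFun a (fun s => Ψ (scale a k ::ₘ s)) s := by
  rw [dilFun, dilFun, Multiset.map_cons, Multiset.card_cons, pow_succ']
  push_cast; ring

section

variable {ρ : ℝ}

/-- The isometry `U_ρ^*` from `H_f ≤ 1` onto `H_f ≤ ρ`. -/
def dilate (ρ : ℝ) (ψ : FockOne) : FockOne := ofFun (dilFun ρ⁻¹ (rep ψ))

lemma isAdm_dilate (h0 : 0 < ρ) (h1 : ρ < 1) (ψ : FockOne) : IsAdm (dilFun ρ⁻¹ (rep ψ)) :=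
  isAdm_dilFun (inv_pos.2 h0) (rep_adm ψ) fun s hs =>
    rep_supp ψ s (((one_lt_inv₀ h0).2 h1).trans hs)

lemma rep_dilate (h0 : 0 < ρ) (h1 : ρ < 1) (ψ : FockOne) : ∀ᵐ x ∂fockMeasure,
    rep (dilate ρ ψ) (bag x) = dilFun ρ⁻¹ (rep ψ) (bag x) :=
  rep_ofFun (isAdm_dilate h0 h1 ψ)

lemma ae_dilFun {a : ℝ} (ha : 0 < a) {Φ Ψ : Bag → ℂ}
    (h : ∀ᵐ x ∂fockMeasure, Φ (bag x) = Ψ (bag x)) :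
    ∀ᵐ x ∂fockMeasure, dilFun a Φ (bag x) = dilFun a Ψ (bag x) := by
  filter_upwards [ae_scaleConfig ha h] with x hx
  rw [bag_scaleConfig] at hx
  rw [dilFun, dilFun, hx]

lemma norm_dilate (h0 : 0 < ρ) (h1 : ρ < 1) (ψ : FockOne) : ‖dilate ρ ψ‖ = ‖ψ‖ := by
  have e : ‖dilate ρ ψ‖ₑ ^ 2 = ‖ψ‖ₑ ^ 2 := by
    rw [enorm_sq_eq, enorm_sq_eq, ← lintegral_dilFun (inv_pos.2 h0) (rep_adm ψ).meas]
    refine lintegral_congr_ae ?_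
    filter_upwards [rep_dilate h0 h1 ψ] with x hx
    rw [hx]
  have e2 := (ENNReal.pow_right_strictMono two_ne_zero).injective e
  have e3 := congrArg ENNReal.toReal e2
  rwa [toReal_enorm, toReal_enorm] at e3

lemma dilate_add (h0 : 0 < ρ) (h1 : ρ < 1) (φ ψ : FockOne) :
    dilate ρ (φ + ψ) = dilate ρ φ + dilate ρ ψ := by
  refine rep_ext ?_
  have h := ae_scaleConfig (inv_pos.2 h0) (rep_add φ ψ)
  filter_upwards [rep_dilate h0 h1 (φ + ψ), rep_dilate h0 h1 φ, rep_dilate h0 h1 ψ,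
    rep_add (dilate ρ φ) (dilate ρ ψ), h] with x a b c d e
  rw [bag_scaleConfig] at e
  rw [a, d, b, c, dilFun, dilFun, dilFun, e, mul_add]

lemma dilate_smul (h0 : 0 < ρ) (h1 : ρ < 1) (z : ℂ) (ψ : FockOne) :
    dilate ρ (z • ψ) = z • dilate ρ ψ := by
  refine rep_ext ?_
  have h := ae_scaleConfig (inv_pos.2 h0) (rep_smul z ψ)
  filter_upwards [rep_dilate h0 h1 (z • ψ), rep_dilate h0 h1 ψ, rep_smul z (dilate ρ ψ), h]
    with x a b d e
  rw [bag_scaleConfig] at e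
  rw [a, d, b, dilFun, dilFun, e]; ring

/-- `U_ρ^*` as a linear isometry. -/
def dilIso (h0 : 0 < ρ) (h1 : ρ < 1) : FockOne →ₗᵢ[ℂ] FockOne where
  toFun := dilate ρ
  map_add' := dilate_add h0 h1
  map_smul' := dilate_smul h0 h1
  norm_map' := norm_dilate h0 h1

/-- The operator `U_ρ^*`. -/
def dilOp (h0 : 0 < ρ) (h1 : ρ < 1) : Op := (dilIso h0 h1).toContinuousLinearMap

lemma adj_dilOp_mul (h0 : 0 < ρ) (h1 : ρ < 1) : adj (dilOp h0 h1) * dilOp h0 h1 = 1 := by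
  refine ContinuousLinearMap.ext fun ψ => ext_inner_left ℂ fun φ => ?_
  have e : inner ℂ φ (adj (dilOp h0 h1) (dilOp h0 h1 ψ)) =
      inner ℂ (dilOp h0 h1 φ) (dilOp h0 h1 ψ) := adjoint_inner_r _ _ _
  exact e.trans ((dilIso h0 h1).inner_map_map φ ψ)

lemma energyLE_dilate (h0 : 0 < ρ) (h1 : ρ < 1) {b : ℝ} {ψ : FockOne} (h : EnergyLE b ψ) :
    EnergyLE (ρ * b) (dilate ρ ψ) := by
  filter_upwards [rep_dilate h0 h1 ψ, ae_scaleConfig (inv_pos.2 h0) h] with x a b hb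
  rw [bag_scaleConfig, mEnergy_map_scale (inv_pos.2 h0).le] at b
  rw [a, dilFun, b, mul_zero]
  rwa [inv_mul_eq_div, lt_div_iff₀' h0]

lemma exists_dilate (h0 : 0 < ρ) (h1 : ρ < 1) {b : ℝ} (hb : b ≤ 1) {ψ : FockOne}
    (h : EnergyLE (ρ * b) ψ) : ∃ φ, dilate ρ φ = ψ ∧ EnergyLE b φ := by
  let Ψ : Bag → ℂ := fun s => (if mEnergy s ≤ ρ * b then 1 else 0) * rep ψ s
  have hΨ : IsAdm Ψ := (efun_indicator (ρ * b)).adm (rep_adm ψ)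
  have ha := isAdm_dilFun h0 hΨ fun s hs => by
    have : ¬ mEnergy s ≤ ρ * b := not_le.2 (lt_of_le_of_lt (mul_le_of_le_one_right h0.le hb) hs)
    simp only [Ψ, if_neg this, zero_mul]
  refine ⟨ofFun (dilFun ρ Ψ), rep_ext ?_, ?_⟩
  · filter_upwards [rep_dilate h0 h1 (ofFun (dilFun ρ Ψ)), ae_dilFun (inv_pos.2 h0) (rep_ofFun ha), h]
      with x e1 e2 e3
    rw [e1, e2, dilFun_dilFun (inv_pos.2 h0) h0 (inv_mul_cancel₀ h0.ne')]
    by_cases hx : mEnergy (bag x) ≤ ρ * b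
    · simp only [Ψ, if_pos hx, one_mul]
    · rw [e3 (not_le.1 hx)]; simp only [Ψ, if_neg hx, zero_mul]
  · filter_upwards [rep_ofFun ha] with x hx hb
    have : ¬ mEnergy ((bag x).map (scale ρ)) ≤ ρ * b := by
      rw [mEnergy_map_scale h0.le, not_le]
      exact mul_lt_mul_of_pos_left hb h0
    rw [hx, dilFun]
    simp only [Ψ, if_neg this, zero_mul, mul_zero]

lemma inner_eq_zero_of_energy {b : ℝ} {φ ψ : FockOne} (hφ : EnergyLE b φ) (hψ : eproj b ψ = 0) :
    inner ℂ φ ψ = 0 := by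
  rw [energyLE_iff] at hφ
  rw [← hφ, ← adjoint_inner_r, adjoint_eproj, hψ]
  exact inner_zero_right φ

lemma dilOp_mul_adj (h0 : 0 < ρ) (h1 : ρ < 1) : dilOp h0 h1 * adj (dilOp h0 h1) = eproj ρ := by
  refine ContinuousLinearMap.ext fun ψ => ?_
  obtain ⟨φ, hφ, -⟩ := exists_dilate h0 h1 le_rfl (ψ := eproj ρ ψ) (by
    rw [mul_one]; exact energyLE_eproj ρ ψ)
  have e1 : adj (dilOp h0 h1) (eproj ρ ψ) = φ := by
    have : adj (dilOp h0 h1) (dilOp h0 h1 φ) = φ :=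
      congrArg (fun X : Op => X φ) (adj_dilOp_mul h0 h1)
    rw [← hφ]; exact this
  have e2 : adj (dilOp h0 h1) (ψ - eproj ρ ψ) = 0 := by
    refine ext_inner_left ℂ fun η => ?_
    rw [adjoint_inner_r]
    refine (inner_eq_zero_of_energy (b := ρ) ?_ ?_).trans (inner_zero_right η).symm
    · have := energyLE_dilate h0 h1 (b := 1) (ψ := η) (.of_forall fun x hx => rep_supp η _ hx)
      rwa [mul_one] at this
    · have : eproj ρ (eproj ρ ψ) = eproj ρ ψ := congrArg (fun X : Op => X ψ) (eproj_mul_eproj ρ)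
      rw [map_sub, this, sub_self]
  have e3 : adj (dilOp h0 h1) ψ = φ := by
    rw [map_sub, sub_eq_zero] at e2
    rw [e2, e1]
  change dilOp h0 h1 (adj (dilOp h0 h1) ψ) = _
  rw [e3]; exact hφ

theorem isDilation_iff (h0 : 0 < ρ) (h1 : ρ < 1) (ψ ψ' : FockOne) :
    IsDilation ρ (wave ψ) (wave ψ') ↔ ψ = dilate ρ ψ' := by
  have hd : IsDilation ρ (wave ψ) (wave ψ') ↔ ∀ᵐ x ∂fockMeasure,
      rep ψ' (bag x) = dilFun ρ (rep ψ) (bag x) := by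
    rw [ae_fockMeasure_iff]
    refine forall_congr' fun n => ?_
    have w1 := ae_fockMeasure_iff.1 (rep_ae ψ') n
    have w2 := ae_fockMeasure_iff.1 (ae_scaleConfig h0 (rep_ae ψ)) n
    refine eventually_congr ?_
    filter_upwards [w1, w2] with q e1 e2
    have hs := sqrtFact_pos (inSector n q)
    have hs' : sqrtFact (scaleConfig ρ (inSector n q)) = sqrtFact (inSector n q) := rfl
    rw [bag_scaleConfig, hs'] at e2
    rw [e1, dilFun, e2, card_bag, ← mul_assoc,
      mul_comm (((ρ ^ (3 / 2 : ℝ)) ^ (inSector n q).1 : ℝ) : ℂ), mul_assoc,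
      mul_right_inj' (by exact_mod_cast hs.ne')]
    rw [Real.rpow_mul h0.le, Real.rpow_natCast]
    rfl
  rw [hd]
  constructor
  · intro h
    refine rep_ext ?_
    filter_upwards [rep_dilate h0 h1 ψ', ae_dilFun (inv_pos.2 h0) h] with x a b
    rw [a, b, dilFun_dilFun (inv_pos.2 h0) h0 (inv_mul_cancel₀ h0.ne')]
  · rintro rfl
    filter_upwards [ae_dilFun h0 (rep_dilate h0 h1 ψ')] with x hx
    rw [hx, dilFun_dilFun h0 (inv_pos.2 h0) (mul_inv_cancel₀ h0.ne')]

lemma IsDilated.comp_eq (h0 : 0 < ρ) (h1 : ρ < 1) {F G : Op} (h : IsDilated ρ F G) :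
    F * dilOp h0 h1 = dilOp h0 h1 * G := by
  refine ContinuousLinearMap.ext fun ψ => ?_
  have e0 : IsDilation ρ (wave (dilate ρ ψ)) (wave ψ) :=
    (isDilation_iff h0 h1 (dilate ρ ψ) ψ).2 (Eq.refl (dilate ρ ψ))
  have e := h (dilate ρ ψ) ψ e0
  exact (isDilation_iff h0 h1 _ _).1 e

theorem ann_dilate (h0 : 0 < ρ) (h1 : ρ < 1) (ψ : FockOne) : ∀ᵐ k ∂photonMeasure,
    ann k (dilate ρ ψ) = ((ρ⁻¹ ^ (3 / 2 : ℝ) : ℝ) : ℂ) • dilate ρ (ann (scale ρ⁻¹ k) ψ) := by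
  filter_upwards [rep_ann (dilate ρ ψ), ae_cons (p := fun s => rep (dilate ρ ψ) s = dilFun ρ⁻¹ (rep ψ) s) (rep_dilate h0 h1 ψ),
    ae_scale (p := fun k => ∀ᵐ x ∂fockMeasure, rep (ann k ψ) (bag x) =
      rep ψ (k ::ₘ bag x)) (inv_pos.2 h0) (rep_ann ψ)] with k a b c
  refine rep_ext ?_
  filter_upwards [a, b, rep_smul ((ρ⁻¹ ^ (3 / 2 : ℝ) : ℝ) : ℂ) (dilate ρ (ann (scale ρ⁻¹ k) ψ)),
    rep_dilate h0 h1 (ann (scale ρ⁻¹ k) ψ), ae_dilFun (Φ := rep (ann (scale ρ⁻¹ k) ψ))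
      (Ψ := fun s => rep ψ (scale ρ⁻¹ k ::ₘ s)) (inv_pos.2 h0) c] with x e1 e2 e3 e4 e5
  rw [e1, e2, e3, e4, e5, dilFun_cons]

lemma energyLE_creat {a b c : ℝ} {S : Set Photon} (hS : GoodSet c S) (hb : ∀ k ∈ S, ‖k.1‖ ≤ b)
    {ψ : FockOne} (h : EnergyLE a ψ) : EnergyLE (a + b) (creat S ψ) := by
  classical
  let G : Photon → Bag → ℝ≥0∞ := fun k u =>
    S.indicator 1 k * (if a < mEnergy u then ‖rep ψ u‖ₑ else 0)
  have hG : Measurable fun p : Photon × Config => G p.1 (bag p.2) := by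
    refine ((measurable_one.indicator hS.meas).comp measurable_fst).mul
      (Measurable.ite ?_ ((rep_adm ψ).meas.enorm.comp measurable_snd) measurable_const)
    exact measurableSet_lt measurable_const (measurable_mEnergy.comp measurable_snd)
  have h0 : ∫⁻ x, mSum G (bag x) ∂fockMeasure = 0 := by
    rw [lintegral_mSum hG, lintegral_prod _ hG.aemeasurable]
    refine (lintegral_congr fun k => ?_).trans lintegral_zero
    refine (lintegral_congr_ae ?_).trans lintegral_zero
    filter_upwards [h] with x hx
    simp only [G]
    split_ifs with h'
    · rw [hx h', enorm_zero, mul_zero]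
    · rw [mul_zero]
  rw [lintegral_eq_zero_iff (measurable_mSum hG)] at h0
  filter_upwards [h0, rep_creat hS ψ] with x hx hc hlt
  rw [hc, creatFun]
  split_ifs with hE
  swap; · rfl
  obtain ⟨n, q⟩ := x
  cases n with
  | zero =>
    have : bag (⟨0, q⟩ : Config) = 0 := by simp [bag]
    rw [this]; rfl
  | succ n =>
    have e1 : mSum G (tupleBag q) = 0 := hx
    rw [mSum_tuple, Finset.sum_eq_zero_iff] at e1
    change mSum (fun k u => S.indicator 1 k * rep ψ u) (tupleBag q) = 0
    rw [mSum_tuple]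
    refine Finset.sum_eq_zero fun i _ => ?_
    have e2 := e1 i (Finset.mem_univ i)
    by_cases hi : q i ∈ S
    · have hlt' : a + b < mEnergy (tupleBag q) := hlt
      rw [bag_removeNth i q] at hlt'
      have e3 : mEnergy (q i ::ₘ tupleBag (i.removeNth q)) =
          ‖(q i).1‖ + mEnergy (tupleBag (i.removeNth q)) := by
        rw [mEnergy, Multiset.map_cons, Multiset.sum_cons]; rfl
      have e4 : a < mEnergy (tupleBag (i.removeNth q)) := by
        have := hb _ hi
        linarith
      simp only [G, Set.indicator_of_mem hi, Pi.one_apply, one_mul, if_pos e4] at e2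
      rw [enorm_eq_zero.1 e2, mul_zero]
    · rw [Set.indicator_of_notMem hi, zero_mul]

lemma mSum_map {β : Type*} [AddCommMonoid β] (G : Photon → Bag → β)
    (f : Photon → Photon) {n : ℕ} (q : Tuple n) :
    mSum G ((tupleBag q).map f) =
      mSum (fun k u => G (f k) (u.map f)) (tupleBag q) := by
  have e : ∀ {m : ℕ} (q : Tuple m), (tupleBag q).map f = tupleBag (f ∘ q) := by
    intro m q
    exact Multiset.map_map _ _ _
  cases n with
  | zero =>
    have : tupleBag q = 0 := by simp [bag]
    rw [this]; rfl
  | succ n =>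
    rw [e, mSum_tuple, mSum_tuple]
    refine Finset.sum_congr rfl fun i _ => ?_
    rw [e]; rfl

lemma creat_dilate (h0 : 0 < ρ) (h1 : ρ < 1) {c c' : ℝ} {S S' : Set Photon} (hS : GoodSet c S)
    (hS' : GoodSet c' S') (hSS : ∀ k, scale ρ⁻¹ k ∈ S' ↔ k ∈ S) {a b : ℝ} (hab : a + b ≤ ρ)
    (hb : ∀ k ∈ S, ‖k.1‖ ≤ b) {ψ : FockOne} (hψ : EnergyLE a (dilate ρ ψ)) :
    ((ρ⁻¹ ^ (3 / 2 : ℝ) : ℝ) : ℂ) • creat S (dilate ρ ψ) = dilate ρ (creat S' ψ) := by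
  classical
  refine rep_ext ?_
  let G : Photon → Bag → ℝ≥0∞ := fun k u =>
    ‖S.indicator 1 k * (rep (dilate ρ ψ) u - dilFun ρ⁻¹ (rep ψ) u)‖ₑ
  have hG : Measurable fun p : Photon × Config => G p.1 (bag p.2) :=
    (((measurable_one.indicator hS.meas).comp measurable_fst).mul
      (((rep_adm (dilate ρ ψ)).meas.sub (isAdm_dilate h0 h1 ψ).meas).comp measurable_snd)).enorm
  have hz : ∫⁻ x, mSum G (bag x) ∂fockMeasure = 0 := by
    rw [lintegral_mSum hG, lintegral_prod _ hG.aemeasurable]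
    refine (lintegral_congr fun k => ?_).trans lintegral_zero
    refine (lintegral_congr_ae ?_).trans lintegral_zero
    filter_upwards [rep_dilate h0 h1 ψ] with x hx
    simp only [G, hx, sub_self, mul_zero, enorm_zero]
  rw [lintegral_eq_zero_iff (measurable_mSum hG)] at hz
  filter_upwards [rep_smul ((ρ⁻¹ ^ (3 / 2 : ℝ) : ℝ) : ℂ) (creat S (dilate ρ ψ)),
    rep_creat hS (dilate ρ ψ), rep_dilate h0 h1 (creat S' ψ),
    ae_dilFun (inv_pos.2 h0) (rep_creat hS' ψ), energyLE_creat hS hb hψ, hz] with x e1 e2 e3 e4 e5 e6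
  rw [e1, e3, e4]
  by_cases hx : mEnergy (bag x) ≤ ρ
  · rw [e2, dilFun, creatFun, creatFun, mEnergy_map_scale (inv_pos.2 h0).le, if_pos (hx.trans h1.le),
      if_pos (by rw [inv_mul_eq_div, div_le_one h0]; exact hx)]
    obtain ⟨n, q⟩ := x
    change _ * mSum _ (tupleBag q) = _ * mSum _ ((tupleBag q).map (scale ρ⁻¹))
    rw [mSum_map]
    cases n with
    | zero =>
      have : tupleBag q = 0 := by simp [bag]
      rw [this]
      change _ * (0 : ℂ) = _ * (0 : ℂ)
      rw [mul_zero, mul_zero]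
    | succ n =>
      have e7 : mSum G (tupleBag q) = 0 := e6
      rw [mSum_tuple, Finset.sum_eq_zero_iff] at e7
      rw [mSum_tuple, mSum_tuple, Finset.mul_sum, Finset.mul_sum]
      refine Finset.sum_congr rfl fun i _ => ?_
      have e8 := e7 i (Finset.mem_univ i)
      by_cases hi : q i ∈ S
      · simp only [G, Set.indicator_of_mem hi, Pi.one_apply, one_mul, enorm_eq_zero,
          sub_eq_zero] at e8
        rw [Set.indicator_of_mem hi, Set.indicator_of_mem ((hSS _).2 hi), e8, dilFun,
          card_bag, card_bag]
        simp only [Pi.one_apply, one_mul]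
        rw [← mul_assoc, ← Complex.ofReal_mul, ← pow_succ']
      · rw [Set.indicator_of_notMem hi, Set.indicator_of_notMem (fun h => hi ((hSS _).1 h))]
        simp only [zero_mul, mul_zero]
  · rw [e5 (lt_of_le_of_lt hab (not_le.1 hx)), mul_zero, dilFun, creatFun,
      mEnergy_map_scale (inv_pos.2 h0).le, if_neg, mul_zero]
    rw [inv_mul_eq_div, div_le_one h0]; exact hx

lemma mem_window_scale {a : ℝ} (ha : 0 < a) (k q : Photon) (j : ℕ) :
    scale a q ∈ window (scale a k) j ↔ q ∈ window k j := by
  simp only [window, Set.mem_prod, Metric.mem_closedBall, dist_eq_norm, scale]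
  rw [smul_comm, ← smul_sub, norm_smul, norm_smul, norm_of_nonneg ha.le, mul_left_comm,
    mul_le_mul_iff_right₀ ha]

lemma winVol_scale {a : ℝ} (ha : 0 < a) (k : Photon) (j : ℕ) :
    winVol (scale a k) j = a ^ 3 * winVol k j := by
  have hw : MeasurableSet (window (scale a k) j) :=
    Metric.isClosed_closedBall.measurableSet.prod (measurableSet_singleton _)
  have e : scale a ⁻¹' window (scale a k) j = window k j :=
    Set.ext fun q => mem_window_scale ha k q j
  have h := congrArg (fun μ => μ (window (scale a k) j)) (map_scale_photonMeasure ha)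
  simp only [Measure.map_apply (measurable_scale a) hw, e, Measure.smul_apply, smul_eq_mul] at h
  rw [winVol, winVol, h, toReal_mul, ENNReal.toReal_ofReal (by positivity), ← mul_assoc,
    mul_inv_cancel₀ (by positivity), one_mul]

theorem addPhoton_dilate (h0 : 0 < ρ) (h1 : ρ < 1) {k : Photon} (hk : k.1 ≠ 0) (j : ℕ) {ψ : FockOne}
    (hψ : EnergyLE (1 - ‖(scale ρ⁻¹ k).1‖) ψ) :
    addPhoton k j (dilate ρ ψ) = dilate ρ (addPhoton (scale ρ⁻¹ k) j ψ) := by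
  have hρ := inv_pos.2 h0
  have hk' : (scale ρ⁻¹ k).1 ≠ 0 := smul_ne_zero hρ.ne' hk
  have hn : ρ * ‖(scale ρ⁻¹ k).1‖ = ‖k.1‖ := by
    rw [scale, norm_smul, norm_of_nonneg hρ.le, ← mul_assoc, mul_inv_cancel₀ h0.ne', one_mul]
  have hE := energyLE_dilate h0 h1 hψ
  rw [mul_sub, mul_one, hn] at hE
  have h := creat_dilate h0 h1 (goodSet_window hk j) (goodSet_window hk' j)
    (fun q => mem_window_scale hρ k q j) (sub_add_cancel ρ ‖k.1‖).le
    (fun q hq => (window_bounds k j hq).1) hE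
  rw [addPhoton, addPhoton, dilate_smul h0 h1, ← h, smul_smul, winVol_scale hρ]
  congr 1
  rw [← Complex.ofReal_mul]
  congr 1
  have e : √(ρ⁻¹ ^ 3 * winVol k j) = ρ⁻¹ ^ (3 / 2 : ℝ) * √(winVol k j) := by
    rw [Real.sqrt_mul (by positivity), ← rpow_three_halves_sq hρ, Real.sqrt_sq (by positivity)]
  have hp : 0 < ρ⁻¹ ^ (3 / 2 : ℝ) := by positivity
  rw [e, mul_inv, mul_comm _ (√(winVol k j))⁻¹, mul_assoc, inv_mul_cancel₀ hp.ne', mul_one]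

/-- The shift of an operator is transported by dilations. -/
theorem ShiftOf.of_dilate (h0 : 0 < ρ) (h1 : ρ < 1) {F G F' G' : Op} {κ : ℂ}
    (hFG : F * dilOp h0 h1 = κ • (dilOp h0 h1 * G)) {k : Photon} (hk : k.1 ≠ 0)
    (hF : ShiftOf F k F') (hG : ShiftOf G (scale ρ⁻¹ k) G')
    {ψ : FockOne} (hψ : EnergyLE (1 - ‖(scale ρ⁻¹ k).1‖) ψ) :
    F' (dilOp h0 h1 ψ) = κ • dilOp h0 h1 (G' ψ) := by
  have hρ := inv_pos.2 h0
  have hn : ρ * ‖(scale ρ⁻¹ k).1‖ = ‖k.1‖ := by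
    rw [scale, norm_smul, norm_of_nonneg hρ.le, ← mul_assoc, mul_inv_cancel₀ h0.ne', one_mul]
  have hJ : ∀ {φ : FockOne}, EnergyLE (1 - ‖(scale ρ⁻¹ k).1‖) φ →
      EnergyLE (1 - ‖k.1‖) (dilOp h0 h1 φ) := fun {φ} hφ => by
    have := energyLE_dilate h0 h1 hφ
    rw [mul_sub, mul_one, hn] at this
    exact this.mono (by linarith)
  have hA : ∀ j {φ : FockOne}, EnergyLE (1 - ‖(scale ρ⁻¹ k).1‖) φ →
      addPhoton k j (dilOp h0 h1 φ) = dilOp h0 h1 (addPhoton (scale ρ⁻¹ k) j φ) :=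
    fun j φ hφ => addPhoton_dilate h0 h1 hk j hφ
  have hG' := hG.pres ψ hψ
  have a := hF.lim _ (hJ hψ)
  have b := ((dilOp h0 h1).continuous.tendsto 0).comp (hG.lim ψ hψ)
  rw [map_zero] at b
  have b2 := b.const_smul κ
  rw [smul_zero] at b2
  have c := b2.sub a
  rw [sub_zero] at c
  have hη : EnergyLE (1 - ‖k.1‖) (F' (dilOp h0 h1 ψ) - κ • dilOp h0 h1 (G' ψ)) :=
    (hF.pres _ (hJ hψ)).sub ((hJ hG').smul κ)
  have e : ∀ j, κ • dilOp h0 h1 (G (addPhoton (scale ρ⁻¹ k) j ψ) -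
        addPhoton (scale ρ⁻¹ k) j (G' ψ)) -
      (F (addPhoton k j (dilOp h0 h1 ψ)) - addPhoton k j (F' (dilOp h0 h1 ψ))) =
      addPhoton k j (F' (dilOp h0 h1 ψ) - κ • dilOp h0 h1 (G' ψ)) := fun j => by
    have e1 : F (dilOp h0 h1 (addPhoton (scale ρ⁻¹ k) j ψ)) =
        κ • dilOp h0 h1 (G (addPhoton (scale ρ⁻¹ k) j ψ)) :=
      congrArg (fun X : Op => X (addPhoton (scale ρ⁻¹ k) j ψ)) hFG
    rw [addPhoton_sub hk, addPhoton_smul hk, hA j hψ, e1, hA j hG', map_sub, smul_sub]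
    abel
  have d : Tendsto (fun j => addPhoton k j (F' (dilOp h0 h1 ψ) - κ • dilOp h0 h1 (G' ψ))) atTop
      (𝓝 0) := c.congr e
  have d2 := (tendsto_norm_addPhoton hk hη)
  have d3 : Tendsto (fun j => ‖addPhoton k j (F' (dilOp h0 h1 ψ) - κ • dilOp h0 h1 (G' ψ))‖) atTop
      (𝓝 0) := tendsto_zero_iff_norm_tendsto_zero.1 d
  exact sub_eq_zero.1 (norm_eq_zero.1 (tendsto_nhds_unique d2 d3))

end

end

section
/-! ### Polar coordinates -/

lemma ae_polar_momentum {p : Momentum → Prop} (h : ∀ᵐ q ∂(volume : Measure Momentum), p q) :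
    ∀ᵐ n : Direction ∂(volume : Measure Momentum).toSphere,
      ∀ᵐ r ∂(volume : Measure ℝ), 0 < r → p (r • (n : Momentum)) := by
  have hmp := (volume : Measure Momentum).measurePreserving_homeomorphUnitSphereProd
  set e := homeomorphUnitSphereProd Momentum
  have hs : MeasurableSet ({0}ᶜ : Set Momentum) := (measurableSet_singleton 0).compl
  have h1 : ∀ᵐ q : ({0}ᶜ : Set Momentum)
      ∂((volume : Measure Momentum).comap ((↑) : ({0}ᶜ : Set Momentum) → Momentum)), p q := by
    rw [← (MeasurableEmbedding.subtype_coe hs).ae_map_iff, map_comap_subtype_coe hs]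
    exact ae_restrict_of_ae h
  have h2 : ∀ᵐ x ∂((volume : Measure Momentum).toSphere.prod
      (Measure.volumeIoiPow (Module.finrank ℝ Momentum - 1))), p (e.symm x) := by
    rw [← hmp.map_eq, e.measurableEmbedding.ae_map_iff]
    filter_upwards [h1] with q hq
    rwa [Homeomorph.symm_apply_apply]
  filter_upwards [Measure.ae_ae_of_ae_prod h2] with n hn
  have hc : Measurable fun r : Set.Ioi (0 : ℝ) =>
      ofReal (r.1 ^ (Module.finrank ℝ Momentum - 1)) := by fun_prop
  rw [Measure.volumeIoiPow, ae_withDensity_iff hc] at hn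
  change ∀ᵐ r : ℝ, r ∈ Set.Ioi (0 : ℝ) → p (r • (n : Momentum))
  rw [← ae_restrict_iff' (s := Set.Ioi (0 : ℝ)) measurableSet_Ioi,
    ← map_comap_subtype_coe measurableSet_Ioi,
    (MeasurableEmbedding.subtype_coe measurableSet_Ioi).ae_map_iff]
  filter_upwards [hn] with r hr
  have hr0 : (0 : ℝ) < r := r.2
  exact hr (ENNReal.ofReal_pos.2 (pow_pos hr0 _)).ne'

lemma ae_polar {p : Photon → Prop} (h : ∀ᵐ k ∂photonMeasure, p k) (lam : Bool) :
    ∀ᵐ n : Direction ∂(volume : Measure Momentum).toSphere,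
      ∀ᵐ r ∂(volume : Measure ℝ), 0 < r → p (r • (n : Momentum), lam) := by
  refine ae_polar_momentum (p := fun q => p (q, lam)) ?_
  filter_upwards [Measure.ae_ae_of_ae_prod h] with q hq
  exact Measure.ae_count_iff.1 hq lam

/-- The filter of essential limits at `0` from the right. -/
def softFilter : Filter ℝ := 𝓝[>] 0 ⊓ ae volume

lemma softFilter_le : softFilter ≤ 𝓝[>] 0 := inf_le_left

lemma eventually_soft_of_ae {p : ℝ → Prop} (h : ∀ᵐ r ∂(volume : Measure ℝ), 0 < r → p r) :
    ∀ᶠ r in softFilter, p r := by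
  have h1 : ∀ᶠ r in softFilter, 0 < r → p r := h.filter_mono inf_le_right
  have h2 : ∀ᶠ r in softFilter, (0 : ℝ) < r :=
    (self_mem_nhdsWithin : Set.Ioi (0 : ℝ) ∈ 𝓝[>] 0) |> fun h => softFilter_le h
  filter_upwards [h1, h2] with r a b using a b

lemma eventually_soft_pos : ∀ᶠ r in softFilter, 0 < r :=
  softFilter_le self_mem_nhdsWithin

lemma tendsto_soft_mul {ρ : ℝ} (h0 : 0 < ρ) : Tendsto (fun r => ρ * r) softFilter softFilter := by
  refine Tendsto.inf ?_ ?_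
  · refine tendsto_nhdsWithin_iff.2 ⟨?_, ?_⟩
    · have := (continuous_const_mul ρ).tendsto (0 : ℝ)
      rw [mul_zero] at this
      exact this.mono_left nhdsWithin_le_nhds
    · filter_upwards [self_mem_nhdsWithin] with r hr
      exact mul_pos h0 hr
  · have hq : Measure.QuasiMeasurePreserving (fun r : ℝ => ρ • r) volume volume :=
      Measure.quasiMeasurePreserving_smul _ h0.ne'
    exact hq.tendsto_ae

/-- The factor `κ̄_σ(r)⁻¹ √r`. -/
def softRatio (σ r : ℝ) : ℝ := √r / infraredReg σ r

lemma infraredReg_of_le {σ r : ℝ} (h : r ≤ σ) : infraredReg σ r = r / σ := by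
  rw [infraredReg, if_neg (not_lt.2 h)]

lemma infraredReg_pos {σ r : ℝ} (hσ : 0 < σ) (hr : 0 < r) : 0 < infraredReg σ r := by
  rw [infraredReg]; split_ifs <;> positivity

lemma softRatio_nonneg {σ r : ℝ} (hσ : 0 < σ) (hr : 0 < r) : 0 ≤ softRatio σ r :=
  div_nonneg (Real.sqrt_nonneg r) (infraredReg_pos hσ hr).le

lemma eventually_soft_le {σ : ℝ} (hσ : 0 < σ) : ∀ᶠ r in softFilter, r ≤ σ := by
  have : ∀ᶠ r in 𝓝 (0 : ℝ), r ≤ σ := (gt_mem_nhds hσ).mono fun _ h => le_of_lt h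
  exact (this.filter_mono nhdsWithin_le_nhds).filter_mono softFilter_le

lemma softRatio_mul_weight {σ : ℝ} (hσ : 0 < σ) {n : Direction} {lam : Bool} :
    ∀ᶠ r in softFilter, softRatio σ r * photonWeight σ (r • (n : Momentum), lam) ≤ max 1 σ := by
  filter_upwards [eventually_soft_pos, eventually_soft_le hσ] with r hr hrσ
  have hn : ‖r • (n : Momentum)‖ = r := by
    rw [norm_smul, norm_of_nonneg hr.le, norm_eq_of_mem_sphere, mul_one]
  have hs : √r ≠ 0 := (Real.sqrt_pos.2 hr).ne'
  have hi := (infraredReg_pos hσ hr).ne'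
  rw [softRatio, photonWeight, hn]
  split_ifs with h
  · rw [div_mul_div_comm, mul_comm, div_self (mul_ne_zero hi hs)]
    exact le_max_left _ _
  · rw [div_mul_eq_mul_div, Real.mul_self_sqrt hr.le, infraredReg_of_le hrσ, div_div_cancel₀ hr.ne']
    exact le_max_right _ _

lemma tendsto_softRatio_mul {σ : ℝ} (hσ : 0 < σ) :
    Tendsto (fun r => softRatio σ r * r) softFilter (𝓝 0) := by
  have h1 : Tendsto (fun r => σ * √r) softFilter (𝓝 0) := by
    have := (Real.continuous_sqrt.const_mul σ).tendsto (0 : ℝ)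
    rw [Real.sqrt_zero, mul_zero] at this
    exact (this.mono_left nhdsWithin_le_nhds).mono_left softFilter_le
  refine h1.congr' ?_
  filter_upwards [eventually_soft_pos, eventually_soft_le hσ] with r hr hrσ
  rw [softRatio, infraredReg_of_le hrσ]
  field_simp

lemma softRatio_scale {σ ρ r : ℝ} (h0 : 0 < ρ) :
    softRatio (σ / ρ) r * √ρ = softRatio σ (ρ * r) := by
  have e : infraredReg (σ / ρ) r = infraredReg σ (ρ * r) := by
    rw [infraredReg, infraredReg]
    have : σ / ρ < r ↔ σ < ρ * r := div_lt_iff₀' h0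
    simp only [this]
    split_ifs
    · rfl
    · field_simp
  rw [softRatio, softRatio, e, Real.sqrt_mul h0.le]; ring

/-! ### Test vectors -/

lemma fockMeasure_bounded_lt_top (N : ℕ) :
    fockMeasure {x | x.1 ≤ N ∧ mEnergy (bag x) ≤ 1} < ⊤ := by
  have hS : MeasurableSet {x : Config | x.1 ≤ N ∧ mEnergy (bag x) ≤ 1} :=
    (measurableSet_le measurable_card measurable_const).inter
      (measurableSet_le measurable_mEnergy measurable_const)
  rw [← lintegral_indicator_one hS, lintegral_fockMeasure (measurable_one.indicator hS)]
  rw [tsum_eq_sum (s := Finset.range (N + 1))]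
  · refine ENNReal.sum_lt_top.2 fun n _ => ENNReal.mul_lt_top ?_ ?_
    · exact ENNReal.inv_lt_top.2 (by exact_mod_cast n.factorial_pos)
    · have hle : ∀ q : Tuple n, Set.indicator
          {x : Config | x.1 ≤ N ∧ mEnergy (bag x) ≤ 1} (1 : Config → ℝ≥0∞) (inSector n q) ≤
          (Set.univ.pi fun _ : Fin n => {k : Photon | ‖k.1‖ ≤ 1}).indicator 1 q := fun q => by
        by_cases hq : inSector n q ∈ {x : Config | x.1 ≤ N ∧ mEnergy (bag x) ≤ 1}
        · rw [Set.indicator_of_mem (s := Set.univ.pi _)]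
          · exact Set.indicator_apply_le fun _ => le_rfl
          · intro i _
            have h1 : mEnergy (bag (inSector n q)) ≤ 1 := hq.2
            rw [mEnergy_bag] at h1
            exact (Finset.single_le_sum (f := fun i => ‖(q i).1‖) (fun _ _ => norm_nonneg _)
              (Finset.mem_univ i)).trans h1
        · rw [Set.indicator_of_notMem hq]
          exact bot_le
      refine (lintegral_mono hle).trans_lt ?_
      have hm : MeasurableSet {k : Photon | ‖k.1‖ ≤ 1} :=
        measurableSet_le measurable_fst.norm measurable_const
      rw [lintegral_indicator_one (MeasurableSet.univ_pi fun _ => hm), photonMeasureN, Measure.pi_pi]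
      exact ENNReal.prod_lt_top fun _ _ => photonMeasure_lt_top (R := 1) fun k hk => hk
  · intro n hn
    have : ∀ q : Tuple n, Set.indicator
        {x : Config | x.1 ≤ N ∧ mEnergy (bag x) ≤ 1} (1 : Config → ℝ≥0∞) (inSector n q) = 0 :=
      fun q => Set.indicator_of_notMem (fun h => hn (Finset.mem_range.2 (Nat.lt_succ_of_le h.1))) _
    simp only [this, lintegral_zero, mul_zero]

theorem IsTestVector.norm_ann_le {ψ : FockOne} (h : IsTestVector ψ) :
    ∃ c : ℝ, ∀ᵐ k ∂photonMeasure, ‖ann k ψ‖ ≤ c := by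
  obtain ⟨N, c, h⟩ := h
  have h1 : ∀ᵐ x ∂fockMeasure, (N < (bag x).card → rep ψ (bag x) = 0) ∧
      ‖rep ψ (bag x)‖ ≤ √N.factorial * |c| := by
    filter_upwards [ae_fockMeasure.2 h, rep_ae ψ] with x hx e
    rw [e, card_bag]
    refine ⟨fun hN => by rw [hx.1 hN, mul_zero], ?_⟩
    rcases lt_or_ge N x.1 with hN | hN
    · rw [hx.1 hN, mul_zero, norm_zero]; positivity
    · rw [norm_mul, norm_real, norm_of_nonneg (sqrtFact_pos x).le]
      refine mul_le_mul ?_ (hx.2.trans (le_abs_self c)) (norm_nonneg _) (Real.sqrt_nonneg _)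
      exact Real.sqrt_le_sqrt (by exact_mod_cast Nat.factorial_le hN)
  set B : ℝ := √N.factorial * |c| with hB
  have hB0 : 0 ≤ B := by positivity
  set V := fockMeasure {x | x.1 ≤ N ∧ mEnergy (bag x) ≤ 1} with hV
  have hVt : V ≠ ⊤ := (fockMeasure_bounded_lt_top N).ne
  refine ⟨√(B ^ 2 * V.toReal), ?_⟩
  filter_upwards [enorm_ann ψ, ae_cons (p := fun s => (N < s.card → rep ψ s = 0) ∧ ‖rep ψ s‖ ≤ B) h1]
    with k e hk
  have hS : MeasurableSet {x : Config | x.1 ≤ N ∧ mEnergy (bag x) ≤ 1} :=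
    (measurableSet_le measurable_card measurable_const).inter
      (measurableSet_le measurable_mEnergy measurable_const)
  have h2 : ‖ann k ψ‖ₑ ^ 2 ≤ ofReal (B ^ 2) * V := by
    rw [e, hV, ← lintegral_indicator_one hS, ← lintegral_const_mul _ (measurable_one.indicator hS)]
    refine lintegral_mono_ae ?_
    filter_upwards [hk] with x hx
    by_cases hxS : x ∈ {x : Config | x.1 ≤ N ∧ mEnergy (bag x) ≤ 1}
    · rw [Set.indicator_of_mem hxS, Pi.one_apply, mul_one, ← ofReal_norm,
        ← ENNReal.ofReal_pow (norm_nonneg _)]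
      exact ENNReal.ofReal_le_ofReal (pow_le_pow_left₀ (norm_nonneg _) hx.2 2)
    · have : rep ψ (k ::ₘ bag x) = 0 := by
        by_contra h0
        apply hxS
        constructor
        · by_contra hN
          refine h0 (hx.1 ?_)
          rw [Multiset.card_cons, card_bag]
          exact (not_le.1 hN).trans (Nat.lt_succ_self _)
        · by_contra hE
          refine h0 (rep_supp ψ _ ((not_le.1 hE).trans_le ?_))
          rw [mEnergy, mEnergy, Multiset.map_cons, Multiset.sum_cons]
          exact le_add_of_nonneg_left (norm_nonneg _)
      rw [this, enorm_zero, zero_pow two_ne_zero]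
      exact bot_le
  have h3 : ‖ann k ψ‖ ^ 2 ≤ B ^ 2 * V.toReal := by
    have := ENNReal.toReal_mono (ENNReal.mul_ne_top ENNReal.ofReal_ne_top hVt) h2
    rwa [toReal_mul, ENNReal.toReal_ofReal (by positivity), ENNReal.toReal_pow,
      toReal_enorm] at this
  exact Real.le_sqrt_of_sq_le h3

theorem exists_test_seq (ψ : FockOne) : ∃ u : ℕ → FockOne, (∀ m, IsTestVector (u m)) ∧
    Tendsto u atTop (𝓝 ψ) := by
  let c : ℕ → Bag → ℂ := fun m s => if s.card ≤ m ∧ ‖rep ψ s‖ ≤ m then 1 else 0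
  have hcm : ∀ m, Measurable fun x => c m (bag x) := fun m => by
    have h1 : MeasurableSet {x : Config | (bag x).card ≤ m ∧ ‖rep ψ (bag x)‖ ≤ m} := by
      simp only [card_bag]
      exact (measurableSet_le measurable_card measurable_const).inter
        (measurableSet_le (rep_adm ψ).meas.norm measurable_const)
    exact Measurable.ite h1 measurable_const measurable_const
  have ha : ∀ m, IsAdm fun s => c m s * rep ψ s := fun m =>
    (rep_adm ψ).of_norm_le ((hcm m).mul (rep_adm ψ).meas) (C := 1) fun s => by
      rw [norm_mul]
      refine mul_le_mul_of_nonneg_right ?_ (norm_nonneg _)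
      simp only [c]; split_ifs <;> simp
  refine ⟨fun m => ofFun fun s => c m s * rep ψ s, fun m => ⟨m, m, ?_⟩, ?_⟩
  · rw [← ae_fockMeasure]
    filter_upwards [wave_ae (ofFun fun s => c m s * rep ψ s), rep_ofFun (ha m)] with x e1 e2
    rw [e1, e2]
    have hs : (1 : ℝ) ≤ sqrtFact x := by
      rw [sqrtFact, Real.one_le_sqrt]
      exact_mod_cast x.1.factorial_pos
    constructor
    · intro hx
      have : ¬ ((bag x).card ≤ m ∧ ‖rep ψ (bag x)‖ ≤ m) := fun h => by
        rw [card_bag] at h; exact absurd h.1 (not_le.2 hx)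
      simp only [c, if_neg this, zero_mul, mul_zero]
    · have h1 : ‖c m (bag x) * rep ψ (bag x)‖ ≤ m := by
        simp only [c]; split_ifs with h
        · rw [one_mul]; exact h.2
        · rw [zero_mul, norm_zero]; positivity
      rw [norm_mul, norm_inv, norm_real, norm_of_nonneg (sqrtFact_pos x).le]
      refine (mul_le_of_le_one_left (norm_nonneg _) (inv_le_one_of_one_le₀ hs)).trans h1
  · have hd : ∀ m, ‖ofFun (fun s => c m s * rep ψ s) - ψ‖ₑ ^ 2 =
        ∫⁻ x, ‖(c m (bag x) - 1) * rep ψ (bag x)‖ₑ ^ 2 ∂fockMeasure := fun m => by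
      rw [enorm_sq_eq]
      refine lintegral_congr_ae ?_
      filter_upwards [rep_ofFun (ha m), rep_add (ofFun (fun s => c m s * rep ψ s) - ψ) ψ] with x e1 e2
      rw [sub_add_cancel, e1] at e2
      rw [sub_mul, one_mul, e2, add_sub_cancel_right]
    have hlim : Tendsto (fun m => ‖ofFun (fun s => c m s * rep ψ s) - ψ‖ₑ ^ 2) atTop (𝓝 0) := by
      have h0 : (0 : ℝ≥0∞) = ∫⁻ _ : Config, 0 ∂fockMeasure := lintegral_zero.symm
      simp only [hd]
      rw [h0]
      refine tendsto_lintegral_of_dominated_convergence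
        (fun x => ‖rep ψ (bag x)‖ₑ ^ 2)
        (fun m => (((hcm m).sub_const 1).mul (rep_adm ψ).meas).enorm.pow_const 2)
        (fun m => Eventually.of_forall fun x => ?_) (rep_adm ψ).sq
        (.of_forall fun x => ?_)
      · dsimp only
        gcongr
        rw [enorm_mul]
        refine mul_le_of_le_one_left bot_le ?_
        simp only [c]; split_ifs <;> simp
      · refine tendsto_const_nhds.congr' ?_
        obtain ⟨M, hM⟩ := exists_nat_ge (max ((bag x).card : ℝ) ‖rep ψ (bag x)‖)
        filter_upwards [eventually_ge_atTop M] with m hm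
        have hm' : (M : ℝ) ≤ m := by exact_mod_cast hm
        have h1 : (bag x).card ≤ m := by
          have := (le_max_left _ _).trans (hM.trans hm')
          exact_mod_cast this
        have h2 := (le_max_right _ _).trans (hM.trans hm')
        simp only [c, if_pos (And.intro h1 h2), sub_self, zero_mul, enorm_zero]
        rw [zero_pow two_ne_zero]
    have h2 : Tendsto (fun m => ‖ofFun (fun s => c m s * rep ψ s) - ψ‖ ^ 2) atTop (𝓝 0) := by
      have := (ENNReal.tendsto_toReal ENNReal.zero_ne_top).comp hlim
      refine this.congr fun m => ?_
      rw [Function.comp_apply, ENNReal.toReal_pow, toReal_enorm]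
    have h3 : Tendsto (fun m => ‖ofFun (fun s => c m s * rep ψ s) - ψ‖) atTop (𝓝 0) := by
      have := (Real.continuous_sqrt.tendsto 0).comp h2
      rw [Real.sqrt_zero] at this
      refine this.congr fun m => ?_
      rw [Function.comp_apply, Real.sqrt_sq (norm_nonneg _)]
    exact tendsto_iff_norm_sub_tendsto_zero.2 h3

end

section
/-! ### Ward–Takahashi identities under the smooth Feshbach map -/

/-- An operator `A` with a pull-through formula whose translates `T` are Lipschitz continuous and
have derivatives `∂` in the sense of forms. -/
structure WardData (A : Op) (T : Momentum → Op) (D : Photon → Op)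
    (der : Momentum → FockOne → FockOne → ℂ) (σ : ℝ) : Prop where
  soft : Soft A T D
  lip : ∃ L : ℝ, ∀ q ψ, EnergyLE (1 - ‖q‖) ψ → ‖T q ψ - A ψ‖ ≤ L * ‖q‖ * ‖ψ‖
  lip_sphere : ∃ L : ℝ, ∀ q q', ‖q‖ = ‖q'‖ → ‖T q - T q'‖ ≤ L * ‖q - q'‖
  deriv : ∀ u φ ψ, Tendsto (fun s : ℝ => (((2 * s)⁻¹ : ℝ) : ℂ) *
    inner ℂ φ ((T (s • u) - T (-(s • u))) ψ)) (𝓝[>] 0) (𝓝 (der u φ ψ))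
  bound : ∃ C : ℝ, ∀ k, ‖D k‖ ≤ C * photonWeight σ k

/-- The Ward–Takahashi identity for annihilation operators, for a general operator `A` and a form
`der` in the role of its derivative. -/
def WardAnn (A : Op) (der : Momentum → FockOne → FockOne → ℂ) (g : ℝ) (e : Direction → Momentum)
    (lam : Bool) (U : Set Direction) (σ : ℝ) : Prop :=
  ∀ φ ψ : FockOne, IsTestVector φ → IsTestVector ψ →
    ∀ᵐ n ∂((volume : Measure Momentum).toSphere.restrict U),
      Tendsto (fun r : ℝ => g * der (e n) φ ψ + (softRatio σ r : ℝ) *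
        (annihilationForm (r • (n : Momentum), lam) φ (A ψ) -
          annihilationForm (r • (n : Momentum), lam) (adj A φ) ψ)) softFilter (𝓝 0)

variable {A : Op} {T : Momentum → Op} {D : Photon → Op} {der : Momentum → FockOne → FockOne → ℂ}
  {σ : ℝ}

lemma norm_inner_sub_le (A : Op) (φ φ' ψ ψ' : FockOne) :
    ‖(inner ℂ φ (A ψ) : ℂ) - inner ℂ φ' (A ψ')‖ ≤
      ‖A‖ * (‖φ - φ'‖ * ‖ψ‖ + ‖φ'‖ * ‖ψ - ψ'‖) := by
  have e : (inner ℂ φ (A ψ) : ℂ) - inner ℂ φ' (A ψ') =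
      inner ℂ (φ - φ') (A ψ) + inner ℂ φ' (A (ψ - ψ')) := by
    rw [map_sub, inner_sub_r, inner_sub_l]; ring
  rw [e]
  refine (norm_add_le _ _).trans ?_
  have h1 := (norm_inner_le (φ - φ') (A ψ)).trans
    (mul_le_mul_of_nonneg_left (A.le_opNorm ψ) (norm_nonneg _))
  have h2 := (norm_inner_le φ' (A (ψ - ψ'))).trans
    (mul_le_mul_of_nonneg_left (A.le_opNorm (ψ - ψ')) (norm_nonneg _))
  calc _ ≤ _ := add_le_add h1 h2
    _ = _ := by ring

lemma photonWeight_nonneg (hσ : 0 < σ) (k : Photon) : 0 ≤ photonWeight σ k := by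
  rw [photonWeight]
  split_ifs
  · refine div_nonneg ?_ (Real.sqrt_nonneg _)
    rw [infraredReg]; split_ifs <;> positivity
  · positivity

lemma WardData.norm_der_sub_le (h : WardData A T D der σ) : ∃ L : ℝ, ∀ u φ φ' ψ ψ',
    ‖der u φ ψ - der u φ' ψ'‖ ≤ L * ‖u‖ * (‖φ - φ'‖ * ‖ψ‖ + ‖φ'‖ * ‖ψ - ψ'‖) := by
  obtain ⟨L, hL⟩ := h.lip_sphere
  refine ⟨L, fun u φ φ' ψ ψ' => ?_⟩
  refine le_of_tendsto ((h.deriv u φ ψ).sub (h.deriv u φ' ψ')).norm ?_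
  filter_upwards [self_mem_nhdsWithin] with s hs
  have hs0 : (0 : ℝ) < s := hs
  rw [← mul_sub, norm_mul, norm_real, norm_of_nonneg (by positivity)]
  have h1 := hL (s • u) (-(s • u)) (norm_neg _).symm
  rw [sub_neg_eq_add, ← two_smul ℝ, smul_smul, norm_smul, norm_of_nonneg (by positivity)] at h1
  have h2 : (0 : ℝ) ≤ ‖φ - φ'‖ * ‖ψ‖ + ‖φ'‖ * ‖ψ - ψ'‖ := by positivity
  calc _ ≤ (2 * s)⁻¹ * (L * (2 * s * ‖u‖) * (‖φ - φ'‖ * ‖ψ‖ + ‖φ'‖ * ‖ψ - ψ'‖)) := by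
        refine mul_le_mul_of_nonneg_left ?_ (by positivity)
        exact (norm_inner_sub_le _ _ _ _ _).trans (mul_le_mul_of_nonneg_right h1 h2)
    _ = _ := by field_simp

lemma WardData.ratio_bound (h : WardData A T D der σ) (hσ : 0 < σ) : ∃ B : ℝ, 0 ≤ B ∧
    ∀ (n : Direction) lam, ∀ᶠ r in softFilter,
      softRatio σ r * ‖D (r • (n : Momentum), lam)‖ ≤ B := by
  obtain ⟨C, hC⟩ := h.bound
  refine ⟨|C| * max 1 σ, by positivity, fun n lam => ?_⟩
  filter_upwards [softRatio_mul_weight hσ (n := n) (lam := lam), eventually_soft_pos] with r hr hr0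
  have h0 := softRatio_nonneg hσ hr0
  have hw := photonWeight_nonneg hσ (r • (n : Momentum), lam)
  calc _ ≤ softRatio σ r * (|C| * photonWeight σ (r • (n : Momentum), lam)) :=
        mul_le_mul_of_nonneg_left
          ((hC _).trans (mul_le_mul_of_nonneg_right (le_abs_self C) hw)) h0
    _ = |C| * (softRatio σ r * photonWeight σ (r • (n : Momentum), lam)) := by ring
    _ ≤ _ := mul_le_mul_of_nonneg_left hr (abs_nonneg C)

lemma inner_commutator_eq (A T' : Op) (φ a d : FockOne) :
    (inner ℂ φ (T' a + d) - inner ℂ φ (A a) - inner ℂ φ d : ℂ) = inner ℂ φ (T' a - A a) := by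
  rw [inner_add_r, inner_sub_r]; ring

/-- On test vectors the commutator with `a(k)` may be replaced by `D_k` in the soft limit. -/
lemma WardData.tendsto_commutator (h : WardData A T D der σ) (hσ : 0 < σ) (lam : Bool)
    (φ : FockOne) {ψ : FockOne} (hψ : IsTestVector ψ) :
    ∀ᵐ n : Direction ∂(volume : Measure Momentum).toSphere,
      Tendsto (fun r : ℝ => (softRatio σ r : ℝ) *
        (annihilationForm (r • (n : Momentum), lam) φ (A ψ) -
          annihilationForm (r • (n : Momentum), lam) (adj A φ) ψ) -
        (softRatio σ r : ℝ) * inner ℂ φ (D (r • (n : Momentum), lam) ψ)) softFilter (𝓝 0) := by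
  obtain ⟨L, hL⟩ := h.lip
  obtain ⟨c, hc⟩ := hψ.norm_ann_le
  have key : ∀ᵐ k ∂photonMeasure,
      ‖annihilationForm k φ (A ψ) - annihilationForm k (adj A φ) ψ - inner ℂ φ (D k ψ)‖ ≤
        ‖φ‖ * (|L| * ‖k.1‖ * |c|) := by
    filter_upwards [annihilationForm_eq φ (A ψ), annihilationForm_eq (adj A φ) ψ, h.soft.pull ψ,
      energyLE_ann ψ, hc] with k e1 e2 e3 e4 e5
    have e6 : annihilationForm k φ (A ψ) - annihilationForm k (adj A φ) ψ - inner ℂ φ (D k ψ) =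
        inner ℂ φ (T k.1 (ann k ψ) - A (ann k ψ)) := by
      rw [e1, e2, adjoint_inner_l, e3]
      exact inner_commutator_eq A (T k.1) φ (ann k ψ) (D k ψ)
    rw [e6]
    refine (norm_inner_le _ _).trans (mul_le_mul_of_nonneg_left ?_ (norm_nonneg _))
    refine (hL _ _ e4).trans ?_
    refine mul_le_mul (mul_le_mul_of_nonneg_right (le_abs_self L) (norm_nonneg _))
      (e5.trans (le_abs_self c)) (norm_nonneg _) (by positivity)
  filter_upwards [ae_polar key lam] with n hn
  have h1 : Tendsto (fun r => ‖φ‖ * |L| * |c| * (softRatio σ r * r)) softFilter (𝓝 0) := by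
    have := (tendsto_softRatio_mul hσ).const_mul (‖φ‖ * |L| * |c|)
    rwa [mul_zero] at this
  refine squeeze_zero_norm' ?_ h1
  filter_upwards [eventually_soft_of_ae hn, eventually_soft_pos] with r hr hr0
  have hnr : ‖r • (n : Momentum)‖ = r := by
    rw [norm_smul, norm_of_nonneg hr0.le, norm_eq_of_mem_sphere, mul_one]
  have hs := softRatio_nonneg hσ hr0
  rw [← mul_sub, norm_mul, norm_real, norm_of_nonneg hs]
  rw [hnr] at hr
  calc _ ≤ softRatio σ r * (‖φ‖ * (|L| * r * |c|)) := mul_le_mul_of_nonneg_left hr hs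
    _ = _ := by ring

theorem WardData.wardAnn_iff (h : WardData A T D der σ) (hσ : 0 < σ) (g : ℝ)
    (e : Direction → Momentum) (lam : Bool) (U : Set Direction) :
    WardAnn A der g e lam U σ ↔ ∀ φ ψ : FockOne, IsTestVector φ → IsTestVector ψ →
      ∀ᵐ n ∂((volume : Measure Momentum).toSphere.restrict U),
        Tendsto (fun r : ℝ => g * der (e n) φ ψ + (softRatio σ r : ℝ) *
          inner ℂ φ (D (r • (n : Momentum), lam) ψ)) softFilter (𝓝 0) := by
  refine forall_congr' fun φ => forall_congr' fun ψ => forall_congr' fun _ => forall_congr' fun hψ => ?_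
  refine eventually_congr ?_
  filter_upwards [ae_restrict_of_ae (h.tendsto_commutator hσ lam φ hψ)] with n hn
  constructor
  · intro h1
    have := h1.sub hn
    rw [sub_zero] at this
    exact this.congr fun r => by ring
  · intro h1
    have := h1.add hn
    rw [add_zero] at this
    exact this.congr fun r => by ring

/-- The Ward–Takahashi identity extends from test vectors to all vectors. -/
theorem WardData.ward_all (h : WardData A T D der σ) (hσ : 0 < σ) {g : ℝ}
    {e : Direction → Momentum} {lam : Bool} {U : Set Direction} (hW : WardAnn A der g e lam U σ)
    (φ ψ : FockOne) : ∀ᵐ n ∂((volume : Measure Momentum).toSphere.restrict U),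
      Tendsto (fun r : ℝ => g * der (e n) φ ψ + (softRatio σ r : ℝ) *
        inner ℂ φ (D (r • (n : Momentum), lam) ψ)) softFilter (𝓝 0) := by
  rw [h.wardAnn_iff hσ] at hW
  obtain ⟨u, hu, hut⟩ := exists_test_seq φ
  obtain ⟨v, hv, hvt⟩ := exists_test_seq ψ
  obtain ⟨L, hL⟩ := h.norm_der_sub_le
  obtain ⟨B, hB0, hB⟩ := h.ratio_bound hσ
  filter_upwards [ae_all_iff.2 fun m => hW (u m) (v m) (hu m) (hv m)] with n hn
  have hK : Tendsto (fun m => (|g| * (L * ‖e n‖) + B) *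
      (‖φ - u m‖ * ‖ψ‖ + ‖u m‖ * ‖ψ - v m‖)) atTop (𝓝 0) := by
    have h1 : Tendsto (fun m => ‖φ - u m‖) atTop (𝓝 0) := by
      have := (tendsto_iff_norm_sub_tendsto_zero.1 hut)
      exact this.congr fun m => norm_sub_rev _ _
    have h2 : Tendsto (fun m => ‖ψ - v m‖) atTop (𝓝 0) := by
      have := (tendsto_iff_norm_sub_tendsto_zero.1 hvt)
      exact this.congr fun m => norm_sub_rev _ _
    have := ((h1.mul_const ‖ψ‖).add (hut.norm.mul h2)).const_mul (|g| * (L * ‖e n‖) + B)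
    rwa [zero_mul, mul_zero, add_zero, mul_zero] at this
  rw [Metric.tendsto_nhds]
  intro δ hδ
  obtain ⟨m, hm⟩ := ((hK.eventually (gt_mem_nhds (half_pos hδ)))).exists
  have h3 := Metric.tendsto_nhds.1 (hn m) _ (half_pos hδ)
  filter_upwards [h3, hB n lam, eventually_soft_pos] with r hr hBr hr0
  rw [dist_zero_right] at hr ⊢
  have hs := softRatio_nonneg hσ hr0
  have hE : (0 : ℝ) ≤ ‖φ - u m‖ * ‖ψ‖ + ‖u m‖ * ‖ψ - v m‖ := by positivity
  have e1 : (g * der (e n) φ ψ + (softRatio σ r : ℝ) *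
        inner ℂ φ (D (r • (n : Momentum), lam) ψ) : ℂ) =
      (g * der (e n) (u m) (v m) + (softRatio σ r : ℝ) *
        inner ℂ (u m) (D (r • (n : Momentum), lam) (v m))) +
      (g * (der (e n) φ ψ - der (e n) (u m) (v m)) + (softRatio σ r : ℝ) *
        (inner ℂ φ (D (r • (n : Momentum), lam) ψ) -
          inner ℂ (u m) (D (r • (n : Momentum), lam) (v m)))) := by ring
  rw [e1]
  have h4 : ‖(g * (der (e n) φ ψ - der (e n) (u m) (v m)) : ℂ)‖ ≤
      |g| * (L * ‖e n‖) * (‖φ - u m‖ * ‖ψ‖ + ‖u m‖ * ‖ψ - v m‖) := by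
    rw [norm_mul, norm_real, Real.norm_eq_abs, mul_assoc]
    exact mul_le_mul_of_nonneg_left (hL _ _ _ _ _) (abs_nonneg g)
  have h5 : ‖((softRatio σ r : ℝ) * (inner ℂ φ (D (r • (n : Momentum), lam) ψ) -
      inner ℂ (u m) (D (r • (n : Momentum), lam) (v m))) : ℂ)‖ ≤
      B * (‖φ - u m‖ * ‖ψ‖ + ‖u m‖ * ‖ψ - v m‖) := by
    rw [norm_mul, norm_real, norm_of_nonneg hs]
    calc _ ≤ softRatio σ r * (‖D (r • (n : Momentum), lam)‖ *
          (‖φ - u m‖ * ‖ψ‖ + ‖u m‖ * ‖ψ - v m‖)) :=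
          mul_le_mul_of_nonneg_left (norm_inner_sub_le _ _ _ _ _) hs
      _ = softRatio σ r * ‖D (r • (n : Momentum), lam)‖ *
          (‖φ - u m‖ * ‖ψ‖ + ‖u m‖ * ‖ψ - v m‖) := by ring
      _ ≤ _ := mul_le_mul_of_nonneg_right hBr hE
  calc _ ≤ _ := norm_add_le _ _
    _ < δ / 2 + δ / 2 := by
        refine add_lt_add_of_lt_of_le hr ((norm_add_le _ _).trans ((add_le_add h4 h5).trans ?_))
        rw [← add_mul]; exact hm.le
    _ = δ := add_halves δ

section Transfer

variable {ρ : ℝ} {F G Y₀ Z₀ : Op} {FT Y Z TG : Momentum → Op} {DG : Photon → Op}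
  {derG : Momentum → FockOne → FockOne → ℂ} {κ : ℂ}

lemma tendsto_inner_of_bounded {ι : Type*} {l : Filter ι} {S : ι → Op} {φ ψ : ι → FockOne}
    {φ₀ ψ₀ : FockOne} {c : ι → ℂ} {b : ℂ} {C : ℝ} (hS : ∀ᶠ i in l, ‖c i‖ * ‖S i‖ ≤ C)
    (hφ : Tendsto φ l (𝓝 φ₀)) (hψ : Tendsto ψ l (𝓝 ψ₀))
    (h : Tendsto (fun i => c i * inner ℂ φ₀ (S i ψ₀)) l (𝓝 b)) :
    Tendsto (fun i => c i * inner ℂ (φ i) (S i (ψ i))) l (𝓝 b) := by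
  have h1 : Tendsto (fun i => C * (‖φ i - φ₀‖ * ‖ψ i‖ + ‖φ₀‖ * ‖ψ i - ψ₀‖)) l (𝓝 0) := by
    have a := tendsto_iff_norm_sub_tendsto_zero.1 hφ
    have b := tendsto_iff_norm_sub_tendsto_zero.1 hψ
    have := ((a.mul hψ.norm).add (b.const_mul ‖φ₀‖)).const_mul C
    rwa [zero_mul, mul_zero, add_zero, mul_zero] at this
  have h2 : Tendsto (fun i => c i * inner ℂ (φ i) (S i (ψ i)) - c i * inner ℂ φ₀ (S i ψ₀)) l
      (𝓝 0) := by
    refine squeeze_zero_norm' ?_ h1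
    filter_upwards [hS] with i hi
    rw [← mul_sub, norm_mul]
    calc _ ≤ ‖c i‖ * (‖S i‖ * (‖φ i - φ₀‖ * ‖ψ i‖ + ‖φ₀‖ * ‖ψ i - ψ₀‖)) :=
          mul_le_mul_of_nonneg_left (norm_inner_sub_le _ _ _ _ _) (norm_nonneg _)
      _ = ‖c i‖ * ‖S i‖ * (‖φ i - φ₀‖ * ‖ψ i‖ + ‖φ₀‖ * ‖ψ i - ψ₀‖) := by ring
      _ ≤ _ := mul_le_mul_of_nonneg_right hi (by positivity)
  have := h2.add h
  rw [zero_add] at this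
  exact this.congr fun i => by ring

/-- The translated operators are transported by the dilation. -/
lemma shift_dilate (h0 : 0 < ρ) (h1 : ρ < 1) (hFG : F * dilOp h0 h1 = κ • (dilOp h0 h1 * G))
    {DF : Photon → Op} (hF : Soft F FT DF) (hG : Soft G TG DG) {q : Momentum} (hq : q ≠ 0)
    {ψ : FockOne} (hψ : EnergyLE (1 - ‖q‖) ψ) :
    FT (ρ • q) (dilOp h0 h1 ψ) = κ • dilOp h0 h1 (TG q ψ) := by
  have e : scale ρ⁻¹ (ρ • q, true) = (q, true) := by
    rw [scale, smul_smul, inv_mul_cancel₀ h0.ne', one_smul]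
  have hk : ((ρ • q, true) : Photon).1 ≠ 0 := smul_ne_zero h0.ne' hq
  refine ShiftOf.of_dilate h0 h1 hFG hk (hF.shift _ hk) ?_ ?_
  · rw [e]; exact hG.shift _ hq
  · rw [e]; exact hψ

lemma deriv_dilate_aux (h0 : 0 < ρ) (h1 : ρ < 1) (hκ : κ ≠ 0)
    (hFG : F * dilOp h0 h1 = κ • (dilOp h0 h1 * G))
    (hP : FeshbachPair T D F FT Y₀ Y Z₀ Z) {σ' : ℝ} (hG : WardData G TG DG derG σ')
    {u : Momentum} {s : ℝ} (hs0 : 0 < s) (hsu : s • u ≠ 0) (φ ψ : FockOne) :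
    (ρ : ℂ) * κ⁻¹ * ((((2 * (ρ * s))⁻¹ : ℝ) : ℂ) *
      inner ℂ (adj (Y (ρ • s • u)) (dilOp h0 h1 (eproj (1 - ‖s • u‖) φ)))
        ((T ((ρ * s) • u) - T (-((ρ * s) • u)))
          (Z (-(ρ • s • u)) (dilOp h0 h1 (eproj (1 - ‖s • u‖) ψ))))) =
    (((2 * s)⁻¹ : ℝ) : ℂ) * inner ℂ φ ((TG (s • u) - TG (-(s • u))) ψ) := by
  set P := eproj (1 - ‖s • u‖) with hPd
  have hqn : ρ • s • u ≠ 0 := smul_ne_zero h0.ne' hsu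
  have hE : EnergyLE (1 - ‖s • u‖) (P ψ) := energyLE_eproj _ ψ
  have e1 : (TG (s • u) - TG (-(s • u))) ψ = P ((TG (s • u) - TG (-(s • u))) (P ψ)) := by
    have a1 := hG.soft.proj_right (s • u)
    have a2 := hG.soft.proj_right (-(s • u))
    have b1 := hG.soft.proj_left (s • u)
    have b2 := hG.soft.proj_left (-(s • u))
    rw [norm_neg (s • u)] at a2 b2
    have : TG (s • u) - TG (-(s • u)) = P * ((TG (s • u) - TG (-(s • u))) * P) := by
      rw [sub_mul, a1, a2, mul_sub, b1, b2]
    exact congrArg (fun X : Op => X ψ) this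
  have e2 : (inner ℂ φ (P ((TG (s • u) - TG (-(s • u))) (P ψ))) : ℂ) =
      inner ℂ (P φ) ((TG (s • u) - TG (-(s • u))) (P ψ)) := by
    have : adj P = P := adjoint_eproj _
    rw [← adjoint_inner_r, this]
  have e3 : dilOp h0 h1 ((TG (s • u) - TG (-(s • u))) (P ψ)) =
      κ⁻¹ • (FT (ρ • s • u) - FT (-(ρ • s • u))) (dilOp h0 h1 (P ψ)) := by
    have c1 := shift_dilate h0 h1 hFG hP.soft hG.soft hsu hE
    have c2 := shift_dilate h0 h1 hFG hP.soft hG.soft (neg_ne_zero.2 hsu) (ψ := P ψ) (by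
      rw [norm_neg (s • u)]; exact hE)
    rw [smul_neg] at c2
    have c3 : (FT (ρ • s • u) - FT (-(ρ • s • u))) (dilOp h0 h1 (P ψ)) =
        κ • dilOp h0 h1 ((TG (s • u) - TG (-(s • u))) (P ψ)) := by
      have c4 : (FT (ρ • s • u) - FT (-(ρ • s • u))) (dilOp h0 h1 (P ψ)) =
        FT (ρ • s • u) (dilOp h0 h1 (P ψ)) - FT (-(ρ • s • u)) (dilOp h0 h1 (P ψ)) := rfl
      have c5 : (TG (s • u) - TG (-(s • u))) (P ψ) = TG (s • u) (P ψ) - TG (-(s • u)) (P ψ) := rfl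
      rw [c4, c1, c2, c5, map_sub, smul_sub]
    rw [c3, smul_smul, inv_mul_cancel₀ hκ, one_smul]
  have e4 : (inner ℂ (P φ) ((TG (s • u) - TG (-(s • u))) (P ψ)) : ℂ) =
      inner ℂ (dilOp h0 h1 (P φ)) (dilOp h0 h1 ((TG (s • u) - TG (-(s • u))) (P ψ))) :=
    ((dilIso h0 h1).inner_map_map _ _).symm
  have e5 := hP.diff (ρ • s • u) (-(ρ • s • u)) hqn (neg_ne_zero.2 hqn) (norm_neg _).symm
  have e6 : (inner ℂ (adj (Y (ρ • s • u)) (dilOp h0 h1 (P φ)))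
        ((T ((ρ * s) • u) - T (-((ρ * s) • u))) (Z (-(ρ • s • u)) (dilOp h0 h1 (P ψ)))) : ℂ) =
      inner ℂ (dilOp h0 h1 (P φ))
        ((FT (ρ • s • u) - FT (-(ρ • s • u))) (dilOp h0 h1 (P ψ))) := by
    rw [adjoint_inner_l, e5, mul_smul]
    rfl
  rw [e6, e1, e2, e4, e3, inner_smul_r]
  push_cast
  have h1' : (ρ : ℂ) ≠ 0 := by exact_mod_cast h0.ne'
  have h2' : (s : ℂ) ≠ 0 := by exact_mod_cast hs0.ne'
  field_simp

lemma deriv_dilate (h0 : 0 < ρ) (h1 : ρ < 1) (hκ : κ ≠ 0)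
    (hFG : F * dilOp h0 h1 = κ • (dilOp h0 h1 * G)) (hH : WardData A T D der σ)
    (hP : FeshbachPair T D F FT Y₀ Y Z₀ Z) {σ' : ℝ} (hG : WardData G TG DG derG σ')
    (u : Momentum) (φ ψ : FockOne) :
    derG u φ ψ = ρ * κ⁻¹ * der u (adj Y₀ (dilOp h0 h1 φ)) (Z₀ (dilOp h0 h1 ψ)) := by
  have hzero : ∀ {A : Op} {T : Momentum → Op} {D : Photon → Op}
      {der : Momentum → FockOne → FockOne → ℂ} {σ : ℝ}, WardData A T D der σ →
      ∀ φ ψ, der 0 φ ψ = 0 := by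
    intro A T D der σ h φ ψ
    refine tendsto_nhds_unique (h.deriv 0 φ ψ) (tendsto_const_nhds.congr fun s => ?_)
    rw [smul_zero, neg_zero, sub_self]
    exact ((congrArg _ (inner_zero_right φ)).trans (mul_zero _)).symm
  by_cases hu : u = 0
  · subst hu
    rw [hzero hG, hzero hH, mul_zero]
  set J := dilOp h0 h1 with hJ
  obtain ⟨DY, sY⟩ := hP.left
  obtain ⟨DZ, sZ⟩ := hP.right
  obtain ⟨L, hL⟩ := hH.lip_sphere
  have hρs : Tendsto (fun s : ℝ => ρ * s) (𝓝[>] 0) (𝓝[>] 0) := by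
    refine tendsto_nhdsWithin_iff.2 ⟨?_, ?_⟩
    · have := (continuous_const_mul ρ).tendsto (0 : ℝ)
      rw [mul_zero] at this
      exact this.mono_left nhdsWithin_le_nhds
    · filter_upwards [self_mem_nhdsWithin] with r hr
      exact mul_pos h0 hr
  have hq0 : Tendsto (fun s : ℝ => ρ • s • u) (𝓝[>] 0) (𝓝[≠] 0) := by
    refine tendsto_nhdsWithin_iff.2 ⟨?_, ?_⟩
    · have : Continuous fun s : ℝ => ρ • s • u := by fun_prop
      have := this.tendsto 0
      rw [zero_smul, smul_zero] at this
      exact this.mono_left nhdsWithin_le_nhds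
    · filter_upwards [self_mem_nhdsWithin] with r hr
      exact smul_ne_zero h0.ne' (smul_ne_zero (ne_of_gt hr) hu)
  have hq0' : Tendsto (fun s : ℝ => -(ρ • s • u)) (𝓝[>] 0) (𝓝[≠] 0) := by
    refine tendsto_nhdsWithin_iff.2 ⟨?_, ?_⟩
    · have := (tendsto_nhdsWithin_iff.1 hq0).1.neg
      rwa [neg_zero] at this
    · filter_upwards [(tendsto_nhdsWithin_iff.1 hq0).2] with r hr
      exact neg_ne_zero.2 hr
  have hp0 : ∀ ψ : FockOne, Tendsto (fun s : ℝ => J (eproj (1 - ‖s • u‖) ψ)) (𝓝[>] 0) (𝓝 (J ψ)) := by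
    intro ψ
    have h1 : Tendsto (fun s : ℝ => ‖s • u‖) (𝓝[>] 0) (𝓝 0) := by
      have : Continuous fun s : ℝ => ‖s • u‖ := by fun_prop
      have := this.tendsto 0
      rw [zero_smul, norm_zero] at this
      exact this.mono_left nhdsWithin_le_nhds
    exact (J.continuous.tendsto _).comp ((tendsto_eproj ψ).comp h1)
  have hφ : Tendsto (fun s : ℝ => adj (Y (ρ • s • u)) (J (eproj (1 - ‖s • u‖) φ))) (𝓝[>] 0)
      (𝓝 (adj Y₀ (J φ))) := by
    obtain ⟨C, hC⟩ := sY.bdd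
    exact tendsto_mul_apply (S := fun s : ℝ => adj (Y (ρ • s • u)))
      (T := fun s : ℝ => J * eproj (1 - ‖s • u‖)) (A := adj Y₀) (B := J) (C := C)
      (fun s => by rw [norm_adj]; exact hC _) (fun η => (sY.conv_adj η).comp hq0) φ (hp0 φ)
  have hψ : Tendsto (fun s : ℝ => Z (-(ρ • s • u)) (J (eproj (1 - ‖s • u‖) ψ))) (𝓝[>] 0)
      (𝓝 (Z₀ (J ψ))) := by
    obtain ⟨C, hC⟩ := sZ.bdd
    exact tendsto_mul_apply (S := fun s : ℝ => Z (-(ρ • s • u)))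
      (T := fun s : ℝ => J * eproj (1 - ‖s • u‖)) (A := Z₀) (B := J) (C := C)
      (fun s => hC _) (fun η => (sZ.conv η).comp hq0') ψ (hp0 ψ)
  have hlim := tendsto_inner_of_bounded
    (S := fun s : ℝ => T ((ρ * s) • u) - T (-((ρ * s) • u)))
    (c := fun s : ℝ => (((2 * (ρ * s))⁻¹ : ℝ) : ℂ)) (C := L * ‖u‖) ?_ hφ hψ
    ((hH.deriv u _ _).comp hρs)
  swap
  · filter_upwards [self_mem_nhdsWithin] with s hs
    have hs1 : 0 < s := hs
    have hs0 : 0 < ρ * s := mul_pos h0 hs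
    have h1 := hL ((ρ * s) • u) (-((ρ * s) • u)) (norm_neg _).symm
    rw [sub_neg_eq_add ((ρ * s) • u), ← two_smul ℝ, smul_smul, norm_smul,
      norm_of_nonneg (by positivity)] at h1
    rw [norm_real, norm_of_nonneg (by positivity)]
    calc _ ≤ (2 * (ρ * s))⁻¹ * (L * (2 * (ρ * s) * ‖u‖)) :=
          mul_le_mul_of_nonneg_left h1 (by positivity)
      _ = _ := by field_simp
  refine tendsto_nhds_unique (hG.deriv u φ ψ) ?_
  refine (hlim.const_mul ((ρ : ℂ) * κ⁻¹)).congr' ?_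
  filter_upwards [self_mem_nhdsWithin] with s hs
  have hs0 : (0 : ℝ) < s := hs
  have hsu : s • u ≠ 0 := smul_ne_zero hs0.ne' hu
  have hqn : ρ • s • u ≠ 0 := smul_ne_zero h0.ne' hsu
  exact deriv_dilate_aux h0 h1 hκ hFG hP hG hs0 hsu φ ψ

theorem commutator_dilate (h0 : 0 < ρ) (h1 : ρ < 1) (hκ : κ ≠ 0)
    (hFG : F * dilOp h0 h1 = κ • (dilOp h0 h1 * G))
    {DF : Photon → Op} (hF : Soft F FT DF) (hG : Soft G TG DG) (ψ : FockOne) :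
    ∀ᵐ k ∂photonMeasure, dilOp h0 h1 (DG k ψ) =
      (κ⁻¹ * ((ρ ^ (3 / 2 : ℝ) : ℝ) : ℂ)) • DF (scale ρ k) (dilOp h0 h1 ψ) := by
  set c : ℂ := ((ρ⁻¹ ^ (3 / 2 : ℝ) : ℝ) : ℂ) with hc
  have hcc : κ⁻¹ * ((ρ ^ (3 / 2 : ℝ) : ℝ) : ℂ) * (κ * c) = 1 := by
    have : ρ ^ (3 / 2 : ℝ) * ρ⁻¹ ^ (3 / 2 : ℝ) = 1 := by
      rw [← Real.mul_rpow h0.le (inv_nonneg.2 h0.le), mul_inv_cancel₀ h0.ne', Real.one_rpow]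
    rw [mul_mul_mul_comm, inv_mul_cancel₀ hκ, one_mul, hc, ← Complex.ofReal_mul, this,
      Complex.ofReal_one]
  have hFψ : F (dilOp h0 h1 ψ) = κ • dilOp h0 h1 (G ψ) :=
    congrArg (fun X : Op => X ψ) hFG
  have key : ∀ᵐ k ∂photonMeasure, DF k (dilOp h0 h1 ψ) =
      (κ * c) • dilOp h0 h1 (DG (scale ρ⁻¹ k) ψ) := by
    filter_upwards [hF.pull (dilOp h0 h1 ψ), ann_dilate h0 h1 ψ, ann_dilate h0 h1 (G ψ),
      ann_smul κ (dilOp h0 h1 (G ψ)), ae_scale (inv_pos.2 h0) (hG.pull ψ),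
      ae_scale (inv_pos.2 h0) (energyLE_ann ψ), ae_photon_ne_zero] with k a1 a2 a3 a4 a5 a6 a7
    have hk : (scale ρ⁻¹ k).1 ≠ 0 := smul_ne_zero (inv_pos.2 h0).ne' a7
    have b := shift_dilate h0 h1 hFG hF hG hk a6
    have hk' : ρ • (scale ρ⁻¹ k).1 = k.1 := by
      rw [scale, smul_smul, mul_inv_cancel₀ h0.ne', one_smul]
    rw [hk'] at b
    have a2' : ann k (dilOp h0 h1 ψ) = c • dilOp h0 h1 (ann (scale ρ⁻¹ k) ψ) := a2
    have a3' : ann k (dilOp h0 h1 (G ψ)) = c • dilOp h0 h1 (ann (scale ρ⁻¹ k) (G ψ)) := a3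
    have a1' : κ • c • dilOp h0 h1 (TG (scale ρ⁻¹ k).1 (ann (scale ρ⁻¹ k) ψ) +
        DG (scale ρ⁻¹ k) ψ) = FT k.1 (c • dilOp h0 h1 (ann (scale ρ⁻¹ k) ψ)) +
        DF k (dilOp h0 h1 ψ) := by
      rw [← a5, ← a3', ← a4, ← hFψ, a1, a2']
    rw [map_smul, b, map_add, smul_add, smul_add, smul_comm c κ, add_right_inj, smul_smul] at a1'
    exact a1'.symm
  filter_upwards [ae_scale h0 key] with k hk
  rw [hk, scale_scale, inv_mul_cancel₀ h0.ne', scale_one, smul_smul, hcc, one_smul]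

theorem WardAnn.transfer (h0 : 0 < ρ) (h1 : ρ < 1) (hκ : κ ≠ 0) (hσ : 0 < σ)
    (hFG : F * dilOp h0 h1 = κ • (dilOp h0 h1 * G)) (hH : WardData A T D der σ)
    (hP : FeshbachPair T D F FT Y₀ Y Z₀ Z) (hG : WardData G TG DG derG (σ / ρ))
    {g : ℝ} {e : Direction → Momentum} {lam : Bool} {U : Set Direction}
    (hW : WardAnn A der g e lam U σ) : WardAnn G derG g e lam U (σ / ρ) := by
  rw [hG.wardAnn_iff (div_pos hσ h0)]
  intro φ ψ _ _
  obtain ⟨DY, sY⟩ := hP.left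
  set φ' := adj Y₀ (dilOp h0 h1 φ) with hφ'
  set ψ' := Z₀ (dilOp h0 h1 ψ) with hψ'
  obtain ⟨B, -, hB⟩ := hH.ratio_bound hσ
  filter_upwards [hH.ward_all hσ hW φ' ψ',
    ae_restrict_of_ae (ae_polar (commutator_dilate h0 h1 hκ hFG hP.soft hG.soft ψ) lam)] with n hn hc
  have hn0 : (n : Momentum) ≠ 0 := ne_zero_of_mem_unit_sphere n
  have hq : Tendsto (fun r : ℝ => r • (n : Momentum)) softFilter (𝓝[≠] 0) := by
    refine tendsto_nhdsWithin_iff.2 ⟨?_, ?_⟩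
    · have : Continuous fun r : ℝ => r • (n : Momentum) := by fun_prop
      have := this.tendsto 0
      rw [zero_smul] at this
      exact (this.mono_left nhdsWithin_le_nhds).mono_left softFilter_le
    · filter_upwards [eventually_soft_pos] with r hr
      exact smul_ne_zero hr.ne' hn0
  have hY : Tendsto (fun r : ℝ => adj (Y (r • (n : Momentum))) (dilOp h0 h1 φ)) softFilter (𝓝 φ') :=
    (sY.conv_adj _).comp hq
  have hlim : Tendsto (fun r : ℝ => ((softRatio σ r : ℝ) : ℂ) *
      inner ℂ φ' (D (r • (n : Momentum), lam) ψ')) softFilter (𝓝 (-(g * der (e n) φ' ψ'))) := by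
    have := hn.sub_const (g * der (e n) φ' ψ')
    rw [zero_sub] at this
    exact this.congr fun r => by ring
  have h3 := tendsto_inner_of_bounded (S := fun r : ℝ => D (r • (n : Momentum), lam))
    (c := fun r : ℝ => ((softRatio σ r : ℝ) : ℂ)) (C := B) (by
      filter_upwards [hB n lam, eventually_soft_pos] with r hr hr0
      rwa [norm_real, norm_of_nonneg (softRatio_nonneg hσ hr0)])
    hY (tendsto_const_nhds (x := ψ')) hlim
  have h4 := (((h3.comp (tendsto_soft_mul h0)).const_add (g * der (e n) φ' ψ')).const_mul
    ((ρ : ℂ) * κ⁻¹))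
  rw [add_neg_cancel, mul_zero] at h4
  refine h4.congr' ?_
  filter_upwards [eventually_soft_of_ae hc, eventually_soft_pos] with r hr hr0
  have e1 : (inner ℂ φ (DG (r • (n : Momentum), lam) ψ) : ℂ) = κ⁻¹ * ((ρ ^ (3 / 2 : ℝ) : ℝ) : ℂ) *
      inner ℂ (adj (Y ((ρ * r) • (n : Momentum))) (dilOp h0 h1 φ))
        (D ((ρ * r) • (n : Momentum), lam) ψ') := by
    have a1 : (inner ℂ φ (DG (r • (n : Momentum), lam) ψ) : ℂ) =
        inner ℂ (dilOp h0 h1 φ) (dilOp h0 h1 (DG (r • (n : Momentum), lam) ψ)) :=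
      ((dilIso h0 h1).inner_map_map _ _).symm
    have a2 : scale ρ (r • (n : Momentum), lam) = ((ρ * r) • (n : Momentum), lam) := by
      rw [scale, smul_smul]
    rw [a2] at hr
    rw [a1, hr, inner_smul_r, adjoint_inner_l]
    rfl
  have e2 : ρ ^ (3 / 2 : ℝ) = √ρ * ρ := by
    rw [Real.sqrt_eq_rpow, ← Real.rpow_add_one h0.ne']; norm_num
  rw [e1, deriv_dilate h0 h1 hκ hFG hH hP hG, e2]
  simp only [Function.comp_apply]
  rw [← softRatio_scale h0]
  push_cast
  ring

end Transfer

end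

section
/-! ### Operators with differentiable kernels -/

/-- Total energy of a tuple of photons. -/
def tupleEnergy {M : ℕ} (K : Tuple M) : ℝ := mEnergy (tupleBag K)

lemma tupleEnergy_nonneg {M : ℕ} (K : Tuple M) : 0 ≤ tupleEnergy K := mEnergy_nonneg _



lemma measurable_tupleEnergy {M : ℕ} : Measurable (tupleEnergy (M := M)) :=
  measurable_mEnergy.comp (measurable_inSector M)

variable {ω : Photon → ℝ} {B θ : ℝ} {u v : Kernels} {Φ Ψ : Bag → ℂ}

lemma wickIntegrand_congr {M N : ℕ}
    {w w' : ℝ × Momentum → Tuple M → Tuple N → ℂ} {a b : ℝ}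
    (hΦ : ∀ s, a < mEnergy s → Φ s = 0) (hΨ : ∀ s, b < mEnergy s → Ψ s = 0)
    (h : ∀ Y K K', ‖Y.2‖ ≤ Y.1 → Y.1 + tupleEnergy K ≤ a → Y.1 + tupleEnergy K' ≤ b →
      w Y K K' = w' Y K K') : wickIntegrand ω w Φ Ψ = wickIntegrand ω w' Φ Ψ := by
  funext z
  have e : ∀ {n : ℕ} (K : Tuple n), mEnergy (tupleBag K + bag z.1) =
      mEnergy (bag z.1) + tupleEnergy K := fun K => (mEnergy_add _ _).trans (add_comm _ _)
  rw [wickIntegrand, wickIntegrand]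
  by_cases h1 : mEnergy (bag z.1) + tupleEnergy z.2.1 ≤ a
  · by_cases h2 : mEnergy (bag z.1) + tupleEnergy z.2.2 ≤ b
    · rw [h (point (bag z.1)) z.2.1 z.2.2 (norm_mMomentum_le _) h1 h2]
    · have h0 := hΨ (tupleBag z.2.2 + bag z.1) ((e z.2.2).symm ▸ not_le.1 h2)
      simp only [h0, mul_zero]
  · have h0 := hΦ (tupleBag z.2.1 + bag z.1) ((e z.2.1).symm ▸ not_le.1 h1)
    simp only [h0, map_zero, zero_mul]

lemma wickSeries_congr_kernel {a b : ℝ} (hΦ : ∀ s, a < mEnergy s → Φ s = 0)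
    (hΨ : ∀ s, b < mEnergy s → Ψ s = 0)
    (h : ∀ M N Y K K', ‖Y.2‖ ≤ Y.1 → Y.1 + tupleEnergy K ≤ a → Y.1 + tupleEnergy K' ≤ b →
      u M N Y K K' = v M N Y K K') : wickSeries ω u Φ Ψ = wickSeries ω v Φ Ψ :=
  tsum_congr fun m => by
    rw [wick, wick, wickIntegrand_congr hΦ hΨ fun Y K K' => h m.1 m.2 Y K K']

/-- Restriction of a kernel to physical arguments. -/
def restrictK (a b : ℝ) (u : Kernels) : Kernels := fun _ _ Y K K' =>
  if ‖Y.2‖ ≤ Y.1 ∧ Y.1 + tupleEnergy K ≤ a ∧ Y.1 + tupleEnergy K' ≤ b then u _ _ Y K K' else 0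

lemma isKernel_restrictK {a b : ℝ} (ha : a ≤ 1) (hb : b ≤ 1) (h0 : 0 ≤ B) (hθ : 0 ≤ θ)
    (hm : ∀ M N, KMeas (u M N))
    (hB : ∀ M N Y K K', ‖Y.2‖ ≤ Y.1 → Y.1 + tupleEnergy K ≤ a → Y.1 + tupleEnergy K' ≤ b →
      ‖u M N Y K K'‖ ≤ B * θ ^ (M + N)) : IsKernel B θ (restrictK a b u) where
  nonneg := h0
  nonneg' := hθ
  meas M N := by
    have e1 : Measurable fun x : (ℝ × Momentum) × Tuple M × Tuple N =>
        x.1.1 + tupleEnergy x.2.1 :=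
      (measurable_fst.fst).add (measurable_tupleEnergy.comp measurable_snd.fst)
    have e2 : Measurable fun x : (ℝ × Momentum) × Tuple M × Tuple N =>
        x.1.1 + tupleEnergy x.2.2 :=
      (measurable_fst.fst).add (measurable_tupleEnergy.comp measurable_snd.snd)
    refine Measurable.ite ?_ (hm M N) measurable_const
    exact (measurableSet_le measurable_fst.snd.norm measurable_fst.fst).inter
      ((measurableSet_le e1 measurable_const).inter (measurableSet_le e2 measurable_const))
  bound M N Y K K' := by
    rw [restrictK]; split_ifs with h
    · exact hB M N Y K K' h.1 h.2.1 h.2.2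
    · rw [norm_zero]; positivity
  left M N Y K K' h := by
    by_contra h'
    exact h (if_neg fun hc => h' (hc.2.1.trans ha))
  right M N Y K K' h := by
    by_contra h'
    exact h (if_neg fun hc => h' (hc.2.2.trans hb))

lemma norm_wickSeries_le_of_phys (hω : IsWeight ω) (hθκ : θ * kappa ≤ 1 / 2) (h0 : 0 ≤ B)
    (hθ : 0 ≤ θ) {b : ℝ} (hb : b ≤ 1) (hm : ∀ M N, KMeas (u M N))
    (hB : ∀ M N Y K K', ‖Y.2‖ ≤ Y.1 → Y.1 + tupleEnergy K ≤ 1 → Y.1 + tupleEnergy K' ≤ b →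
      ‖u M N Y K K'‖ ≤ B * θ ^ (M + N))
    (hΦ : IsAdm Φ) (hΨ : IsAdm Ψ) (hs : ∀ s, b < mEnergy s → Ψ s = 0) :
    ‖wickSeries ω u Φ Ψ‖ ≤ 4 * B * nrm Φ * nrm Ψ := by
  have e : wickSeries ω u Φ Ψ = wickSeries ω (restrictK 1 b u) Φ Ψ :=
    wickSeries_congr_kernel hΦ.supp hs fun M N Y K K' h1 h2 h3 => (if_pos ⟨h1, h2, h3⟩).symm
  rw [e]
  exact norm_wickSeries_le hω (isKernel_restrictK le_rfl hb h0 hθ hm hB) hθκ hΦ hΨ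

lemma wickSeries_sub {B' θ' : ℝ} (hω : IsWeight ω) (hu : IsKernel B θ u) (hθ : θ * kappa ≤ 1 / 2)
    (hv : IsKernel B' θ' v) (hθ' : θ' * kappa ≤ 1 / 2) (hΦ : IsAdm Φ) (hΨ : IsAdm Ψ) :
    wickSeries ω (fun M N Y K K' => u M N Y K K' - v M N Y K K') Φ Ψ =
      wickSeries ω u Φ Ψ - wickSeries ω v Φ Ψ := by
  rw [wickSeries, wickSeries, wickSeries,
    ← (summable_wick hω hu hθ hΦ hΨ).tsum_sub (summable_wick hω hv hθ' hΦ hΨ)]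
  refine tsum_congr fun m => ?_
  rw [wick, wick, wick, ← integral_sub
    (integrable_wickIntegrand hω (hu.meas _ _) (hu.bound _ _) hΦ hΨ)
    (integrable_wickIntegrand hω (hv.meas _ _) (hv.bound _ _) hΦ hΨ)]
  refine integral_congr_ae (.of_forall fun z => ?_)
  simp only [wickIntegrand]; ring

lemma exists_lipschitz_chi (C : SmoothCutoff) : ∃ L : ℝ, 0 ≤ L ∧ ∀ x y, 0 ≤ x → 0 ≤ y →
    |C.chi x - C.chi y| ≤ L * |x - y| := by
  have hd : ContDiff ℝ 1 C.chi := C.chi_smooth.of_le (by exact_mod_cast le_top)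
  obtain ⟨L, hL⟩ := (isCompact_Icc (a := (0 : ℝ)) (b := 1)).exists_bound_of_continuousOn
    (hd.continuous_deriv le_rfl).continuousOn
  have hL0 : 0 ≤ L := (norm_nonneg _).trans (hL 0 ⟨le_rfl, zero_le_one⟩)
  have h1 : ∀ x ∈ Set.Icc (0 : ℝ) 1, ∀ y ∈ Set.Icc (0 : ℝ) 1,
      |C.chi x - C.chi y| ≤ L * |x - y| := fun x hx y hy => by
    have := (convex_Icc (0 : ℝ) 1).norm_image_sub_le_of_norm_deriv_le
      (fun z _ => (hd.differentiable one_ne_zero).differentiableAt) hL hy hx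
    simpa only [Real.norm_eq_abs] using this
  have key : ∀ x y, 0 ≤ x → x ≤ y → |C.chi x - C.chi y| ≤ L * |x - y| := fun x y hx hxy => by
    rcases le_total y 1 with hy | hy
    · exact h1 x ⟨hx, hxy.trans hy⟩ y ⟨hx.trans hxy, hy⟩
    · rcases le_total x 1 with hx1 | hx1
      · have h2 := h1 x ⟨hx, hx1⟩ 1 ⟨zero_le_one, le_rfl⟩
        rw [C.chi_eq_zero 1 le_rfl] at h2
        rw [C.chi_eq_zero y hy]
        refine h2.trans (mul_le_mul_of_nonneg_left ?_ hL0)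
        rw [abs_sub_comm, abs_sub_comm x y, abs_of_nonneg (by linarith), abs_of_nonneg (by linarith)]
        linarith
      · rw [C.chi_eq_zero y hy, C.chi_eq_zero x hx1, sub_zero, abs_zero]
        positivity
  refine ⟨L, hL0, fun x y hx hy => ?_⟩
  rcases le_total x y with h | h
  · exact key x y hx h
  · rw [abs_sub_comm, abs_sub_comm x y]; exact key y x hy h

/-- The energy cutoffs of an interaction kernel; the kernel of degree zero carries none. -/
def cutFactor (C : SmoothCutoff) (M N : ℕ) (r a b : ℝ) : ℝ :=
  if M + N = 0 then 1 else C.chi (r + a) * C.chi (r + b)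

lemma cutFactor_nonneg (C : SmoothCutoff) (M N : ℕ) (r a b : ℝ) : 0 ≤ cutFactor C M N r a b := by
  rw [cutFactor]; split_ifs
  · exact zero_le_one
  · exact mul_nonneg (C.chi_nonneg _) (C.chi_nonneg _)

lemma cutFactor_le_one (C : SmoothCutoff) (M N : ℕ) (r a b : ℝ) : cutFactor C M N r a b ≤ 1 := by
  rw [cutFactor]; split_ifs
  · exact le_rfl
  · exact mul_le_one₀ (C.chi_le_one _) (C.chi_nonneg _) (C.chi_le_one _)

lemma cutFactor_sub_le (C : SmoothCutoff) {L : ℝ}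
    (hL : ∀ x y, 0 ≤ x → 0 ≤ y → |C.chi x - C.chi y| ≤ L * |x - y|) (hL0 : 0 ≤ L) (M N : ℕ)
    {r r' a b : ℝ} (hr : 0 ≤ r) (hr' : 0 ≤ r') (ha : 0 ≤ a) (hb : 0 ≤ b) :
    |cutFactor C M N r a b - cutFactor C M N r' a b| ≤ 2 * L * |r - r'| := by
  rw [cutFactor, cutFactor]
  split_ifs
  · rw [sub_self, abs_zero]; positivity
  · have h1 := hL (r + a) (r' + a) (by positivity) (by positivity)
    have h2 := hL (r + b) (r' + b) (by positivity) (by positivity)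
    rw [add_sub_add_right_eq_sub] at h1 h2
    have e : C.chi (r + a) * C.chi (r + b) - C.chi (r' + a) * C.chi (r' + b) =
        (C.chi (r + a) - C.chi (r' + a)) * C.chi (r + b) +
          C.chi (r' + a) * (C.chi (r + b) - C.chi (r' + b)) := by ring
    rw [e]
    refine (abs_add_le _ _).trans ?_
    rw [abs_mul, abs_mul, abs_of_nonneg (C.chi_nonneg _), abs_of_nonneg (C.chi_nonneg _)]
    have h3 := mul_le_of_le_one_right (abs_nonneg (C.chi (r + a) - C.chi (r' + a)))
      (C.chi_le_one (r + b))
    have h4 := mul_le_of_le_one_left (abs_nonneg (C.chi (r + b) - C.chi (r' + b)))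
      (C.chi_le_one (r' + a))
    linarith

lemma continuous_cutFactor (C : SmoothCutoff) (M N : ℕ) (a b : ℝ) :
    Continuous fun r => cutFactor C M N r a b := by
  simp only [cutFactor]
  split_ifs
  · exact continuous_const
  · exact (C.chi_smooth.continuous.comp (by fun_prop)).mul (C.chi_smooth.continuous.comp (by fun_prop))

/-- The kernels of an effective hamiltonian, with the energy cutoffs and the restriction to the
joint spectrum of energy and momentum built in. -/
def truncK (C : SmoothCutoff) (f : Kernels) : Kernels := fun M N Y K K' =>
  if ‖Y.2‖ ≤ Y.1 ∧ Y.1 ≤ 1 then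
    (cutFactor C M N Y.1 (tupleEnergy K) (tupleEnergy K') : ℂ) * f M N Y K K'
  else 0

/-- Kernels that are bounded, Lipschitz continuous and differentiable on the joint spectrum of energy
and momentum. -/
structure SmoothKernels (B θ : ℝ) (f : Kernels) (f' : Momentum → Kernels) : Prop where
  nonneg : 0 ≤ B
  nonneg' : 0 ≤ θ
  meas : ∀ M N, KMeas fun Y K K' => if ‖Y.2‖ ≤ Y.1 ∧ Y.1 ≤ 1 then f M N Y K K' else 0
  bound : ∀ M N Y K K', ‖Y.2‖ ≤ Y.1 → Y.1 ≤ 1 → ‖f M N Y K K'‖ ≤ B * θ ^ (M + N)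
  lip : ∀ M N Y Y' K K', ‖Y.2‖ ≤ Y.1 → Y.1 ≤ 1 → ‖Y'.2‖ ≤ Y'.1 → Y'.1 ≤ 1 →
    ‖f M N Y K K' - f M N Y' K K'‖ ≤ B * θ ^ (M + N) * (|Y.1 - Y'.1| + ‖Y.2 - Y'.2‖)
  deriv : ∀ p M N Y K K', ‖Y.2‖ ≤ Y.1 → Y.1 < 1 → Tendsto (fun s : ℝ => (((2 * s)⁻¹ : ℝ) : ℂ) *
    (f M N (‖s • p‖ + Y.1, s • p + Y.2) K K' - f M N (‖s • p‖ + Y.1, -(s • p) + Y.2) K K')) (𝓝[>] 0)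
    (𝓝 (f' p M N Y K K'))

variable {C : SmoothCutoff} {f : Kernels} {f' : Momentum → Kernels}

lemma SmoothKernels.adj (h : SmoothKernels B θ f f') :
    SmoothKernels B θ (kernelsAdj f) fun p => kernelsAdj (f' p) where
  nonneg := h.nonneg
  nonneg' := h.nonneg'
  meas M N := by
    have h1 := (h.meas N M).kadj
    have e : (fun (Y : ℝ × Momentum) (K : Tuple M) (K' : Tuple N) =>
        if ‖Y.2‖ ≤ Y.1 ∧ Y.1 ≤ 1 then kernelsAdj f M N Y K K' else 0) =
        kadj fun Y K K' => if ‖Y.2‖ ≤ Y.1 ∧ Y.1 ≤ 1 then f N M Y K K' else 0 := by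
      funext Y K K'
      simp only [kadj, kernelsAdj]
      split_ifs <;> simp
    rw [e]; exact h1
  bound M N Y K K' h1 h2 := by
    rw [kernelsAdj, kadj, RCLike.norm_conj, add_comm M N]
    exact h.bound N M Y K' K h1 h2
  lip M N Y Y' K K' h1 h2 h3 h4 := by
    rw [kernelsAdj, kadj, kadj, ← map_sub, RCLike.norm_conj, add_comm M N]
    exact h.lip N M Y Y' K' K h1 h2 h3 h4
  deriv p M N Y K K' h1 h2 := by
    refine ((continuous_conj.tendsto _).comp (h.deriv p N M Y K' K h1 h2)).congr fun s => ?_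
    simp only [Function.comp_apply, kernelsAdj, kadj, map_mul, map_sub, conj_ofReal]

lemma kernelsAdj_truncK : kernelsAdj (truncK C f) = truncK C (kernelsAdj f) := by
  funext M N Y K K'
  simp only [kernelsAdj, kadj, truncK, cutFactor]
  split_ifs with h1 h2 h3 h3
  · simp
  · omega
  · omega
  · rw [map_mul, conj_ofReal, mul_comm (C.chi _)]
  · simp

lemma shiftK_adj (q : Momentum) : shiftK q (kernelsAdj v) = kernelsAdj (shiftK q v) := rfl

lemma measurable_cutFactor {M N : ℕ} : Measurable
    fun x : (ℝ × Momentum) × Tuple M × Tuple N =>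
      cutFactor C M N x.1.1 (tupleEnergy x.2.1) (tupleEnergy x.2.2) := by
  simp only [cutFactor]
  split_ifs
  · exact measurable_const
  · exact (C.chi_smooth.continuous.measurable.comp
      (measurable_fst.fst.add (measurable_tupleEnergy.comp measurable_snd.fst))).mul
      (C.chi_smooth.continuous.measurable.comp
      (measurable_fst.fst.add (measurable_tupleEnergy.comp measurable_snd.snd)))

lemma cutFactor_ne_zero {M N : ℕ} {r : ℝ} (hr : r ≤ 1) {K : Tuple M} {K' : Tuple N}
    (h : cutFactor C M N r (tupleEnergy K) (tupleEnergy K') ≠ 0) :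
    r + tupleEnergy K ≤ 1 ∧ r + tupleEnergy K' ≤ 1 := by
  rw [cutFactor] at h
  split_ifs at h with h1
  · obtain ⟨rfl, rfl⟩ := Nat.add_eq_zero_iff.1 h1
    have e : ∀ K : Fin 0 → Photon, tupleEnergy K = 0 := fun K => by
      simp [tupleEnergy, mEnergy, bag]
    rw [e, e, add_zero]; exact ⟨hr, hr⟩
  · constructor
    · by_contra h2
      rw [C.chi_eq_zero _ (not_le.1 h2).le, zero_mul] at h; exact h rfl
    · by_contra h2
      rw [C.chi_eq_zero (r + tupleEnergy K') (not_le.1 h2).le, mul_zero] at h; exact h rfl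

theorem SmoothKernels.isKernel (h : SmoothKernels B θ f f') : IsKernel B θ (truncK C f) where
  nonneg := h.nonneg
  nonneg' := h.nonneg'
  meas M N := by
    have h1 := (measurable_ofReal.comp (measurable_cutFactor (C := C) (M := M) (N := N))).mul
      (h.meas M N)
    have e : (fun x : (ℝ × Momentum) × Tuple M × Tuple N =>
        truncK C f M N x.1 x.2.1 x.2.2) = fun x =>
        (cutFactor C M N x.1.1 (tupleEnergy x.2.1) (tupleEnergy x.2.2) : ℂ) *
          if ‖x.1.2‖ ≤ x.1.1 ∧ x.1.1 ≤ 1 then f M N x.1 x.2.1 x.2.2 else 0 := by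
      funext x
      simp only [truncK]
      split_ifs <;> simp
    rw [KMeas, e]; exact h1
  bound M N Y K K' := by
    rw [truncK]; split_ifs with hY
    · rw [norm_mul, norm_real, norm_of_nonneg (cutFactor_nonneg _ _ _ _ _ _)]
      exact (mul_le_of_le_one_left (norm_nonneg _) (cutFactor_le_one _ _ _ _ _ _)).trans
        (h.bound M N Y K K' hY.1 hY.2)
    · rw [norm_zero]; have := h.nonneg; have := h.nonneg'; positivity
  left M N Y K K' h0 := by
    rw [truncK] at h0
    split_ifs at h0 with hY
    · have := left_ne_zero_of_mul h0
      exact (cutFactor_ne_zero hY.2 (by exact_mod_cast this)).1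
    · exact absurd rfl h0
  right M N Y K K' h0 := by
    rw [truncK] at h0
    split_ifs at h0 with hY
    · have := left_ne_zero_of_mul h0
      exact (cutFactor_ne_zero hY.2 (by exact_mod_cast this)).2
    · exact absurd rfl h0

lemma phys_shift {Y : ℝ × Momentum} (h : ‖Y.2‖ ≤ Y.1) (q : Momentum) :
    ‖q + Y.2‖ ≤ ‖q‖ + Y.1 := (norm_add_le _ _).trans (add_le_add_right h _)

/-- Lipschitz continuity of the translated kernels. -/
theorem SmoothKernels.shift_lip (h : SmoothKernels B θ f f') : ∃ L : ℝ, 0 ≤ L ∧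
    ∀ (q q' : Momentum) M N Y K K', ‖Y.2‖ ≤ Y.1 → ‖q‖ + Y.1 ≤ 1 → ‖q'‖ + Y.1 ≤ 1 →
      ‖shiftK q (truncK C f) M N Y K K' - shiftK q' (truncK C f) M N Y K K'‖ ≤
        L * ‖q - q'‖ * θ ^ (M + N) := by
  obtain ⟨Lc, hL0, hL⟩ := exists_lipschitz_chi C
  have hB := h.nonneg
  have hθ := h.nonneg'
  refine ⟨B * (2 * Lc + 2), by positivity, fun q q' M N Y K K' hY h1 h2 => ?_⟩
  have hY0 : 0 ≤ Y.1 := (norm_nonneg _).trans hY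
  have p1 := phys_shift hY q
  have p2 := phys_shift hY q'
  set Z : ℝ × Momentum := (‖q‖ + Y.1, q + Y.2) with hZ
  set Z' : ℝ × Momentum := (‖q'‖ + Y.1, q' + Y.2) with hZ'
  have e : shiftK q (truncK C f) M N Y K K' - shiftK q' (truncK C f) M N Y K K' =
      ((cutFactor C M N Z.1 (tupleEnergy K) (tupleEnergy K') -
        cutFactor C M N Z'.1 (tupleEnergy K) (tupleEnergy K') : ℝ) : ℂ) * f M N Z K K' +
      (cutFactor C M N Z'.1 (tupleEnergy K) (tupleEnergy K') : ℂ) *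
        (f M N Z K K' - f M N Z' K K') := by
    rw [shiftK, shiftK, truncK, truncK, if_pos (show _ ∧ _ from ⟨p1, h1⟩),
      if_pos (show _ ∧ _ from ⟨p2, h2⟩)]
    push_cast; ring
  have hZZ : |Z.1 - Z'.1| ≤ ‖q - q'‖ := by
    simp only [hZ, hZ', add_sub_add_right_eq_sub]
    exact abs_norm_sub_norm_le q q'
  have hZ2 : Z.2 - Z'.2 = q - q' := by simp only [hZ, hZ', add_sub_add_right_eq_sub]
  have b1 : ‖((cutFactor C M N Z.1 (tupleEnergy K) (tupleEnergy K') -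
        cutFactor C M N Z'.1 (tupleEnergy K) (tupleEnergy K') : ℝ) : ℂ) * f M N Z K K'‖ ≤
      2 * Lc * ‖q - q'‖ * (B * θ ^ (M + N)) := by
    rw [norm_mul, norm_real, Real.norm_eq_abs]
    refine mul_le_mul ?_ (h.bound M N Z K K' p1 h1) (norm_nonneg _) (by positivity)
    exact (cutFactor_sub_le C hL hL0 M N (by positivity) (by positivity) (tupleEnergy_nonneg K)
      (tupleEnergy_nonneg K')).trans (mul_le_mul_of_nonneg_left hZZ (by positivity))
  have b2 : ‖(cutFactor C M N Z'.1 (tupleEnergy K) (tupleEnergy K') : ℂ) *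
        (f M N Z K K' - f M N Z' K K')‖ ≤ B * θ ^ (M + N) * (2 * ‖q - q'‖) := by
    rw [norm_mul, norm_real, norm_of_nonneg (cutFactor_nonneg _ _ _ _ _ _)]
    refine (mul_le_of_le_one_left (norm_nonneg _) (cutFactor_le_one _ _ _ _ _ _)).trans ?_
    refine (h.lip M N Z Z' K K' p1 h1 p2 h2).trans (mul_le_mul_of_nonneg_left ?_ (by positivity))
    rw [hZ2]; linarith
  rw [e]
  calc _ ≤ _ := (norm_add_le _ _).trans (add_le_add b1 b2)
    _ = _ := by ring

lemma SmoothKernels.isKernel_shift (h : SmoothKernels B θ f f') (q : Momentum) :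
    IsKernel B θ (shiftK q (truncK C f)) := h.isKernel.shift q

lemma shiftK_zero : shiftK 0 v = v := by
  funext M N Y K K'
  simp [shiftK]

lemma norm_le_of_inner {x : FockOne} {c : ℝ} (hc : 0 ≤ c) (h : ∀ φ : FockOne, ‖(inner ℂ φ x : ℂ)‖ ≤ c * ‖φ‖) :
    ‖x‖ ≤ c := by
  have h1 := h x
  rw [inner_self_eq, norm_real, norm_of_nonneg (by positivity), pow_two] at h1
  by_cases hx : ‖x‖ = 0
  · rwa [hx]
  · exact le_of_mul_le_mul_right h1 (lt_of_le_of_ne (norm_nonneg x) (Ne.symm hx))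

theorem SmoothKernels.norm_shift_sub_le (h : SmoothKernels B θ f f') (hω : IsWeight ω)
    (hθ : θ * kappa ≤ 1 / 2) : ∃ L : ℝ, 0 ≤ L ∧ ∀ (q q' : Momentum) (b : ℝ) ψ,
      b + ‖q‖ ≤ 1 → b + ‖q'‖ ≤ 1 → EnergyLE b ψ →
      ‖kop ω (shiftK q (truncK C f)) ψ - kop ω (shiftK q' (truncK C f)) ψ‖ ≤
        L * ‖q - q'‖ * ‖ψ‖ := by
  obtain ⟨L, hL0, hL⟩ := h.shift_lip (C := C)
  refine ⟨4 * L, by positivity, fun q q' b ψ hq hq' hψ => norm_le_of_inner (by positivity) fun φ => ?_⟩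
  have k1 := kop_spec hω (h.isKernel_shift (C := C) q) hθ
  have k2 := kop_spec hω (h.isKernel_shift (C := C) q') hθ
  let Ψ : Bag → ℂ := fun s => (if mEnergy s ≤ b then 1 else 0) * rep ψ s
  have hΨ : IsAdm Ψ := (efun_indicator b).adm (rep_adm ψ)
  have hΨs : ∀ s, b < mEnergy s → Ψ s = 0 := fun s hs => by
    simp only [Ψ, if_neg (not_le.2 hs), zero_mul]
  have hae : ∀ᵐ x ∂fockMeasure, rep ψ (bag x) = Ψ (bag x) := by
    filter_upwards [hψ] with x hx
    by_cases hxb : mEnergy (bag x) ≤ b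
    · simp only [Ψ, if_pos hxb, one_mul]
    · rw [hx (not_le.1 hxb), hΨs _ (not_le.1 hxb)]
  have hb : b ≤ 1 := by have := norm_nonneg q; linarith
  have e : (inner ℂ φ (kop ω (shiftK q (truncK C f)) ψ - kop ω (shiftK q' (truncK C f)) ψ) : ℂ) =
      wickSeries ω (fun M N Y K K' => shiftK q (truncK C f) M N Y K K' -
        shiftK q' (truncK C f) M N Y K K') (rep φ) Ψ := by
    rw [inner_sub_r, k1.1, k2.1,
      wickSeries_sub hω (h.isKernel_shift q) hθ (h.isKernel_shift q') hθ (rep_adm φ) hΨ]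
    congr 1
    · exact wickSeries_congr hω (h.isKernel_shift q) (rep_adm φ) (rep_adm φ) (rep_adm ψ) hΨ
        (.of_forall fun _ => rfl) hae
    · exact wickSeries_congr hω (h.isKernel_shift q') (rep_adm φ) (rep_adm φ) (rep_adm ψ) hΨ
        (.of_forall fun _ => rfl) hae
  rw [e]
  have hbd := norm_wickSeries_le_of_phys hω hθ (B := L * ‖q - q'‖)
    (u := fun M N Y K K' => shiftK q (truncK C f) M N Y K K' -
        shiftK q' (truncK C f) M N Y K K') (by positivity) h.nonneg' hb
    (fun M N => ((h.isKernel_shift (C := C) q).meas M N).sub ((h.isKernel_shift (C := C) q').meas M N))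
    (fun M N Y K K' hY _ hK' => hL q q' M N Y K K' hY
      (by have := tupleEnergy_nonneg K'; linarith) (by have := tupleEnergy_nonneg K'; linarith))
    (rep_adm φ) hΨ hΨs
  refine hbd.trans (le_of_eq ?_)
  rw [nrm_rep, ← nrm_congr hae, nrm_rep]; ring

lemma kop_shift_eproj (hω : IsWeight ω) (hv : IsKernel B θ v) (hθ : θ * kappa ≤ 1 / 2)
    (q : Momentum) : kop ω (shiftK q v) * eproj (1 - ‖q‖) = kop ω (shiftK q v) := by
  refine ContinuousLinearMap.ext fun ψ => ext_inner_left ℂ fun φ => ?_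
  have k1 := kop_spec hω (hv.shift q) hθ
  change inner ℂ φ (kop ω (shiftK q v) (eproj (1 - ‖q‖) ψ)) = _
  rw [k1.1, k1.1]
  let Ψ : Bag → ℂ := fun s => (if mEnergy s ≤ 1 - ‖q‖ then 1 else 0) * rep ψ s
  have hΨ : IsAdm Ψ := (efun_indicator (1 - ‖q‖)).adm (rep_adm ψ)
  refine (wickSeries_congr hω (hv.shift q) (rep_adm φ) (rep_adm φ) (rep_adm _) hΨ
    (.of_forall fun _ => rfl) (rep_eproj (1 - ‖q‖) ψ)).trans ?_
  refine tsum_congr fun m => integral_congr_ae (.of_forall fun z => ?_)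
  simp only [wickIntegrand]
  by_cases h0 : shiftK q v m.1 m.2 (point (bag z.1)) z.2.1 z.2.2 = 0
  · rw [h0]; simp
  · have h1 := hv.right _ _ _ _ _ h0
    have h2 : mEnergy (tupleBag z.2.2 + bag z.1) ≤ 1 - ‖q‖ := by
      rw [mEnergy_add]
      have : ‖q‖ + mEnergy (bag z.1) + mEnergy (tupleBag z.2.2) ≤ 1 := h1
      linarith
    simp only [Ψ, if_pos h2, one_mul]

lemma eproj_kop_shift (hω : IsWeight ω) (hv : IsKernel B θ v) (hθ : θ * kappa ≤ 1 / 2)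
    (q : Momentum) : eproj (1 - ‖q‖) * kop ω (shiftK q v) = kop ω (shiftK q v) := by
  have h1 := kop_shift_eproj hω hv.adj hθ q
  rw [shiftK_adj, ← adjoint_kop hω (hv.shift q) hθ] at h1
  have h2 := congrArg (fun X : Op => adj X) h1
  simpa only [adj_mul, adj_adj, adjoint_eproj] using h2

/-- The commutators `[a(k), kop ω v]`, up to translations. -/
def commK (ω : Photon → ℝ) (v : Kernels) (k : Photon) : Op := (ω k : ℂ) • kop ω (contractK k v)

lemma norm_commK_le (hω : IsWeight ω) (hv : IsKernel B θ v) (hθ : θ * kappa ≤ 1 / 4) (k : Photon) :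
    ‖commK ω v k‖ ≤ 4 * (θ * B) * ω k := by
  have h1 := (kop_spec hω (hv.contract k) (by linarith : 2 * θ * kappa ≤ 1 / 2)).2
  refine (norm_smul_le (ω k : ℂ) _).trans ?_
  rw [norm_real, norm_of_nonneg (hω.nonneg k), mul_comm]
  exact mul_le_mul_of_nonneg_right h1 (hω.nonneg k)

end

section
variable {ω : Photon → ℝ} {B θ : ℝ} {v : Kernels} {Φ Ψ : Bag → ℂ}
  {C : SmoothCutoff} {f : Kernels} {f' : Momentum → Kernels}

/-! ### Translated kernels as soft photon data -/

lemma wickSeries_const_mul (c : ℂ) : wickSeries ω (fun M N Y K K' => c * v M N Y K K') Φ Ψ =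
    c * wickSeries ω v Φ Ψ := by
  rw [wickSeries, wickSeries, ← tsum_mul_left]
  refine tsum_congr fun m => ?_
  rw [wick, wick, ← integral_const_mul]
  refine integral_congr_ae (.of_forall fun z => ?_)
  simp only [wickIntegrand]; ring

lemma tendsto_wickSeries {ι : Type*} {l : Filter ι} [l.IsCountablyGenerated] {U : ι → Kernels}
    (hω : IsWeight ω) (h0 : 0 ≤ B) (h0' : 0 ≤ θ) (hθ : θ * kappa ≤ 1 / 2)
    (hm : ∀ i M N, KMeas (U i M N))
    (hB : ∀ᶠ i in l, ∀ M N Y K K', ‖U i M N Y K K'‖ ≤ B * θ ^ (M + N))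
    (hlim : ∀ M N Y K K', Tendsto (fun i => U i M N Y K K') l (𝓝 (v M N Y K K')))
    (hΦ : IsAdm Φ) (hΨ : IsAdm Ψ) :
    Tendsto (fun i => wickSeries ω (U i) Φ Ψ) l (𝓝 (wickSeries ω v Φ Ψ)) := by
  refine tendsto_tsum_of_dominated_convergence ((summable_geometric_pair
    (mul_nonneg h0' kappa_nonneg) hθ).1.mul_left (B * nrm Φ * nrm Ψ)) (fun m => ?_)
    (hB.mono fun i hi => norm_wick_kernel_le hω h0 h0' hi hΦ hΨ)
  have hb0 : 0 ≤ B * θ ^ (m.1 + m.2) := by positivity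
  have hi := integrable_wickIntegrand (M := m.1) (N := m.2) hω
    (w := fun _ _ _ => ((B * θ ^ (m.1 + m.2) : ℝ) : ℂ)) measurable_const
    (fun _ _ _ => le_rfl) hΦ hΨ
  refine tendsto_integral_filter_of_dominated_convergence _
    (.of_forall fun i =>
      (measurable_wickIntegrand hω.meas (hm i m.1 m.2) hΦ.meas hΨ.meas).aestronglyMeasurable)
    (hB.mono fun i hi => Eventually.of_forall fun z => ?_) hi.norm
    (.of_forall fun z => ?_)
  · simp only [wickIntegrand, norm_mul]
    gcongr
    rw [norm_real, norm_of_nonneg hb0]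
    exact hi _ _ _ _ _
  · simp only [wickIntegrand]
    exact (((hlim m.1 m.2 _ _ _).const_mul _).mul_const _).const_mul _

lemma SmoothKernels.tendsto_shift (h : SmoothKernels B θ f f') (hω : IsWeight ω)
    (hθ : θ * kappa ≤ 1 / 2) (ψ : FockOne) :
    Tendsto (fun q => kop ω (shiftK q (truncK C f)) ψ) (𝓝[≠] 0) (𝓝 (kop ω (truncK C f) ψ)) := by
  obtain ⟨L, hL0, hL⟩ := h.norm_shift_sub_le (C := C) hω hθ
  have hP : Tendsto (fun q : Momentum => eproj (1 - ‖q‖) ψ) (𝓝[≠] 0) (𝓝 ψ) := by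
    have h1 : Tendsto (fun q : Momentum => ‖q‖) (𝓝[≠] 0) (𝓝 0) :=
      tendsto_norm_zero.mono_left nhdsWithin_le_nhds
    exact (tendsto_eproj ψ).comp h1
  have h2 := ((kop ω (truncK C f)).continuous.tendsto ψ).comp hP
  have h3 : Tendsto (fun q : Momentum => kop ω (shiftK q (truncK C f)) ψ -
      kop ω (truncK C f) (eproj (1 - ‖q‖) ψ)) (𝓝[≠] 0) (𝓝 0) := by
    have h4 : Tendsto (fun q : Momentum => L * ‖q‖ * ‖ψ‖) (𝓝[≠] 0) (𝓝 0) := by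
      have := ((tendsto_norm_zero (E := Momentum)).const_mul L).mul_const ‖ψ‖
      rw [mul_zero, zero_mul] at this
      exact this.mono_left nhdsWithin_le_nhds
    refine squeeze_zero_norm (fun q => ?_) h4
    have e : kop ω (shiftK q (truncK C f)) ψ =
        kop ω (shiftK q (truncK C f)) (eproj (1 - ‖q‖) ψ) :=
      (congrArg (fun X : Op => X ψ) (kop_shift_eproj hω h.isKernel hθ q)).symm
    rw [e]
    have := hL q 0 (1 - ‖q‖) (eproj (1 - ‖q‖) ψ) (by linarith) (by simp) (energyLE_eproj _ _)
    rw [shiftK_zero, sub_zero] at this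
    refine this.trans (mul_le_mul_of_nonneg_left ?_ (by positivity))
    exact ((eproj _).le_of_opNorm_le (norm_eproj_le _) ψ).trans (one_mul _).le
  have h5 := h3.add h2
  rw [zero_add] at h5
  exact h5.congr fun q => sub_add_cancel _ _

lemma SmoothKernels.shiftOf (h : SmoothKernels B θ f f') (hω : IsWeight ω)
    (hθ : θ * kappa ≤ 1 / 4) {k : Photon} (hk : k.1 ≠ 0) :
    ShiftOf (kop ω (truncK C f)) k (kop ω (shiftK k.1 (truncK C f))) := by
  have hθ' : θ * kappa ≤ 1 / 2 := by linarith
  have hv := h.isKernel (C := C)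
  have hc : 0 < ‖k.1‖ / 2 := by have := norm_pos_iff.2 hk; positivity
  obtain ⟨L, hL0, hL⟩ := h.norm_shift_sub_le (C := C) hω hθ'
  refine shiftOf_of_pull (T := fun q => kop ω (shiftK q (truncK C f)))
    (D := fun q => commK ω (kernelsAdj (truncK C f)) q)
    (C := 4 * (θ * B) * (√(‖k.1‖ / 2))⁻¹) hk (fun φ => ?_) (fun q hq => ?_) (fun ψ hψ => ?_)
    fun ψ hψ => ?_
  · filter_upwards [ann_kop hω hv.adj hθ φ] with q hq
    rw [adjoint_kop hω hv hθ', adjoint_kop hω (hv.shift q.1) hθ', hq]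
    rfl
  · refine (norm_commK_le hω hv.adj hθ q).trans (mul_le_mul_of_nonneg_left ?_
      (mul_nonneg (by norm_num) (mul_nonneg h.nonneg' h.nonneg)))
    refine (hω.le q).trans ?_
    exact inv_anti₀ (Real.sqrt_pos.2 hc) (Real.sqrt_le_sqrt hq)
  · rw [energyLE_iff]
    exact congrArg (fun X : Op => X ψ) (eproj_kop_shift hω hv hθ' k.1)
  · rw [tendsto_iff_norm_sub_tendsto_zero]
    have h4 : Tendsto (fun q : Momentum => L * ‖q - k.1‖ * ‖ψ‖) (𝓝[{q | ‖q‖ ≤ ‖k.1‖}] k.1)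
        (𝓝 0) := by
      have : Continuous fun q : Momentum => L * ‖q - k.1‖ * ‖ψ‖ := by fun_prop
      refine (this.tendsto' _ _ (by simp)).mono_left nhdsWithin_le_nhds
    refine squeeze_zero' (.of_forall fun q => norm_nonneg _) ?_ h4
    filter_upwards [self_mem_nhdsWithin] with q hq
    have hq' : ‖q‖ ≤ ‖k.1‖ := hq
    exact hL q k.1 (1 - ‖k.1‖) ψ (by linarith) (by linarith) hψ

theorem SmoothKernels.soft (h : SmoothKernels B θ f f') (hω : IsWeight ω)
    (hθ : θ * kappa ≤ 1 / 4) : Soft (kop ω (truncK C f)) (fun q => kop ω (shiftK q (truncK C f)))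
      (commK ω (truncK C f)) := by
  have hθ' : θ * kappa ≤ 1 / 2 := by linarith
  have hv := h.isKernel (C := C)
  have ea := adjoint_kop hω hv hθ'
  have es := fun q => adjoint_kop hω (hv.shift q) hθ'
  simp only [← shiftK_adj] at es
  rw [kernelsAdj_truncK] at ea
  simp only [kernelsAdj_truncK] at es
  refine ⟨ann_kop hω hv hθ, fun k hk => h.shiftOf hω hθ hk, fun k hk => ?_,
    h.tendsto_shift hω hθ', fun ψ => ?_, ⟨4 * B, fun q => (kop_spec hω (hv.shift q) hθ').2⟩,
    kop_shift_eproj hω hv hθ', eproj_kop_shift hω hv hθ'⟩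
  · rw [ea, es]; exact h.adj.shiftOf hω hθ hk
  · simp only [es, ea]
    exact h.adj.tendsto_shift hω hθ' ψ

/-- Derivatives of the kernels `truncK`. -/
def derivK (C : SmoothCutoff) (g : Kernels) : Kernels := fun M N Y K K' =>
  if ‖Y.2‖ ≤ Y.1 ∧ Y.1 < 1 then
    (cutFactor C M N Y.1 (tupleEnergy K) (tupleEnergy K') : ℂ) * g M N Y K K'
  else 0

lemma SmoothKernels.tendsto_quotient (h : SmoothKernels B θ f f') (p : Momentum) (M N : ℕ)
    {Y : ℝ × Momentum} (hY : ‖Y.2‖ ≤ Y.1) (K : Tuple M) (K' : Tuple N) :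
    Tendsto (fun s : ℝ => (((2 * s)⁻¹ : ℝ) : ℂ) * (shiftK (s • p) (truncK C f) M N Y K K' -
      shiftK (-(s • p)) (truncK C f) M N Y K K')) (𝓝[>] 0)
      (𝓝 (derivK C (f' p) M N Y K K')) := by
  have hn : Tendsto (fun s : ℝ => ‖s • p‖ + Y.1) (𝓝[>] 0) (𝓝 Y.1) := by
    have : Continuous fun s : ℝ => ‖s • p‖ + Y.1 := by fun_prop
    exact (this.tendsto' _ _ (by simp)).mono_left nhdsWithin_le_nhds
  rcases lt_or_ge Y.1 1 with h1 | h1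
  · rw [derivK, if_pos ⟨hY, h1⟩]
    have hc : Tendsto (fun s : ℝ => (cutFactor C M N (‖s • p‖ + Y.1) (tupleEnergy K)
        (tupleEnergy K') : ℂ)) (𝓝[>] 0) (𝓝 (cutFactor C M N Y.1 (tupleEnergy K)
        (tupleEnergy K') : ℂ)) :=
      ((Complex.continuous_ofReal.comp (continuous_cutFactor C M N _ _)).tendsto _).comp hn
    refine (hc.mul (h.deriv p M N Y K K' hY h1)).congr' ?_
    filter_upwards [hn.eventually (gt_mem_nhds h1)] with s hs
    have e1 := phys_shift hY (s • p)
    have e2 := phys_shift hY (-(s • p))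
    rw [norm_neg] at e2
    rw [shiftK, shiftK, norm_neg, truncK, truncK, if_pos ⟨e1, hs.le⟩, if_pos ⟨e2, hs.le⟩]
    ring
  · rw [derivK, if_neg fun hc => absurd hc.2 (not_lt.2 h1)]
    refine tendsto_const_nhds.congr' ?_
    filter_upwards [self_mem_nhdsWithin] with s hs
    by_cases hp : p = 0
    · simp [hp]
    · have h2 : ¬ (‖s • p‖ + Y.1 ≤ 1) := by
        have : 0 < ‖s • p‖ := norm_pos_iff.2 (smul_ne_zero (ne_of_gt hs) hp)
        linarith
      rw [shiftK, shiftK, norm_neg, truncK, truncK, if_neg fun hc => h2 hc.2,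
        if_neg fun hc => h2 hc.2, sub_zero, mul_zero]

/-- Symmetric difference quotients of the kernels `truncK` under translations. -/
def quotK (C : SmoothCutoff) (f : Kernels) (p : Momentum) (s : ℝ) : Kernels := fun M N Y K K' =>
  if ‖Y.2‖ ≤ Y.1 then (((2 * s)⁻¹ : ℝ) : ℂ) *
    (shiftK (s • p) (truncK C f) M N Y K K' - shiftK (-(s • p)) (truncK C f) M N Y K K') else 0

lemma SmoothKernels.kmeas_quotK (h : SmoothKernels B θ f f') (p : Momentum) (s : ℝ) (M N : ℕ) :
    KMeas (quotK C f p s M N) :=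
  Measurable.ite (measurableSet_le measurable_fst.snd.norm measurable_fst.fst)
    ((((h.isKernel.shift (s • p)).meas M N).sub
      ((h.isKernel.shift (-(s • p))).meas M N)).const_mul _) measurable_const

lemma SmoothKernels.norm_quotK_le (h : SmoothKernels B θ f f') (p : Momentum) : ∃ B' : ℝ, 0 ≤ B' ∧
    ∀ s : ℝ, 0 < s → ∀ M N Y K K', ‖quotK C f p s M N Y K K'‖ ≤ B' * θ ^ (M + N) := by
  obtain ⟨L, hL0, hL⟩ := h.shift_lip (C := C)
  refine ⟨L * ‖p‖, by positivity, fun s hs M N Y K K' => ?_⟩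
  have hθ0 := h.nonneg'
  rw [quotK]
  split_ifs with hY
  · by_cases h1 : ‖s • p‖ + Y.1 ≤ 1
    · have h2 := hL (s • p) (-(s • p)) M N Y K K' hY h1 (by rwa [norm_neg])
      have h3 : ‖s • p - -(s • p)‖ = 2 * s * ‖p‖ := by
        rw [sub_neg_eq_add, ← two_smul ℝ, smul_smul, norm_smul, norm_of_nonneg
          (by positivity)]
      rw [h3] at h2
      rw [norm_mul, norm_real, norm_of_nonneg (by positivity)]
      refine (mul_le_mul_of_nonneg_left h2 (by positivity)).trans (le_of_eq ?_)
      field_simp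
    · rw [shiftK, shiftK, norm_neg, truncK, truncK, if_neg fun hc => h1 hc.2,
        if_neg fun hc => h1 hc.2, sub_zero, mul_zero, norm_zero]
      positivity
  · rw [norm_zero]; positivity

lemma SmoothKernels.tendsto_quotK (h : SmoothKernels B θ f f') (p : Momentum) (M N : ℕ)
    (Y : ℝ × Momentum) (K : Tuple M) (K' : Tuple N) :
    Tendsto (fun s => quotK C f p s M N Y K K') (𝓝[>] 0) (𝓝 (derivK C (f' p) M N Y K K')) := by
  simp only [quotK]
  split_ifs with hY
  · exact h.tendsto_quotient p M N hY K K'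
  · rw [derivK, if_neg fun hc => hY hc.1]; exact tendsto_const_nhds

lemma SmoothKernels.isKernel_derivK (h : SmoothKernels B θ f f') (p : Momentum) :
    ∃ B' : ℝ, IsKernel B' θ (derivK C (f' p)) := by
  obtain ⟨B', h0, hB⟩ := h.norm_quotK_le (C := C) p
  refine ⟨B', h0, h.nonneg', fun M N => ?_, fun M N Y K K' => ?_, fun M N Y K K' hn => ?_,
    fun M N Y K K' hn => ?_⟩
  · have hs : Tendsto (fun n : ℕ => 1 / ((n : ℝ) + 1)) atTop (𝓝[>] 0) :=
      tendsto_nhdsWithin_iff.2 ⟨tendsto_one_div_add_atTop_nhds_zero_nat,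
        Eventually.of_forall fun n => show (0 : ℝ) < _ by positivity⟩
    exact measurable_of_tendsto_metrizable (fun n : ℕ => h.kmeas_quotK p (1 / ((n : ℝ) + 1)) M N)
      (tendsto_pi_nhds.2 fun x => (h.tendsto_quotK p M N x.1 x.2.1 x.2.2).comp hs)
  · refine le_of_tendsto (h.tendsto_quotK p M N Y K K').norm ?_
    filter_upwards [self_mem_nhdsWithin] with s hs using hB s hs M N Y K K'
  all_goals
    rw [derivK] at hn
    split_ifs at hn with hY
    · have := left_ne_zero_of_mul hn
      have h1 := cutFactor_ne_zero hY.2.le (C := C) (K := K) (K' := K') (by exact_mod_cast this)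
      first | exact h1.1 | exact h1.2
    · exact absurd rfl hn

lemma SmoothKernels.tendsto_inner (h : SmoothKernels B θ f f') (hω : IsWeight ω)
    (hθ : θ * kappa ≤ 1 / 2) (p : Momentum) (φ ψ : FockOne) :
    Tendsto (fun s : ℝ => (((2 * s)⁻¹ : ℝ) : ℂ) * inner ℂ φ ((kop ω (shiftK (s • p) (truncK C f)) -
      kop ω (shiftK (-(s • p)) (truncK C f))) ψ)) (𝓝[>] 0)
      (𝓝 (wickSeries ω (derivK C (f' p)) (rep φ) (rep ψ))) := by
  obtain ⟨B', h0, hB⟩ := h.norm_quotK_le (C := C) p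
  have hv := h.isKernel (C := C)
  have hU := tendsto_wickSeries (l := 𝓝[>] (0 : ℝ)) hω h0 h.nonneg' hθ (h.kmeas_quotK (C := C) p)
    (by filter_upwards [self_mem_nhdsWithin] with s hs using hB s hs)
    (h.tendsto_quotK p) (rep_adm φ) (rep_adm ψ)
  refine hU.congr fun s => ?_
  rw [sub_apply, inner_sub_r, (kop_spec hω (hv.shift _) hθ).1,
    (kop_spec hω (hv.shift _) hθ).1, ← wickSeries_sub hω (hv.shift _) hθ (hv.shift _) hθ
      (rep_adm φ) (rep_adm ψ), ← wickSeries_const_mul]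
  exact wickSeries_congr_kernel (rep_adm φ).supp (rep_adm ψ).supp
    fun M N Y K K' h1 _ _ => if_pos h1

theorem SmoothKernels.wardData (h : SmoothKernels B θ f f') (hω : IsWeight ω)
    (hθ : θ * kappa ≤ 1 / 4) {σ : ℝ} (hσ : ∀ k, ω k ≤ photonWeight σ k) :
    WardData (kop ω (truncK C f)) (fun q => kop ω (shiftK q (truncK C f)))
      (commK ω (truncK C f)) (fun p φ ψ => wickSeries ω (derivK C (f' p)) (rep φ) (rep ψ)) σ := by
  have hθ' : θ * kappa ≤ 1 / 2 := by linarith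
  have hv := h.isKernel (C := C)
  obtain ⟨L, hL0, hL⟩ := h.norm_shift_sub_le (C := C) hω hθ'
  refine ⟨h.soft hω hθ, ⟨L, fun q ψ hψ => ?_⟩, ⟨L, fun q q' hq => ?_⟩,
    fun p φ ψ => h.tendsto_inner hω hθ' p φ ψ, ⟨4 * (θ * B), fun k => ?_⟩⟩
  · have := hL q 0 (1 - ‖q‖) ψ (by linarith) (by simp) hψ
    rwa [shiftK_zero, sub_zero] at this
  · refine ContinuousLinearMap.opNorm_le_bound _ (by positivity) fun ψ => ?_
    have e1 : kop ω (shiftK q (truncK C f)) (eproj (1 - ‖q‖) ψ) = kop ω (shiftK q (truncK C f)) ψ :=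
      congrArg (fun X : Op => X ψ) (kop_shift_eproj hω hv hθ' q)
    have e2 : kop ω (shiftK q' (truncK C f)) (eproj (1 - ‖q'‖) ψ) =
        kop ω (shiftK q' (truncK C f)) ψ :=
      congrArg (fun X : Op => X ψ) (kop_shift_eproj hω hv hθ' q')
    rw [sub_apply, ← e1, ← e2, ← hq]
    refine (hL q q' (1 - ‖q‖) (eproj (1 - ‖q‖) ψ) (by linarith) (by linarith)
      (energyLE_eproj _ _)).trans (mul_le_mul_of_nonneg_left ?_ (by positivity))
    exact ((eproj _).le_of_opNorm_le (norm_eproj_le _) ψ).trans (one_mul _).le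
  · exact (norm_commK_le hω hv hθ k).trans (mul_le_mul_of_nonneg_left (hσ k)
      (mul_nonneg (by norm_num) (mul_nonneg h.nonneg' h.nonneg)))

end

section
/-! ### Effective hamiltonians as kernel operators -/

/-- The photon weight, cut off at the maximal energy. -/
def weight (σ : ℝ) (k : Photon) : ℝ := if ‖k.1‖ ≤ 1 then photonWeight σ k else 0

lemma measurable_photonWeight (σ : ℝ) : Measurable (photonWeight σ) := by
  unfold photonWeight infraredReg
  refine Measurable.ite (MeasurableSet.const _) (Measurable.div ?_ (by fun_prop)) (by fun_prop)
  exact Measurable.ite (measurableSet_lt measurable_const (by fun_prop)) (by fun_prop)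
    (by fun_prop)

lemma weight_le {σ : ℝ} (hσ : 0 < σ) (k : Photon) : weight σ k ≤ photonWeight σ k := by
  rw [weight]; split_ifs
  · exact le_rfl
  · exact photonWeight_nonneg hσ k

lemma isWeight_weight {σ : ℝ} (hσ : 0 < σ) : IsWeight (weight σ) where
  meas := Measurable.ite (measurableSet_le (by fun_prop) measurable_const)
    (measurable_photonWeight σ) measurable_const
  nonneg k := by
    rw [weight]; split_ifs
    · exact photonWeight_nonneg hσ k
    · exact le_rfl
  le k := by
    rw [weight]; split_ifs with h1
    · rw [photonWeight]; split_ifs with h2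
      · rw [div_eq_mul_inv]
        refine mul_le_of_le_one_left (by positivity) ?_
        rw [infraredReg]; split_ifs with h3
        · exact le_rfl
        · exact (div_le_one hσ).2 (not_lt.1 h3)
      · rcases (Real.sqrt_nonneg ‖k.1‖).eq_or_lt with h0 | h0
        · rw [← h0, inv_zero]
        · rw [← one_div, le_div_iff₀ h0, Real.mul_self_sqrt (norm_nonneg _)]; exact h1
    · positivity
  supp k h := if_neg (not_le.2 h)

lemma measurePreserving_append (M n : ℕ) :
    MeasurePreserving (fun p : Tuple M × Tuple n => Fin.append p.1 p.2)
      ((photonMeasureN M).prod (photonMeasureN n)) (photonMeasureN (M + n)) := by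
  have h1 := measurePreserving_sumPiEquivProdPi_symm (fun _ : Fin M ⊕ Fin n => photonMeasure)
  have h2 := measurePreserving_piCongrLeft (fun _ : Fin (M + n) => photonMeasure) finSumFinEquiv
  have h3 := h2.comp h1
  refine (congrArg (fun F => MeasurePreserving F ((photonMeasureN M).prod (photonMeasureN n))
    (photonMeasureN (M + n))) ?_).mp h3
  funext p i
  obtain ⟨j, rfl⟩ := finSumFinEquiv.surjective i
  have := Equiv.piCongrLeft_apply_apply (fun _ : Fin (M + n) => Photon) finSumFinEquiv
    ((MeasurableEquiv.sumPiEquivProdPi (fun _ : Fin M ⊕ Fin n => Photon)).symm p) j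
  refine this.trans ?_
  rcases j with j | j
  · simp only [finSumFinEquiv_apply_left, Fin.append_left]; rfl
  · simp only [finSumFinEquiv_apply_right, Fin.append_right]; rfl

lemma wave_append (φ : FockOne) (M n : ℕ) :
    ∀ᵐ p ∂(photonMeasureN n).prod (photonMeasureN M), wave φ ⟨M + n, Fin.append p.2 p.1⟩ =
      (√((M + n).factorial) : ℂ)⁻¹ * rep φ (tupleBag p.2 + bag (inSector n p.1)) := by
  have h1 := (measurePreserving_append M n).quasiMeasurePreserving.ae
    (ae_fockMeasure_iff.1 (wave_ae φ) (M + n))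
  have h2 := (Measure.measurePreserving_swap (μ := photonMeasureN n)
    (ν := photonMeasureN M)).quasiMeasurePreserving.ae h1
  filter_upwards [h2] with p hp
  have e := bag_appendConfig (p.2, inSector n p.1)
  rw [← e]
  exact hp

lemma integrable_prod_sector {α : Type*} [MeasurableSpace α] {ν : Measure α} [SFinite ν]
    {F : Config × α → ℂ} (hF : Measurable F) (hi : Integrable F (fockMeasure.prod ν)) (n : ℕ) :
    Integrable (fun p : Tuple n × α => F (inSector n p.1, p.2))
      ((photonMeasureN n).prod ν) := by
  have hm : Measurable fun p : α × Tuple n => F (inSector n p.2, p.1) :=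
    hF.comp (((measurable_inSector n).comp measurable_snd).prodMk measurable_fst)
  have h1 : Integrable (fun p : α × Tuple n => F (inSector n p.2, p.1))
      (ν.prod (photonMeasureN n)) := by
    refine ⟨hm.aestronglyMeasurable, ?_⟩
    have h2 := hi.swap.2
    rw [HasFiniteIntegral, lintegral_prod_fockMeasure ν (hF.comp measurable_swap).enorm] at h2
    have h3 := (ENNReal.le_tsum n).trans_lt h2
    exact (ENNReal.mul_lt_top_iff.1 h3).elim (fun h => h.2) fun h => h.elim
      (fun h => absurd h (ENNReal.inv_ne_zero.2 (ENNReal.natCast_ne_top _)))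
      fun h => by
        have : ∫⁻ p, ‖F (inSector n p.2, p.1)‖ₑ ∂ν.prod (photonMeasureN n) = 0 := h
        rw [HasFiniteIntegral, this]; exact ENNReal.zero_lt_top
  exact h1.swap

variable {B θ : ℝ} {C : SmoothCutoff} {u w : Kernels} {σ : ℝ}

lemma energy_append {M n : ℕ} (K : Tuple M) (q : Tuple n) :
    energy (Fin.append K q) = mEnergy (bag (inSector n q)) + tupleEnergy K := by
  have h := mEnergy_bag (appendConfig (K, inSector n q))
  rw [bag_appendConfig, mEnergy_add, add_comm] at h
  exact h.symm

lemma prodWeight_eq {M : ℕ} {K : Tuple M} (h : tupleEnergy K ≤ 1) :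
    prodWeight (weight σ) K = ∏ i, photonWeight σ (K i) := by
  refine Finset.prod_congr rfl fun i _ => if_pos (le_trans ?_ h)
  rw [tupleEnergy, tupleBag, mEnergy_bag]
  exact Finset.single_le_sum (f := fun i => ‖(K i).1‖) (fun _ _ => norm_nonneg _) (Finset.mem_univ i)

lemma sqrt_descFactorial (M n : ℕ) : (√((M + n).descFactorial M) : ℝ) * (√((M + n).factorial))⁻¹ =
    (√(n.factorial))⁻¹ := by
  have h := Nat.factorial_mul_descFactorial (Nat.le_add_right M n)
  rw [Nat.add_sub_cancel_left] at h
  have h2 : (√((M + n).factorial) : ℝ) = √(n.factorial) * √((M + n).descFactorial M) := by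
    rw [← Real.sqrt_mul (by positivity), ← h]; push_cast; rfl
  have h3 : (√((M + n).descFactorial M) : ℝ) ≠ 0 := (Real.sqrt_pos.2 (by
    exact_mod_cast Nat.descFactorial_pos.2 (Nat.le_add_right M n))).ne'
  rw [h2, mul_inv]
  field_simp

lemma wickForm_eq (hσ : 0 < σ) (hu : IsKernel B θ u) {M N : ℕ}
    (h : ∀ Y K K', ‖Y.2‖ ≤ Y.1 → Y.1 + tupleEnergy K ≤ 1 → Y.1 + tupleEnergy K' ≤ 1 →
      u M N Y K K' = C.chi (Y.1 + tupleEnergy K) * w M N Y K K' * C.chi (Y.1 + tupleEnergy K'))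
    (φ ψ : FockOne) : wickForm C σ (w M N) φ ψ = wick (weight σ) (u M N) (rep φ) (rep ψ) := by
  have hω := isWeight_weight hσ
  have hi := integrable_wickIntegrand hω (hu.meas M N) (hu.bound M N) (rep_adm φ) (rep_adm ψ)
  have hm := measurable_wickIntegrand hω.meas (hu.meas M N) (rep_adm φ).meas (rep_adm ψ).meas
  rw [wick, wickMeasure, integral_prod _ hi, wickForm]
  refine (hasSum_of_eq (hasSum_integral_fockMeasure hi.integral_prod_left) fun n => ?_).tsum_eq
  rw [← integral_prod _ (integrable_prod_sector hm hi n), ← integral_const_mul,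
    ← integral_const_mul]
  refine integral_congr_ae ?_
  have a1 := (QuasiMeasurePreserving.prodMap
    (Measure.QuasiMeasurePreserving.id (photonMeasureN n)) (Measure.quasiMeasurePreserving_fst (μ := photonMeasureN M) (ν := photonMeasureN N))).ae
    (wave_append φ M n)
  have a2 := (QuasiMeasurePreserving.prodMap
    (Measure.QuasiMeasurePreserving.id (photonMeasureN n)) (Measure.quasiMeasurePreserving_snd (μ := photonMeasureN M) (ν := photonMeasureN N))).ae
    (wave_append ψ N n)
  filter_upwards [a1, a2] with x h1 h2
  obtain ⟨q, K, K'⟩ := x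
  replace h1 : wave φ ⟨M + n, Fin.append K q⟩ = (√((M + n).factorial) : ℂ)⁻¹ *
      rep φ (tupleBag K + bag (inSector n q)) := h1
  replace h2 : wave ψ ⟨N + n, Fin.append K' q⟩ = (√((N + n).factorial) : ℂ)⁻¹ *
      rep ψ (tupleBag K' + bag (inSector n q)) := h2
  have e : ∀ {m : ℕ} (K : Tuple m), mEnergy (tupleBag K + bag (inSector n q)) =
      mEnergy (bag (inSector n q)) + tupleEnergy K := fun K =>
    (mEnergy_add _ _).trans (add_comm _ _)
  have h3 := rep_supp φ (tupleBag K + bag (inSector n q))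
  have h4 := rep_supp ψ (tupleBag K' + bag (inSector n q))
  rw [e] at h3 h4
  have hE := mEnergy_nonneg (bag (inSector n q))
  simp only [h1, h2, energy_append, wickIntegrand]
  generalize rep φ (tupleBag K + bag (inSector n q)) = a at *
  generalize rep ψ (tupleBag K' + bag (inSector n q)) = b at *
  by_cases b1 : mEnergy (bag (inSector n q)) + tupleEnergy K ≤ 1
  swap
  · rw [h3 (not_le.1 b1)]; simp
  by_cases b2 : mEnergy (bag (inSector n q)) + tupleEnergy K' ≤ 1
  swap
  · rw [h4 (not_le.1 b2)]; simp
  rw [prodWeight_eq (by linarith), prodWeight_eq (by linarith),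
    h (point (bag (inSector n q))) K K' (norm_mMomentum_le _) b1 b2]
  have ep : point (bag (inSector n q)) = (energy q, momentum q) :=
    Prod.ext (mEnergy_bag _) (mMomentum_bag _)
  have eE : (point (bag (inSector n q))).1 = mEnergy (bag (inSector n q)) := rfl
  rw [eE, ep]
  have s1 := congrArg (fun r : ℝ => (r : ℂ)) (sqrt_descFactorial M n)
  have s2 := congrArg (fun r : ℝ => (r : ℂ)) (sqrt_descFactorial N n)
  have s3 : ((n.factorial : ℝ) : ℂ)⁻¹ = ((√(n.factorial))⁻¹ : ℝ) * ((√(n.factorial))⁻¹ : ℝ) := by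
    rw [← Complex.ofReal_mul, ← mul_inv, Real.mul_self_sqrt (by positivity), Complex.ofReal_inv]
  rw [s3]
  nth_rewrite 1 [← s1]
  rw [← s2]
  simp only [map_mul, map_inv₀, conj_ofReal]
  push_cast
  ring

lemma wick_zero {T₀ : ℝ × Momentum → ℂ}
    (h : ∀ Y K K', ‖Y.2‖ ≤ Y.1 → Y.1 < 1 → u 0 0 Y K K' = T₀ Y) (φ ψ : FockOne) :
    ∫ x, conj (wave φ x) * T₀ (energy x.2, momentum x.2) * wave ψ x ∂configMeasure =
      wick (weight σ) (u 0 0) (rep φ) (rep ψ) := by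
  have h0 : ∀ K : Fin 0 → Photon, tupleBag K = 0 := fun K => by
    rw [← Multiset.card_eq_zero, card_bag]
  have hfst : ∀ᵐ z ∂wickMeasure 0 0, mEnergy (bag z.1) ≠ 1 :=
    Measure.quasiMeasurePreserving_fst.ae (energy_ne zero_lt_one)
  have e : ∫ z, (fun x : Config => conj (rep φ (bag x)) * T₀ (energy x.2, momentum x.2) *
      rep ψ (bag x)) z.1 ∂wickMeasure 0 0 = wick (weight σ) (u 0 0) (rep φ) (rep ψ) := by
    refine integral_congr_ae ?_
    filter_upwards [hfst] with z hz
    simp only [wickIntegrand, h0, zero_add, prodWeight, Finset.univ_eq_empty, Finset.prod_empty,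
      mul_one, Complex.ofReal_one, one_mul]
    rcases lt_or_gt_of_ne hz with h1 | h1
    · rw [h (point (bag z.1)) z.2.1 z.2.2 (norm_mMomentum_le _) h1]
      have ep : point (bag z.1) = (energy z.1.2, momentum z.1.2) :=
        Prod.ext (mEnergy_bag _) (mMomentum_bag _)
      rw [ep]
    · rw [rep_supp φ _ h1]; simp
  rw [← e, wickMeasure, integral_fun_fst (μ := fockMeasure)
    (ν := (photonMeasureN 0).prod (photonMeasureN 0)) fun x : Config =>
      conj (rep φ (bag x)) * T₀ (energy x.2, momentum x.2) * rep ψ (bag x),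
    ← integral_fock_eq_config]
  have hp : ((photonMeasureN 0).prod (photonMeasureN 0)).real Set.univ = 1 := by
    rw [Measure.real, ← Set.univ_prod_univ, Measure.prod_prod, photonMeasureN,
      Measure.pi_empty_univ]
    simp
  rw [hp, one_smul]

theorem seriesForm_eq (hσ : 0 < σ) (hu : IsKernel B θ u) (hθ : θ * kappa ≤ 1 / 2)
    {T₀ : ℝ × Momentum → ℂ} (h0 : ∀ Y K K', ‖Y.2‖ ≤ Y.1 → Y.1 < 1 → u 0 0 Y K K' = T₀ Y)
    (h : ∀ M N, 1 ≤ M + N → ∀ Y K K', ‖Y.2‖ ≤ Y.1 → Y.1 + tupleEnergy K ≤ 1 →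
      Y.1 + tupleEnergy K' ≤ 1 →
      u M N Y K K' = C.chi (Y.1 + tupleEnergy K) * w M N Y K K' * C.chi (Y.1 + tupleEnergy K'))
    (φ ψ : FockOne) : seriesForm C σ T₀ w φ ψ = wickSeries (weight σ) u (rep φ) (rep ψ) := by
  rw [seriesForm, wickSeries,
    (summable_wick (isWeight_weight hσ) hu hθ (rep_adm φ) (rep_adm ψ)).tsum_eq_add_tsum_ite (0, 0),
    wick_zero h0 φ ψ]
  congr 1
  refine tsum_congr fun m => ?_
  by_cases hm : m = (0, 0)
  · rw [if_pos hm, hm, if_neg (by norm_num)]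
  · have h1 : 1 ≤ m.1 + m.2 := by
      rcases m with ⟨a, b⟩
      simp only [Prod.mk.injEq] at hm ⊢
      omega
    rw [if_neg hm, if_pos h1, wickForm_eq hσ hu (h m.1 m.2 h1)]

variable {np : Momentum}

/-- The kernels of `H[h]`, including the free part. -/
def pointK (h : Point np) : Kernels := fun M N Y K K' =>
  if 1 ≤ M + N then h.w M N Y K K' else axial np h.T Y - h.z

/-- The derivatives of the kernels of `H[h]` with respect to momentum. -/
def pointDerivK (h : Point np) (p : Momentum) : Kernels := fun M N Y K K' =>
  if 1 ≤ M + N then lineDeriv ℝ (fun P => h.w M N (Y.1, P) K K') Y.2 p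
  else lineDeriv ℝ (fun P => axial np h.T (Y.1, P)) Y.2 p

theorem effHam_eq (hσ : 0 < σ) {h : Point np}
    (hf : SmoothKernels B θ (pointK h) (pointDerivK h)) (hθ : θ * kappa ≤ 1 / 2) :
    effHam C σ h = kop (weight σ) (truncK C (pointK h)) := by
  refine opOfForm_eq fun φ ψ => ?_
  rw [(kop_spec (isWeight_weight hσ) hf.isKernel hθ).1]
  refine (seriesForm_eq hσ hf.isKernel hθ (fun Y K K' h1 h2 => ?_)
    (fun M N hMN Y K K' h1 h2 h3 => ?_) φ ψ).symm
  · rw [truncK, if_pos ⟨h1, h2.le⟩, cutFactor, if_pos rfl, pointK, if_neg (by norm_num)]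
    simp
  · rw [truncK, if_pos ⟨h1, by linarith [tupleEnergy_nonneg K]⟩, cutFactor, if_neg (by omega),
      pointK, if_pos hMN]
    push_cast; ring

theorem momentumDerivForm_eq (hσ : 0 < σ) {h : Point np}
    (hf : SmoothKernels B θ (pointK h) (pointDerivK h)) (hθ : θ * kappa ≤ 1 / 2) (p : Momentum)
    (φ ψ : FockOne) : momentumDerivForm C σ h p φ ψ =
      wickSeries (weight σ) (derivK C (pointDerivK h p)) (rep φ) (rep ψ) := by
  obtain ⟨B', hB'⟩ := hf.isKernel_derivK (C := C) p
  refine seriesForm_eq hσ hB' hθ (fun Y K K' h1 h2 => ?_) (fun M N hMN Y K K' h1 h2 h3 => ?_) φ ψ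
  · rw [derivK, if_pos ⟨h1, h2⟩, cutFactor, if_pos rfl, pointDerivK, if_neg (by norm_num)]
    simp
  · by_cases h4 : Y.1 < 1
    · rw [derivK, if_pos ⟨h1, h4⟩, cutFactor, if_neg (by omega), pointDerivK, if_pos hMN]
      push_cast; ring
    · rw [derivK, if_neg fun hc => h4 hc.2,
        C.chi_eq_zero _ (by linarith [tupleEnergy_nonneg K])]
      simp

end

section
/-! ### Smoothness of the kernels in the polydisc -/

variable {np : Momentum}

lemma norm_le_of_enorm_le {E : Type*} [SeminormedAddGroup E] {x : E} {c : ℝ} (hc : 0 ≤ c)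
    (h : ‖x‖ₑ ≤ ofReal c) : ‖x‖ ≤ c := by
  rwa [← ofReal_norm, ENNReal.ofReal_le_ofReal_iff hc] at h

/-- `perp` as a linear map. -/
def perpL (np : Momentum) : Momentum →L[ℝ] Momentum :=
  ContinuousLinearMap.id ℝ Momentum - (innerSL ℝ np).smulRight np

lemma perpL_apply (P : Momentum) : perpL np P = perp np P := rfl

lemma innerSL_eq_par (P : Momentum) : innerSL ℝ np P = par np P := rfl

lemma abs_par_le (h : ‖np‖ = 1) (P : Momentum) : |par np P| ≤ ‖P‖ := by
  have := abs_real_inner_le_norm np P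
  rwa [h, one_mul] at this

lemma norm_perp_le (h : ‖np‖ = 1) (P : Momentum) : ‖perp np P‖ ≤ ‖P‖ := by
  refine abs_le_of_sq_le_sq' ?_ (norm_nonneg P) |>.2
  rw [perp, norm_sub_sq_real, inner_smul_right, norm_smul, h, real_inner_comm, mul_one,
    Real.norm_eq_abs, sq_abs, real_inner_comm]
  nlinarith [sq_nonneg (inner ℝ np P : ℝ)]

lemma mem_spec (h : ‖np‖ = 1) {Y : ℝ × Momentum} (h0 : 0 ≤ Y.1) (h1 : Y.1 ≤ 1)
    (h2 : ‖Y.2‖ ≤ 1) : Y ∈ spec np :=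
  ⟨⟨h0, h1⟩, abs_le.1 ((abs_par_le h _).trans h2), (norm_perp_le h _).trans h2⟩

lemma convex_spec : Convex ℝ (spec np) := by
  have h1 := (convex_Icc (0 : ℝ) 1).is_linear_preimage
    (ContinuousLinearMap.fst ℝ ℝ Momentum).toLinearMap.isLinear
  have h2 := (convex_Icc (-1 : ℝ) 1).is_linear_preimage
    ((innerSL ℝ np).comp (ContinuousLinearMap.snd ℝ ℝ Momentum)).toLinearMap.isLinear
  have h3 := (convex_closedBall (0 : Momentum) 1).is_linear_preimage
    ((perpL np).comp (ContinuousLinearMap.snd ℝ ℝ Momentum)).toLinearMap.isLinear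
  intro x hx y hy a b ha hb hab
  exact ⟨h1 hx.1 hy.1 ha hb hab, h2 hx.2.1 hy.2.1 ha hb hab, mem_closedBall_zero_iff.1
    (h3 (mem_closedBall_zero_iff.2 hx.2.2) (mem_closedBall_zero_iff.2 hy.2.2) ha hb hab)⟩

lemma uniqueDiffOn_spec : UniqueDiffOn ℝ (spec np) := by
  refine uniqueDiffOn_convex convex_spec ⟨((1 / 2 : ℝ), (0 : Momentum)), ?_⟩
  rw [mem_interior]
  refine ⟨Prod.fst ⁻¹' Set.Ioo 0 1 ∩ ((fun Y => innerSL ℝ np Y.2) ⁻¹' Set.Ioo (-1) 1 ∩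
    (fun Y => perpL np Y.2) ⁻¹' Metric.ball 0 1), fun Y hY => ?_, ?_, ?_⟩
  · exact ⟨Set.Ioo_subset_Icc_self hY.1, Set.Ioo_subset_Icc_self hY.2.1,
      (mem_ball_zero_iff.1 hY.2.2).le⟩
  · exact (isOpen_Ioo.preimage continuous_fst).inter
      ((isOpen_Ioo.preimage ((innerSL ℝ np).continuous.comp continuous_snd)).inter
      (Metric.isOpen_ball.preimage ((perpL np).continuous.comp continuous_snd)))
  · refine ⟨⟨by norm_num, by norm_num⟩, ?_, ?_⟩
    · simp
    · simp

lemma convex_specZero : Convex ℝ specZero :=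
  (convex_Icc _ _).prod ((convex_Icc _ _).prod (convex_Icc _ _))

lemma uniqueDiffOn_specZero : UniqueDiffOn ℝ specZero :=
  (uniqueDiffOn_Icc (by norm_num)).prod
    ((uniqueDiffOn_Icc (by norm_num)).prod (uniqueDiffOn_Icc (by norm_num)))

section Interaction

variable {M N : ℕ} {w : ℝ × Momentum → Tuple M → Tuple N → ℂ} {c : ℝ}

lemma kernelNorm_term (hc : 0 ≤ c) (hw : kernelNorm np w ≤ ofReal c) (j : Fin 3)
    (a : Fin j → Fin 3) (ha : Monotone a) {Y : ℝ × Momentum} (hY : Y ∈ spec np)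
    (K : Tuple M) (K' : Tuple N) :
    ‖(iteratedFDerivWithin ℝ j (fun Y => w Y K K') (spec np) Y).compContinuousLinearMap
      fun i => componentProj np (a i)‖ ≤ c := by
  refine norm_le_of_enorm_le hc (le_trans ?_ hw)
  rw [kernelNorm]
  refine le_trans ?_ (Finset.single_le_sum (fun _ _ => zero_le) (Finset.mem_univ j))
  refine le_trans ?_ (Finset.single_le_sum (fun _ _ => zero_le) (Finset.mem_univ a))
  rw [if_pos ha]
  exact le_iSup₂_of_le Y hY (le_iSup₂_of_le K K' le_rfl)

lemma norm_kernel_le (hc : 0 ≤ c) (hw : kernelNorm np w ≤ ofReal c) {Y : ℝ × Momentum}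
    (hY : Y ∈ spec np) (K : Tuple M) (K' : Tuple N) : ‖w Y K K'‖ ≤ c := by
  have h := kernelNorm_term hc hw 0 (fun _ => 0) monotone_const hY K K'
  have h2 := ContinuousMultilinearMap.le_opNorm ((iteratedFDerivWithin ℝ 0 (fun Y => w Y K K')
    (spec np) Y).compContinuousLinearMap fun _ => componentProj np 0) (fun _ => 0)
  rw [ContinuousMultilinearMap.compContinuousLinearMap_apply, iteratedFDerivWithin_zero_apply] at h2
  refine h2.trans ?_
  simpa using h

lemma componentProj_sum (v : ℝ × Momentum) :
    v = componentProj np 0 v + componentProj np 1 v + componentProj np 2 v := by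
  ext1 <;> simp [componentProj]

lemma norm_kernel_sub_le (hc : 0 ≤ c) (hw : kernelNorm np w ≤ ofReal c)
    (K : Tuple M) (K' : Tuple N)
    (hd : DifferentiableOn ℝ (fun Y => w Y K K') (spec np)) {Y Y' : ℝ × Momentum}
    (hY : Y ∈ spec np) (hY' : Y' ∈ spec np) :
    ‖w Y K K' - w Y' K K'‖ ≤ 3 * c * (|Y.1 - Y'.1| + ‖Y.2 - Y'.2‖) := by
  have hb : ∀ x ∈ spec np, ‖fderivWithin ℝ (fun Y => w Y K K') (spec np) x‖ ≤ 3 * c := by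
    intro x hx
    refine ContinuousLinearMap.opNorm_le_bound _ (by positivity) fun v => ?_
    have h1 : ∀ i, ‖fderivWithin ℝ (fun Y => w Y K K') (spec np) x (componentProj np i v)‖ ≤
        c * ‖v‖ := by
      intro i
      have h := kernelNorm_term hc hw 1 (fun _ => i) monotone_const hx K K'
      have h2 := ContinuousMultilinearMap.le_opNorm ((iteratedFDerivWithin ℝ 1 (fun Y => w Y K K')
        (spec np) x).compContinuousLinearMap fun _ => componentProj np i) (fun _ => v)
      rw [ContinuousMultilinearMap.compContinuousLinearMap_apply,
        iteratedFDerivWithin_one_apply (uniqueDiffOn_spec x hx)] at h2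
      refine h2.trans (mul_le_mul h (by simp) (by positivity) hc)
    rw [componentProj_sum (np := np) v, map_add, map_add, ← componentProj_sum]
    refine (norm_add₃_le ..).trans ?_
    linarith [h1 0, h1 1, h1 2]
  refine ((convex_spec.norm_image_sub_le_of_norm_fderivWithin_le hd hb hY' hY)).trans
    (mul_le_mul_of_nonneg_left ?_ (by positivity))
  rw [Prod.norm_def, Prod.fst_sub, Prod.snd_sub, Real.norm_eq_abs]
  exact max_le_add_of_nonneg (abs_nonneg _) (norm_nonneg _)

end Interaction

section Free

variable {T : ℝ × ℝ × ℝ → ℂ}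

lemma freeNorm_term (h : freeNorm T ≤ 2) (j : Fin 3) (a : Fin j → Fin 3) {y : ℝ × ℝ × ℝ}
    (hy : y ∈ specZero) : ‖iteratedFDerivWithin ℝ j T specZero y fun i =>
      (![((1 : ℝ), (0 : ℝ), (0 : ℝ)), (0, 1, 0), (0, 0, 1)] : Fin 3 → ℝ × ℝ × ℝ) (a i)‖ ≤ 2 := by
  refine norm_le_of_enorm_le zero_le_two (le_trans ?_ (h.trans_eq (by simp)))
  exact le_iSup₂_of_le j a (le_iSup₂_of_le y hy le_rfl)

lemma norm_free_le (h : freeNorm T ≤ 2) {y : ℝ × ℝ × ℝ} (hy : y ∈ specZero) : ‖T y‖ ≤ 2 :=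
  freeNorm_term h 0 (fun _ => 0) hy

lemma norm_free_sub_le (h : freeNorm T ≤ 2) (hd : DifferentiableOn ℝ T specZero)
    {y y' : ℝ × ℝ × ℝ} (hy : y ∈ specZero) (hy' : y' ∈ specZero) :
    ‖T y - T y'‖ ≤ 6 * ‖y - y'‖ := by
  refine convex_specZero.norm_image_sub_le_of_norm_fderivWithin_le hd (fun x hx => ?_) hy' hy
  refine ContinuousLinearMap.opNorm_le_bound _ (by norm_num) fun v => ?_
  have h1 : ∀ i, ‖fderivWithin ℝ T specZero x ((![((1 : ℝ), (0 : ℝ), (0 : ℝ)), (0, 1, 0),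
      (0, 0, 1)] : Fin 3 → ℝ × ℝ × ℝ) i)‖ ≤ 2 := by
    intro i
    have e := iteratedFDerivWithin_one_apply (f := T) (uniqueDiffOn_specZero x hx) fun _ => (![((1 :
      ℝ), (0 : ℝ), (0 : ℝ)), (0, 1, 0), (0, 0, 1)] : Fin 3 → ℝ × ℝ × ℝ) i
    rw [← e]
    exact freeNorm_term h 1 (fun _ => i) hx
  have e : v = v.1 • ((1 : ℝ), (0 : ℝ), (0 : ℝ)) + v.2.1 • ((0 : ℝ), (1 : ℝ), (0 : ℝ)) +
      v.2.2 • ((0 : ℝ), (0 : ℝ), (1 : ℝ)) := by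
    ext <;> simp
  have h2 : ‖v.1‖ ≤ ‖v‖ := norm_fst_le v
  have h3 : ‖v.2.1‖ ≤ ‖v‖ := (norm_fst_le v.2).trans (norm_snd_le v)
  have h4 : ‖v.2.2‖ ≤ ‖v‖ := (norm_snd_le v.2).trans (norm_snd_le v)
  have e2 := congrArg (fderivWithin ℝ T specZero x) e
  rw [map_add, map_add, map_smul, map_smul, map_smul] at e2
  rw [e2]
  refine (norm_add₃_le ..).trans ?_
  rw [norm_smul, norm_smul, norm_smul]
  have g1 := mul_le_mul h2 (h1 0) (norm_nonneg _) (norm_nonneg _)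
  have g2 := mul_le_mul h3 (h1 1) (norm_nonneg _) (norm_nonneg _)
  have g3 := mul_le_mul h4 (h1 2) (norm_nonneg _) (norm_nonneg _)
  simp only [Matrix.cons_val] at g1 g2 g3
  linarith

/-- The arguments of a free part. -/
def axialPoint (np : Momentum) (Y : ℝ × Momentum) : ℝ × ℝ × ℝ := (Y.1, par np Y.2, ‖perp np Y.2‖)

lemma axialPoint_mem (h : ‖np‖ = 1) {Y : ℝ × Momentum} (h0 : 0 ≤ Y.1) (h1 : Y.1 ≤ 1)
    (h2 : ‖Y.2‖ ≤ 1) : axialPoint np Y ∈ specZero :=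
  ⟨⟨h0, h1⟩, abs_le.1 ((abs_par_le h _).trans h2), norm_nonneg _, (norm_perp_le h _).trans h2⟩

lemma continuous_axialPoint : Continuous (axialPoint np) :=
  continuous_fst.prodMk (((innerSL ℝ np).continuous.comp continuous_snd).prodMk
    ((perpL np).continuous.comp continuous_snd).norm)

lemma norm_axialPoint_sub_le (h : ‖np‖ = 1) (Y Y' : ℝ × Momentum) :
    ‖axialPoint np Y - axialPoint np Y'‖ ≤ |Y.1 - Y'.1| + ‖Y.2 - Y'.2‖ := by
  have h1 : |par np Y.2 - par np Y'.2| ≤ ‖Y.2 - Y'.2‖ := by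
    have e : par np Y.2 - par np Y'.2 = par np (Y.2 - Y'.2) := (inner_sub_right _ _ _).symm
    rw [e]; exact abs_par_le h _
  have h2 : |‖perp np Y.2‖ - ‖perp np Y'.2‖| ≤ ‖Y.2 - Y'.2‖ := by
    refine (abs_norm_sub_norm_le _ _).trans ?_
    have e : perp np Y.2 - perp np Y'.2 = perp np (Y.2 - Y'.2) := ((perpL np).map_sub _ _).symm
    rw [e]; exact norm_perp_le h _
  have := abs_nonneg (Y.1 - Y'.1)
  refine max_le ?_ (max_le ?_ ?_)
  · change |Y.1 - Y'.1| ≤ _; linarith [norm_nonneg (Y.2 - Y'.2)]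
  · change |par np Y.2 - par np Y'.2| ≤ _; linarith
  · change |‖perp np Y.2‖ - ‖perp np Y'.2‖| ≤ _; linarith

end Free

/-- Symmetric difference quotients along two curves. -/
lemma tendsto_quotient_of_hasFDerivWithinAt {E : Type*} [NormedAddCommGroup E] [NormedSpace ℝ E]
    {G : E → ℂ} {D : E →L[ℝ] ℂ} {S : Set E} {y v : E} (hD : HasFDerivWithinAt G D S y)
    {a b : ℝ → E} {c : ℝ} (ha : ∀ᶠ s in 𝓝[>] (0 : ℝ), a s ∈ S ∧ ‖a s - y‖ ≤ c * ‖s‖)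
    (hb : ∀ᶠ s in 𝓝[>] (0 : ℝ), b s ∈ S ∧ ‖b s - y‖ ≤ c * ‖s‖)
    (hv : Tendsto (fun s : ℝ => (2 * s)⁻¹ • (a s - b s)) (𝓝[>] 0) (𝓝 v)) :
    Tendsto (fun s : ℝ => (((2 * s)⁻¹ : ℝ) : ℂ) * (G (a s) - G (b s))) (𝓝[>] 0) (𝓝 (D v)) := by
  have key : ∀ a : ℝ → E, (∀ᶠ s in 𝓝[>] (0 : ℝ), a s ∈ S ∧ ‖a s - y‖ ≤ c * ‖s‖) →
      (fun s => G (a s) - G y - D (a s - y)) =o[𝓝[>] 0] fun s : ℝ => s := by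
    intro a ha
    have h1 : (fun s => a s - y) =O[𝓝[>] 0] fun s : ℝ => s :=
      Asymptotics.IsBigO.of_bound c (ha.mono fun s hs => hs.2)
    have h0 : Tendsto (fun s : ℝ => s) (𝓝[>] 0) (𝓝 0) := tendsto_id.mono_left nhdsWithin_le_nhds
    have h2 : Tendsto (fun s => a s - y) (𝓝[>] 0) (𝓝 0) := h1.trans_tendsto h0
    have h3 : Tendsto a (𝓝[>] 0) (𝓝[S] y) := tendsto_nhdsWithin_iff.2
      ⟨by simpa using h2.add_const y, ha.mono fun s hs => hs.1⟩
    exact (hD.isLittleO.comp_tendsto h3).trans_isBigO h1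
  have h := (key a ha).sub (key b hb)
  have h1 : Tendsto (fun s : ℝ => (2 * s)⁻¹ • (G (a s) - G y - D (a s - y) -
      (G (b s) - G y - D (b s - y)))) (𝓝[>] 0) (𝓝 0) := by
    have h2 := h.tendsto_inv_smul_nhds_zero.const_smul (2⁻¹ : ℝ)
    rw [smul_zero] at h2
    refine h2.congr fun s => ?_
    rw [smul_smul, mul_inv]
  have h3 := h1.add ((D.continuous.tendsto v).comp hv)
  rw [zero_add] at h3
  refine h3.congr fun s => ?_
  simp only [Function.comp_apply]
  rw [map_smul, ← smul_add, Complex.real_smul]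
  congr 1
  rw [map_sub, map_sub, map_sub]; ring

lemma tendsto_symm_slope {F : Type*} [NormedAddCommGroup F] [NormedSpace ℝ F] {f : ℝ → F} {d : F}
    (h : HasDerivAt f d 0) :
    Tendsto (fun s : ℝ => (2 * s)⁻¹ • (f s - f (-s))) (𝓝[>] 0) (𝓝 d) := by
  have h1 := hasDerivAt_iff_tendsto_slope_zero.1 h
  have h2 : Tendsto (fun s : ℝ => s) (𝓝[>] 0) (𝓝[≠] 0) :=
    tendsto_id.mono_left (nhdsWithin_mono _ fun s hs => ne_of_gt hs)
  have h3 : Tendsto (fun s : ℝ => -s) (𝓝[>] 0) (𝓝[≠] 0) := by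
    refine tendsto_nhdsWithin_iff.2 ⟨?_, ?_⟩
    · exact (continuous_neg.tendsto' _ _ neg_zero).mono_left nhdsWithin_le_nhds
    · filter_upwards [self_mem_nhdsWithin] with s hs using neg_ne_zero.2 (ne_of_gt hs)
  have h4 := ((h1.comp h2).add (h1.comp h3)).const_smul (2⁻¹ : ℝ)
  rw [← two_smul ℝ d, smul_smul, inv_mul_cancel₀ two_ne_zero, one_smul] at h4
  refine h4.congr fun s => ?_
  simp only [Function.comp_apply, zero_add, inv_neg, neg_smul]
  rw [← sub_eq_add_neg, ← smul_sub, smul_smul, mul_inv]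
  congr 1
  abel

lemma exists_tendsto_norm_quotient (x e : Momentum) : ∃ δ : ℝ,
    Tendsto (fun s : ℝ => (2 * s)⁻¹ • (‖s • e + x‖ - ‖-(s • e) + x‖)) (𝓝[>] 0) (𝓝 δ) := by
  by_cases hx : x = 0
  · exact ⟨0, tendsto_const_nhds.congr fun s => by rw [hx, add_zero, add_zero, norm_neg]; simp⟩
  · have hd : DifferentiableAt ℝ (fun t : ℝ => ‖t • e + x‖) 0 :=
      DifferentiableAt.norm ℝ (by fun_prop) (by simpa using hx)
    exact ⟨_, (tendsto_symm_slope hd.hasDerivAt).congr fun s => by rw [neg_smul]⟩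

lemma eventually_norm_le {P p : Momentum} (h : ‖P‖ < 1) :
    ∀ᶠ s in 𝓝[>] (0 : ℝ), ‖s • p + P‖ ≤ 1 ∧ ‖-(s • p) + P‖ ≤ 1 := by
  have h1 : Tendsto (fun s : ℝ => ‖s • p + P‖) (𝓝[>] 0) (𝓝 ‖P‖) :=
    ((by fun_prop : Continuous fun s : ℝ => ‖s • p + P‖).tendsto' _ _ (by simp)).mono_left
      nhdsWithin_le_nhds
  have h2 : Tendsto (fun s : ℝ => ‖-(s • p) + P‖) (𝓝[>] 0) (𝓝 ‖P‖) :=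
    ((by fun_prop : Continuous fun s : ℝ => ‖-(s • p) + P‖).tendsto' _ _ (by simp)).mono_left
      nhdsWithin_le_nhds
  filter_upwards [h1.eventually (gt_mem_nhds h), h2.eventually (gt_mem_nhds h)] with s a b
    using ⟨a.le, b.le⟩

lemma eventually_energy_le {r : ℝ} (h : r < 1) (p : Momentum) :
    ∀ᶠ s in 𝓝[>] (0 : ℝ), ‖s • p‖ + r ≤ 1 := by
  have h1 : Tendsto (fun s : ℝ => ‖s • p‖ + r) (𝓝[>] 0) (𝓝 r) :=
    ((by fun_prop : Continuous fun s : ℝ => ‖s • p‖ + r).tendsto' _ _ (by simp)).mono_left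
      nhdsWithin_le_nhds
  filter_upwards [h1.eventually (gt_mem_nhds h)] with s a using a.le

lemma tendsto_free_quotient (hn : ‖np‖ = 1) {T : ℝ × ℝ × ℝ → ℂ}
    (hd : DifferentiableOn ℝ T specZero) {Y : ℝ × Momentum} (h0 : ‖Y.2‖ ≤ Y.1) (h1 : Y.1 < 1)
    (p : Momentum) : ∃ l : ℂ, ∀ r : ℝ → ℝ,
      (∀ᶠ s in 𝓝[>] (0 : ℝ), 0 ≤ r s ∧ r s ≤ 1 ∧ |r s - Y.1| ≤ ‖p‖ * ‖s‖) →
      Tendsto (fun s : ℝ => (((2 * s)⁻¹ : ℝ) : ℂ) * (axial np T (r s, s • p + Y.2) -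
        axial np T (r s, -(s • p) + Y.2))) (𝓝[>] 0) (𝓝 l) := by
  have hY : axialPoint np Y ∈ specZero :=
    axialPoint_mem hn ((norm_nonneg _).trans h0) h1.le (h0.trans h1.le)
  obtain ⟨δ, hδ⟩ := exists_tendsto_norm_quotient (perp np Y.2) (perp np p)
  refine ⟨fderivWithin ℝ T specZero (axialPoint np Y) (0, par np p, δ), fun r hr => ?_⟩
  refine tendsto_quotient_of_hasFDerivWithinAt (c := 2 * ‖p‖)
    (a := fun s => axialPoint np (r s, s • p + Y.2))
    (b := fun s => axialPoint np (r s, -(s • p) + Y.2)) (hd _ hY).hasFDerivWithinAt ?_ ?_ ?_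
  · filter_upwards [hr, eventually_norm_le (p := p) (h0.trans_lt h1)] with s a b
    refine ⟨axialPoint_mem hn a.1 a.2.1 b.1, (norm_axialPoint_sub_le hn _ _).trans ?_⟩
    simp only [add_sub_cancel_right, norm_smul]
    linarith [a.2.2]
  · filter_upwards [hr, eventually_norm_le (p := p) (h0.trans_lt h1)] with s a b
    refine ⟨axialPoint_mem hn a.1 a.2.1 b.2, (norm_axialPoint_sub_le hn _ _).trans ?_⟩
    simp only [add_sub_cancel_right, norm_neg, norm_smul]
    linarith [a.2.2]
  · have e : ∀ s : ℝ, perp np (s • p + Y.2) = s • perp np p + perp np Y.2 ∧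
        perp np (-(s • p) + Y.2) = -(s • perp np p) + perp np Y.2 := fun s => by
      simp only [← perpL_apply, map_add, map_smul, map_neg, and_self]
    have e' : ∀ s : ℝ, par np (s • p + Y.2) - par np (-(s • p) + Y.2) = 2 * s * par np p :=
      fun s => by
        simp only [← innerSL_eq_par, map_add, map_smul, map_neg, smul_eq_mul]; ring
    refine (tendsto_const_nhds (x := (0 : ℝ))).prodMk_nhds
      ((tendsto_const_nhds (x := par np p)).prodMk_nhds hδ) |>.congr' ?_
    filter_upwards [self_mem_nhdsWithin] with s hs
    have hs0 : (2 * s) ≠ 0 := mul_ne_zero two_ne_zero (ne_of_gt hs)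
    ext
    · simp [axialPoint]
    · simp only [axialPoint, Prod.smul_mk, Prod.mk_sub_mk, e', smul_eq_mul]
      rw [inv_mul_cancel_left₀ hs0]
    · simp only [axialPoint, Prod.smul_mk, Prod.mk_sub_mk, e]

lemma measurable_free (hn : ‖np‖ = 1) {T : ℝ × ℝ × ℝ → ℂ} (hT : ContinuousOn T specZero) (z : ℂ) :
    Measurable fun Y : ℝ × Momentum => if ‖Y.2‖ ≤ Y.1 ∧ Y.1 ≤ 1 then axial np T Y - z else 0 := by
  have hm : MeasurableSet {Y : ℝ × Momentum | ‖Y.2‖ ≤ Y.1 ∧ Y.1 ≤ 1} :=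
    (measurableSet_le measurable_snd.norm measurable_fst).inter
      (measurableSet_le measurable_fst measurable_const)
  have hc : ContinuousOn (fun Y => axial np T Y - z)
      {Y : ℝ × Momentum | ‖Y.2‖ ≤ Y.1 ∧ Y.1 ≤ 1} :=
    (hT.comp continuous_axialPoint.continuousOn fun Y hY =>
      axialPoint_mem hn ((norm_nonneg _).trans hY.1) hY.2 (hY.1.trans hY.2)).sub continuousOn_const
  exact hc.measurable_piecewise (g := fun _ => 0) continuousOn_const hm

theorem InPolydisc.smoothKernels {C : SmoothCutoff} {ε ξ : ℝ} {h : Point np} (hn : ‖np‖ = 1)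
    (hε : 0 < ε) (hξ : 0 < ξ) (hh : InPolydisc C ε ξ h) :
    SmoothKernels (3 * ε + 6 + ‖h.z‖) ξ (pointK h) (pointDerivK h) := by
  have hw := fun {M N : ℕ} (hMN : 1 ≤ M + N) => hh.w_norm M N hMN
  have hwd := fun {M N : ℕ} (hMN : 1 ≤ M + N) (K : Tuple M) (K' : Tuple N) =>
    (h.w_contDiff M N hMN K K').differentiableOn two_ne_zero
  have hTd := h.T_contDiff.differentiableOn two_ne_zero
  have hc : ∀ n : ℕ, 0 ≤ ε * ξ ^ n := fun n => by positivity
  have hspec : ∀ Y : ℝ × Momentum, ‖Y.2‖ ≤ Y.1 → Y.1 ≤ 1 → Y ∈ spec np := fun Y h0 h1 =>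
    mem_spec hn ((norm_nonneg _).trans h0) h1 (h0.trans h1)
  have hz := norm_nonneg h.z
  refine ⟨by positivity, hξ.le, fun M N => ?_, fun M N Y K K' h0 h1 => ?_,
    fun M N Y Y' K K' h0 h1 h0' h1' => ?_, fun p M N Y K K' h0 h1 => ?_⟩
  · by_cases hMN : 1 ≤ M + N
    · simp only [pointK, if_pos hMN]
      exact Measurable.ite ((measurableSet_le measurable_fst.snd.norm measurable_fst.fst).inter
        (measurableSet_le measurable_fst.fst measurable_const)) (h.w_measurable M N hMN)
        measurable_const
    · simp only [pointK, if_neg hMN]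
      exact (measurable_free hn h.T_contDiff.continuousOn h.z).comp measurable_fst
  · by_cases hMN : 1 ≤ M + N
    · simp only [pointK, if_pos hMN]
      refine (norm_kernel_le (hc _) (hw hMN) (hspec Y h0 h1) K K').trans ?_
      exact mul_le_mul_of_nonneg_right (by linarith) (by positivity)
    · simp only [pointK, if_neg hMN]
      rw [show M + N = 0 by omega, pow_zero, mul_one]
      have := norm_free_le hh.T_norm (axialPoint_mem hn ((norm_nonneg _).trans h0) h1 (h0.trans h1))
      refine (norm_sub_le _ _).trans ?_
      change ‖h.T (axialPoint np Y)‖ + ‖h.z‖ ≤ _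
      linarith
  · have hnn : 0 ≤ |Y.1 - Y'.1| + ‖Y.2 - Y'.2‖ := by positivity
    by_cases hMN : 1 ≤ M + N
    · simp only [pointK, if_pos hMN]
      refine (norm_kernel_sub_le (hc _) (hw hMN) K K' (hwd hMN K K') (hspec Y h0 h1)
        (hspec Y' h0' h1')).trans (mul_le_mul_of_nonneg_right ?_ hnn)
      rw [← mul_assoc]
      exact mul_le_mul_of_nonneg_right (by linarith) (by positivity)
    · simp only [pointK, if_neg hMN]
      rw [show M + N = 0 by omega, pow_zero, mul_one, sub_sub_sub_cancel_right]
      have := norm_free_sub_le hh.T_norm hTd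
        (axialPoint_mem hn ((norm_nonneg _).trans h0) h1 (h0.trans h1))
        (axialPoint_mem hn ((norm_nonneg _).trans h0') h1' (h0'.trans h1'))
      refine this.trans ((mul_le_mul_of_nonneg_left (norm_axialPoint_sub_le hn Y Y')
        (by norm_num)).trans (mul_le_mul_of_nonneg_right (by linarith) hnn))
  · have hY0 : 0 ≤ Y.1 := (norm_nonneg _).trans h0
    have hsp : ∀ s : ℝ, ‖s • p‖ = ‖p‖ * ‖s‖ := fun s => by rw [norm_smul, mul_comm]
    by_cases hMN : 1 ≤ M + N
    · simp only [pointK, pointDerivK, if_pos hMN]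
      have hD := (hwd hMN K K' Y (hspec Y h0 h1.le)).hasFDerivWithinAt
      have hl : HasLineDerivAt ℝ (fun P => h.w M N (Y.1, P) K K')
          (fderivWithin ℝ (fun Y => h.w M N Y K K') (spec np) Y (0, p)) Y.2 p := by
        have hγ : HasDerivAt (fun t : ℝ => (Y.1, Y.2 + t • p)) (0, p) 0 := by
          have := ((hasDerivAt_id (0 : ℝ)).smul_const p).const_add Y.2
          rw [one_smul] at this
          exact (hasDerivAt_const _ _).prodMk this
        have e : (Y.1, Y.2 + (0 : ℝ) • p) = Y := by simp
        refine HasFDerivWithinAt.comp_hasDerivAt (t := spec np) 0 (by rwa [e]) hγ ?_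
        have hc : Tendsto (fun t : ℝ => ‖Y.2 + t • p‖) (𝓝 0) (𝓝 ‖Y.2‖) :=
          (by fun_prop : Continuous fun t : ℝ => ‖Y.2 + t • p‖).tendsto' _ _ (by simp)
        filter_upwards [hc.eventually (gt_mem_nhds (h0.trans_lt h1))] with t ht
        exact mem_spec hn hY0 h1.le ht.le
      rw [hl.lineDeriv]
      refine tendsto_quotient_of_hasFDerivWithinAt (c := ‖p‖)
        (a := fun s => (‖s • p‖ + Y.1, s • p + Y.2))
        (b := fun s => (‖s • p‖ + Y.1, -(s • p) + Y.2)) hD ?_ ?_ ?_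
      · filter_upwards [eventually_energy_le h1 p] with s hs
        refine ⟨hspec _ (phys_shift h0 _) hs, ?_⟩
        rw [Prod.norm_def, Prod.fst_sub, Prod.snd_sub, add_sub_cancel_right, add_sub_cancel_right,
          norm_norm, max_self, hsp]
      · filter_upwards [eventually_energy_le h1 p] with s hs
        refine ⟨hspec _ (by simpa using phys_shift h0 (-(s • p))) hs, ?_⟩
        rw [Prod.norm_def, Prod.fst_sub, Prod.snd_sub, add_sub_cancel_right, add_sub_cancel_right,
          norm_norm, norm_neg, max_self, hsp]
      · refine tendsto_const_nhds.congr' ?_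
        filter_upwards [self_mem_nhdsWithin] with s hs
        have hs0 : (2 * s) ≠ 0 := mul_ne_zero two_ne_zero (ne_of_gt hs)
        rw [Prod.mk_sub_mk, sub_self, add_sub_add_right_eq_sub, sub_neg_eq_add, ← two_smul ℝ,
          smul_smul, Prod.smul_mk, smul_zero, smul_smul, inv_mul_cancel₀ hs0, one_smul]
    · simp only [pointK, pointDerivK, if_neg hMN, sub_sub_sub_cancel_right]
      obtain ⟨l, hl⟩ := tendsto_free_quotient hn hTd h0 h1 p
      have h2 := hl (fun _ => Y.1) (.of_forall fun s => ⟨hY0, h1.le, by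
        rw [sub_self, abs_zero]; positivity⟩)
      have hP := h0.trans_lt h1
      have hd : DifferentiableAt ℝ (fun P => axial np h.T (Y.1, P)) Y.2 :=
        (hh.T_analytic Y.1 ⟨hY0, h1.le⟩ Y.2
          ⟨abs_lt.1 ((abs_par_le hn _).trans_lt hP), (norm_perp_le hn _).trans_lt hP⟩).differentiableAt
      have h3 := tendsto_symm_slope (hd.lineDifferentiableAt (v := p)).hasLineDerivAt
      have e := tendsto_nhds_unique h2 (h3.congr fun s => by
        rw [Complex.real_smul, neg_smul, add_comm Y.2, add_comm Y.2])
      rw [← e]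
      refine hl _ ?_
      filter_upwards [eventually_energy_le h1 p] with s hs
      refine ⟨by positivity, hs, ?_⟩
      rw [add_sub_cancel_right, abs_norm, hsp]

end


/-! ### Transfer of the Ward–Takahashi identities -/

variable {np : Momentum} {C : SmoothCutoff} {ε ξ σ ρ : ℝ} {h : Point np}

theorem InPolydisc.wardData (hh : InPolydisc C ε ξ h) (hn : ‖np‖ = 1) (hε : 0 < ε) (hξ : 0 < ξ)
    (hξ' : ξ * kappa ≤ 1 / 4) (hσ : 0 < σ) : ∃ T D,
      WardData (effHam C σ h) T D (momentumDerivForm C σ h) σ := by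
  have hf := hh.smoothKernels hn hε hξ
  have h2 : ξ * kappa ≤ 1 / 2 := by linarith
  have e : momentumDerivForm C σ h = fun p φ ψ =>
      wickSeries (weight σ) (derivK C (pointDerivK h p)) (rep φ) (rep ψ) :=
    funext fun p => funext fun φ => funext fun ψ => momentumDerivForm_eq hσ hf h2 p φ ψ
  rw [effHam_eq hσ hf h2, e]
  exact ⟨_, _, hf.wardData (isWeight_weight hσ) hξ' (weight_le hσ)⟩

lemma kernelsAdj_derivK (g : Kernels) : kernelsAdj (derivK C g) = derivK C (kernelsAdj g) := by
  funext M N Y K K'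
  simp only [kernelsAdj, kadj, derivK, cutFactor]
  split_ifs with h1 h2 h3 h3
  · simp
  · omega
  · omega
  · rw [map_mul, conj_ofReal, mul_comm (C.chi _)]
  · simp

theorem InPolydisc.wardData_adj (hh : InPolydisc C ε ξ h) (hn : ‖np‖ = 1) (hε : 0 < ε)
    (hξ : 0 < ξ) (hξ' : ξ * kappa ≤ 1 / 4) (hσ : 0 < σ) : ∃ T D,
      WardData (adj (effHam C σ h)) T D
        (fun p φ ψ => conj (momentumDerivForm C σ h p ψ φ)) σ := by
  have hf := hh.smoothKernels hn hε hξ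
  have h2 : ξ * kappa ≤ 1 / 2 := by linarith
  have e : (fun p φ ψ => conj (momentumDerivForm C σ h p ψ φ)) = fun p φ ψ =>
      wickSeries (weight σ) (derivK C (kernelsAdj (pointDerivK h p))) (rep φ) (rep ψ) :=
    funext fun p => funext fun φ => funext fun ψ => by
      rw [momentumDerivForm_eq hσ hf h2, ← wickSeries_adj, kernelsAdj_derivK]
  rw [effHam_eq hσ hf h2, adjoint_kop (isWeight_weight hσ) hf.isKernel h2, kernelsAdj_truncK, e]
  exact ⟨_, _, hf.adj.wardData (isWeight_weight hσ) hξ' (weight_le hσ)⟩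

lemma wardTakahashi_annihilation (pol : Polarization) (g : ℝ) (lam : Bool) (U : Set Direction) :
    WardTakahashi C pol g .annihilation lam U σ h ↔ WardAnn (effHam C σ h)
      (momentumDerivForm C σ h) g (fun n => pol.vec .annihilation n lam) lam U σ := Iff.rfl

lemma tendsto_conj_iff {l : Filter ℝ} (g : ℝ) (m : ℂ) (t : ℝ → ℝ) (a b : ℝ → ℂ) :
    Tendsto (fun r => g * m + t r * (conj (a r) - conj (b r))) l (𝓝 0) ↔
      Tendsto (fun r => g * conj m + t r * (a r - b r)) l (𝓝 0) := by
  rw [tendsto_zero_iff_norm_tendsto_zero, tendsto_zero_iff_norm_tendsto_zero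
    (f := fun r => g * conj m + t r * (a r - b r))]
  refine tendsto_congr fun r => ?_
  rw [← RCLike.norm_conj]
  simp only [map_add, map_mul, map_sub, conj_ofReal, conj_conj]

lemma wardTakahashi_creation (pol : Polarization) (g : ℝ) (lam : Bool) (U : Set Direction) :
    WardTakahashi C pol g .creation lam U σ h ↔ WardAnn (adj (effHam C σ h))
      (fun p φ ψ => conj (momentumDerivForm C σ h p ψ φ)) g
      (fun n => pol.vec .creation n lam) lam U σ := by
  have key := fun (φ ψ : FockOne) (n : Direction) => tendsto_conj_iff (l := softFilter) g
    (momentumDerivForm C σ h (pol.vec .creation n lam) φ ψ) (softRatio σ)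
    (fun r => annihilationForm (r • (n : Momentum), lam) ψ (adj (effHam C σ h) φ))
    (fun r => annihilationForm (r • (n : Momentum), lam) (effHam C σ h ψ) φ)
  rw [WardTakahashi, WardAnn, adj_adj]
  constructor
  · intro hW φ ψ hφ hψ
    filter_upwards [hW ψ φ hψ hφ] with n hn
    exact (key ψ φ n).1 hn
  · intro hW φ ψ hφ hψ
    filter_upwards [hW ψ φ hψ hφ] with n hn
    exact (key φ ψ n).2 hn

lemma dilated_adj {F G : Op} {κ : ℂ} (h0 : 0 < ρ) (h1 : ρ < 1)
    (hFG : F * dilOp h0 h1 = κ • (dilOp h0 h1 * G)) (hc : F * eproj ρ = eproj ρ * F) :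
    adj F * dilOp h0 h1 = conj κ • (dilOp h0 h1 * adj G) := by
  have hJ := adj_dilOp_mul h0 h1
  have hP := dilOp_mul_adj h0 h1
  generalize dilOp h0 h1 = J at *
  have e1 : adj J * F * J = κ • G := by
    rw [mul_assoc, hFG, mul_smul_comm, ← mul_assoc, hJ, one_mul]
  have e2 : adj J * adj F * J = conj κ • adj G := by
    have := congrArg (fun X : Op => adj X) e1
    simpa only [adj_mul, adj_adj, adj_smul, mul_assoc] using this
  have e3 : eproj ρ * adj F = adj F * eproj ρ := by
    have := congrArg (fun X : Op => adj X) hc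
    simpa only [adj_mul, adjoint_eproj] using this
  have e4 : eproj ρ * J = J := by rw [← hP, mul_assoc, hJ, mul_one]
  calc adj F * J = adj F * (eproj ρ * J) := by rw [e4]
    _ = J * (adj J * adj F * J) := by rw [← mul_assoc, ← e3, ← hP]; simp only [mul_assoc]
    _ = _ := by rw [e2, mul_smul_comm]

theorem wardTakahashi_transfer {ε' ξ' g : ℝ} {h' : Point np} (pol : Polarization) (hn : ‖np‖ = 1)
    (h0 : 0 < ρ) (h1 : ρ < 1) (hσ : 0 < σ) (hε : 0 < ε) (hξ : 0 < ξ) (hκ : ξ * kappa ≤ 1 / 4)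
    (hε' : 0 < ε') (hξ' : 0 < ξ') (hκ' : ξ' * kappa ≤ 1 / 4) (hh : InPolydisc C ε ξ h)
    (hh' : InPolydisc C ε' ξ' h') (hren : IsRenormalized C ρ σ h h') (s : Sharp) (lam : Bool)
    (U : Set Direction) (hW : WardTakahashi C pol g s lam U σ h) :
    WardTakahashi C pol g s lam U (σ / ρ) h' := by
  obtain ⟨Δ, ΔE, R, hΔ, hR, -, -, -, hdil⟩ := hren
  have eτ : (fun r : ℝ => (1 + Δ) * (r : ℂ) - h.z + ΔE) =
      fun r : ℝ => (1 + Δ) * (r : ℂ) + (ΔE - h.z) := funext fun r => by ring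
  rw [eτ] at hR hdil
  have hκ0 : (ρ : ℂ) * (1 + Δ) ≠ 0 := mul_ne_zero (by exact_mod_cast h0.ne') hΔ
  have hFG := hdil.comp_eq h0 h1
  rw [mul_smul_comm] at hFG
  have hσ' : 0 < σ / ρ := div_pos hσ h0
  cases s with
  | annihilation =>
    rw [wardTakahashi_annihilation] at hW ⊢
    obtain ⟨T, D, hd⟩ := hh.wardData hn hε hξ hκ hσ
    obtain ⟨T', D', hd'⟩ := hh'.wardData hn hε' hξ' hκ' hσ'
    obtain ⟨FT, Y₀, Y, Z₀, Z, hP⟩ := Soft.feshbachPair C h0 hd.soft (1 + Δ) (ΔE - h.z) hR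
    exact hW.transfer h0 h1 hκ0 hσ hFG hd hP hd'
  | creation =>
    rw [wardTakahashi_creation] at hW ⊢
    obtain ⟨T, D, hd⟩ := hh.wardData_adj hn hε hξ hκ hσ
    obtain ⟨T', D', hd'⟩ := hh'.wardData_adj hn hε' hξ' hκ' hσ'
    have hχ := adj_real_energyOp (energySymbol_chi C ρ).toEFun
    have hχb := adj_real_energyOp (energySymbol_chibar C ρ).toEFun
    have hR' := hR.adj (adj_barProj C) hχb
    rw [adj_sub, adj_affine] at hR'
    obtain ⟨FT, Y₀, Y, Z₀, Z, hP⟩ := Soft.feshbachPair C h0 hd.soft _ _ hR'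
    rw [← adj_affine, ← adj_sub, ← adj_feshbach _ _ _ _ _ hχ hχb] at hP
    exact hW.transfer h0 h1 ((map_ne_zero _).2 hκ0) hσ
      (dilated_adj h0 h1 hFG (feshbach_comm_eproj C h0 _ _ _ _ _)) hd hP hd'

end SoftPhoton

end

theorem proposition6p7 :
    ∃ ε₀ : ℝ, 0 < ε₀ ∧ ∃ ξ₀ : ℝ, 0 < ξ₀ ∧
      ∀ (C : SoftPhoton.SmoothCutoff) (pol : SoftPhoton.Polarization)
        (np : SoftPhoton.Momentum) (_ : ‖np‖ = 1)
        (g ρ σ : ℝ) (_ : 0 < ρ) (_ : ρ < 1) (_ : 0 < σ)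
        (ε ξ : ℝ) (_ : 0 < ε) (_ : ε < ε₀) (_ : 0 < ξ) (_ : ξ < ξ₀)
        (ε' ξ' : ℝ) (_ : 0 < ε') (_ : 0 < ξ') (_ : ξ' < ξ₀)
        (h h' : SoftPhoton.Point np)
        (_ : SoftPhoton.InPolydisc C ε ξ h) (_ : SoftPhoton.InPolydisc C ε' ξ' h')
        (_ : SoftPhoton.IsRenormalized C ρ σ h h')
        (s : SoftPhoton.Sharp) (lam : Bool)
        (U : Set SoftPhoton.Direction) (_ : MeasurableSet U),
        SoftPhoton.WardTakahashi C pol g s lam U σ h →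
          SoftPhoton.WardTakahashi C pol g s lam U (σ / ρ) h' := by
  have hk := SoftPhoton.kappa_nonneg
  have hsmall : ∀ ξ : ℝ, ξ < 1 / (4 * (1 + SoftPhoton.kappa)) → ξ * SoftPhoton.kappa ≤ 1 / 4 := by
    intro ξ hξ
    refine (mul_le_mul_of_nonneg_right hξ.le hk).trans ?_
    rw [div_mul_eq_mul_div, one_mul, div_le_div_iff₀ (by positivity) (by norm_num)]
    linarith
  refine ⟨1, one_pos, 1 / (4 * (1 + SoftPhoton.kappa)), by positivity, ?_⟩
  intro C pol np hn g ρ σ h0 h1 hσ ε ξ hε _ hξ hξ₀ ε' ξ' hε' hξ' hξ'₀ h h' hh hh' hren s lam U _ hW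
  exact SoftPhoton.wardTakahashi_transfer pol hn h0 h1 hσ hε hξ (hsmall ξ hξ₀) hε' hξ'
    (hsmall ξ' hξ'₀) hh hh' hren s lam U hW
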